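/- **Setting.** Let $L$ be a non-degenerate even lattice of rank $N$, realized as $\mathbb{Z}^N$ with the quadratic form $L[x]=x^{T}Lx$, where $L$ is a symmetric half-integral matrix with integral diagonal, and with bilinear form $\langle x,y\rangle_L=L[x+y]-L[x]-L[y]=2x^{T}Ly$ (extended bilinearly to $\mathbb{C}^N$). Let $(dV_+,dV_-)$ be its signature, $L^\vee=\{\lambda\in\mathbb{R}^N:\langle\lambda,\mathbb{Z}^N\rangle_L\subset\mathbb{Z}\}$ and $\mathrm{disc}(L)=L^\vee/\mathbb{Z}^N$. Write $e(x)=\exp(2\pi i x)$, $\tau=x+iy\in\mathbb{H}$, $z=u+iv\in\mathbb{C}^N$. **Frames.** A compatible pair of partial frames is a pair of linearly independent tuples $E=(e_1,\dots,e_{dV_-})$, $E'=(e'_1,\dots,e'_{dV_-})$ in $\mathbb{R}^N$ such that the form $L$ is positive semi-definite on the $L$-orthogonal complements of $E$ and of $E'$, the planes $\mathrm{span}(e_i,e'_i)$ have signature $(1,1)$ and are mutually $L$-orthogonal, $\langle e_i,e'_i\rangle_L<0$ for all $i$, and every isotropic vector in $E$ or $E'$ spans a rational line. (All vectors in $E$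 and $E'$ then satisfy $L[e]\le 0$.) **Theta series.** For such a vector $e$ put $s=\langle e,\nu+v/y\rangle_L$ and $$\rho^e(\tau,z;\nu)=\operatorname{sgn}(s)\ \text{ if } L[e]=0,\qquad \rho^e(\tau,z;\nu)=\tfrac{1}{\sqrt\pi}\operatorname{sgn}(s)\,\gamma\bigl(\tfrac12,-\tfrac{\pi y s^2}{L[e]}\bigr)\ \text{ if } L[e]<0,$$ where $\gamma(\frac12,t)=\int_0^t w^{-1/2}e^{-w}\,dw$. The indefinite theta series is $$\theta_L^{E,E'}(\tau,z)=\sum_{\nu\in\mathbb{Z}^N}\Bigl(\prod_{i=1}^{dV_-}\bigl(\rho^{e_i}-\rho^{e'_i}\bigr)(\tau,z;\nu)\Bigr)\,e\bigl(L[\nu]\tau+\langle z,\nu\rangle_L\bigr).$$ Let $D$ be the set of $(\tau,z)$ with $\langle e,\nu+v/y\rangle_L\ne0$ for all $\nu\in\mathbb{Z}^N$ and all isotropic $e$ in $E$ or $E'$. For $\lambda\in L^\vee$ the translate is $(\theta_L^{E,E'}|(\lambda,0))(\tau,z)=e(L[\lambda]\tau+\langle\lambda,z\rangle_L)\,\theta_L^{E,E'}(\tau,z+\lambda\tau)$,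 defined if $(\tau,z+\lambda\tau)\in D$. **Slash action and type.** Let $\mathrm{Mp}_2(\mathbb{Z})$ be the group of pairs $(\gamma,j)$ with $\gamma=\left(\begin{smallmatrix}a&b\\c&d\end{smallmatrix}\right)\in\mathrm{SL}_2(\mathbb{Z})$ and $j:\mathbb{H}\to\mathbb{C}$ continuous with $j(\tau)^2=c\tau+d$. For $k\in\frac12\mathbb{Z}$ and $\lambda,\mu\in\mathbb{Z}^N$ set $$\bigl(\phi|_{k,L}(\gamma,j,\lambda,\mu)\bigr)(\tau,z)=j(\tau)^{-2k}\,e\Bigl(\tfrac{-c\,L[z+\lambda\tau+\mu]}{c\tau+d}+\langle\lambda,z\rangle_L+L[\lambda]\tau\Bigr)\,\phi\Bigl(\tfrac{a\tau+b}{c\tau+d},\tfrac{z+\lambda\tau+\mu}{c\tau+d}\Bigr);$$ for $k\in\mathbb{Z}$ this depends only on $(\gamma,\lambda,\mu)$. Let $\rho_L$ be the Weil representation of $\mathrm{Mp}_2(\mathbb{Z})$ on $\mathbb{C}[\mathrm{disc}(L)]=\bigoplus_\lambda\mathbb{C}b_\lambda$, given on the generators $T=(\left(\begin{smallmatrix}1&1\\0&1\end{smallmatrix}\right),1)$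 and $S=(\left(\begin{smallmatrix}0&-1\\1&0\end{smallmatrix}\right),\sqrt\tau)$ by $$\rho_L(T)b_\lambda=e(L[\lambda])\,b_\lambda,\qquad \rho_L(S)b_\lambda=\frac{e^{\pi i(dV_--dV_+)/4}}{\sqrt{|\mathrm{disc}(L)|}}\sum_{\lambda'\in\mathrm{disc}(L)}e(-\langle\lambda,\lambda'\rangle_L)\,b_{\lambda'},$$ and let $\rho_L^J$ be its extension to $\mathrm{Mp}_2(\mathbb{Z})\ltimes(\mathbb{Z}^N\otimes\mathbb{Z}^2)$ that is trivial on $\mathbb{Z}^N\otimes\mathbb{Z}^2$. **Operators.** With $M=2\pi iL$, $\Delta_\kappa=4y^2\partial_\tau\partial_{\bar\tau}-2\kappa iy\,\partial_{\bar\tau}$ and $M^{-1}[a]=a^{T}M^{-1}a$, the Casimir operator is $$\begin{aligned}\mathcal{C}_{k,L}={}&-2\Delta_{k-N/2}+2y^2\bigl(\partial_{\bar\tau}M^{-1}[\partial_z]+\partial_\tau M^{-1}[\partial_{\bar z}]\bigr)-8y\,\partial_\tau v^{T}\partial_{\bar z}-\tfrac12y^2\bigl(M^{-1}[\partial_{\bar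 z}]M^{-1}[\partial_z]-(\partial_{\bar z}^{T}M^{-1}\partial_z)^2\bigr)\\&+2y(v^{T}\partial_{\bar z})\,\partial_z^{T}M^{-1}\partial_u-\tfrac12(2k-N+1)iy\,\partial_{\bar z}^{T}M^{-1}\partial_u+2\sum_{i,j}v_iv_j\partial_{\bar z_i}\partial_{\bar z_j}+(2k-N-1)i\,v^{T}\partial_{\bar z}.\end{aligned}$$ For $e\in\mathbb{R}^N$ let $\partial_{z_e}=\sum_ie_i\partial_{z_i}$, $\partial_{\bar z_e}=\sum_ie_i\partial_{\bar z_i}$ and $\Delta^{\mathrm{H}[e]}_L=y\,\partial_{z_e}\partial_{\bar z_e}+4\pi i\,(v^{T}Le)\,\partial_{\bar z_e}$. **Maaß–Jacobi forms.** The singularities of a function on $\mathbb{H}\times\mathbb{C}^N$ are the points at which it is not real-analytic. A vector-valued Maaß–Jacobi form of weight $k$, index $L$ and type $\rho_L^J$ is a family $\Phi=(\Phi_\lambda)_{\lambda\in\mathrm{disc}(L)}$ of functions $\Phi_\lambda:\mathbb{H}\times\mathbb{C}^N\to\mathbb{C}$ such that 1. the singularities of each $\Phi_\lambda$ are non-moving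 (contained in finitely many sets $\{p(z)=\alpha+\beta\tau\}+\mathbb{Z}^N+\tau\mathbb{Z}^N$ with $p\neq0$ a real linear form and $\alpha,\beta\in\mathbb{R}$) and of almost meromorphic type (locally $\Phi_\lambda$ is the quotient of a real-analytic function by a holomorphic function that does not vanish identically, wherever the latter is non-zero); 2. $\Phi|_{k,L}\,g=\rho_L^J(g)\,\Phi$ for all $g\in\mathrm{Mp}_2(\mathbb{Z})\ltimes(\mathbb{Z}^N\otimes\mathbb{Z}^2)$, at all points for which neither the point nor its image under $g$ is a singularity of a component; 3. $\mathcal{C}_{k,L}\Phi_\lambda=0$ away from the singularities; 4. for all $\alpha,\beta\in\mathbb{R}^N$ such that $\tau\mapsto(\tau,\alpha\tau+\beta)$ does not meet the singularities of $\Phi_\lambda$, there is $a>0$ with $\Phi_\lambda(\tau,\alpha\tau+\beta)=O(e^{ay})$ as $y\to\infty$, uniformly in $x$. An $\mathrm{H}[E]$-harmonic Maaß–Jacobi form of weight $k\in\mathbb{Z}$ and index $L$ is a function $\phi$ with the properties 1, 3, 4, with $\phi|_{k,L}g=\phi$ for all $g\in\mathrm{SL}_2(\mathbb{Z})\ltimes(\mathbb{Z}^N\otimes\mathbb{Z}^2)$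 (as in 2), and such that, away from the singularities, $\Delta^{\mathrm{H}[e]}_L\phi=0$ for all $e\in E$ and $\phi$ is holomorphic in $z$ along the directions of the $L$-orthogonal complement of $E$. **Theorem.** Let $(E,E')$ be a compatible pair of partial frames of the non-degenerate even lattice $L$. Then the series defining $\theta_L^{E,E'}$ converges absolutely on $D$, and the translates $\bigl(\theta_L^{E,E'}|(\lambda,0)\bigr)_{\lambda\in\mathrm{disc}(L)}$ extend to $\mathbb{H}\times\mathbb{C}^N$ as the components of a vector-valued Maaß–Jacobi form of weight $\mathrm{rk}(L)/2$, index $L$ and type $\rho_L^J$: there is such a form $\Phi$ with $\Phi_{\lambda+\mathbb{Z}^N}(\tau,z)=(\theta_L^{E,E'}|(\lambda,0))(\tau,z)$ for all $\lambda\in L^\vee$ and all $(\tau,z)$ with $(\tau,z+\lambda\tau)\in D$. If moreover $L$ is unimodular and $E'$ contains only isotropic vectors, then $\mathrm{rk}(L)/2$ is an integer, and $\theta_L^{E,E'}$ (that is, $\Phi_0$) is an $\mathrm{H}[E]$-harmonic Maaß–Jacobi form of weight $\mathrm{rk}(L)/2$ and index $L$. -/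

import Mathlib

open UpperHalfPlane Filter Topology
open scoped MatrixGroups Matrix

noncomputable section

/-! ### Lattices -/

/-- A non-degenerate even lattice on `ℤ^N`, given by the Gram matrix `gram = 2 L` of its bilinear
form, where `L` is the half-integral symmetric matrix with integral diagonal. -/
structure EvenLattice (N : ℕ) where
  gram : Matrix (Fin N) (Fin N) ℤ
  symm : gram.IsSymm
  even_diag : ∀ i, Even (gram i i)
  nondeg : gram.det ≠ 0

namespace EvenLattice

variable {N : ℕ} (L : EvenLattice N)

/-- The bilinear form `⟨x, y⟩_L = L[x + y] - L[x] - L[y] = 2 xᵀ L y` over a field `R`. -/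
def bil {R : Type*} [Field R] (x y : Fin N → R) : R :=
  ∑ i, ∑ j, x i * (L.gram i j : R) * y j

/-- The quadratic form `L[x] = xᵀ L x`. -/
def quad {R : Type*} [Field R] (x : Fin N → R) : R := L.bil x x / 2

/-- The real symmetric matrix `L`. -/
def mat : Matrix (Fin N) (Fin N) ℝ := (1 / 2 : ℝ) • L.gram.map (fun a : ℤ => (a : ℝ))

/-- The real quadratic form `L[·]` as a Mathlib object. -/
def form : QuadraticForm ℝ (Fin N → ℝ) := L.mat.toQuadraticForm'

/-- `d V₊`. -/
def dPos : ℕ := sigPos L.form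

/-- `d V₋`. -/
def dNeg : ℕ := sigNeg L.form

/-- The lattice is unimodular. -/
def IsUnimodular : Prop := |L.gram.det| = 1

/-- The dual lattice `L^∨ = {l ∈ ℝ^N : ⟨l, ν⟩_L ∈ ℤ for all ν ∈ ℤ^N}`. -/
def dual : AddSubgroup (Fin N → ℝ) where
  carrier := {l | ∀ ν : Fin N → ℤ, ∃ m : ℤ, L.bil l (fun i => (ν i : ℝ)) = m}
  zero_mem' := fun ν => ⟨0, by simp [bil]⟩
  add_mem' := by
    intro a b ha hb ν
    obtain ⟨m, hm⟩ := ha ν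
    obtain ⟨n, hn⟩ := hb ν
    refine ⟨m + n, ?_⟩
    push_cast
    rw [← hm, ← hn]
    simp only [bil, Pi.add_apply, add_mul, Finset.sum_add_distrib]
  neg_mem' := by
    intro a ha ν
    obtain ⟨m, hm⟩ := ha ν
    refine ⟨-m, ?_⟩
    push_cast
    rw [← hm]
    simp only [bil, Pi.neg_apply, neg_mul, Finset.sum_neg_distrib]

/-- The discriminant group `disc(L) = L^∨ / ℤ^N`. -/
abbrev Disc : Type :=
  L.dual ⧸ ((Int.castAddHom ℝ).compLeft (Fin N)).range.addSubgroupOf L.dual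

/-- Coordinates of a dual vector in the dual basis, reduced modulo an integer. -/
def dualMod (D : ℕ) : L.dual →+ (Fin N → ZMod D) where
  toFun l i := ((round (L.bil l.1 (fun j => ((Pi.single i 1 : Fin N → ℤ) j : ℝ))) : ℤ) : ZMod D)
  map_zero' := by
    funext i
    simp [bil]
  map_add' := by
    intro a b
    funext i
    obtain ⟨m, hm⟩ := a.2 (Pi.single i 1)
    obtain ⟨n, hn⟩ := b.2 (Pi.single i 1)
    have hmn : L.bil (a + b).1 (fun j => ((Pi.single i 1 : Fin N → ℤ) j : ℝ)) =
        ((m + n : ℤ) : ℝ) := by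
      push_cast
      rw [← hm, ← hn]
      simp only [bil, Pi.add_apply, add_mul, Finset.sum_add_distrib]
    simp only [Pi.add_apply, hm, hn, hmn, round_intCast]
    push_cast
    rfl

/-- The discriminant group of a non-degenerate lattice is finite. -/
instance finite_disc : Finite L.Disc := by
  have hD : L.gram.det.natAbs ≠ 0 := Int.natAbs_ne_zero.mpr L.nondeg
  have : NeZero L.gram.det.natAbs := ⟨hD⟩
  have hle : (L.dualMod L.gram.det.natAbs).ker ≤
      ((Int.castAddHom ℝ).compLeft (Fin N)).range.addSubgroupOf L.dual := by
    intro l hl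
    rw [AddSubgroup.mem_addSubgroupOf]
    have hl' : ∀ i, ∃ m : ℤ, L.bil l.1 (fun j => ((Pi.single i 1 : Fin N → ℤ) j : ℝ)) =
        (L.gram.det : ℝ) * m := by
      intro i
      obtain ⟨m, hm⟩ := l.2 (Pi.single i 1)
      have h1 := congrFun (AddMonoidHom.mem_ker.mp hl) i
      have h2 : ((m : ℤ) : ZMod L.gram.det.natAbs) = 0 := by
        have h3 : ((round (L.bil l.1 (fun j => ((Pi.single i 1 : Fin N → ℤ) j : ℝ))) : ℤ) :
            ZMod L.gram.det.natAbs) = 0 := h1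
        rwa [hm, round_intCast] at h3
      rw [ZMod.intCast_zmod_eq_zero_iff_dvd] at h2
      obtain ⟨k, hk⟩ := Int.natAbs_dvd.mp h2
      exact ⟨k, by rw [hm, hk]; push_cast; ring⟩
    choose m hm using hl'
    have hv : l.1 ᵥ* (L.gram.map (fun a : ℤ => (a : ℝ))) =
        (L.gram.det : ℝ) • (fun i => (m i : ℝ)) := by
      funext i
      have := hm i
      simp only [bil, Pi.single_apply, Int.cast_ite, Int.cast_one, Int.cast_zero, mul_ite,
        mul_one, mul_zero, Finset.sum_ite_eq', Finset.mem_univ, if_true] at this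
      simp only [Matrix.vecMul, dotProduct, Matrix.map_apply, Pi.smul_apply, smul_eq_mul]
      exact this
    refine ⟨m ᵥ* L.gram.adjugate, ?_⟩
    have hdet : (L.gram.det : ℝ) ≠ 0 := by exact_mod_cast L.nondeg
    have hadj : (L.gram.map (fun a : ℤ => (a : ℝ))) * (L.gram.adjugate.map (fun a : ℤ => (a : ℝ)))
        = (L.gram.det : ℝ) • (1 : Matrix (Fin N) (Fin N) ℝ) := by
      ext i j
      have h := congrFun (congrFun (Matrix.mul_adjugate L.gram) i) j
      have h' := congrArg (fun a : ℤ => (a : ℝ)) h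
      simp only [Matrix.mul_apply, Matrix.smul_apply, Matrix.one_apply, smul_eq_mul] at h'
      simp only [Matrix.mul_apply, Matrix.map_apply, Matrix.smul_apply, Matrix.one_apply,
        smul_eq_mul]
      simpa only [Int.cast_sum, Int.cast_mul, Int.cast_ite, Int.cast_one, Int.cast_zero] using h'
    have key := congrArg (fun w => w ᵥ* (L.gram.adjugate.map (fun a : ℤ => (a : ℝ)))) hv
    simp only [Matrix.vecMul_vecMul, hadj, Matrix.vecMul_smul, Matrix.vecMul_one,
      Matrix.smul_vecMul] at key
    have key' := smul_right_injective _ hdet key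
    rw [key']
    funext i
    simp [Matrix.vecMul, dotProduct]
  have : (((Int.castAddHom ℝ).compLeft (Fin N)).range.addSubgroupOf L.dual).FiniteIndex :=
    AddSubgroup.finiteIndex_of_le hle
  exact AddSubgroup.finite_quotient_of_finiteIndex

instance fintype_disc : Fintype L.Disc := Fintype.ofFinite _

instance decEq_disc : DecidableEq L.Disc := Classical.decEq _

end EvenLattice

/-! ### The metaplectic cover of `SL₂(ℤ)` and the Weil representation -/

/-- `e(x) = exp(2 π i x)`. -/
def ee (x : ℂ) : ℂ := Complex.exp (2 * Real.pi * Complex.I * x)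

/-- The automorphy factor `c τ + d`. -/
def cocyc (γ : SL(2, ℤ)) (τ : ℍ) : ℂ := (γ 1 0 : ℂ) * (τ : ℂ) + (γ 1 1 : ℂ)

lemma cocyc_one (τ : ℍ) : cocyc 1 τ = 1 := by simp [cocyc]

lemma cocyc_ne_zero (γ : SL(2, ℤ)) (τ : ℍ) : cocyc γ τ ≠ 0 := by
  have h := UpperHalfPlane.denom_ne_zero (γ : GL (Fin 2) ℝ) τ
  simpa [cocyc, UpperHalfPlane.denom] using h

lemma cocyc_mul (γ δ : SL(2, ℤ)) (τ : ℍ) :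
    cocyc (γ * δ) τ = cocyc γ (δ • τ) * cocyc δ τ := by
  have h := cocyc_ne_zero δ τ
  have hs : ((δ • τ : ℍ) : ℂ) =
      ((δ 0 0 : ℂ) * (τ : ℂ) + (δ 0 1 : ℂ)) / cocyc δ τ := by
    rw [UpperHalfPlane.coe_specialLinearGroup_apply]
    simp [cocyc]
  rw [cocyc, cocyc, hs]
  field_simp
  simp only [Matrix.SpecialLinearGroup.coe_mul, Matrix.mul_apply, Fin.sum_univ_two, cocyc]
  push_cast
  ring

lemma continuous_sl_smul (γ : SL(2, ℤ)) : Continuous fun τ : ℍ => γ • τ := by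
  have := continuous_const_smul (T := ℍ) (γ : SL(2, ℝ))
  exact this

/-- The metaplectic group `Mp₂(ℤ)`: pairs of `γ ∈ SL₂(ℤ)` and a continuous square root `j` of
`τ ↦ c τ + d` on the upper half plane. -/
@[ext]
structure Mp2Z where
  γ : SL(2, ℤ)
  j : ℍ → ℂ
  cont : Continuous j
  sq : ∀ τ : ℍ, j τ ^ 2 = cocyc γ τ

namespace Mp2Z

instance : Mul Mp2Z where
  mul g h :=
    { γ := g.γ * h.γ
      j := fun τ => g.j (h.γ • τ) * h.j τ
      cont := (g.cont.comp (continuous_sl_smul h.γ)).mul h.cont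
      sq := fun τ => by rw [mul_pow, g.sq, h.sq, cocyc_mul] }

instance : One Mp2Z where
  one :=
    { γ := 1
      j := fun _ => 1
      cont := continuous_const
      sq := fun τ => by simp [cocyc_one] }

lemma j_ne_zero (g : Mp2Z) (τ : ℍ) : g.j τ ≠ 0 := by
  intro h0
  have h1 := g.sq τ
  have h2 := cocyc_mul g.γ⁻¹ g.γ τ
  rw [← h1, h0] at h2
  simp [cocyc_one] at h2

instance : Inv Mp2Z where
  inv g :=
    { γ := g.γ⁻¹
      j := fun τ => (g.j (g.γ⁻¹ • τ))⁻¹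
      cont := (g.cont.comp (continuous_sl_smul g.γ⁻¹)).inv₀ (fun τ => g.j_ne_zero _)
      sq := fun τ => by
        have h2 := cocyc_mul g.γ g.γ⁻¹ τ
        rw [mul_inv_cancel, cocyc_one] at h2
        rw [inv_pow, g.sq]
        exact inv_eq_of_mul_eq_one_right h2.symm }

instance : Group Mp2Z where
  mul_assoc a b c := by
    apply Mp2Z.ext
    · exact mul_assoc a.γ b.γ c.γ
    · funext τ
      change (a.j (b.γ • c.γ • τ) * b.j (c.γ • τ)) * c.j τ =
        a.j ((b.γ * c.γ) • τ) * (b.j (c.γ • τ) * c.j τ)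
      rw [mul_smul, mul_assoc]
  one_mul a := by
    apply Mp2Z.ext
    · exact one_mul a.γ
    · funext τ
      exact one_mul (a.j τ)
  mul_one a := by
    apply Mp2Z.ext
    · exact mul_one a.γ
    · funext τ
      change a.j ((1 : SL(2, ℤ)) • τ) * 1 = a.j τ
      rw [one_smul, mul_one]
  inv_mul_cancel a := by
    apply Mp2Z.ext
    · exact inv_mul_cancel a.γ
    · funext τ
      change (a.j (a.γ⁻¹ • a.γ • τ))⁻¹ * a.j τ = 1
      rw [inv_smul_smul, inv_mul_cancel₀ (a.j_ne_zero τ)]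

/-- The generator of `Mp₂(ℤ)` above `T = (1 1; 0 1)`. -/
def T : Mp2Z where
  γ := ModularGroup.T
  j := fun _ => 1
  cont := continuous_const
  sq := fun τ => by simp [cocyc, ModularGroup.T]

/-- The generator of `Mp₂(ℤ)` above `(0 -1; 1 0)`, with the principal branch of `√τ`. -/
def S : Mp2Z where
  γ := ModularGroup.S
  j := fun τ => (τ : ℂ) ^ (1 / 2 : ℂ)
  cont := by
    refine Continuous.cpow UpperHalfPlane.continuous_coe continuous_const ?_
    intro τ
    exact Or.inr τ.im_pos.ne'
  sq := fun τ => by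
    rw [← Complex.cpow_nat_mul]
    simp [cocyc, ModularGroup.S]

end Mp2Z

namespace EvenLattice

variable {N : ℕ} (L : EvenLattice N)

/-- A representative in `L^∨` of a class in the discriminant group. -/
def rep (x : L.Disc) : Fin N → ℝ := (Quotient.out x : L.dual).1

/-- `ρ_L(T) b_x = e(L[x]) b_x` on the group algebra `ℂ[disc(L)]`, whose elements are written in
coordinates with respect to the basis `b_x`. -/
def weilT : Module.End ℂ (L.Disc → ℂ) :=
  Matrix.toLin' (Matrix.diagonal fun x => ee ((L.quad (L.rep x) : ℝ) : ℂ))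

/-- `ρ_L(S) b_x = √i^(d V₋ - d V₊) |disc(L)|^(-1/2) ∑_{x'} e(-⟨x, x'⟩_L) b_{x'}`. -/
def weilS : Module.End ℂ (L.Disc → ℂ) :=
  Matrix.toLin' (Matrix.of fun x' x =>
    Complex.exp (Real.pi * Complex.I * ((L.dNeg : ℂ) - (L.dPos : ℂ)) / 4) /
      ((Real.sqrt (Fintype.card L.Disc) : ℝ) : ℂ) *
      ee (-((L.bil (L.rep x) (L.rep x') : ℝ) : ℂ)))

/-- `L.IsWeil g A`: the endomorphism `A` of `ℂ[disc(L)]` is the value `ρ_L(g)` of the Weil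
representation at `g ∈ Mp₂(ℤ)`.  The representation is given by its values on the generators `S`
and `T`, and `Mp₂(ℤ)` is generated by them as a monoid, because `S` has finite order and
`(S T)³ = S²`. -/
inductive IsWeil : Mp2Z → Module.End ℂ (L.Disc → ℂ) → Prop
  | one : IsWeil 1 1
  | gen_T : IsWeil Mp2Z.T L.weilT
  | gen_S : IsWeil Mp2Z.S L.weilS
  | mul {g h : Mp2Z} {A B : Module.End ℂ (L.Disc → ℂ)} :
      IsWeil g A → IsWeil h B → IsWeil (g * h) (A * B)

end EvenLattice

/-! ### The Jacobi group and the slash action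

Functions on the Jacobi upper half plane `ℍ × ℂ^N` are represented by functions on `ℂ × ℂ^N`, of
which only the values at points with first component in `ℍ` matter. -/

/-- The action of `(γ, l, m)` on the Jacobi upper half plane:
`(τ, z) ↦ (γ τ, (z + l τ + m) / (c τ + d))`. -/
def jacobiAct {N : ℕ} (γ : SL(2, ℤ)) (l m : Fin N → ℝ) (τ : ℍ) (z : Fin N → ℂ) :
    ℂ × (Fin N → ℂ) :=
  (((γ • τ : ℍ) : ℂ), fun i => (z i + l i * (τ : ℂ) + m i) / cocyc γ τ)

/-- The Jacobi slash action of `(γ, l, m)` of index `L`; `J` is the factor that depends on the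
weight `k`, that is `(c τ + d)^(-k)`, or `j(τ)^(-2k)` on the metaplectic cover. -/
def jacobiSlash {N : ℕ} (L : EvenLattice N) (J : ℍ → ℂ) (γ : SL(2, ℤ)) (l m : Fin N → ℝ)
    (φ : ℂ × (Fin N → ℂ) → ℂ) (τ : ℍ) (z : Fin N → ℂ) : ℂ :=
  J τ *
    ee (-(γ 1 0 : ℂ) * L.quad (fun i => z i + l i * (τ : ℂ) + m i) / cocyc γ τ +
      L.bil (fun i => (l i : ℂ)) z + (L.quad l : ℝ) * (τ : ℂ)) *
    φ (jacobiAct γ l m τ z)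

/-! ### Differential operators -/

section operators

variable {N : ℕ}

/-- The holomorphic Wirtinger derivative in the direction `w`. -/
def wD (w : ℂ × (Fin N → ℂ)) (φ : ℂ × (Fin N → ℂ) → ℂ) (p : ℂ × (Fin N → ℂ)) : ℂ :=
  (fderiv ℝ φ p w - Complex.I * fderiv ℝ φ p (Complex.I • w)) / 2

/-- The antiholomorphic Wirtinger derivative in the direction `w`. -/
def wDbar (w : ℂ × (Fin N → ℂ)) (φ : ℂ × (Fin N → ℂ) → ℂ) (p : ℂ × (Fin N → ℂ)) : ℂ :=
  (fderiv ℝ φ p w + Complex.I * fderiv ℝ φ p (Complex.I • w)) / 2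

/-- The direction of the modular variable `τ`. -/
def dirTau : ℂ × (Fin N → ℂ) := (1, 0)

/-- The direction of the elliptic variable `z_i`. -/
def dirZ (i : Fin N) : ℂ × (Fin N → ℂ) := (0, Pi.single i 1)

/-- The elliptic direction given by a real vector. -/
def dirVec (e : Fin N → ℝ) : ℂ × (Fin N → ℂ) := (0, fun i => (e i : ℂ))

/-- `∂_{u_i}`, where `u` is the real part of `z`. -/
def dU (i : Fin N) (φ : ℂ × (Fin N → ℂ) → ℂ) (p : ℂ × (Fin N → ℂ)) : ℂ :=
  fderiv ℝ φ p (dirZ i)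

/-- `Δ_k = 4 y² ∂_τ ∂_τ̄ - 2 k i y ∂_τ̄`. -/
def laplaceWeight (k : ℝ) (φ : ℂ × (Fin N → ℂ) → ℂ) (p : ℂ × (Fin N → ℂ)) : ℂ :=
  4 * (p.1.im : ℂ) ^ 2 * wD dirTau (wDbar dirTau φ) p -
    2 * (k : ℂ) * Complex.I * (p.1.im : ℂ) * wDbar dirTau φ p

/-- The inverse of `2 π i L`. -/
def invL (L : EvenLattice N) : Matrix (Fin N) (Fin N) ℂ :=
  ((2 * Real.pi * Complex.I : ℂ) • L.mat.map (fun a : ℝ => (a : ℂ)))⁻¹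

/-- The operator `∑ (2 π i L)⁻¹_{ij} A_i B_j`, for vectors of operators `A`, `B`. -/
def contract (L : EvenLattice N)
    (A B : Fin N → (ℂ × (Fin N → ℂ) → ℂ) → (ℂ × (Fin N → ℂ) → ℂ))
    (φ : ℂ × (Fin N → ℂ) → ℂ) (p : ℂ × (Fin N → ℂ)) : ℂ :=
  ∑ i, ∑ j, invL L i j * A i (B j φ) p

/-- `∂_{z_i}`. -/
def dZ (i : Fin N) : (ℂ × (Fin N → ℂ) → ℂ) → (ℂ × (Fin N → ℂ) → ℂ) := wD (dirZ i)

/-- `∂_{z̄_i}`. -/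
def dZbar (i : Fin N) : (ℂ × (Fin N → ℂ) → ℂ) → (ℂ × (Fin N → ℂ) → ℂ) := wDbar (dirZ i)

/-- The Casimir operator of weight `k` and index `L`; here `y = Im τ` and `v = Im z`. -/
def casimir (L : EvenLattice N) (k : ℝ) (φ : ℂ × (Fin N → ℂ) → ℂ) (p : ℂ × (Fin N → ℂ)) : ℂ :=
  -2 * laplaceWeight (k - N / 2) φ p +
  2 * (p.1.im : ℂ) ^ 2 *
    (wDbar dirTau (contract L dZ dZ φ) p + wD dirTau (contract L dZbar dZbar φ) p) -
  8 * (p.1.im : ℂ) * (∑ i, ((p.2 i).im : ℂ) * wD dirTau (dZbar i φ) p) -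
  1 / 2 * (p.1.im : ℂ) ^ 2 *
    (contract L dZbar dZbar (contract L dZ dZ φ) p -
      contract L dZbar dZ (contract L dZbar dZ φ) p) +
  2 * (p.1.im : ℂ) * (∑ i, ((p.2 i).im : ℂ) * dZbar i (contract L dZ dU φ) p) -
  1 / 2 * (2 * k - N + 1) * Complex.I * (p.1.im : ℂ) * contract L dZbar dU φ p +
  2 * (∑ i, ∑ j, ((p.2 i).im : ℂ) * ((p.2 j).im : ℂ) * dZbar i (dZbar j φ) p) +
  (2 * k - N - 1) * Complex.I * (∑ i, ((p.2 i).im : ℂ) * dZbar i φ p)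

/-- The Heisenberg Laplace operator `y ∂_e ∂̄_e + 4 π i (vᵀ L e) ∂̄_e` in the direction `e`. -/
def heisenbergLaplace (L : EvenLattice N) (e : Fin N → ℝ) (φ : ℂ × (Fin N → ℂ) → ℂ)
    (p : ℂ × (Fin N → ℂ)) : ℂ :=
  (p.1.im : ℂ) * wD (dirVec e) (wDbar (dirVec e) φ) p +
    2 * Real.pi * Complex.I * ((L.bil (fun i => (p.2 i).im) e : ℝ) : ℂ) * wDbar (dirVec e) φ p

end operators

/-! ### Maaß–Jacobi forms

The singularities of `φ` are the points at which `φ` is not real-analytic. -/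

section forms

variable {N : ℕ}

/-- `φ` has non-moving singularities: they are located on finitely many sets
`{z : p(z) = α + β τ} + ℤ^N + τ ℤ^N`, with `p ≠ 0` a linear form on `ℝ^N` and `α, β ∈ ℝ`. -/
def HasNonMovingSingularities (φ : ℂ × (Fin N → ℂ) → ℂ) : Prop :=
  ∃ s : Finset ((Fin N → ℝ) × ℝ × ℝ), (∀ t ∈ s, t.1 ≠ 0) ∧
    ∀ (τ : ℍ) (z : Fin N → ℂ), ¬ AnalyticAt ℝ φ ((τ : ℂ), z) →
      ∃ t ∈ s, ∃ l m : Fin N → ℤ,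
        ∑ i, (t.1 i : ℂ) * (z i - m i - l i * (τ : ℂ)) = t.2.1 + t.2.2 * (τ : ℂ)

/-- `φ` has at most almost meromorphic singularities: locally it is the quotient of a
real-analytic by a (non-zero) holomorphic function. -/
def HasAlmostMeromorphicSingularities (φ : ℂ × (Fin N → ℂ) → ℂ) : Prop :=
  ∀ (τ : ℍ) (z : Fin N → ℂ), ∃ f h : ℂ × (Fin N → ℂ) → ℂ,
    AnalyticAt ℝ f ((τ : ℂ), z) ∧ AnalyticAt ℂ h ((τ : ℂ), z) ∧
    (¬ ∀ᶠ p in 𝓝 ((τ : ℂ), z), h p = 0) ∧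
    ∀ᶠ p in 𝓝 ((τ : ℂ), z), h p ≠ 0 → φ p = f p / h p

/-- Annihilation by an operator away from the singularities. -/
def IsAnnihilatedBy (D : (ℂ × (Fin N → ℂ) → ℂ) → (ℂ × (Fin N → ℂ) → ℂ))
    (φ : ℂ × (Fin N → ℂ) → ℂ) : Prop :=
  ∀ (τ : ℍ) (z : Fin N → ℂ), AnalyticAt ℝ φ ((τ : ℂ), z) → D φ ((τ : ℂ), z) = 0

/-- Growth condition: `φ(τ, α τ + β) = O(e^{a y})` for some `a > 0` as `y → ∞`, for all real
`α`, `β` such that `τ ↦ (τ, α τ + β)` does not meet the singularities of `φ`. -/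
def HasWeakGrowth (φ : ℂ × (Fin N → ℂ) → ℂ) : Prop :=
  ∀ α β : Fin N → ℝ,
    (∀ τ : ℍ, AnalyticAt ℝ φ ((τ : ℂ), fun i => α i * (τ : ℂ) + β i)) →
    ∃ a : ℝ, 0 < a ∧
      (fun τ : ℍ => φ ((τ : ℂ), fun i => α i * (τ : ℂ) + β i)) =O[atImInfty]
        fun τ : ℍ => Real.exp (a * τ.im)

/-- Vector-valued Maaß–Jacobi forms of weight `r / 2`, index `L` and type `ρ^J_L`, the
representation that is the Weil representation on `Mp₂(ℤ)` and trivial on the Heisenberg part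
`ℤ^N ⊗ ℤ²`. -/
structure IsVectorValuedMaassJacobiForm (L : EvenLattice N) (r : ℤ)
    (Φ : L.Disc → ℂ × (Fin N → ℂ) → ℂ) : Prop where
  nonMoving : ∀ x, HasNonMovingSingularities (Φ x)
  almostMeromorphic : ∀ x, HasAlmostMeromorphicSingularities (Φ x)
  casimir : ∀ x, IsAnnihilatedBy (casimir L (r / 2)) (Φ x)
  growth : ∀ x, HasWeakGrowth (Φ x)
  weil_exists : ∀ g : Mp2Z, ∃ A, L.IsWeil g A
  slash : ∀ (g : Mp2Z) (A : Module.End ℂ (L.Disc → ℂ)), L.IsWeil g A →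
    ∀ (l m : Fin N → ℤ) (τ : ℍ) (z : Fin N → ℂ),
      (∀ x, AnalyticAt ℝ (Φ x) ((τ : ℂ), z)) →
      (∀ x, AnalyticAt ℝ (Φ x) (jacobiAct g.γ (fun i => l i) (fun i => m i) τ z)) →
      ∀ x, jacobiSlash L (fun τ => g.j τ ^ (-r)) g.γ (fun i => l i) (fun i => m i) (Φ x) τ z =
        A (fun x' => Φ x' ((τ : ℂ), z)) x

/-- `H[E]`-harmonic Maaß–Jacobi forms of weight `k` and index `L`. -/
structure IsHHarmonicMaassJacobiForm {d : ℕ} (L : EvenLattice N) (E : Fin d → Fin N → ℝ) (k : ℤ)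
    (φ : ℂ × (Fin N → ℂ) → ℂ) : Prop where
  nonMoving : HasNonMovingSingularities φ
  almostMeromorphic : HasAlmostMeromorphicSingularities φ
  slash : ∀ (γ : SL(2, ℤ)) (l m : Fin N → ℤ) (τ : ℍ) (z : Fin N → ℂ),
    AnalyticAt ℝ φ ((τ : ℂ), z) →
    AnalyticAt ℝ φ (jacobiAct γ (fun i => l i) (fun i => m i) τ z) →
    jacobiSlash L (fun τ => cocyc γ τ ^ (-k)) γ (fun i => l i) (fun i => m i) φ τ z =
      φ ((τ : ℂ), z)
  casimir : IsAnnihilatedBy (casimir L k) φ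
  heisenberg : ∀ i, IsAnnihilatedBy (heisenbergLaplace L (E i)) φ
  holomorphic : ∀ w : Fin N → ℝ, (∀ i, L.bil w (E i) = 0) → IsAnnihilatedBy (wDbar (dirVec w)) φ
  growth : HasWeakGrowth φ

end forms

/-! ### Indefinite theta series -/

namespace EvenLattice

variable {N d : ℕ} (L : EvenLattice N)

/-- Half of the conditions on a compatible pair: `E` is a partial frame of length `d V₋` such that
`E^⊥` modulo its radical is positive definite or zero.  Isotropic vectors in `E` are required to
span rational lines. -/
structure IsThetaFrame (E : Fin d → Fin N → ℝ) : Prop where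
  length_eq : d = L.dNeg
  linearIndependent : LinearIndependent ℝ E
  perp_nonneg : ∀ w : Fin N → ℝ, (∀ i, L.bil w (E i) = 0) → 0 ≤ L.quad w
  rational : ∀ i, L.quad (E i) = 0 → ∃ c : ℝ, c ≠ 0 ∧ ∃ ν : Fin N → ℤ, ∀ k, c * E i k = ν k

/-- Compatible pairs of partial frames: the planes `span(e_i, e'_i)` have signature `(1, 1)` and
are mutually orthogonal; the vectors are oriented by `⟨e_i, e'_i⟩_L < 0`. -/
structure IsCompatiblePair (E E' : Fin d → Fin N → ℝ) : Prop where
  left : L.IsThetaFrame E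
  right : L.IsThetaFrame E'
  span_pos : ∀ i, ∃ w ∈ Submodule.span ℝ {E i, E' i}, 0 < L.quad w
  span_neg : ∀ i, ∃ w ∈ Submodule.span ℝ {E i, E' i}, L.quad w < 0
  orthogonal : ∀ i j, i ≠ j → ∀ w ∈ Submodule.span ℝ {E i, E' i},
    ∀ w' ∈ Submodule.span ℝ {E j, E' j}, L.bil w w' = 0
  orientation : ∀ i, L.bil (E i) (E' i) < 0

/-- `ν + v / y`. -/
def shifted (p : ℂ × (Fin N → ℂ)) (ν : Fin N → ℝ) : Fin N → ℝ :=
  fun i => ν i + (p.2 i).im / p.1.im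

/-- The lower incomplete gamma function `γ(1/2, t)`. -/
def lowerGammaHalf (t : ℝ) : ℝ := ∫ u in (0 : ℝ)..t, u ^ (-(1 / 2) : ℝ) * Real.exp (-u)

/-- `ρ^e(τ, z; ν)`: the sign of `⟨e, ν + v / y⟩_L` if `e` is isotropic, and
`π^(-1/2) sgn(⟨e, ν + v / y⟩_L) γ(1/2, -π y ⟨e, ν + v / y⟩_L² / L[e])` if `L[e] < 0`. -/
def rho (e : Fin N → ℝ) (p : ℂ × (Fin N → ℂ)) (ν : Fin N → ℝ) : ℝ :=
  open scoped Classical in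
  if L.quad e = 0 then Real.sign (L.bil e (shifted p ν))
  else (Real.sqrt Real.pi)⁻¹ * Real.sign (L.bil e (shifted p ν)) *
    lowerGammaHalf (-(Real.pi * p.1.im * L.bil e (shifted p ν) ^ 2) / L.quad e)

/-- The term of the indefinite theta series at `ν ∈ ℤ^N`. -/
def thetaTerm (E E' : Fin d → Fin N → ℝ) (p : ℂ × (Fin N → ℂ)) (ν : Fin N → ℤ) : ℂ :=
  ((∏ i, (L.rho (E i) p (fun k => ν k) - L.rho (E' i) p (fun k => ν k)) : ℝ) : ℂ) *
    ee (L.quad (fun k => (ν k : ℂ)) * p.1 + L.bil p.2 (fun k => (ν k : ℂ)))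

/-- The indefinite theta series `θ_L^{E, E'}`. -/
def theta (E E' : Fin d → Fin N → ℝ) (p : ℂ × (Fin N → ℂ)) : ℂ :=
  ∑' ν : Fin N → ℤ, L.thetaTerm E E' p ν

/-- The domain `D(E)`: the points with `⟨e, ν + v / y⟩_L ≠ 0` for all `ν ∈ ℤ^N` and all isotropic
`e` in `E`. -/
def domD (E : Fin d → Fin N → ℝ) : Set (ℂ × (Fin N → ℂ)) :=
  {p | 0 < p.1.im ∧ ∀ i, L.quad (E i) = 0 →
    ∀ ν : Fin N → ℤ, L.bil (E i) (shifted p (fun k => ν k)) ≠ 0}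

/-- `Φ` is given by the translates `θ_L^{E, E'} | (1, l, 0)`, `l ∈ disc(L)`: the theta series
converges absolutely on `D(E) ∩ D(E')`, and `Φ` agrees there with the translates. -/
def IsThetaTranslates (E E' : Fin d → Fin N → ℝ) (Φ : L.Disc → ℂ × (Fin N → ℂ) → ℂ) : Prop :=
  ∀ (l : L.dual) (τ : ℍ) (z : Fin N → ℂ),
    jacobiAct 1 l.1 0 τ z ∈ L.domD E ∩ L.domD E' →
    Summable (L.thetaTerm E E' (jacobiAct 1 l.1 0 τ z)) ∧
    Φ (QuotientAddGroup.mk l) ((τ : ℂ), z) =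
      jacobiSlash L (fun _ => 1) 1 l.1 0 (L.theta E E') τ z

end EvenLattice

end

open Real (exp sqrt)
open Finset (sum_congr mul_sum sum_mul sum_add_distrib prod_congr sum_div sum_comm prod_mul_distrib
  sum_neg_distrib sum_eq_zero prod_ne_zero_iff sum_sub_distrib)
open scoped Real

local notation "Jac[" N "]" => ℂ × (Fin N → ℂ)
local notation "𝕚" => Complex.I

noncomputable section

/-! ### Locally uniformly summable families of holomorphic functions of several variables -/

section holomorphic

variable {E : Type} [NormedAddCommGroup E] [NormedSpace ℂ E]

open scoped ContDiff

lemma norm_fderiv_le_of_forall_ball {F : Type} [NormedAddCommGroup F] [NormedSpace ℂ F]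
    {f : E → F} {x : E} {δ M : ℝ} (hδ : 0 < δ)
    (hf : DifferentiableOn ℂ f (Metric.ball x δ)) (hM : ∀ y ∈ Metric.ball x δ, ‖f y‖ ≤ M) :
    ‖fderiv ℂ f x‖ ≤ M * (2 / δ) := by
  have := Complex.norm_fderiv_le_div_of_mapsTo_ball (R₂ := 2 * M) hf (fun y hy => by
    rw [Metric.mem_closedBall, dist_eq_norm]
    calc ‖f y - f x‖ ≤ ‖f y‖ + ‖f x‖ := norm_sub_le _ _
      _ ≤ 2 * M := by linarith [hM y hy, hM x (Metric.mem_ball_self hδ)]) hδ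
  calc _ ≤ _ := this
    _ = _ := by ring

lemma norm_iteratedFDeriv_le_of_forall_ball {F : Type} [NormedAddCommGroup F] [NormedSpace ℂ F]
    {f : E → F} {x : E} {r δ M : ℝ} (hδ : 0 < δ)
    (hf : ContDiffOn ℂ ∞ f (Metric.ball x r)) (hM : ∀ y ∈ Metric.ball x r, ‖f y‖ ≤ M) (k : ℕ) :
    ∀ y ∈ Metric.ball x (r - k * δ), ‖iteratedFDeriv ℂ k f y‖ ≤ M * (2 / δ) ^ k := by
  induction k with
  | zero =>
    intro y hy
    simpa using hM y (by simpa using hy)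
  | succ k ih =>
    intro y hy
    have hsub : Metric.ball y δ ⊆ Metric.ball x (r - k * δ) := by
      apply Metric.ball_subset_ball'
      rw [Metric.mem_ball] at hy
      push_cast at hy
      linarith
    have hsub' : Metric.ball x (r - k * δ) ⊆ Metric.ball x r :=
      Metric.ball_subset_ball (by have : (0 : ℝ) ≤ k * δ := by positivity
                                  linarith)
    rw [← norm_fderiv_iteratedFDeriv, pow_succ, ← mul_assoc]
    refine norm_fderiv_le_of_forall_ball hδ (fun z hz => ?_) fun z hz => ih z (hsub hz)
    have := hf.contDiffAt (Metric.isOpen_ball.mem_nhds (hsub' (hsub hz)))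
    exact (this.differentiableAt_iteratedFDeriv (by exact_mod_cast ENat.natCast_lt_top k)).differentiableWithinAt

lemma iteratedDeriv_comp_line {F : Type} [NormedAddCommGroup F] [NormedSpace ℂ F]
    {f : E → F} {x v : E} {r : ℝ}
    (hf : ContDiffOn ℂ ∞ f (Metric.ball x r)) (k : ℕ) :
    ∀ t : ℂ, x + t • v ∈ Metric.ball x r → iteratedDeriv k (fun t : ℂ => f (x + t • v)) t =
        iteratedFDeriv ℂ k f (x + t • v) fun _ => v := by
  have hcont : Continuous fun t : ℂ => x + t • v := by fun_prop
  induction k with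
  | zero => intro t _; simp
  | succ k ih =>
    intro t ht
    rw [iteratedDeriv_succ, iteratedFDeriv_succ_apply_left]
    have hev : ∀ᶠ s in 𝓝 t, x + s • v ∈ Metric.ball x r :=
      hcont.continuousAt.eventually (Metric.isOpen_ball.mem_nhds ht)
    have heq : iteratedDeriv k (fun t : ℂ => f (x + t • v)) =ᶠ[𝓝 t]
        fun s => iteratedFDeriv ℂ k f (x + s • v) fun _ => v := hev.mono fun s hs => ih s hs
    rw [heq.deriv_eq]
    have hd : DifferentiableAt ℂ (iteratedFDeriv ℂ k f) (x + t • v) :=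
      (hf.contDiffAt (Metric.isOpen_ball.mem_nhds ht)).differentiableAt_iteratedFDeriv
        (by exact_mod_cast ENat.natCast_lt_top k)
    have hl : HasDerivAt (fun s : ℂ => x + s • v) v t := by
      simpa using ((hasDerivAt_id t).smul_const v).const_add x
    have h1 := hd.hasFDerivAt.comp_hasDerivAt t hl
    have h2 := ((ContinuousMultilinearMap.apply ℂ (fun _ : Fin k => E) F fun _ => v).hasFDerivAt
      (x := iteratedFDeriv ℂ k f (x + t • v))).comp_hasDerivAt t h1
    exact h2.deriv

/-- A bounded smooth function of several complex variables is analytic. -/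
theorem analyticAt_of_contDiffOn_of_bounded {F : Type} [NormedAddCommGroup F] [NormedSpace ℂ F]
    [CompleteSpace F] {f : E → F} {x : E} {r M : ℝ}
    (hr : 0 < r) (hf : ContDiffOn ℂ ∞ f (Metric.ball x r))
    (hM : ∀ y ∈ Metric.ball x r, ‖f y‖ ≤ M) : AnalyticAt ℂ f x := by
  have hM0 : 0 ≤ M := (norm_nonneg _).trans (hM x (Metric.mem_ball_self hr))
  let p : FormalMultilinearSeries ℂ E F := fun k => ((k.factorial : ℂ)⁻¹) • iteratedFDeriv ℂ k f x
  set ρ : ℝ := r / (2 * exp 1) with hρ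
  have hρ0 : 0 < ρ := by positivity
  have hbound : ∀ k, ‖p k‖ * ρ ^ k ≤ M * exp 1 := by
    intro k
    have h1 := norm_iteratedFDeriv_le_of_forall_ball (δ := r / (k + 1)) (by positivity) hf hM k x
      (by
        apply Metric.mem_ball_self
        have : (k : ℝ) * (r / (k + 1)) = r * (k / (k + 1)) := by ring
        have h2 : (k : ℝ) / (k + 1) < 1 := by rw [div_lt_one (by positivity)]; linarith
        nlinarith)
    have h3 := Real.pow_div_factorial_le_exp ((k : ℝ) + 1) (by positivity) k
    have hk : (0 : ℝ) < k.factorial := by positivity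
    calc ‖p k‖ * ρ ^ k = (k.factorial : ℝ)⁻¹ * ‖iteratedFDeriv ℂ k f x‖ * ρ ^ k := by
          simp only [p]; rw [norm_smul]; simp
      _ ≤ (k.factorial : ℝ)⁻¹ * (M * (2 / (r / (k + 1))) ^ k) * ρ ^ k := by gcongr
      _ = M * (((k : ℝ) + 1) ^ k / k.factorial) * (exp 1)⁻¹ ^ k := by
          have h5 : 2 / (r / ((k : ℝ) + 1)) * ρ = (k + 1) * (exp 1)⁻¹ := by
            rw [hρ]; field_simp
          rw [show (k.factorial : ℝ)⁻¹ * (M * (2 / (r / (k + 1))) ^ k) * ρ ^ k =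
            (k.factorial : ℝ)⁻¹ * M * ((2 / (r / (k + 1))) * ρ) ^ k by rw [mul_pow]; ring, h5,
            mul_pow]
          ring
      _ ≤ M * exp (k + 1) * (exp 1)⁻¹ ^ k := by gcongr
      _ = M * exp 1 := by
          rw [Real.exp_add, ← Real.exp_neg, ← Real.exp_nat_mul, mul_assoc, mul_comm (exp _),
            mul_assoc, ← Real.exp_add]
          simp
  obtain ⟨R, hR⟩ : ∃ R : NNReal, (R : ℝ) = ρ := ⟨⟨ρ, hρ0.le⟩, rfl⟩
  have hrad : (R : ENNReal) ≤ p.radius :=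
    p.le_radius_of_bound (M * exp 1) (by rw [hR]; exact hbound)
  refine ⟨p, (R : ENNReal), hrad, ?_, ?_⟩
  · rw [ENNReal.coe_pos, ← NNReal.coe_pos, hR]
    exact hρ0
  intro y hy
  have hy' : ‖y‖ < ρ := by
    rwa [Metric.eball_coe, mem_ball_zero_iff, hR] at hy
  have he : 1 ≤ exp 1 := Real.one_le_exp zero_le_one
  have hρr : 2 * ρ ≤ r := by
    rw [hρ]
    rw [show 2 * (r / (2 * exp 1)) = r / exp 1 by field_simp]
    exact div_le_self hr.le he
  have hmem : ∀ t ∈ Metric.ball (0 : ℂ) 2, x + t • y ∈ Metric.ball x r := by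
    intro t ht
    rw [mem_ball_zero_iff] at ht
    rw [Metric.mem_ball, dist_eq_norm, add_sub_cancel_left, norm_smul]
    nlinarith [norm_nonneg t, norm_nonneg y]
  have hdiff : DifferentiableOn ℂ (fun t : ℂ => f (x + t • y)) (Metric.ball 0 2) := by
    intro t ht
    have h1 := (hf.contDiffAt (Metric.isOpen_ball.mem_nhds (hmem t ht))).differentiableAt
      (by simp)
    exact (h1.comp t (by fun_prop)).differentiableWithinAt
  have key := Complex.hasSum_taylorSeries_on_ball hdiff (z := 1) (by simp)
  simp only [sub_zero, one_pow, one_smul] at key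
  convert key using 2 with k
  rw [iteratedDeriv_comp_line hf k 0 (by simpa using hr)]
  simp [p]

/-- A normally convergent series of smooth functions on a ball is smooth on every smaller ball. -/
theorem contDiffOn_tsum_ball {α : Type*} {u : α → ℝ} (hu : Summable u) (x : E) (n : ℕ) :
    ∀ {F : Type} [NormedAddCommGroup F] [NormedSpace ℂ F] [CompleteSpace F] {g : α → E → F} {r δ M : ℝ},
      0 < δ → 0 ≤ M → (∀ a, ContDiffOn ℂ ∞ (g a) (Metric.ball x r)) →
      (∀ a, ∀ y ∈ Metric.ball x r, ‖g a y‖ ≤ M * u a) →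
      ContDiffOn ℂ n (fun y => ∑' a, g a y) (Metric.ball x (r - n * δ)) ∧
      (∀ y ∈ Metric.ball x (r - δ), HasFDerivAt (fun y => ∑' a, g a y)
        (∑' a, fderiv ℂ (g a) y) y) := by
  have hder : ∀ {F : Type} [NormedAddCommGroup F] [NormedSpace ℂ F] [CompleteSpace F]
      {g : α → E → F} {r δ M : ℝ},
      0 < δ → (∀ a, ContDiffOn ℂ ∞ (g a) (Metric.ball x r)) →
      (∀ a, ∀ y ∈ Metric.ball x r, ‖g a y‖ ≤ M * u a) →
      (∀ a, ∀ y ∈ Metric.ball x (r - δ), ‖fderiv ℂ (g a) y‖ ≤ M * (2 / δ) * u a) ∧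
      (∀ y ∈ Metric.ball x (r - δ), HasFDerivAt (fun y => ∑' a, g a y)
        (∑' a, fderiv ℂ (g a) y) y) := by
    intro F _ _ _ g r δ M hδ hg hM
    have hsub : ∀ y ∈ Metric.ball x (r - δ), Metric.ball y δ ⊆ Metric.ball x r := by
      intro y hy
      apply Metric.ball_subset_ball'
      rw [Metric.mem_ball] at hy
      linarith
    have hb : ∀ a, ∀ y ∈ Metric.ball x (r - δ), ‖fderiv ℂ (g a) y‖ ≤ M * (2 / δ) * u a := by
      intro a y hy
      have := norm_fderiv_le_of_forall_ball hδ
        (((hg a).differentiableOn (by simp)).mono (hsub y hy))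
        (fun z hz => hM a z (hsub y hy hz))
      calc _ ≤ _ := this
        _ = _ := by ring
    refine ⟨hb, fun y hy => ?_⟩
    have hyr : y ∈ Metric.ball x r := hsub y hy (Metric.mem_ball_self hδ)
    have : NormedSpace ℝ E := NormedSpace.restrictScalars ℝ ℂ E
    refine hasFDerivAt_tsum_of_isPreconnected (hu.mul_left (M * (2 / δ))) Metric.isOpen_ball
      (convex_ball x (r - δ)).isPreconnected (fun a z hz => ?_) hb hy ?_ hy
    · exact ((hg a).differentiableOn (by simp) |>.differentiableAt
        (Metric.isOpen_ball.mem_nhds (hsub z hz (Metric.mem_ball_self hδ)))).hasFDerivAt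
    · exact Summable.of_norm_bounded (hu.mul_left M) fun a => hM a y hyr
  induction n with
  | zero =>
    intro F _ _ _ g r δ M hδ hM0 hg hM
    refine ⟨?_, (hder hδ hg hM).2⟩
    have hc : ContinuousOn (fun y => ∑' a, g a y) (Metric.ball x r) :=
      continuousOn_tsum (fun a => (hg a).continuousOn) (hu.mul_left M) hM
    simpa [contDiffOn_zero] using hc
  | succ n ih =>
    intro F _ _ _ g r δ M hδ hM0 hg hM
    obtain ⟨hb, hd⟩ := hder hδ hg hM
    refine ⟨?_, hd⟩
    have hle : Metric.ball x (r - (n + 1 : ℕ) * δ) ⊆ Metric.ball x (r - δ) :=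
      Metric.ball_subset_ball (by push_cast; nlinarith [(Nat.cast_nonneg n : (0 : ℝ) ≤ n)])
    have hle' : Metric.ball x (r - δ) ⊆ Metric.ball x r := Metric.ball_subset_ball (by linarith)
    push_cast
    rw [contDiffOn_succ_iff_fderiv_of_isOpen Metric.isOpen_ball]
    refine ⟨fun y hy => (hd y (hle (by push_cast; exact hy))).differentiableAt.differentiableWithinAt, by simp, ?_⟩
    have h1 := (ih (g := fun a => fderiv ℂ (g a)) (r := r - δ) (δ := δ) (M := M * (2 / δ)) hδ
      (by positivity) (fun a => ?_) hb).1
    · have h2 : r - δ - n * δ = r - (n + 1) * δ := by ring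
      rw [h2] at h1
      refine h1.congr fun y hy => (hd y (hle (by push_cast; exact hy))).fderiv
    · have := (contDiffOn_infty_iff_fderiv_of_isOpen Metric.isOpen_ball).1 (hg a)
      exact this.2.mono hle'

/-- `g` is a normally convergent family of holomorphic functions near `x`. -/
def NormallySummableAt {α : Type*} (g : α → E → ℂ) (x : E) : Prop :=
  ∃ (u : α → ℝ) (r : ℝ), Summable u ∧ 0 < r ∧
    (∀ a, ContDiffOn ℂ ∞ (g a) (Metric.ball x r)) ∧ ∀ a, ∀ y ∈ Metric.ball x r, ‖g a y‖ ≤ u a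

variable {α : Type*} {g : α → E → ℂ} {x : E}

lemma NormallySummableAt.summable (h : NormallySummableAt g x) :
    ∀ᶠ y in 𝓝 x, Summable fun a => g a y := by
  obtain ⟨u, r, hu, hr, -, hb⟩ := h
  filter_upwards [Metric.ball_mem_nhds x hr] with y hy
  exact Summable.of_norm_bounded hu fun a => hb a y hy

lemma NormallySummableAt.fderiv (h : NormallySummableAt g x) (w : E) :
    NormallySummableAt (fun a y => fderiv ℂ (g a) y w) x ∧
    ∀ᶠ y in 𝓝 x, DifferentiableAt ℂ (fun y => ∑' a, g a y) y ∧ (∀ a, DifferentiableAt ℂ (g a) y) ∧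
      _root_.fderiv ℂ (fun y => ∑' a, g a y) y w = ∑' a, _root_.fderiv ℂ (g a) y w := by
  obtain ⟨u, r, hu, hr, hg, hb⟩ := h
  have hsub : ∀ y ∈ Metric.ball x (r / 2), Metric.ball y (r / 2) ⊆ Metric.ball x r := by
    intro y hy
    apply Metric.ball_subset_ball'
    rw [Metric.mem_ball] at hy
    linarith
  have hsub' : Metric.ball x (r / 2) ⊆ Metric.ball x r := Metric.ball_subset_ball (by linarith)
  have hbd : ∀ a, ∀ y ∈ Metric.ball x (r / 2), ‖_root_.fderiv ℂ (g a) y‖ ≤ u a * (2 / (r / 2)) := by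
    intro a y hy
    exact norm_fderiv_le_of_forall_ball (by linarith)
      (((hg a).differentiableOn (by simp)).mono (hsub y hy)) (fun z hz => hb a z (hsub y hy hz))
  refine ⟨⟨fun a => u a * (2 / (r / 2)) * ‖w‖, r / 2, (hu.mul_right _).mul_right _, by linarith,
    fun a => ?_, fun a y hy => ?_⟩, ?_⟩
  · have := ((contDiffOn_infty_iff_fderiv_of_isOpen Metric.isOpen_ball).1 (hg a)).2.mono hsub'
    exact this.clm_apply contDiffOn_const
  · calc _ ≤ ‖_root_.fderiv ℂ (g a) y‖ * ‖w‖ := ContinuousLinearMap.le_opNorm _ _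
      _ ≤ _ := mul_le_mul_of_nonneg_right (hbd a y hy) (norm_nonneg w)
  · filter_upwards [Metric.ball_mem_nhds x (half_pos hr)] with y hy
    have h1 := (contDiffOn_tsum_ball (F := ℂ) (g := g) hu x 0 (δ := r / 2) (M := 1) (r := r)
      (by linarith) zero_le_one hg (by simpa using hb)).2 y (by simpa [sub_half] using hy)
    refine ⟨h1.differentiableAt, fun a => ((hg a).differentiableOn (by simp)).differentiableAt
      (Metric.isOpen_ball.mem_nhds (hsub' hy)), ?_⟩
    rw [h1.fderiv]
    have hs : Summable fun a => _root_.fderiv ℂ (g a) y :=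
      Summable.of_norm_bounded (hu.mul_right _) fun a => hbd a y hy
    exact (ContinuousLinearMap.apply ℂ ℂ w).map_tsum hs

theorem NormallySummableAt.analyticAt (h : NormallySummableAt g x) :
    AnalyticAt ℂ (fun y => ∑' a, g a y) x := by
  obtain ⟨u, r, hu, hr, hg, hb⟩ := h
  have hu0 : ∀ a, 0 ≤ u a := fun a => (norm_nonneg _).trans (hb a x (Metric.mem_ball_self hr))
  refine analyticAt_of_contDiffOn_of_bounded (r := r / 2) (M := ∑' a, u a) (by linarith) ?_ ?_
  · rw [contDiffOn_infty]
    intro n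
    have h1 := (contDiffOn_tsum_ball (F := ℂ) (g := g) hu x n (δ := r / 2 / (n + 1)) (M := 1)
      (r := r) (by positivity) zero_le_one hg (by simpa using hb)).1
    refine h1.mono (Metric.ball_subset_ball ?_)
    have h2 : (n : ℝ) * (r / 2 / (n + 1)) = r / 2 * (n / (n + 1)) := by ring
    have h3 : (n : ℝ) / (n + 1) ≤ 1 := by rw [div_le_one (by positivity)]; linarith
    rw [h2]
    nlinarith
  · intro y hy
    exact tsum_of_norm_bounded hu.hasSum fun a => hb a y (Metric.ball_subset_ball (by linarith) hy)

end holomorphic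

/-! ### Wirtinger derivatives of series with a holomorphic polarization -/

section families

variable {N : ℕ}

/-- The family `φ` is the restriction to the points `(p, p̄)` of a normally convergent family of
holomorphic functions in twice as many variables. -/
def SumFamily {α : Type*} (φ : α → Jac[N] → ℂ) (p₀ : Jac[N]) : Prop :=
  ∃ g : α → Jac[N] × Jac[N] → ℂ, NormallySummableAt g (p₀, star p₀) ∧
    ∀ᶠ p in 𝓝 p₀, ∀ a, φ a p = g a (p, star p)

lemma continuous_polar : Continuous fun p : Jac[N] => (p, star p) := by fun_prop

lemma hasFDerivAt_polar {g : Jac[N] × Jac[N] → ℂ} {p : Jac[N]}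
    (hg : DifferentiableAt ℂ g (p, star p)) :
    HasFDerivAt (fun p => g (p, star p)) (((fderiv ℂ g (p, star p)).restrictScalars ℝ).comp
      ((ContinuousLinearMap.id ℝ _).prod (starL' ℝ : Jac[N] ≃L[ℝ] _).toContinuousLinearMap)) p := by
  have h1 := hg.hasFDerivAt.restrictScalars ℝ
  have h2 : HasFDerivAt (fun p : Jac[N] => (p, star p))
      ((ContinuousLinearMap.id ℝ _).prod
        (starL' ℝ : Jac[N] ≃L[ℝ] _).toContinuousLinearMap) p :=
    (hasFDerivAt_id p).prodMk (starL' ℝ : Jac[N] ≃L[ℝ] _).hasFDerivAt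
  exact h1.comp p h2

lemma polar_split (T : Jac[N] × Jac[N] →L[ℂ] ℂ) (w w' : Jac[N]) :
    T (𝕚 • w, star (𝕚 • w')) = 𝕚 * (T (w, 0) - T (0, star w')) := by
  have : ((𝕚 • w, star (𝕚 • w')) : Jac[N] × Jac[N]) = 𝕚 • ((w, 0) - (0, star w')) := by
    ext <;> simp
  rw [this, map_smul, map_sub, smul_eq_mul]

lemma wD_polar {g : Jac[N] × Jac[N] → ℂ} {p : Jac[N]}
    (hg : DifferentiableAt ℂ g (p, star p)) (w : Jac[N]) :
    wD w (fun p => g (p, star p)) p = fderiv ℂ g (p, star p) (w, 0) := by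
  rw [wD, (hasFDerivAt_polar hg).fderiv]
  have h1 : fderiv ℂ g (p, star p) (w, star w) =
      fderiv ℂ g (p, star p) (w, 0) + fderiv ℂ g (p, star p) (0, star w) := by
    rw [← map_add]; simp
  have h2 := polar_split (fderiv ℂ g (p, star p)) w w
  simp only [ContinuousLinearMap.comp_apply, ContinuousLinearMap.prod_apply,
    ContinuousLinearMap.coe_restrictScalars', ContinuousLinearMap.id_apply,
    ContinuousLinearEquiv.coe_coe, starL'_apply, h1, h2]
  linear_combination (-(fderiv ℂ g (p, star p)) (w, 0) + (fderiv ℂ g (p, star p)) (0, star w)) / 2 *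
    Complex.I_sq

lemma wDbar_polar {g : Jac[N] × Jac[N] → ℂ} {p : Jac[N]}
    (hg : DifferentiableAt ℂ g (p, star p)) (w : Jac[N]) :
    wDbar w (fun p => g (p, star p)) p = fderiv ℂ g (p, star p) (0, star w) := by
  rw [wDbar, (hasFDerivAt_polar hg).fderiv]
  have h1 : fderiv ℂ g (p, star p) (w, star w) =
      fderiv ℂ g (p, star p) (w, 0) + fderiv ℂ g (p, star p) (0, star w) := by
    rw [← map_add]; simp
  have h2 := polar_split (fderiv ℂ g (p, star p)) w w
  simp only [ContinuousLinearMap.comp_apply, ContinuousLinearMap.prod_apply,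
    ContinuousLinearMap.coe_restrictScalars', ContinuousLinearMap.id_apply,
    ContinuousLinearEquiv.coe_coe, starL'_apply, h1, h2]
  linear_combination ((fderiv ℂ g (p, star p)) (w, 0) - (fderiv ℂ g (p, star p)) (0, star w)) / 2 *
    Complex.I_sq

lemma wD_congr {φ ψ : Jac[N] → ℂ} {p : Jac[N]} (h : φ =ᶠ[𝓝 p] ψ)
    (w : Jac[N]) : wD w φ =ᶠ[𝓝 p] wD w ψ := by
  filter_upwards [h.eventuallyEq_nhds] with q hq
  rw [wD, wD, hq.fderiv_eq]

lemma wDbar_congr {φ ψ : Jac[N] → ℂ} {p : Jac[N]} (h : φ =ᶠ[𝓝 p] ψ)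
    (w : Jac[N]) : wDbar w φ =ᶠ[𝓝 p] wDbar w ψ := by
  filter_upwards [h.eventuallyEq_nhds] with q hq
  rw [wDbar, wDbar, hq.fderiv_eq]

variable {α : Type*} {φ : α → Jac[N] → ℂ} {p₀ : Jac[N]}

lemma SumFamily.congr {ψ : α → Jac[N] → ℂ} (h : SumFamily φ p₀)
    (he : ∀ᶠ p in 𝓝 p₀, ∀ a, ψ a p = φ a p) : SumFamily ψ p₀ := by
  obtain ⟨g, hg, hφ⟩ := h
  exact ⟨g, hg, by filter_upwards [hφ, he] with p h1 h2 a; rw [h2, h1]⟩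

lemma SumFamily.summable (h : SumFamily φ p₀) : ∀ᶠ p in 𝓝 p₀, Summable fun a => φ a p := by
  obtain ⟨g, hg, hφ⟩ := h
  filter_upwards [hφ, continuous_polar.continuousAt.eventually hg.summable] with p h1 h2
  simpa only [h1] using h2

lemma SumFamily.analyticAt (h : SumFamily φ p₀) : AnalyticAt ℝ (fun p => ∑' a, φ a p) p₀ := by
  obtain ⟨g, hg, hφ⟩ := h
  have h1 := (hg.analyticAt.restrictScalars (𝕜 := ℝ)).comp_of_eq (f := fun p => (p, star p)) (x := p₀)
    (analyticAt_id.prod ((starL' ℝ : Jac[N] ≃L[ℝ] _).analyticAt p₀)) rfl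
  refine h1.congr ?_
  filter_upwards [hφ] with p hp
  simp only [Function.comp, hp]

lemma SumFamily.wD (h : SumFamily φ p₀) (w : Jac[N]) :
    SumFamily (fun a => wD w (φ a)) p₀ ∧
    ∀ᶠ p in 𝓝 p₀, _root_.wD w (fun p => ∑' a, φ a p) p = ∑' a, _root_.wD w (φ a) p := by
  obtain ⟨g, hg, hφ⟩ := h
  obtain ⟨h1, h2⟩ := hg.fderiv (w, 0)
  have h3 : ∀ᶠ p in 𝓝 p₀, ∀ a, _root_.wD w (φ a) p = fderiv ℂ (g a) (p, star p) (w, 0) := by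
    filter_upwards [hφ.eventually_nhds, continuous_polar.continuousAt.eventually h2] with p hp hp2 a
    rw [← wD_polar (hp2.2.1 a)]
    exact (wD_congr (hp.mono fun q hq => hq a) w).eq_of_nhds
  refine ⟨⟨_, h1, h3⟩, ?_⟩
  filter_upwards [h3, hφ.eventually_nhds, continuous_polar.continuousAt.eventually h2]
    with p hp3 hp hp2
  simp only [hp3]
  rw [← hp2.2.2, ← wD_polar hp2.1]
  exact (wD_congr (hp.mono fun q hq => by simp only [hq]) w).eq_of_nhds

lemma SumFamily.wDbar (h : SumFamily φ p₀) (w : Jac[N]) :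
    SumFamily (fun a => wDbar w (φ a)) p₀ ∧
    ∀ᶠ p in 𝓝 p₀, _root_.wDbar w (fun p => ∑' a, φ a p) p = ∑' a, _root_.wDbar w (φ a) p := by
  obtain ⟨g, hg, hφ⟩ := h
  obtain ⟨h1, h2⟩ := hg.fderiv (0, star w)
  have h3 : ∀ᶠ p in 𝓝 p₀, ∀ a, _root_.wDbar w (φ a) p = fderiv ℂ (g a) (p, star p) (0, star w) := by
    filter_upwards [hφ.eventually_nhds, continuous_polar.continuousAt.eventually h2] with p hp hp2 a
    rw [← wDbar_polar (hp2.2.1 a)]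
    exact (wDbar_congr (hp.mono fun q hq => hq a) w).eq_of_nhds
  refine ⟨⟨_, h1, h3⟩, ?_⟩
  filter_upwards [h3, hφ.eventually_nhds, continuous_polar.continuousAt.eventually h2]
    with p hp3 hp hp2
  simp only [hp3]
  rw [← hp2.2.2, ← wDbar_polar hp2.1]
  exact (wDbar_congr (hp.mono fun q hq => by simp only [hq]) w).eq_of_nhds

end families

/-! ### The error function -/

section erf

open Complex in
lemma exists_cerf : ∃ F : ℂ → ℂ, F 0 = 0 ∧
    ∀ z, HasDerivAt F (((2 / Real.sqrt π : ℝ) : ℂ) * Complex.exp (-z ^ 2)) z := by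
  have hd : Differentiable ℂ fun z : ℂ =>
      ((2 / Real.sqrt π : ℝ) : ℂ) * Complex.exp (-z ^ 2) := by fun_prop
  obtain ⟨g, h0, hg⟩ := hd.isExactOn_univ.with_val_at 0 0
  exact ⟨g, h0, fun z => hg z (Set.mem_univ z)⟩

/-- The error function. -/
def cerf : ℂ → ℂ := exists_cerf.choose

lemma cerf_zero : cerf 0 = 0 := exists_cerf.choose_spec.1

lemma hasDerivAt_cerf (z : ℂ) :
    HasDerivAt cerf (((2 / sqrt π : ℝ) : ℂ) * Complex.exp (-z ^ 2)) z :=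
  exists_cerf.choose_spec.2 z

lemma differentiable_cerf : Differentiable ℂ cerf := fun z => (hasDerivAt_cerf z).differentiableAt

lemma contDiff_cerf {n : WithTop ℕ∞} : ContDiff ℂ n cerf := differentiable_cerf.contDiff

lemma cerf_neg (z : ℂ) : cerf (-z) = -cerf z := by
  have hd : ∀ z, HasDerivAt (fun z => cerf (-z) + cerf z) 0 z := by
    intro z
    have h1 := (hasDerivAt_cerf (-z)).scomp z (hasDerivAt_neg z)
    exact (h1.add (hasDerivAt_cerf z)).congr_deriv (by simp)
  have h := is_const_of_deriv_eq_zero (fun z => (hd z).differentiableAt) (fun z => (hd z).deriv) z 0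
  simp only [neg_zero, cerf_zero, add_zero] at h
  exact eq_neg_of_add_eq_zero_left h

/-- The real error function. -/
def rerf (x : ℝ) : ℝ := ∫ u in (0 : ℝ)..x, 2 / sqrt π * exp (-u ^ 2)

lemma hasDerivAt_rerf (x : ℝ) :
    HasDerivAt rerf (2 / sqrt π * exp (-x ^ 2)) x := by
  have hc : Continuous fun u : ℝ => 2 / sqrt π * exp (-u ^ 2) := by fun_prop
  exact intervalIntegral.integral_hasDerivAt_right (hc.intervalIntegrable _ _)
    hc.aestronglyMeasurable.stronglyMeasurableAtFilter hc.continuousAt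

lemma rerf_zero : rerf 0 = 0 := by simp [rerf]

lemma cerf_ofReal (x : ℝ) : cerf x = rerf x := by
  have hd : ∀ x : ℝ, HasDerivAt (fun x : ℝ => cerf x - (rerf x : ℂ)) 0 x := by
    intro x
    have h1 := (hasDerivAt_cerf x).comp_ofReal
    have h2 := (hasDerivAt_rerf x).ofReal_comp
    exact (h1.sub h2).congr_deriv (by push_cast; ring)
  have h := is_const_of_deriv_eq_zero (fun z => (hd z).differentiableAt) (fun z => (hd z).deriv) x 0
  simp only [Complex.ofReal_zero, cerf_zero, rerf_zero, sub_zero] at h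
  exact sub_eq_zero.1 h

lemma rerf_neg (x : ℝ) : rerf (-x) = -rerf x := by
  have := cerf_neg x
  rw [← Complex.ofReal_neg, cerf_ofReal, cerf_ofReal] at this
  exact_mod_cast this

lemma rerf_mono : Monotone rerf :=
  monotone_of_deriv_nonneg (fun x => (hasDerivAt_rerf x).differentiableAt) fun x => by
    rw [(hasDerivAt_rerf x).deriv]; positivity

lemma tendsto_rerf : Tendsto rerf atTop (𝓝 1) := by
  have h1 : MeasureTheory.IntegrableOn (fun u : ℝ => 2 / sqrt π * exp (-u ^ 2))
      (Set.Ioi 0) := by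
    have := (integrable_exp_neg_mul_sq (b := 1) one_pos).const_mul (2 / sqrt π)
    simpa using this.integrableOn
  have h2 := MeasureTheory.intervalIntegral_tendsto_integral_Ioi 0 h1 tendsto_id
  have h3 : ∫ u in Set.Ioi (0 : ℝ), 2 / sqrt π * exp (-u ^ 2) = 1 := by
    rw [MeasureTheory.integral_const_mul]
    have := integral_gaussian_Ioi 1
    simp only [neg_mul, one_mul, div_one] at this
    rw [this]
    field_simp
  rw [← h3]
  exact h2

lemma rerf_le_one (x : ℝ) : rerf x ≤ 1 := rerf_mono.ge_of_tendsto tendsto_rerf x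

lemma one_sub_rerf_le {u : ℝ} (hu : 0 ≤ u) : 1 - rerf u ≤ exp (-u ^ 2) := by
  set k : ℝ → ℝ := fun R => exp (-u ^ 2) * rerf (R - u) - rerf R with hk
  have hd : ∀ R, HasDerivAt k (exp (-u ^ 2) * (2 / sqrt π * exp (-(R - u) ^ 2)) -
      2 / sqrt π * exp (-R ^ 2)) R := by
    intro R
    have h1 := (hasDerivAt_rerf (R - u)).comp R ((hasDerivAt_id R).sub_const u)
    simp only [mul_one] at h1
    exact (h1.const_mul _).sub (hasDerivAt_rerf R)
  have hmono : MonotoneOn k (Set.Ici u) := by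
    refine monotoneOn_of_deriv_nonneg (convex_Ici u)
      (fun R _ => (hd R).continuousAt.continuousWithinAt)
      (fun R _ => (hd R).differentiableAt.differentiableWithinAt) fun R hR => ?_
    rw [interior_Ici, Set.mem_Ioi] at hR
    rw [(hd R).deriv, sub_nonneg]
    have : exp (-R ^ 2) ≤ exp (-u ^ 2) * exp (-(R - u) ^ 2) := by
      rw [← Real.exp_add, Real.exp_le_exp]; nlinarith
    calc _ ≤ 2 / sqrt π * (exp (-u ^ 2) * exp (-(R - u) ^ 2)) := by gcongr
      _ = _ := by ring
  have h1 : Tendsto (fun R => exp (-u ^ 2) - rerf R) atTop (𝓝 (exp (-u ^ 2) - 1)) :=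
    tendsto_const_nhds.sub tendsto_rerf
  have h2 : -rerf u ≤ exp (-u ^ 2) - 1 := by
    refine ge_of_tendsto h1 ?_
    filter_upwards [eventually_ge_atTop u] with R hR
    have h3 := hmono (Set.mem_Ici.2 le_rfl) (Set.mem_Ici.2 hR) hR
    simp only [hk, sub_self, rerf_zero, mul_zero, zero_sub] at h3
    have h4 : exp (-u ^ 2) * rerf (R - u) ≤ exp (-u ^ 2) * 1 := by
      gcongr; exact rerf_le_one _
    linarith
  linarith

/-- `γ(1/2, x²) = √π erf x`. -/
lemma lowerGammaHalf_sq (x : ℝ) (hx : 0 ≤ x) :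
    EvenLattice.lowerGammaHalf (x ^ 2) = sqrt π * rerf x := by
  have hint : IntervalIntegrable (fun u : ℝ => u ^ (-(1 / 2) : ℝ) * exp (-u))
      MeasureTheory.volume 0 (x ^ 2) := by
    refine (intervalIntegral.intervalIntegrable_rpow' (by norm_num)).mul_continuousOn ?_
    fun_prop
  have hpi : 0 < sqrt π := Real.sqrt_pos.2 Real.pi_pos
  have hcont : Continuous rerf :=
    continuous_iff_continuousAt.2 fun x => (hasDerivAt_rerf x).continuousAt
  have := intervalIntegral.integral_eq_sub_of_hasDerivAt_of_le (a := 0) (b := x ^ 2) (sq_nonneg x)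
    (f := fun t => sqrt π * rerf (sqrt t))
    (by exact (continuous_const.mul (hcont.comp Real.continuous_sqrt)).continuousOn)
    (fun t ht => ?_) hint
  · rw [EvenLattice.lowerGammaHalf, this, Real.sqrt_sq hx, Real.sqrt_zero, rerf_zero]
    ring
  · have ht0 : 0 < t := ht.1
    have h1 := ((hasDerivAt_rerf (sqrt t)).comp t (Real.hasDerivAt_sqrt ht0.ne')).const_mul
      (sqrt π)
    refine h1.congr_deriv ?_
    rw [Real.sq_sqrt ht0.le, Real.rpow_neg ht0.le, ← Real.sqrt_eq_rpow]
    have : 0 < sqrt t := Real.sqrt_pos.2 ht0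
    field_simp

/-- Growth of the error function near the real axis, compared with a sign. -/
lemma norm_sub_cerf_le {ζ : ℂ} (hζ : 0 ≤ ζ.re) :
    ‖1 - cerf ζ‖ ≤ 3 * exp (2 * ζ.im ^ 2 - ζ.re ^ 2) := by
  have hπ : 2 / sqrt π ≤ 2 := by
    apply div_le_self zero_le_two
    rw [Real.one_le_sqrt]
    linarith [Real.pi_gt_three]
  have h1 : ‖cerf ζ - cerf ζ.re‖ ≤ 2 * exp (ζ.im ^ 2 - ζ.re ^ 2) * ‖ζ - ζ.re‖ := by
    set s : Set ℂ := {z | z.re = ζ.re} ∩ {z | |z.im| ≤ |ζ.im|} with hs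
    have hconv : Convex ℝ s := by
      apply Convex.inter
      · exact (convex_singleton ζ.re).linear_preimage Complex.reLm
      · have : {z : ℂ | |z.im| ≤ |ζ.im|} = Complex.imLm ⁻¹' (Set.Icc (-|ζ.im|) |ζ.im|) := by
          ext z; simp [abs_le]
        rw [this]
        exact (convex_Icc _ _).linear_preimage Complex.imLm
    refine hconv.norm_image_sub_le_of_norm_hasDerivWithin_le (f := cerf)
      (fun z _ => (hasDerivAt_cerf z).hasDerivWithinAt) (fun z hz => ?_) ?_ ?_
    · obtain ⟨hz1, hz2⟩ := hz
      change z.re = ζ.re at hz1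
      change |z.im| ≤ |ζ.im| at hz2
      rw [norm_mul, Complex.norm_real, Complex.norm_exp, Real.norm_of_nonneg (by positivity)]
      have h3 : (-z ^ 2).re ≤ ζ.im ^ 2 - ζ.re ^ 2 := by
        have : z.im ^ 2 ≤ ζ.im ^ 2 := sq_le_sq.2 hz2
        simp only [Complex.neg_re, sq, Complex.mul_re, hz1] at *
        linarith
      exact mul_le_mul hπ (Real.exp_le_exp.2 h3) (Real.exp_pos _).le zero_le_two
    · simp [hs]
    · simp [hs]
  have h2 : ‖ζ - ζ.re‖ = |ζ.im| := by
    have : ζ - ζ.re = ζ.im * 𝕚 := by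
      apply Complex.ext <;> simp
    rw [this, norm_mul, Complex.norm_I, mul_one, Complex.norm_real, Real.norm_eq_abs]
  have h3 : ‖(1 : ℂ) - cerf ζ.re‖ ≤ exp (-ζ.re ^ 2) := by
    rw [cerf_ofReal, ← Complex.ofReal_one, ← Complex.ofReal_sub, Complex.norm_real,
      Real.norm_of_nonneg (by linarith [rerf_le_one ζ.re])]
    exact one_sub_rerf_le hζ
  have h4 : |ζ.im| ≤ exp (ζ.im ^ 2) := by
    have := Real.add_one_le_exp (ζ.im ^ 2)
    nlinarith [sq_abs ζ.im, sq_nonneg (|ζ.im| - 1)]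
  have h5 : exp (-ζ.re ^ 2) ≤ exp (2 * ζ.im ^ 2 - ζ.re ^ 2) :=
    Real.exp_le_exp.2 (by nlinarith [sq_nonneg ζ.im])
  have h6 : 2 * exp (ζ.im ^ 2 - ζ.re ^ 2) * |ζ.im| ≤ 2 * exp (2 * ζ.im ^ 2 - ζ.re ^ 2) := by
    have : exp (2 * ζ.im ^ 2 - ζ.re ^ 2) = exp (ζ.im ^ 2 - ζ.re ^ 2) * exp (ζ.im ^ 2) := by
      rw [← Real.exp_add]; congr 1; ring
    rw [this]
    nlinarith [Real.exp_pos (ζ.im ^ 2 - ζ.re ^ 2)]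
  calc ‖1 - cerf ζ‖ = ‖(1 - cerf ζ.re) - (cerf ζ - cerf ζ.re)‖ := by congr 1; ring
    _ ≤ ‖1 - cerf ζ.re‖ + ‖cerf ζ - cerf ζ.re‖ := norm_sub_le _ _
    _ ≤ 3 * exp (2 * ζ.im ^ 2 - ζ.re ^ 2) := by rw [h2] at h1; linarith

end erf

/-! ### The bilinear form and adapted frames -/

namespace EvenLattice

variable {N : ℕ} (L : EvenLattice N)

section bilinear

variable {R : Type*} [Field R]

lemma bil_add_left (x y z : Fin N → R) : L.bil (x + y) z = L.bil x z + L.bil y z := by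
  simp only [bil, Pi.add_apply, add_mul, sum_add_distrib]

lemma bil_add_right (x y z : Fin N → R) : L.bil x (y + z) = L.bil x y + L.bil x z := by
  simp only [bil, Pi.add_apply, mul_add, sum_add_distrib]

lemma bil_smul_left (c : R) (x z : Fin N → R) : L.bil (c • x) z = c * L.bil x z := by
  simp only [bil, Pi.smul_apply, smul_eq_mul, mul_sum, mul_assoc]

lemma bil_smul_right (c : R) (x z : Fin N → R) : L.bil x (c • z) = c * L.bil x z := by
  simp only [bil, Pi.smul_apply, smul_eq_mul, mul_sum]
  refine sum_congr rfl fun i _ => sum_congr rfl fun j _ => by ring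

lemma bil_comm (x y : Fin N → R) : L.bil x y = L.bil y x := by
  rw [bil, bil, sum_comm]
  refine sum_congr rfl fun i _ => sum_congr rfl fun j _ => ?_
  rw [L.symm.apply i j]
  ring

/-- The bilinear form as a Mathlib object. -/
def bilin : LinearMap.BilinForm R (Fin N → R) :=
  LinearMap.mk₂ R L.bil (fun x y z => L.bil_add_left x y z) (fun c x z => L.bil_smul_left c x z)
    (fun x y z => L.bil_add_right x y z) (fun c x z => L.bil_smul_right c x z)

@[simp] lemma bilin_apply (x y : Fin N → R) : L.bilin x y = L.bil x y := rfl

lemma bil_sub_left (x y z : Fin N → R) : L.bil (x - y) z = L.bil x z - L.bil y z :=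
  L.bilin.map_sub₂ x y z

lemma bil_sub_right (x y z : Fin N → R) : L.bil x (y - z) = L.bil x y - L.bil x z :=
  (L.bilin x).map_sub y z

lemma bil_neg_right (x z : Fin N → R) : L.bil x (-z) = -L.bil x z := (L.bilin x).map_neg z

lemma bil_zero_left (z : Fin N → R) : L.bil 0 z = 0 := L.bilin.map_zero₂ z

lemma bil_zero_right (z : Fin N → R) : L.bil z 0 = 0 := (L.bilin z).map_zero

lemma bil_sum_left {ι : Type*} (s : Finset ι) (x : ι → Fin N → R) (z : Fin N → R) :
    L.bil (∑ i ∈ s, x i) z = ∑ i ∈ s, L.bil (x i) z :=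
  L.bilin.map_sum₂ s x z

lemma bil_sum_right {ι : Type*} (s : Finset ι) (x : ι → Fin N → R) (z : Fin N → R) :
    L.bil z (∑ i ∈ s, x i) = ∑ i ∈ s, L.bil z (x i) := by
  simp only [bil_comm L z, bil_sum_left]

lemma bil_self [CharZero R] (x : Fin N → R) : L.bil x x = 2 * L.quad x := by
  rw [quad]; field_simp

lemma quad_add [CharZero R] (x y : Fin N → R) :
    L.quad (x + y) = L.quad x + L.bil x y + L.quad y := by
  simp only [quad, bil_add_left, bil_add_right, L.bil_comm y x]
  field_simp
  ring

lemma quad_smul (c : R) (x : Fin N → R) : L.quad (c • x) = c ^ 2 * L.quad x := by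
  simp only [quad, bil_smul_left, bil_smul_right]
  ring

lemma bil_ofReal (x y : Fin N → ℝ) :
    L.bil (fun k => (x k : ℂ)) (fun k => (y k : ℂ)) = ((L.bil x y : ℝ) : ℂ) := by
  simp [bil]

lemma quad_ofReal (x : Fin N → ℝ) : L.quad (fun k => (x k : ℂ)) = ((L.quad x : ℝ) : ℂ) := by
  simp [quad, bil_ofReal]

lemma bil_intCast (x y : Fin N → ℤ) : L.bil (fun k => (x k : ℝ)) (fun k => (y k : ℝ)) =
    ((x ⬝ᵥ (L.gram *ᵥ y) : ℤ) : ℝ) := by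
  simp [bil, dotProduct, Matrix.mulVec, mul_sum, mul_assoc]

end bilinear

lemma eq_zero_of_bil_eq_zero {x : Fin N → ℝ} (h : ∀ y, L.bil x y = 0) : x = 0 := by
  have hdet : (L.gram.map (Int.cast : ℤ → ℝ)).det ≠ 0 := by
    have : (L.gram.map (Int.cast : ℤ → ℝ)).det = (L.gram.det : ℝ) :=
      ((Int.castRingHom ℝ).map_det L.gram).symm
    rw [this]
    exact_mod_cast L.nondeg
  refine Matrix.eq_zero_of_vecMul_eq_zero hdet (funext fun j => ?_)
  have := h (Pi.single j 1)
  simpa [bil, Matrix.vecMul, dotProduct, Pi.single_apply] using this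

/-- An orthogonal frame with `d` vectors `n i` of norm `L[n] = -1` and `d + m` vectors of norm `1`;
the planes spanned by `n i` and `g i` are hyperbolic. -/
structure AdaptedFrame (d m : ℕ) where
  n : Fin d → Fin N → ℝ
  g : Fin d → Fin N → ℝ
  w : Fin m → Fin N → ℝ
  card : d + d + m = N
  nn : ∀ i j, L.bil (n i) (n j) = if i = j then -2 else 0
  gg : ∀ i j, L.bil (g i) (g j) = if i = j then 2 else 0
  ww : ∀ i j, L.bil (w i) (w j) = if i = j then 2 else 0
  ng : ∀ i j, L.bil (n i) (g j) = 0
  nw : ∀ i j, L.bil (n i) (w j) = 0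
  gw : ∀ i j, L.bil (g i) (w j) = 0

namespace AdaptedFrame

variable {L} {d m : ℕ} (F : L.AdaptedFrame d m)

/-- The vectors of the frame as one family. -/
def vec : (Fin d ⊕ Fin d) ⊕ Fin m → Fin N → ℝ := Sum.elim (Sum.elim F.n F.g) F.w

/-- The signs `L[b]` of the frame vectors. -/
def sgn : (Fin d ⊕ Fin d) ⊕ Fin m → ℝ := Sum.elim (Sum.elim (fun _ => -1) fun _ => 1) fun _ => 1

lemma sgn_ne_zero (k : (Fin d ⊕ Fin d) ⊕ Fin m) : (sgn k : ℝ) ≠ 0 := by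
  rcases k with (k | k) | k <;> simp [sgn]

lemma sgn_mul_self (k : (Fin d ⊕ Fin d) ⊕ Fin m) : (sgn k : ℝ) * sgn k = 1 := by
  rcases k with (k | k) | k <;> simp [sgn]

lemma bil_vec (k l : (Fin d ⊕ Fin d) ⊕ Fin m) :
    L.bil (F.vec k) (F.vec l) = if k = l then 2 * sgn k else 0 := by
  rcases k with (k | k) | k <;> rcases l with (l | l) | l <;>
    simp [vec, sgn, F.nn, F.gg, F.ww, F.ng, F.nw, F.gw, L.bil_comm (F.g _) (F.n _),
      L.bil_comm (F.w _) (F.n _), L.bil_comm (F.w _) (F.g _)]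

lemma linearIndependent_vec : LinearIndependent ℝ F.vec := by
  rw [Fintype.linearIndependent_iff]
  intro c hc k
  have h := congrArg (fun x => L.bil x (F.vec k)) hc
  simp only [bil_sum_left, bil_smul_left, bil_vec, bil_zero_left, mul_ite, mul_zero,
    Finset.sum_ite_eq', Finset.mem_univ, if_true] at h
  simpa [sgn_ne_zero] using h

/-- The frame as a basis. -/
def basis : Module.Basis ((Fin d ⊕ Fin d) ⊕ Fin m) ℝ (Fin N → ℝ) :=
  basisOfLinearIndependentOfCardEqFinrank' F.vec F.linearIndependent_vec (by
    simp [← F.card])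

lemma basis_apply (k : (Fin d ⊕ Fin d) ⊕ Fin m) : F.basis k = F.vec k := by
  simp [basis]

lemma expand (x : Fin N → ℝ) : x = ∑ k, (sgn k / 2 * L.bil (F.vec k) x) • F.vec k := by
  have h1 : ∀ l, L.bil (F.vec l) (∑ k, (sgn k / 2 * L.bil (F.vec k) x) • F.vec k) =
      L.bil (F.vec l) x := by
    intro l
    simp only [bil_sum_right, bil_smul_right, bil_vec, mul_ite, mul_zero,
      Finset.sum_ite_eq, Finset.mem_univ, if_true]
    linear_combination L.bil (F.vec l) x * sgn_mul_self l
  have h2 : x - ∑ k, (sgn k / 2 * L.bil (F.vec k) x) • F.vec k = 0 := by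
    apply L.eq_zero_of_bil_eq_zero
    intro y
    rw [← F.basis.sum_repr y, bil_sum_right]
    refine sum_eq_zero fun l _ => ?_
    rw [bil_smul_right, basis_apply, L.bil_comm, bil_sub_right, h1, sub_self, mul_zero]
  exact sub_eq_zero.1 h2

lemma bil_eq_sum (x y : Fin N → ℝ) :
    L.bil x y = ∑ k, sgn k / 2 * L.bil (F.vec k) x * L.bil (F.vec k) y := by
  conv_lhs => rw [F.expand x]
  simp only [bil_sum_left, bil_smul_left]

lemma bil_eq (x y : Fin N → ℝ) : L.bil x y =
    ∑ i, (L.bil (F.g i) x * L.bil (F.g i) y - L.bil (F.n i) x * L.bil (F.n i) y) / 2 +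
      ∑ k, L.bil (F.w k) x * L.bil (F.w k) y / 2 := by
  rw [F.bil_eq_sum, Fintype.sum_sum_type, Fintype.sum_sum_type, ← sum_add_distrib]
  congr 1
  · refine sum_congr rfl fun i _ => ?_
    simp only [vec, sgn, Sum.elim_inl, Sum.elim_inr]
    ring
  · refine sum_congr rfl fun i _ => ?_
    simp only [vec, sgn, Sum.elim_inr]
    ring

end AdaptedFrame

/-! ### The frame of a compatible pair -/

/-- Normal form of a pair of negative or isotropic vectors in a hyperbolic plane. -/
lemma exists_plane_frame {e e' : Fin N → ℝ} (hq : L.quad e ≤ 0) (hq' : L.quad e' ≤ 0)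
    (hb : L.bil e e' < 0) (hD : 4 * L.quad e * L.quad e' < L.bil e e' ^ 2) :
    ∃ n ∈ Submodule.span ℝ {e, e'}, ∃ g ∈ Submodule.span ℝ {e, e'}, ∃ a b a' b' : ℝ,
      L.bil n n = -2 ∧ L.bil g g = 2 ∧ L.bil n g = 0 ∧ 0 < a ∧ 0 < a' ∧
      e = a • (n + b • g) ∧ e' = a' • (n + b' • g) := by
  set q := L.quad e
  set q' := L.quad e'
  set b := L.bil e e'
  set S := q + q' + b with hS
  have hSneg : S < 0 := by linarith
  set G := -((b ^ 2 - 4 * q * q') * S) with hG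
  have hGpos : 0 < G := by rw [hG]; nlinarith
  have hee : L.bil e e = 2 * q := L.bil_self e
  have hee' : L.bil e' e' = 2 * q' := L.bil_self e'
  have hbe : L.bil e' e = b := L.bil_comm _ _
  have hbb : L.bil e e' = b := rfl
  have hs1 : sqrt (-S) ^ 2 = -S := Real.sq_sqrt (by linarith)
  have hs2 : sqrt G ^ 2 = G := Real.sq_sqrt hGpos.le
  have hp1 : 0 < sqrt (-S) := Real.sqrt_pos.2 (by linarith)
  have hp2 : 0 < sqrt G := Real.sqrt_pos.2 hGpos
  set r := sqrt (-S)
  set t := sqrt G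
  have hme : e ∈ Submodule.span ℝ {e, e'} := Submodule.subset_span (by simp)
  have hme' : e' ∈ Submodule.span ℝ {e, e'} := Submodule.subset_span (by simp)
  refine ⟨r⁻¹ • (e + e'), Submodule.smul_mem _ _ (Submodule.add_mem _ hme hme'),
    t⁻¹ • ((b + 2 * q') • e - (2 * q + b) • e'),
    Submodule.smul_mem _ _ (Submodule.sub_mem _ (Submodule.smul_mem _ _ hme)
      (Submodule.smul_mem _ _ hme')),
    (2 * q + b) / (2 * S) * r, t / r / (2 * q + b), (2 * q' + b) / (2 * S) * r,
    -(t / r / (2 * q' + b)), ?_, ?_, ?_, ?_, ?_, ?_, ?_⟩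
  · simp only [bil_smul_left, bil_smul_right, bil_add_left, bil_add_right, hee, hee', hbe, hbb]
    field_simp
    rw [hs1]; ring
  · simp only [bil_smul_left, bil_smul_right, bil_sub_left, bil_sub_right, hee, hee', hbe, hbb]
    field_simp
    rw [hs2, hG, hS]; ring
  · simp only [bil_smul_left, bil_smul_right, bil_sub_right, bil_add_left, hee, hee', hbe, hbb]
    ring
  · exact mul_pos (div_pos_of_neg_of_neg (by linarith) (by linarith)) hp1
  · exact mul_pos (div_pos_of_neg_of_neg (by linarith) (by linarith)) hp1
  · have h1 : 2 * q + b ≠ 0 := by linarith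
    funext k
    simp only [Pi.smul_apply, Pi.add_apply, Pi.sub_apply, smul_eq_mul]
    have hSne := hSneg.ne
    field_simp
    rw [hS]; ring
  · have h1 : 2 * q' + b ≠ 0 := by linarith
    funext k
    simp only [Pi.smul_apply, Pi.add_apply, Pi.sub_apply, smul_eq_mul]
    have hSne := hSneg.ne
    field_simp
    rw [hS]; ring

lemma quad_span_pair (e e' : Fin N → ℝ) (x y : ℝ) :
    L.quad (x • e + y • e') = L.quad e * x ^ 2 + L.bil e e' * (x * y) + L.quad e' * y ^ 2 := by
  rw [quad_add, quad_smul, quad_smul, bil_smul_left, bil_smul_right]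
  ring

variable {d : ℕ} {E E' : Fin d → Fin N → ℝ}

namespace IsCompatiblePair

variable {L}

lemma swap (h : L.IsCompatiblePair E E') : L.IsCompatiblePair E' E where
  left := h.right
  right := h.left
  span_pos i := by rw [Set.pair_comm]; exact h.span_pos i
  span_neg i := by rw [Set.pair_comm]; exact h.span_neg i
  orthogonal i j hij w hw w' hw' := by
    rw [Set.pair_comm] at hw hw'; exact h.orthogonal i j hij w hw w' hw'
  orientation i := by rw [L.bil_comm]; exact h.orientation i

lemma disc_pos (h : L.IsCompatiblePair E E') (i : Fin d) :
    4 * L.quad (E i) * L.quad (E' i) < L.bil (E i) (E' i) ^ 2 := by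
  obtain ⟨w, hw, hwp⟩ := h.span_pos i
  obtain ⟨w', hw', hwn⟩ := h.span_neg i
  obtain ⟨x, y, rfl⟩ := Submodule.mem_span_pair.1 hw
  obtain ⟨x', y', rfl⟩ := Submodule.mem_span_pair.1 hw'
  rw [quad_span_pair] at hwp hwn
  have hb := h.orientation i
  set q := L.quad (E i)
  set q' := L.quad (E' i)
  set b := L.bil (E i) (E' i)
  by_contra! hcon
  have hb2 : 0 < b ^ 2 := by nlinarith
  have key : ∀ x y : ℝ, 0 ≤ q * (q * x ^ 2 + b * (x * y) + q' * y ^ 2) := fun x y => by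
    nlinarith [sq_nonneg (q * x + b * y / 2), mul_nonneg (sub_nonneg.2 hcon) (sq_nonneg y)]
  have h1 := key x y
  have h2 := key x' y'
  have h3 : 0 ≤ q := by by_contra! hq; nlinarith
  have h4 : q ≤ 0 := by by_contra! hq; nlinarith
  have h5 : q = 0 := le_antisymm h4 h3
  rw [h5] at hcon
  linarith

lemma bil_eq_zero (h : L.IsCompatiblePair E E') {i j : Fin d} (hij : i ≠ j) {w w' : Fin N → ℝ}
    (hw : w ∈ Submodule.span ℝ {E i, E' i}) (hw' : w' ∈ Submodule.span ℝ {E j, E' j}) :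
    L.bil w w' = 0 := h.orthogonal i j hij w hw w' hw'

lemma quad_left_nonpos (h : L.IsCompatiblePair E E') (i : Fin d) : L.quad (E i) ≤ 0 := by
  by_contra! hq
  have hD := h.disc_pos i
  set c := L.bil (E i) (E' i) / (2 * L.quad (E i)) with hc
  have hw : E' i - c • E i ∈ Submodule.span ℝ {E i, E' i} :=
    Submodule.sub_mem _ (Submodule.subset_span (by simp))
      (Submodule.smul_mem _ _ (Submodule.subset_span (by simp)))
  have h1 := h.left.perp_nonneg (E' i - c • E i) fun j => by
    by_cases hij : i = j
    · subst hij
      rw [bil_sub_left, bil_smul_left, bil_self, hc, L.bil_comm (E' i)]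
      field_simp
      ring
    · exact h.bil_eq_zero hij hw (Submodule.subset_span (by simp))
  have h2 : L.quad (E' i - c • E i) = L.quad (E' i) - L.bil (E i) (E' i) ^ 2 / (4 * L.quad (E i)) := by
    have : E' i - c • E i = (-c) • E i + (1 : ℝ) • E' i := by
      funext k; simp only [Pi.sub_apply, Pi.add_apply, Pi.smul_apply, smul_eq_mul]; ring
    rw [this, quad_span_pair, hc]
    field_simp
    ring
  rw [h2, sub_nonneg, div_le_iff₀ (by positivity)] at h1
  linarith

end IsCompatiblePair

/-- The orthogonal frame adapted to a compatible pair. -/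
theorem exists_adaptedFrame (h : L.IsCompatiblePair E E') :
    ∃ (m : ℕ) (F : L.AdaptedFrame d m) (a b a' b' : Fin d → ℝ),
      (∀ i, 0 < a i) ∧ (∀ i, 0 < a' i) ∧ (∀ i, E i = a i • (F.n i + b i • F.g i)) ∧
      (∀ i, E' i = a' i • (F.n i + b' i • F.g i)) := by
  choose n hn g hg a b a' b' hnn hgg hng ha ha' hE hE' using fun i =>
    L.exists_plane_frame (h.quad_left_nonpos i) (h.swap.quad_left_nonpos i) (h.orientation i)
      (h.disc_pos i)
  have onn : ∀ i j, L.bil (n i) (n j) = if i = j then -2 else 0 := fun i j => by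
    split_ifs with hij
    · rw [← hij, hnn]
    · exact h.bil_eq_zero hij (hn i) (hn j)
  have ogg : ∀ i j, L.bil (g i) (g j) = if i = j then 2 else 0 := fun i j => by
    split_ifs with hij
    · rw [← hij, hgg]
    · exact h.bil_eq_zero hij (hg i) (hg j)
  have ong : ∀ i j, L.bil (n i) (g j) = 0 := fun i j => by
    by_cases hij : i = j
    · rw [← hij, hng]
    · exact h.bil_eq_zero hij (hn i) (hg j)
  let T : (Fin N → ℝ) →ₗ[ℝ] (Fin d → ℝ) × (Fin d → ℝ) :=
    (LinearMap.pi fun i => L.bilin (n i)).prod (LinearMap.pi fun i => L.bilin (g i))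
  let P : (Fin d → ℝ) × (Fin d → ℝ) → Fin N → ℝ := fun c =>
    ∑ i, (-(c.1 i) / 2) • n i + ∑ i, (c.2 i / 2) • g i
  have hTP : ∀ c, T (P c) = c := by
    intro c
    refine Prod.ext (funext fun i => ?_) (funext fun i => ?_)
    · simp [T, P, onn, ong]
    · simp [T, P, ogg, ong, L.bil_comm (g _) (n _)]
  have hTsurj : Function.Surjective T := fun c => ⟨P c, hTP c⟩
  let W := LinearMap.ker T
  have hW : ∀ x, x ∈ W ↔ (∀ i, L.bil (n i) x = 0) ∧ ∀ i, L.bil (g i) x = 0 := by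
    intro x
    rw [LinearMap.mem_ker, Prod.ext_iff, funext_iff, funext_iff]
    rfl
  have hrank : d + d + Module.finrank ℝ W = N := by
    have h1 := T.finrank_range_add_finrank_ker
    rw [LinearMap.range_eq_top.2 hTsurj, finrank_top] at h1
    simpa using h1
  have hWE : ∀ x ∈ W, ∀ i, L.bil x (E i) = 0 := by
    intro x hx i
    obtain ⟨h1, h2⟩ := (hW x).1 hx
    rw [L.bil_comm, hE i]
    simp [bil_smul_left, bil_add_left, h1, h2]
  have hnonneg : ∀ x ∈ W, 0 ≤ L.quad x := fun x hx => h.left.perp_nonneg x (hWE x hx)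
  have hpos : ∀ x ∈ W, x ≠ 0 → 0 < L.quad x := by
    intro x hx hx0
    refine lt_of_le_of_ne (hnonneg x hx) fun hq => hx0 ?_
    apply L.eq_zero_of_bil_eq_zero
    have hxW : ∀ y ∈ W, L.bil x y = 0 := by
      intro y hy
      by_contra hne
      have key : ∀ t : ℝ, 0 ≤ t * L.bil x y + L.quad y := by
        intro t
        have := hnonneg (t • x + (1 : ℝ) • y)
          (W.add_mem (W.smul_mem _ hx) (W.smul_mem _ hy))
        rw [quad_span_pair, ← hq] at this
        linarith
      have := key (-(L.quad y + 1) / L.bil x y)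
      rw [div_mul_cancel₀ _ hne] at this
      linarith
    intro y
    have hy : y - P (T y) ∈ W := by
      rw [LinearMap.mem_ker, map_sub, hTP, sub_self]
    have h1 := hxW _ hy
    obtain ⟨h2, h3⟩ := (hW x).1 hx
    have h4 : L.bil x (P (T y)) = 0 := by
      rw [L.bil_comm]
      simp only [P, bil_add_left, bil_sum_left, bil_smul_left, h2, h3, mul_zero,
        Finset.sum_const_zero, add_zero]
    rw [bil_sub_right, h4, sub_zero] at h1
    exact h1
  let BW : LinearMap.BilinForm ℝ W := L.bilin.restrict W
  have hBW : LinearMap.IsSymm BW := ⟨fun x y => L.bil_comm x.1 y.1⟩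
  obtain ⟨v, hv⟩ := LinearMap.BilinForm.exists_orthogonal_basis (K := ℝ) (V := W) (B := BW) hBW
  have hvpos : ∀ k, 0 < L.quad (v k).1 := fun k => hpos _ (v k).2 fun h0 =>
    v.ne_zero k (Subtype.ext h0)
  refine ⟨Module.finrank ℝ W, ⟨n, g, fun k => (sqrt (L.quad (v k).1))⁻¹ • (v k).1, hrank, onn,
    ogg, fun i j => ?_, ong, fun i j => ?_, fun i j => ?_⟩, a, b, a', b', ha, ha', hE, hE'⟩
  · rw [bil_smul_left, bil_smul_right]
    split_ifs with hij
    · subst hij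
      rw [bil_self]
      have h1 : sqrt (L.quad (v i).1) ^ 2 = L.quad (v i).1 := Real.sq_sqrt (hvpos i).le
      have h2 : 0 < sqrt (L.quad (v i).1) := Real.sqrt_pos.2 (hvpos i)
      field_simp
      rw [h1]
    · have : L.bil (v i).1 (v j).1 = 0 := hv hij
      rw [this]; ring
  · rw [bil_smul_right, ((hW _).1 (v j).2).1 i, mul_zero]
  · rw [bil_smul_right, ((hW _).1 (v j).2).2 i, mul_zero]

end EvenLattice

/-! ### Estimates for the kernels in one hyperbolic plane -/

section kernels

lemma norm_one_sub_cerf_perturbed {T u : ℝ} {Y du : ℂ} (hT : 0 ≤ T) (hu : 0 ≤ u)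
    (hY : ‖Y - T‖ ≤ T / 100) (hdu : ‖du‖ ≤ 1 / 100) :
    ‖1 - cerf (Y * (u + du))‖ ≤ 5 * exp (T ^ 2 * (2 - 9 / 10 * u ^ 2)) := by
  set ζ := Y * (u + du) with hζ
  set η := (u + 2) / 100 with hη
  have hη0 : 0 ≤ η := by positivity
  have hdist : ‖ζ - (T * u : ℝ)‖ ≤ T * η := by
    have h1 : ζ - (T * u : ℝ) = (Y - T) * u + Y * du := by rw [hζ]; push_cast; ring
    have h2 : ‖Y‖ ≤ T + T / 100 := by
      calc ‖Y‖ = ‖(T : ℂ) + (Y - T)‖ := by congr 1; ring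
        _ ≤ ‖(T : ℂ)‖ + ‖Y - T‖ := norm_add_le _ _
        _ ≤ T + T / 100 := by
          rw [Complex.norm_real, Real.norm_of_nonneg hT]; linarith
    have h3 : ‖(Y - T) * (u : ℂ)‖ ≤ T / 100 * u := by
      rw [norm_mul, Complex.norm_real, Real.norm_of_nonneg hu]; gcongr
    have h4 : ‖Y * du‖ ≤ (T + T / 100) * (1 / 100) := by rw [norm_mul]; gcongr
    rw [h1]
    calc _ ≤ _ := norm_add_le _ _
      _ ≤ T / 100 * u + (T + T / 100) * (1 / 100) := add_le_add h3 h4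
      _ ≤ T * η := by rw [hη]; nlinarith
  have hre : |ζ.re - T * u| ≤ T * η := by
    have := Complex.abs_re_le_norm (ζ - (T * u : ℝ))
    rw [Complex.sub_re, Complex.ofReal_re] at this
    exact this.trans hdist
  have him : |ζ.im| ≤ T * η := by
    have := Complex.abs_im_le_norm (ζ - (T * u : ℝ))
    rw [Complex.sub_im, Complex.ofReal_im, sub_zero] at this
    exact this.trans hdist
  have him2 : ζ.im ^ 2 ≤ T ^ 2 * η ^ 2 := by
    rw [← mul_pow, ← sq_abs]; gcongr
  obtain ⟨hre1, -⟩ := abs_le.1 hre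
  rcases le_or_gt 0 (ζ.re) with h0 | h0
  · have hb := norm_sub_cerf_le h0
    have hexp : 2 * ζ.im ^ 2 - ζ.re ^ 2 ≤ T ^ 2 * (2 - 9 / 10 * u ^ 2) := by
      rcases le_or_gt 0 (u - η) with h1 | h1
      · have h2 : (T * (u - η)) ^ 2 ≤ ζ.re ^ 2 := by
          apply pow_le_pow_left₀ (by positivity)
          linarith
        have h3 : 2 * η ^ 2 - (u - η) ^ 2 ≤ 2 - 9 / 10 * u ^ 2 := by rw [hη]; nlinarith
        have h4 := mul_le_mul_of_nonneg_left h3 (sq_nonneg T)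
        nlinarith
      · have h5 : u ≤ 1 / 10 := by rw [hη] at h1; linarith
        have h3 : 2 * η ^ 2 ≤ 2 - 9 / 10 * u ^ 2 := by rw [hη]; nlinarith
        have h4 := mul_le_mul_of_nonneg_left h3 (sq_nonneg T)
        nlinarith [sq_nonneg ζ.re]
    calc _ ≤ _ := hb
      _ ≤ 5 * exp (T ^ 2 * (2 - 9 / 10 * u ^ 2)) := by gcongr; norm_num
  · have hb := norm_sub_cerf_le (ζ := -ζ) (by simpa using h0.le)
    rw [cerf_neg, Complex.neg_im, Complex.neg_re] at hb
    have h6 : T * (u - η) ≤ 0 := by linarith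
    have h7 : 2 * ζ.im ^ 2 - ζ.re ^ 2 ≤ T ^ 2 * (2 - 9 / 10 * u ^ 2) ∧
        0 ≤ T ^ 2 * (2 - 9 / 10 * u ^ 2) := by
      rcases hT.eq_or_lt with h8 | h8
      · rw [← h8] at him2 ⊢
        constructor
        · nlinarith [sq_nonneg ζ.re]
        · simp
      · have h9 : u - η ≤ 0 := by
          by_contra! hc
          nlinarith
        have h5 : u ≤ 1 / 10 := by rw [hη] at h9; linarith
        have h3 : 2 * η ^ 2 ≤ 2 - 9 / 10 * u ^ 2 := by rw [hη]; nlinarith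
        have h4 := mul_le_mul_of_nonneg_left h3 (sq_nonneg T)
        refine ⟨by nlinarith [sq_nonneg ζ.re], by nlinarith [sq_nonneg T, sq_nonneg η]⟩
    have h10 : 1 ≤ exp (T ^ 2 * (2 - 9 / 10 * u ^ 2)) := Real.one_le_exp h7.2
    have h11 : exp (2 * (-ζ.im) ^ 2 - (-ζ.re) ^ 2) ≤ exp (T ^ 2 * (2 - 9 / 10 * u ^ 2)) := by
      rw [neg_sq, neg_sq]; exact Real.exp_le_exp.2 h7.1
    calc ‖1 - cerf ζ‖ = ‖2 - (1 - -cerf ζ)‖ := by congr 1; ring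
      _ ≤ ‖(2 : ℂ)‖ + ‖1 - -cerf ζ‖ := norm_sub_le _ _
      _ ≤ _ := by rw [Complex.norm_ofNat]; linarith

lemma norm_sign_sub_cerf_perturbed {T u σ : ℝ} {Y du : ℂ} (hT : 0 ≤ T) (hσ : σ = 1 ∨ σ = -1)
    (hu : 0 ≤ σ * u) (hY : ‖Y - T‖ ≤ T / 100) (hdu : ‖du‖ ≤ 1 / 100) :
    ‖σ - cerf (Y * (u + du))‖ ≤ 5 * exp (T ^ 2 * (2 - 9 / 10 * u ^ 2)) := by
  rcases hσ with rfl | rfl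
  · rw [one_mul] at hu
    simpa using norm_one_sub_cerf_perturbed hT hu hY hdu
  · have := norm_one_sub_cerf_perturbed (u := -u) (du := -du) hT (by linarith) hY (by simpa using hdu)
    have h2 : Y * (((-u : ℝ) : ℂ) + -du) = -(Y * (u + du)) := by push_cast; ring
    rw [h2, cerf_neg, neg_sq, ← norm_neg] at this
    have h3 : ((-1 : ℝ) : ℂ) - cerf (Y * (u + du)) = -(1 - -cerf (Y * (u + du))) := by
      push_cast; ring
    rw [h3]
    exact this

lemma norm_cerf_perturbed {T u : ℝ} {Y du : ℂ} (hT : 0 ≤ T)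
    (hY : ‖Y - T‖ ≤ T / 100) (hdu : ‖du‖ ≤ 1 / 100) :
    ‖cerf (Y * (u + du))‖ ≤ 6 * exp (2 * T ^ 2) := by
  have key : ∀ σ : ℝ, (σ = 1 ∨ σ = -1) → 0 ≤ σ * u →
      ‖cerf (Y * (u + du))‖ ≤ 6 * exp (2 * T ^ 2) := by
    intro σ hσ hu
    have h1 := norm_sign_sub_cerf_perturbed hT hσ hu hY hdu
    have h2 : exp (T ^ 2 * (2 - 9 / 10 * u ^ 2)) ≤ exp (2 * T ^ 2) := by
      apply Real.exp_le_exp.2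
      nlinarith [mul_nonneg (sq_nonneg T) (sq_nonneg u)]
    have h3 : ‖(σ : ℂ)‖ = 1 := by rcases hσ with rfl | rfl <;> simp
    have h4 : 1 ≤ exp (2 * T ^ 2) := Real.one_le_exp (by positivity)
    calc ‖cerf (Y * (u + du))‖ = ‖(σ : ℂ) - (σ - cerf (Y * (u + du)))‖ := by congr 1; ring
      _ ≤ _ := norm_sub_le _ _
      _ ≤ _ := by rw [h3]; linarith
  rcases le_total 0 u with hu | hu
  · exact key 1 (Or.inl rfl) (by simpa using hu)
  · exact key (-1) (Or.inr rfl) (by linarith)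

lemma exists_common_sign {u v : ℝ} (h : 0 ≤ u * v) :
    ∃ σ : ℝ, (σ = 1 ∨ σ = -1) ∧ 0 ≤ σ * u ∧ 0 ≤ σ * v := by
  rcases mul_nonneg_iff.1 h with ⟨h1, h2⟩ | ⟨h1, h2⟩
  · exact ⟨1, Or.inl rfl, by simpa using h1, by simpa using h2⟩
  · exact ⟨-1, Or.inr rfl, by linarith, by linarith⟩

lemma norm_cerf_sub_cerf_perturbed {T u v : ℝ} {Y du dv : ℂ} (hT : 0 ≤ T) (huv : 0 ≤ u * v)
    (hY : ‖Y - T‖ ≤ T / 100) (hdu : ‖du‖ ≤ 1 / 100) (hdv : ‖dv‖ ≤ 1 / 100) :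
    ‖cerf (Y * (u + du)) - cerf (Y * (v + dv))‖ ≤
      5 * exp (T ^ 2 * (2 - 9 / 10 * u ^ 2)) + 5 * exp (T ^ 2 * (2 - 9 / 10 * v ^ 2)) := by
  obtain ⟨σ, hσ, h1, h2⟩ := exists_common_sign huv
  have h3 := norm_sign_sub_cerf_perturbed hT hσ h1 hY hdu
  have h4 := norm_sign_sub_cerf_perturbed hT hσ h2 hY hdv
  calc _ = ‖(σ - cerf (Y * (v + dv))) - (σ - cerf (Y * (u + du)))‖ := by congr 1; ring
    _ ≤ _ := norm_sub_le _ _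
    _ ≤ _ := by linarith

/-- A quadratic decay rate dominates a linear one. -/
lemma quadratic_to_linear {T T₁ κ A x y : ℝ} (hT₁ : 0 < T₁) (hT : T₁ ≤ T) (hκ : 0 ≤ κ) (hκ' : κ ≤ 1)
    (h : A ≤ -(κ * (x ^ 2 + y ^ 2))) :
    T ^ 2 * A ≤ T ^ 2 * 2 - κ * T₁ ^ 2 * (|x| + |y|) := by
  have h1 : T₁ ^ 2 ≤ T ^ 2 := by gcongr
  have h2 : |x| + |y| ≤ x ^ 2 + y ^ 2 + 2 := by
    nlinarith [sq_abs x, sq_abs y, sq_nonneg (|x| - 1), sq_nonneg (|y| - 1)]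
  have h3 : T ^ 2 * A ≤ T ^ 2 * (-(κ * (x ^ 2 + y ^ 2))) := mul_le_mul_of_nonneg_left h (sq_nonneg T)
  have h4 : κ * T₁ ^ 2 * (|x| + |y|) ≤ κ * T ^ 2 * (x ^ 2 + y ^ 2 + 2) := by
    have : 0 ≤ |x| + |y| := by positivity
    gcongr
  nlinarith [mul_nonneg (sub_nonneg.2 hκ') (sq_nonneg T)]

lemma boost_lower_bound (β ξ ρ : ℝ) :
    (1 - |β|) ^ 2 * (ξ ^ 2 + ρ ^ 2) * (1 - β ^ 2) ≤ (ξ + β * ρ) ^ 2 + (ρ + β * ξ) ^ 2 := by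
  have hβ0 := abs_nonneg β
  have h1 : -(|β| * (ξ ^ 2 + ρ ^ 2)) ≤ 2 * (β * (ξ * ρ)) := by
    have h2 := neg_abs_le (β * (ξ * ρ))
    rw [abs_mul, abs_mul] at h2
    have h3 : 2 * (|ξ| * |ρ|) ≤ ξ ^ 2 + ρ ^ 2 := by
      nlinarith [sq_abs ξ, sq_abs ρ, sq_nonneg (|ξ| - |ρ|)]
    linarith [mul_le_mul_of_nonneg_left h3 hβ0]
  have h3 : (1 - |β|) ^ 2 * (ξ ^ 2 + ρ ^ 2) * (1 - β ^ 2) ≤ (1 - |β|) ^ 2 * (ξ ^ 2 + ρ ^ 2) :=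
    mul_le_of_le_one_right (by positivity) (by linarith [sq_nonneg β])
  have h4 : (1 - |β|) ^ 2 = 1 - 2 * |β| + β ^ 2 := by rw [← sq_abs β]; ring
  have h5 : (ξ + β * ρ) ^ 2 + (ρ + β * ξ) ^ 2 =
      (1 + β ^ 2) * (ξ ^ 2 + ρ ^ 2) + 2 * (2 * (β * (ξ * ρ))) := by ring
  rw [h5]
  rw [h4] at h3 ⊢
  linarith

/-- Decay of the kernel of a negative vector in the plane. -/
lemma kernel_bound_negative {β T₁ : ℝ} (hβ : |β| < 1) (hT₁ : 0 < T₁) :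
    ∃ κ > 0, ∀ (T ξ ρ : ℝ) (Y ds dξ : ℂ), T₁ ≤ T → ‖Y - T‖ ≤ T / 100 → ‖ds‖ ≤ 1 / 100 →
      ‖dξ‖ ≤ 1 / 100 →
      ‖cerf (Y * (((ξ + β * ρ) / sqrt (1 - β ^ 2) : ℝ) + ds)) - cerf (Y * (ξ + dξ))‖ *
        exp (T ^ 2 * ((ξ ^ 2 - ρ ^ 2) / 2)) ≤
      12 * exp (4 * T ^ 2) * exp (-(κ * (|ξ| + |ρ|))) := by
  have hβ2 : 0 < 1 - β ^ 2 := by nlinarith [sq_abs β, abs_nonneg β]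
  set D := sqrt (1 - β ^ 2) with hD
  have hD0 : 0 < D := Real.sqrt_pos.2 hβ2
  have hDsq : D ^ 2 = 1 - β ^ 2 := Real.sq_sqrt hβ2.le
  set κ₀ := (1 - |β|) ^ 2 / 5 with hκ₀
  have hκ₀pos : 0 < κ₀ := by have : 0 < 1 - |β| := by linarith
                             positivity
  have hβ0 := abs_nonneg β
  have hκ₀le : κ₀ ≤ 1 / 5 := by rw [hκ₀]; nlinarith
  refine ⟨κ₀ * T₁ ^ 2, by positivity, ?_⟩
  intro T ξ ρ Y ds dξ hT hY hds hdξ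
  have hT0 : 0 ≤ T := hT₁.le.trans hT
  set u := (ξ + β * ρ) / D with hu
  set w := (ρ + β * ξ) / D with hw
  have huw : w ^ 2 - u ^ 2 = ρ ^ 2 - ξ ^ 2 := by
    rw [hu, hw, div_pow, div_pow, hDsq]; field_simp; ring
  have huw2 : (1 - |β|) ^ 2 * (ξ ^ 2 + ρ ^ 2) ≤ u ^ 2 + w ^ 2 := by
    rw [hu, hw, div_pow, div_pow, ← add_div, hDsq, le_div_iff₀ hβ2]
    exact boost_lower_bound β ξ ρ
  have hlin : ∀ A : ℝ, A ≤ -(κ₀ * (ξ ^ 2 + ρ ^ 2)) →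
      exp (T ^ 2 * A) ≤ exp (2 * T ^ 2) * exp (-(κ₀ * T₁ ^ 2 * (|ξ| + |ρ|))) := by
    intro A hA
    rw [← Real.exp_add]
    apply Real.exp_le_exp.2
    have := quadratic_to_linear (T := T) hT₁ hT hκ₀pos.le (by linarith) hA
    linarith
  have e4 : exp (4 * T ^ 2) = exp (2 * T ^ 2) * exp (2 * T ^ 2) := by
    rw [← Real.exp_add]; congr 1; ring
  have hβle : (1 - |β|) ^ 2 ≤ 1 := by nlinarith
  have hs0 : 0 ≤ ξ ^ 2 + ρ ^ 2 := by positivity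
  rcases le_or_gt 0 (u * ξ) with hs | hs
  · have h1 := norm_cerf_sub_cerf_perturbed hT0 hs hY hds hdξ
    have h2 := hlin (-(9 / 10) * u ^ 2 + (ξ ^ 2 - ρ ^ 2) / 2) (by
      rw [hκ₀]
      have : 0 ≤ (1 - |β|) ^ 2 * (ξ ^ 2 + ρ ^ 2) := by positivity
      linarith [sq_nonneg w, sq_nonneg u])
    have h3 := hlin (-(9 / 10) * ξ ^ 2 + (ξ ^ 2 - ρ ^ 2) / 2) (by
      linarith [mul_le_mul_of_nonneg_right hκ₀le hs0, sq_nonneg ξ, sq_nonneg ρ])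
    have e : ∀ v : ℝ, 5 * exp (T ^ 2 * (2 - 9 / 10 * v ^ 2)) *
        exp (T ^ 2 * ((ξ ^ 2 - ρ ^ 2) / 2)) = 5 * exp (2 * T ^ 2) *
        exp (T ^ 2 * (-(9 / 10) * v ^ 2 + (ξ ^ 2 - ρ ^ 2) / 2)) := by
      intro v
      rw [mul_assoc, mul_assoc, ← Real.exp_add, ← Real.exp_add]
      congr 2; ring
    calc _ ≤ (5 * exp (T ^ 2 * (2 - 9 / 10 * u ^ 2)) + 5 * exp (T ^ 2 * (2 - 9 / 10 * ξ ^ 2))) *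
          exp (T ^ 2 * ((ξ ^ 2 - ρ ^ 2) / 2)) := by gcongr
      _ = 5 * exp (2 * T ^ 2) * exp (T ^ 2 * (-(9 / 10) * u ^ 2 + (ξ ^ 2 - ρ ^ 2) / 2)) +
          5 * exp (2 * T ^ 2) * exp (T ^ 2 * (-(9 / 10) * ξ ^ 2 + (ξ ^ 2 - ρ ^ 2) / 2)) := by
        rw [add_mul, e, e]
      _ ≤ 5 * exp (2 * T ^ 2) * (exp (2 * T ^ 2) * exp (-(κ₀ * T₁ ^ 2 * (|ξ| + |ρ|)))) +
          5 * exp (2 * T ^ 2) * (exp (2 * T ^ 2) * exp (-(κ₀ * T₁ ^ 2 * (|ξ| + |ρ|)))) := by gcongr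
      _ ≤ _ := by
        rw [e4]
        have : 0 ≤ exp (2 * T ^ 2) * exp (2 * T ^ 2) *
          exp (-(κ₀ * T₁ ^ 2 * (|ξ| + |ρ|))) := by positivity
        linarith
  · have h1 := norm_cerf_perturbed (u := u) hT0 hY hds
    have h2 := norm_cerf_perturbed (u := ξ) hT0 hY hdξ
    have h3 : ξ ^ 2 ≤ β ^ 2 * ρ ^ 2 := by
      have h4 : (ξ + β * ρ) * ξ < 0 := by
        have : (ξ + β * ρ) * ξ = D * (u * ξ) := by rw [hu]; field_simp
        rw [this]; exact mul_neg_of_pos_of_neg hD0 hs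
      have h5 : β ^ 2 * ρ ^ 2 - ξ ^ 2 = (ξ + β * ρ) ^ 2 - 2 * ((ξ + β * ρ) * ξ) := by ring
      linarith [sq_nonneg (ξ + β * ρ)]
    have h5 := hlin ((ξ ^ 2 - ρ ^ 2) / 2) (by
      have h6 : β ^ 2 ≤ |β| := by
        rw [← sq_abs, sq]; exact mul_le_of_le_one_left hβ0 hβ.le
      have h7 : κ₀ ≤ (1 - |β|) / 5 := by
        rw [hκ₀, sq]
        have := mul_le_of_le_one_left (sub_nonneg.2 hβ.le) (show 1 - |β| ≤ 1 by linarith)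
        linarith
      have h8 : ξ ^ 2 ≤ |β| * ρ ^ 2 := h3.trans (mul_le_mul_of_nonneg_right h6 (sq_nonneg ρ))
      have h9 : ξ ^ 2 + ρ ^ 2 ≤ 2 * ρ ^ 2 := by
        linarith [mul_le_mul_of_nonneg_right hβ.le (sq_nonneg ρ)]
      have h10 : κ₀ * (ξ ^ 2 + ρ ^ 2) ≤ (1 - |β|) / 5 * (2 * ρ ^ 2) :=
        mul_le_mul h7 h9 hs0 (by linarith)
      linarith [mul_nonneg (sub_nonneg.2 hβ.le) (sq_nonneg ρ)])
    calc _ ≤ (12 * exp (2 * T ^ 2)) * (exp (2 * T ^ 2) * exp (-(κ₀ * T₁ ^ 2 * (|ξ| + |ρ|)))) := by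
          gcongr
          calc _ ≤ _ := norm_sub_le _ _
            _ ≤ _ := by linarith
      _ = _ := by rw [e4]; ring

/-- Decay of the kernel of an isotropic vector in the plane, away from its wall. -/
lemma kernel_bound_isotropic {β δ T₁ : ℝ} (hβ : β ^ 2 = 1) (hδ : 0 < δ) (hT₁ : 0 < T₁) :
    ∃ κ > 0, ∀ (T ξ ρ σ : ℝ) (Y dξ : ℂ), T₁ ≤ T → ‖Y - T‖ ≤ T / 100 → ‖dξ‖ ≤ 1 / 100 →
      (σ = 1 ∨ σ = -1) → δ ≤ σ * (ξ + β * ρ) →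
      ‖σ - cerf (Y * (ξ + dξ))‖ * exp (T ^ 2 * ((ξ ^ 2 - ρ ^ 2) / 2)) ≤
      12 * exp (4 * T ^ 2) * exp (-(κ * (|ξ| + |ρ|))) := by
  have hβ1 : |β| = 1 := by
    rw [← sq_eq_sq₀ (abs_nonneg β) zero_le_one, sq_abs, hβ, one_pow]
  refine ⟨min (1 / 5 * T₁ ^ 2) (T₁ ^ 2 / 4 * δ), by positivity, ?_⟩
  intro T ξ ρ σ Y dξ hT hY hdξ hσ hs
  set κ := min (1 / 5 * T₁ ^ 2) (T₁ ^ 2 / 4 * δ)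
  have hT0 : 0 ≤ T := hT₁.le.trans hT
  have hsum : 0 ≤ |ξ| + |ρ| := by positivity
  have hσ2 : σ ^ 2 = 1 := by rcases hσ with rfl | rfl <;> norm_num
  rcases le_or_gt 0 (σ * ξ) with h0 | h0
  · have h1 := norm_sign_sub_cerf_perturbed hT0 hσ h0 hY hdξ
    have h2 := quadratic_to_linear (T := T) (κ := 1 / 5) (A := -(9 / 10) * ξ ^ 2 + (ξ ^ 2 - ρ ^ 2) / 2)
      (x := ξ) (y := ρ) hT₁ hT (by norm_num) (by norm_num)
      (by nlinarith [sq_nonneg ξ, sq_nonneg ρ])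
    calc _ ≤ 5 * exp (T ^ 2 * (2 - 9 / 10 * ξ ^ 2)) *
          exp (T ^ 2 * ((ξ ^ 2 - ρ ^ 2) / 2)) := by gcongr
      _ = 5 * exp (2 * T ^ 2 + T ^ 2 * (-(9 / 10) * ξ ^ 2 + (ξ ^ 2 - ρ ^ 2) / 2)) := by
        rw [mul_assoc, ← Real.exp_add]; congr 2; ring
      _ ≤ 12 * exp (4 * T ^ 2 + -(κ * (|ξ| + |ρ|))) := by
        have : κ * (|ξ| + |ρ|) ≤ 1 / 5 * T₁ ^ 2 * (|ξ| + |ρ|) := by gcongr; exact min_le_left _ _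
        exact mul_le_mul (by norm_num) (Real.exp_le_exp.2 (by nlinarith [sq_nonneg T]))
          (Real.exp_pos _).le (by norm_num)
      _ = _ := by rw [Real.exp_add]; ring
  · have h1 := norm_cerf_perturbed (u := ξ) hT0 hY hdξ
    have hn : ‖(σ : ℂ)‖ = 1 := by rcases hσ with rfl | rfl <;> simp
    set s := ξ + β * ρ with hsdef
    have hξ : |ξ| = -(σ * ξ) := by
      rw [← abs_of_neg h0, abs_mul]
      rcases hσ with rfl | rfl <;> simp
    have hρ : |ρ| ≤ σ * s + |ξ| := by
      have h3 : |ρ| = |σ * (β * ρ)| := by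
        rw [abs_mul, abs_mul, hβ1]
        rcases hσ with rfl | rfl <;> simp
      rw [h3, hξ, abs_of_nonneg] <;> nlinarith
    have hdiff : ξ ^ 2 - ρ ^ 2 = -((σ * s) ^ 2 + 2 * (σ * s) * |ξ|) := by
      have : ρ ^ 2 = (s - ξ) ^ 2 := by rw [hsdef]; linear_combination (-ρ ^ 2) * hβ
      rw [this, hξ]
      rcases hσ with rfl | rfl <;> ring
    have h4 : (ξ ^ 2 - ρ ^ 2) / 2 ≤ -(δ / 4 * (|ξ| + |ρ|)) := by
      rw [hdiff]
      nlinarith [abs_nonneg ξ, mul_le_mul_of_nonneg_right hs (abs_nonneg ξ)]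
    have h5 : T ^ 2 * ((ξ ^ 2 - ρ ^ 2) / 2) ≤ -(κ * (|ξ| + |ρ|)) := by
      have h6 : T₁ ^ 2 ≤ T ^ 2 := by gcongr
      have h7 : κ * (|ξ| + |ρ|) ≤ T₁ ^ 2 / 4 * δ * (|ξ| + |ρ|) := by gcongr; exact min_le_right _ _
      have h8 := mul_le_mul_of_nonneg_left h4 (sq_nonneg T)
      have h9 : T₁ ^ 2 * (δ / 4 * (|ξ| + |ρ|)) ≤ T ^ 2 * (δ / 4 * (|ξ| + |ρ|)) := by gcongr
      nlinarith
    have h10 : 1 ≤ exp (2 * T ^ 2) := Real.one_le_exp (by positivity)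
    have h11 : exp (2 * T ^ 2) ≤ exp (4 * T ^ 2) := Real.exp_le_exp.2 (by nlinarith [sq_nonneg T])
    calc _ ≤ (12 * exp (4 * T ^ 2)) * exp (-(κ * (|ξ| + |ρ|))) := by
          gcongr
          calc _ ≤ _ := norm_sub_le _ _
            _ ≤ _ := by rw [hn]; linarith
      _ = _ := by ring

/-- Decay of the difference of the kernel along an isotropic vector, on its wall. -/
lemma kernel_bound_wall {β T₁ : ℝ} (γ : ℝ) (hβ : β ^ 2 = 1) (hT₁ : 0 < T₁) :
    ∃ κ > 0, ∃ C, ∀ (T ξ ρ : ℝ) (Y dξ : ℂ), T₁ ≤ T → ‖Y - T‖ ≤ T / 100 → ‖dξ‖ ≤ 1 / 100 →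
      |ξ + β * ρ| ≤ 1 →
      ‖cerf (Y * (ξ + dξ + γ)) - cerf (Y * (ξ + dξ))‖ * exp (T ^ 2 * ((ξ ^ 2 - ρ ^ 2) / 2)) ≤
      12 * exp (C * T ^ 2) * exp (-(κ * (|ξ| + |ρ|))) := by
  have hβ1 : |β| = 1 := by
    rw [← sq_eq_sq₀ (abs_nonneg β) zero_le_one, sq_abs, hβ, one_pow]
  refine ⟨T₁ ^ 2 / 10, by positivity, 10 + 2 * γ ^ 2, ?_⟩
  intro T ξ ρ Y dξ hT hY hdξ hs
  have hT0 : 0 ≤ T := hT₁.le.trans hT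
  have hT2 : T₁ ^ 2 ≤ T ^ 2 := by gcongr
  set s := ξ + β * ρ with hsdef
  have hρ : |ρ| ≤ 1 + |ξ| := by
    have h3 : |ρ| = |s - ξ| := by
      rw [hsdef, add_sub_cancel_left, abs_mul, hβ1, one_mul]
    rw [h3]
    exact (abs_sub _ _).trans (by linarith)
  have hdiff : (ξ ^ 2 - ρ ^ 2) / 2 ≤ |ξ| := by
    have : ρ ^ 2 = (s - ξ) ^ 2 := by rw [hsdef]; linear_combination (-ρ ^ 2) * hβ
    rw [this]
    have h1 : s * ξ ≤ |ξ| := by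
      calc s * ξ ≤ |s * ξ| := le_abs_self _
        _ = |s| * |ξ| := abs_mul _ _
        _ ≤ 1 * |ξ| := by gcongr
        _ = |ξ| := one_mul _
    nlinarith [sq_nonneg s]
  have hlin : ∀ A : ℝ, A ≤ 9 + 2 * γ ^ 2 - (|ξ| + |ρ|) / 10 →
      exp (T ^ 2 * A) ≤ exp ((10 + 2 * γ ^ 2) * T ^ 2) * exp (-(T₁ ^ 2 / 10 * (|ξ| + |ρ|))) := by
    intro A hA
    rw [← Real.exp_add]
    apply Real.exp_le_exp.2
    have h1 := mul_le_mul_of_nonneg_left hA (sq_nonneg T)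
    have h2 : T₁ ^ 2 * ((|ξ| + |ρ|) / 10) ≤ T ^ 2 * ((|ξ| + |ρ|) / 10) := by gcongr
    nlinarith [sq_nonneg T]
  have hd : (ξ : ℂ) + dξ + γ = ((ξ + γ : ℝ) : ℂ) + dξ := by push_cast; ring
  rw [hd]
  rcases le_or_gt 0 ((ξ + γ) * ξ) with h0 | h0
  · have h1 := norm_cerf_sub_cerf_perturbed hT0 h0 hY hdξ hdξ
    have h2 := hlin (2 - 9 / 10 * (ξ + γ) ^ 2 + (ξ ^ 2 - ρ ^ 2) / 2) (by
      nlinarith [sq_abs ξ, sq_nonneg (|ξ| - 3), sq_nonneg (ξ + 2 * γ), sq_nonneg γ])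
    have h3 := hlin (2 - 9 / 10 * ξ ^ 2 + (ξ ^ 2 - ρ ^ 2) / 2) (by
      nlinarith [sq_abs ξ, sq_nonneg (|ξ| - 1), sq_nonneg γ])
    have e : ∀ v : ℝ, 5 * exp (T ^ 2 * (2 - 9 / 10 * v ^ 2)) * exp (T ^ 2 * ((ξ ^ 2 - ρ ^ 2) / 2)) =
        5 * exp (T ^ 2 * (2 - 9 / 10 * v ^ 2 + (ξ ^ 2 - ρ ^ 2) / 2)) := by
      intro v
      rw [mul_assoc, ← Real.exp_add]
      congr 2; ring
    calc _ ≤ (5 * exp (T ^ 2 * (2 - 9 / 10 * (ξ + γ) ^ 2)) +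
          5 * exp (T ^ 2 * (2 - 9 / 10 * ξ ^ 2))) *
          exp (T ^ 2 * ((ξ ^ 2 - ρ ^ 2) / 2)) := by gcongr
      _ = _ := by rw [add_mul, e, e]
      _ ≤ 5 * (exp ((10 + 2 * γ ^ 2) * T ^ 2) * exp (-(T₁ ^ 2 / 10 * (|ξ| + |ρ|)))) +
          5 * (exp ((10 + 2 * γ ^ 2) * T ^ 2) * exp (-(T₁ ^ 2 / 10 * (|ξ| + |ρ|)))) := by
        gcongr
      _ ≤ _ := by
        have : 0 ≤ exp ((10 + 2 * γ ^ 2) * T ^ 2) *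
          exp (-(T₁ ^ 2 / 10 * (|ξ| + |ρ|))) := by positivity
        linarith
  · have h1 := norm_cerf_perturbed (u := ξ + γ) hT0 hY hdξ
    have h2 := norm_cerf_perturbed (u := ξ) hT0 hY hdξ
    have h3 : |ξ| ≤ |γ| := by
      rw [← sq_le_sq]
      nlinarith [sq_nonneg (ξ + γ)]
    have h4 := hlin (2 + (ξ ^ 2 - ρ ^ 2) / 2) (by
      nlinarith [sq_abs γ, sq_nonneg (|γ| - 1), abs_nonneg ξ])
    calc _ ≤ (12 * exp (2 * T ^ 2)) * exp (T ^ 2 * ((ξ ^ 2 - ρ ^ 2) / 2)) := by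
          gcongr
          calc _ ≤ _ := norm_sub_le _ _
            _ ≤ _ := by linarith
      _ = 12 * exp (T ^ 2 * (2 + (ξ ^ 2 - ρ ^ 2) / 2)) := by
        rw [mul_assoc, ← Real.exp_add]; congr 2; ring
      _ ≤ 12 * (exp ((10 + 2 * γ ^ 2) * T ^ 2) * exp (-(T₁ ^ 2 / 10 * (|ξ| + |ρ|)))) := by gcongr
      _ = _ := by ring

end kernels

/-! ### The terms of the theta series and their complexification -/

lemma summable_prod_pi {ι : Type*} [Fintype ι] [DecidableEq ι] {β : Type*} {f : β → ℝ}
    (hf : Summable f) (h0 : ∀ b, 0 ≤ f b) : Summable fun ν : ι → β => ∏ i, f (ν i) := by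
  classical
  refine summable_of_sum_le (c := ∏ _i : ι, ∑' b, f b)
    (fun ν => Finset.prod_nonneg fun i _ => h0 _) fun s => ?_
  calc ∑ ν ∈ s, ∏ i, f (ν i)
      ≤ ∑ ν ∈ Fintype.piFinset fun i => s.image fun ν => ν i, ∏ i, f (ν i) := by
        refine Finset.sum_le_sum_of_subset_of_nonneg (fun ν hν => ?_)
          fun ν _ _ => Finset.prod_nonneg fun i _ => h0 _
        exact Fintype.mem_piFinset.2 fun i => Finset.mem_image_of_mem _ hν
    _ = ∏ i, ∑ b ∈ s.image fun ν => ν i, f b := by rw [Finset.prod_univ_sum]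
    _ ≤ _ := Finset.prod_le_prod (fun i _ => Finset.sum_nonneg fun b _ => h0 b)
        fun i _ => hf.sum_le_tsum _ fun b _ => h0 b

lemma summable_exp_neg_abs_int {κ : ℝ} (hκ : 0 < κ) :
    Summable fun n : ℤ => exp (-(κ * |(n : ℝ)|)) := by
  have h : Summable fun n : ℕ => exp (-(κ * n)) := by
    have h1 : (fun n : ℕ => exp (-(κ * n))) = fun n : ℕ => exp (-κ) ^ n := by
      funext n
      rw [← Real.exp_nat_mul]; congr 1; ring
    rw [h1]
    exact summable_geometric_of_lt_one (Real.exp_pos _).le (by rw [Real.exp_lt_one_iff]; linarith)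
  refine Summable.of_nat_of_neg ?_ ?_ <;> simpa using h

lemma summable_exp_neg_norm {N : ℕ} {κ : ℝ} (hκ : 0 < κ) :
    Summable fun ν : Fin N → ℤ => exp (-(κ * ‖fun k => (ν k : ℝ)‖)) := by
  rcases Nat.eq_zero_or_pos N with rfl | hN
  · exact Summable.of_finite
  have hN' : (0 : ℝ) < N := by exact_mod_cast hN
  refine Summable.of_nonneg_of_le (fun ν => (Real.exp_pos _).le) (fun ν => ?_)
    (summable_prod_pi (summable_exp_neg_abs_int (κ := κ / N) (by positivity))
      fun n => (Real.exp_pos _).le)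
  rw [← Real.exp_sum]
  apply Real.exp_le_exp.2
  rw [sum_neg_distrib, neg_le_neg_iff, ← mul_sum]
  have h1 : ∑ i, |(ν i : ℝ)| ≤ N * ‖fun k => (ν k : ℝ)‖ := by
    calc ∑ i, |(ν i : ℝ)| ≤ ∑ _i : Fin N, ‖fun k => (ν k : ℝ)‖ :=
          Finset.sum_le_sum fun i _ => norm_le_pi_norm (fun k => (ν k : ℝ)) i
      _ = _ := by simp
  calc κ / N * ∑ i, |(ν i : ℝ)| ≤ κ / N * (N * ‖fun k => (ν k : ℝ)‖) := by gcongr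
    _ = _ := by field_simp

/-- Complexification of a real vector. -/
def toC {N : ℕ} (x : Fin N → ℝ) : Fin N → ℂ := fun k => (x k : ℂ)

/-- The point `ν + l` of a coset of `ℤ^N`. -/
def coset {N : ℕ} (l : Fin N → ℝ) (ν : Fin N → ℤ) : Fin N → ℝ := fun k => ν k + l k

namespace EvenLattice

variable {N : ℕ} {L : EvenLattice N} {d m : ℕ}

lemma bil_toC (x y : Fin N → ℝ) : L.bil (toC x) (toC y) = ((L.bil x y : ℝ) : ℂ) := L.bil_ofReal x y

lemma quad_toC (x : Fin N → ℝ) : L.quad (toC x) = ((L.quad x : ℝ) : ℂ) := L.quad_ofReal x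

lemma toC_add (x y : Fin N → ℝ) : toC (x + y) = toC x + toC y := by
  funext k; simp [toC]

lemma toC_smul (c : ℝ) (x : Fin N → ℝ) : toC (c • x) = (c : ℂ) • toC x := by
  funext k; simp [toC]

lemma bil_toC_im (x : Fin N → ℝ) (z : Fin N → ℂ) :
    (L.bil (toC x) z).im = L.bil x fun k => (z k).im := by
  have h : z = toC (fun k => (z k).re) + 𝕚 • toC (fun k => (z k).im) := by
    funext k
    simp only [toC, Pi.add_apply, Pi.smul_apply, smul_eq_mul, mul_comm 𝕚, Complex.re_add_im]
  conv_lhs => rw [h]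
  rw [bil_add_right, bil_smul_right, bil_toC, bil_toC]
  simp

lemma exists_bil_bound {𝕜 : Type*} [RCLike 𝕜] (u : Fin N → 𝕜) :
    ∃ M, 0 < M ∧ ∀ z : Fin N → 𝕜, ‖L.bil u z‖ ≤ M * ‖z‖ := by
  refine ⟨‖(L.bilin u).toContinuousLinearMap‖ + 1, by positivity, fun z => ?_⟩
  calc ‖L.bil u z‖ ≤ ‖(L.bilin u).toContinuousLinearMap‖ * ‖z‖ :=
        (L.bilin u).toContinuousLinearMap.le_opNorm z
    _ ≤ _ := by gcongr; linarith

/-- One of the two partial frames, in terms of an adapted frame: the `i`-th vector is a positive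
multiple of `n i + β i • g i`, and if it is isotropic then `κ i • (n i + β i • g i)` is integral. -/
structure Side (F : L.AdaptedFrame d m) where
  β : Fin d → ℝ
  κ : Fin d → ℝ
  sq_le : ∀ i, β i ^ 2 ≤ 1
  κ_pos : ∀ i, 0 < κ i
  integral : ∀ i, β i ^ 2 = 1 → ∃ ν : Fin N → ℤ, ∀ k, κ i * (F.n i k + β i * F.g i k) = ν k

namespace Side

variable {F : L.AdaptedFrame d m} (B B' : Side F)

/-- The direction of the `i`-th vector. -/
def dir (i : Fin d) : Fin N → ℝ := F.n i + B.β i • F.g i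

lemma bil_dir (i : Fin d) (x : Fin N → ℝ) :
    L.bil (B.dir i) x = L.bil (F.n i) x + B.β i * L.bil (F.g i) x := by
  rw [dir, bil_add_left, bil_smul_left]

/-- The kernel attached to the `i`-th vector, relative to `n i`, at the complexified point `X`;
the sign is frozen at `x₀`, and on the wall the kernel is replaced by its difference along the
isotropic vector. -/
def kern (i : Fin d) (Y : ℂ) (X : Fin N → ℂ) (x₀ : Fin N → ℝ) (h : ℂ) : ℂ :=
  open scoped Classical in
  if B.β i ^ 2 = 1 then
    if L.bil (B.dir i) x₀ = 0 then
      cerf (Y * (L.bil (toC (F.n i)) X + (2 * B.κ i : ℝ))) - cerf (Y * L.bil (toC (F.n i)) X)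
    else h * ((Real.sign (L.bil (B.dir i) x₀) : ℝ) - cerf (Y * L.bil (toC (F.n i)) X))
  else cerf (Y * (L.bil (toC (B.dir i)) X / (sqrt (1 - B.β i ^ 2) : ℝ))) -
    cerf (Y * L.bil (toC (F.n i)) X)

/-- The `i`-th vector is isotropic, and `a₀` lies on one of its walls. -/
def OnWall (a₀ l : Fin N → ℝ) (i : Fin d) : Prop :=
  B.β i ^ 2 = 1 ∧ ∃ ν : Fin N → ℤ, L.bil (B.dir i) (coset l ν + a₀) = 0

/-- The holomorphic factor which clears the pole at the wall. -/
def hfac (a₀ l : Fin N → ℝ) (i : Fin d) (P : Jac[N]) : ℂ :=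
  open scoped Classical in
  if B.OnWall a₀ l i then
    1 - ee (B.κ i * (L.bil (toC (B.dir i)) P.2 - (L.bil (B.dir i) a₀ : ℝ) * P.1))
  else 1

end Side

/-- The complexification of `v / y`. -/
def aC (P Q : Jac[N]) : Fin N → ℂ := fun k => (P.2 k - Q.2 k) / (P.1 - Q.1)

/-- The complexification of `√(π y)`. -/
def yC (P Q : Jac[N]) : ℂ := (π * ((P.1 - Q.1) / (2 * 𝕚))) ^ (1 / 2 : ℂ)

/-- The vector `v / y`. -/
def vy (P : Jac[N]) : Fin N → ℝ := fun k => (P.2 k).im / P.1.im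

/-- The holomorphic exponential of the theta series. -/
def qexp (L : EvenLattice N) (x : Fin N → ℝ) (P : Jac[N]) : ℂ :=
  ee ((L.quad x : ℝ) * P.1 + L.bil (toC x) P.2)

lemma norm_ee (z : ℂ) : ‖ee z‖ = exp (-(2 * π * z.im)) := by
  rw [ee, Complex.norm_exp]
  congr 1
  simp [Complex.mul_re, Complex.mul_im]

lemma ee_add (z w : ℂ) : ee (z + w) = ee z * ee w := by
  rw [ee, ee, ee, ← Complex.exp_add]; congr 1; ring

lemma ee_zero : ee 0 = 1 := by simp [ee]

lemma ee_ne_zero (z : ℂ) : ee z ≠ 0 := Complex.exp_ne_zero _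

lemma ee_neg (z : ℂ) : ee (-z) = (ee z)⁻¹ := by
  rw [ee, ee, ← Complex.exp_neg]; congr 1; ring

lemma ee_intCast (n : ℤ) : ee n = 1 := by
  rw [ee, Complex.exp_eq_one_iff]
  exact ⟨n, by ring⟩

lemma contDiff_ee {n : WithTop ℕ∞} : ContDiff ℂ n ee := by
  unfold ee; fun_prop

lemma norm_qexp {P : Jac[N]} (hP : 0 < P.1.im) (x : Fin N → ℝ) :
    ‖qexp L x P‖ = exp (2 * π * P.1.im * (L.quad (vy P) - L.quad (x + vy P))) := by
  rw [qexp, norm_ee]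
  congr 1
  have h1 : (fun k => (P.2 k).im) = P.1.im • vy P := by
    funext k; simp only [vy, Pi.smul_apply, smul_eq_mul]; field_simp
  rw [Complex.add_im, bil_toC_im, h1, bil_smul_right, quad_add]
  simp
  ring

variable (F : L.AdaptedFrame d m)

/-- The frame coordinates control the norm. -/
lemma exists_norm_le :
    ∃ M, 0 < M ∧ ∀ x : Fin N → ℝ, ‖x‖ ≤
      M * (∑ i, (|L.bil (F.n i) x| + |L.bil (F.g i) x|) + ∑ k, |L.bil (F.w k) x|) := by
  refine ⟨∑ k, ‖F.vec k‖ + 1, by positivity, fun x => ?_⟩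
  have h1 : ∀ k, ‖(AdaptedFrame.sgn k / 2 * L.bil (F.vec k) x) • F.vec k‖ ≤
      (∑ k, ‖F.vec k‖ + 1) * |L.bil (F.vec k) x| := by
    intro k
    have h2 : |(AdaptedFrame.sgn k : ℝ)| = 1 := by
      rcases k with (k | k) | k <;> simp [AdaptedFrame.sgn]
    rw [norm_smul, Real.norm_eq_abs, abs_mul, abs_div, h2, abs_two, mul_comm]
    have h3 : ‖F.vec k‖ ≤ ∑ k, ‖F.vec k‖ + 1 := by
      have := Finset.single_le_sum (f := fun k => ‖F.vec k‖) (fun i _ => norm_nonneg _)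
        (Finset.mem_univ k)
      linarith
    have h4 : 1 / 2 * |L.bil (F.vec k) x| ≤ |L.bil (F.vec k) x| := by
      linarith [abs_nonneg (L.bil (F.vec k) x)]
    gcongr
  calc ‖x‖ = ‖∑ k, (AdaptedFrame.sgn k / 2 * L.bil (F.vec k) x) • F.vec k‖ := by
        conv_lhs => rw [F.expand x]
    _ ≤ ∑ k, (∑ k, ‖F.vec k‖ + 1) * |L.bil (F.vec k) x| := norm_sum_le_of_le _ fun k _ => h1 k
    _ = _ := by
      generalize ∑ k, ‖F.vec k‖ + 1 = M
      rw [← mul_sum, Fintype.sum_sum_type, Fintype.sum_sum_type, ← sum_add_distrib]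
      rfl

/-- Bounds in the hyperbolic planes give exponential decay of the whole term. -/
theorem exists_prod_bound {T₁ κ : ℝ} (hT₁ : 0 < T₁) (hκ : 0 < κ) :
    ∃ κ' > 0, ∃ A : ℝ, ∀ (P : Jac[N]) (x : Fin N → ℝ) (k : Fin d → ℂ) (C : ℝ),
      0 < P.1.im → T₁ ≤ π * P.1.im →
      (∀ i, ‖k i‖ * exp (π * P.1.im *
        ((L.bil (F.n i) (x + vy P) ^ 2 - L.bil (F.g i) (x + vy P) ^ 2) / 2)) ≤
        C * exp (-(κ * (|L.bil (F.n i) (x + vy P)| + |L.bil (F.g i) (x + vy P)|)))) →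
      ‖(∏ i, k i) * qexp L x P‖ ≤ A * C ^ d * exp (2 * π * P.1.im * L.quad (vy P)) *
          exp (-(κ' * ‖x + vy P‖)) := by
  obtain ⟨M, hM, hx⟩ := exists_norm_le F
  set κ₁ := min κ (T₁ / 2) with hκ₁
  have hκ₁0 : 0 < κ₁ := by positivity
  refine ⟨κ₁ / M, by positivity, exp (m * (T₁ / 2)), ?_⟩
  intro P x k C hP hT hk
  set t := π * P.1.im with ht
  set X := x + vy P with hX
  have hC0 : ∀ i : Fin d, 0 ≤ C := fun i => by
    have := (by positivity : 0 ≤ ‖k i‖ * exp (t *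
      ((L.bil (F.n i) X ^ 2 - L.bil (F.g i) X ^ 2) / 2))).trans (hk i)
    exact nonneg_of_mul_nonneg_left this (Real.exp_pos _)
  have hq : 2 * π * P.1.im * (L.quad (vy P) - L.quad X) = 2 * π * P.1.im * L.quad (vy P) +
        (∑ i, t * ((L.bil (F.n i) X ^ 2 - L.bil (F.g i) X ^ 2) / 2) +
          ∑ j, -(t / 2 * L.bil (F.w j) X ^ 2)) := by
    have h1 : L.quad X = ∑ i, (L.bil (F.g i) X ^ 2 - L.bil (F.n i) X ^ 2) / 4 +
        ∑ j, L.bil (F.w j) X ^ 2 / 4 := by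
      rw [quad, F.bil_eq, add_div, sum_div, sum_div]
      congr 1 <;> exact sum_congr rfl fun i _ => by ring
    rw [h1, ht]
    simp only [mul_sub, mul_add, mul_sum, sum_neg_distrib]
    rw [sub_eq_add_neg, neg_add, ← sum_neg_distrib, ← sum_neg_distrib, ← sum_neg_distrib]
    congr 2 <;> exact sum_congr rfl fun i _ => by ring
  have hw : ∀ j, exp (-(t / 2 * L.bil (F.w j) X ^ 2)) ≤
      exp (T₁ / 2) * exp (-(κ₁ * |L.bil (F.w j) X|)) := by
    intro j
    rw [← Real.exp_add]
    apply Real.exp_le_exp.2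
    have h1 : κ₁ * |L.bil (F.w j) X| ≤ T₁ / 2 * |L.bil (F.w j) X| := by
      gcongr; exact min_le_right _ _
    have h2 : |L.bil (F.w j) X| ≤ L.bil (F.w j) X ^ 2 + 1 := by
      nlinarith [sq_abs (L.bil (F.w j) X), sq_nonneg (|L.bil (F.w j) X| - 1)]
    have h3 : T₁ / 2 * L.bil (F.w j) X ^ 2 ≤ t / 2 * L.bil (F.w j) X ^ 2 := by gcongr
    have h4 : T₁ / 2 * |L.bil (F.w j) X| ≤ T₁ / 2 * (L.bil (F.w j) X ^ 2 + 1) := by gcongr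
    linarith
  have hk' : ∀ i, ‖k i‖ * exp (t * ((L.bil (F.n i) X ^ 2 - L.bil (F.g i) X ^ 2) / 2)) ≤
      C * exp (-(κ₁ * (|L.bil (F.n i) X| + |L.bil (F.g i) X|))) := by
    intro i
    have := hC0 i
    refine (hk i).trans ?_
    gcongr
    exact min_le_left _ _
  rw [norm_mul, norm_qexp hP, norm_prod, hq, Real.exp_add, Real.exp_add, Real.exp_sum, Real.exp_sum]
  calc (∏ i, ‖k i‖) * (exp (2 * π * P.1.im * L.quad (vy P)) *
        ((∏ i, exp (t * ((L.bil (F.n i) X ^ 2 - L.bil (F.g i) X ^ 2) / 2))) *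
          ∏ j, exp (-(t / 2 * L.bil (F.w j) X ^ 2))))
      = exp (2 * π * P.1.im * L.quad (vy P)) *
        ((∏ i, ‖k i‖ * exp (t * ((L.bil (F.n i) X ^ 2 - L.bil (F.g i) X ^ 2) / 2))) *
          ∏ j, exp (-(t / 2 * L.bil (F.w j) X ^ 2))) := by
        rw [prod_mul_distrib]; ring
    _ ≤ exp (2 * π * P.1.im * L.quad (vy P)) *
        ((∏ i, C * exp (-(κ₁ * (|L.bil (F.n i) X| + |L.bil (F.g i) X|)))) *
          ∏ j, exp (T₁ / 2) * exp (-(κ₁ * |L.bil (F.w j) X|))) := by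
        refine mul_le_mul_of_nonneg_left (mul_le_mul
          (Finset.prod_le_prod (fun i _ => by positivity) fun i _ => hk' i)
          (Finset.prod_le_prod (fun i _ => by positivity) fun i _ => hw i)
          (Finset.prod_nonneg fun i _ => by positivity)
          (Finset.prod_nonneg fun i _ => mul_nonneg (hC0 i) (Real.exp_pos _).le))
          (Real.exp_pos _).le
    _ = exp (m * (T₁ / 2)) * C ^ d * exp (2 * π * P.1.im * L.quad (vy P)) *
        exp (-(κ₁ * (∑ i, (|L.bil (F.n i) X| + |L.bil (F.g i) X|) + ∑ k, |L.bil (F.w k) X|))) := by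
        have e1 : ∏ _j : Fin m, exp (T₁ / 2) = exp (m * (T₁ / 2)) := by
          rw [Finset.prod_const, Finset.card_univ, Fintype.card_fin, ← Real.exp_nat_mul]
        have e2 : ∏ _i : Fin d, C = C ^ d := by
          rw [Finset.prod_const, Finset.card_univ, Fintype.card_fin]
        rw [prod_mul_distrib, prod_mul_distrib, e1, e2, ← Real.exp_sum,
          ← Real.exp_sum, mul_add, neg_add, Real.exp_add,
          mul_sum, mul_sum, sum_neg_distrib, sum_neg_distrib]
        ring
    _ ≤ _ := by
        have h0 : 0 ≤ C ^ d := by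
          rcases Nat.eq_zero_or_pos d with h | h
          · rw [h, pow_zero]; exact zero_le_one
          · exact pow_nonneg (hC0 ⟨0, h⟩) d
        refine mul_le_mul_of_nonneg_left (Real.exp_le_exp.2 (neg_le_neg ?_)) (by positivity)
        rw [div_mul_eq_mul_div, div_le_iff₀ hM]
        calc κ₁ * ‖X‖ ≤ κ₁ * _ := mul_le_mul_of_nonneg_left (hx X) hκ₁0.le
          _ = _ := by ring

end EvenLattice

/-! ### Uniform bounds for the terms of the theta series -/

lemma exists_pos_le_of_finite {ι : Type*} [Finite ι] {κ : ι → ℝ} (h : ∀ i, 0 < κ i) :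
    ∃ κ₀ > 0, ∀ i, κ₀ ≤ κ i := by
  obtain ⟨⟨M, hM⟩, h'⟩ := Finite.exists_ge fun i => (⟨κ i, h i⟩ : Set.Ioi (0 : ℝ))
  exact ⟨M, hM, fun i => h' i⟩

namespace EvenLattice

variable {N : ℕ} {L : EvenLattice N} {d m : ℕ} (F : L.AdaptedFrame d m)

/-- The coordinate `⟨n i, ν + l + v / y⟩`. -/
abbrev AdaptedFrame.xi (l : Fin N → ℝ) (i : Fin d) (P : Jac[N]) (ν : Fin N → ℤ) : ℝ :=
  L.bil (F.n i) (coset l ν + vy P)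

/-- The coordinate `⟨g i, ν + l + v / y⟩`. -/
abbrev AdaptedFrame.eta (l : Fin N → ℝ) (i : Fin d) (P : Jac[N]) (ν : Fin N → ℤ) : ℝ :=
  L.bil (F.g i) (coset l ν + vy P)

/-- A kernel in the `i`-th hyperbolic plane which decays so fast that it makes the theta series
converge, uniformly on `S` up to factors which grow exponentially with `y`. -/
def Controlled (l : Fin N → ℝ) (i : Fin d) (S : Set (Jac[N] × Jac[N]))
    (k : Jac[N] × Jac[N] → (Fin N → ℤ) → ℂ) : Prop :=
  ∃ κ > 0, ∃ C, 0 ≤ C ∧ ∀ p ∈ S, ∀ ν, ‖k p ν‖ * exp (π * p.1.1.im *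
    ((F.xi l i p.1 ν ^ 2 - F.eta l i p.1 ν ^ 2) / 2)) ≤
    C * exp (C * (π * p.1.1.im)) * exp (-(κ * (|F.xi l i p.1 ν| + |F.eta l i p.1 ν|)))

variable {F} {l : Fin N → ℝ} {i : Fin d} {S S' : Set (Jac[N] × Jac[N])}
  {k k' : Jac[N] × Jac[N] → (Fin N → ℤ) → ℂ}

lemma Controlled.mono (h : Controlled F l i S k) (hS : S' ⊆ S) : Controlled F l i S' k := by
  obtain ⟨κ, hκ, C, hC, h⟩ := h
  exact ⟨κ, hκ, C, hC, fun p hp => h p (hS hp)⟩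

lemma Controlled.sub (hS : ∀ p ∈ S, 0 < p.1.1.im) (h : Controlled F l i S k)
    (h' : Controlled F l i S k') : Controlled F l i S fun p ν => k p ν - k' p ν := by
  obtain ⟨κ, hκ, C, hC, h⟩ := h
  obtain ⟨κ', hκ', C', hC', h'⟩ := h'
  refine ⟨min κ κ', lt_min hκ hκ', C + C', by positivity, fun p hp ν => ?_⟩
  have ht : 0 ≤ π * p.1.1.im := by have := hS p hp; positivity
  set t := π * p.1.1.im
  set X := |F.xi l i p.1 ν| + |F.eta l i p.1 ν| with hX
  have hX0 : 0 ≤ X := by positivity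
  have e1 : C * exp (C * t) * exp (-(κ * X)) ≤ C * exp ((C + C') * t) * exp (-(min κ κ' * X)) := by
    gcongr
    · linarith
    · exact min_le_left _ _
  have e2 : C' * exp (C' * t) * exp (-(κ' * X)) ≤
      C' * exp ((C + C') * t) * exp (-(min κ κ' * X)) := by
    gcongr
    · linarith
    · exact min_le_right _ _
  calc _ ≤ (‖k p ν‖ + ‖k' p ν‖) * _ :=
        mul_le_mul_of_nonneg_right (norm_sub_le _ _) (Real.exp_pos _).le
    _ ≤ C * exp ((C + C') * t) * exp (-(min κ κ' * X)) +
        C' * exp ((C + C') * t) * exp (-(min κ κ' * X)) := by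
        rw [add_mul]
        exact add_le_add ((h p hp ν).trans e1) ((h' p hp ν).trans e2)
    _ = _ := by ring

lemma Controlled.mul_left (hS : ∀ p ∈ S, 0 < p.1.1.im) (h : Controlled F l i S k)
    {f : Jac[N] × Jac[N] → (Fin N → ℤ) → ℂ} {C' : ℝ} (hC' : 0 ≤ C')
    (hf : ∀ p ∈ S, ∀ ν, ‖f p ν‖ ≤ C' * exp (C' * (π * p.1.1.im))) :
    Controlled F l i S fun p ν => f p ν * k p ν := by
  obtain ⟨κ, hκ, C, hC, h⟩ := h
  refine ⟨κ, hκ, C' * C + (C' + C), by positivity, fun p hp ν => ?_⟩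
  have ht : 0 ≤ π * p.1.1.im := by have := hS p hp; positivity
  set t := π * p.1.1.im
  rw [norm_mul, mul_assoc]
  calc _ ≤ (C' * exp (C' * t)) * _ := mul_le_mul_of_nonneg_right (hf p hp ν) (by positivity)
    _ ≤ (C' * exp (C' * t)) * _ := mul_le_mul_of_nonneg_left (h p hp ν) (by positivity)
    _ = (C' * C) * exp ((C' + C) * t) * exp (-(κ * (|F.xi l i p.1 ν| + |F.eta l i p.1 ν|))) := by
        rw [add_mul, Real.exp_add]; ring
    _ ≤ _ := by
      have e1 : C' * C ≤ C' * C + (C' + C) := by linarith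
      have e2 : C' + C ≤ C' * C + (C' + C) := by linarith [mul_nonneg hC' hC]
      gcongr

/-- The theta series with controlled kernels converges normally. -/
theorem Controlled.prod_bound {T₁ R : ℝ} (hT₁ : 0 < T₁)
    {k : Fin d → Jac[N] × Jac[N] → (Fin N → ℤ) → ℂ}
    (hS : ∀ p ∈ S, 0 < p.1.1.im ∧ T₁ ≤ π * p.1.1.im ∧ ‖vy p.1‖ ≤ R)
    (hk : ∀ i, Controlled F l i S (k i)) :
    ∃ κ > 0, ∃ C, 0 ≤ C ∧ ∀ p ∈ S, ∀ ν, ‖(∏ i, k i p ν) * qexp L (coset l ν) p.1‖ ≤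
      C * exp (C * p.1.1.im) * exp (-(κ * ‖fun k => (ν k : ℝ)‖)) := by
  choose κ hκ C hC h using hk
  obtain ⟨κ₀, hκ₀, hκ₀'⟩ := exists_pos_le_of_finite hκ
  obtain ⟨C₀, hC₀⟩ := Finite.exists_le C
  set C₁ := max C₀ 0 with hC₁
  have hC₁' : ∀ i, C i ≤ C₁ := fun i => (hC₀ i).trans (le_max_left _ _)
  have hC₁0 : 0 ≤ C₁ := le_max_right _ _
  obtain ⟨κ', hκ', A, hA⟩ := exists_prod_bound F hT₁ hκ₀
  obtain ⟨M, hM, hq⟩ : ∃ M, 0 < M ∧ ∀ a : Fin N → ℝ, ‖a‖ ≤ R → L.quad a ≤ M := by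
    have hcont : Continuous fun a : Fin N → ℝ => L.quad a := by
      unfold quad bil; fun_prop
    obtain ⟨M, hM⟩ := (isCompact_closedBall (0 : Fin N → ℝ) R).bddAbove_image hcont.continuousOn
    exact ⟨max M 1, by positivity, fun a ha => (hM ⟨a, by simpa using ha, rfl⟩).trans
      (le_max_left _ _)⟩
  set C₂ := |A| * C₁ ^ d * exp (κ' * (‖l‖ + R)) with hC₂
  set C₃ := C₁ * π * d + 2 * π * M with hC₃
  refine ⟨κ', hκ', C₂ + C₃, by positivity, fun p hp ν => ?_⟩
  obtain ⟨h0, h1, h2⟩ := hS p hp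
  set t := p.1.1.im with ht
  have h3 := hA p.1 (coset l ν) (fun i => k i p ν) (C₁ * exp (C₁ * (π * t))) h0 h1
    (fun i => (h i p hp ν).trans (by
      have := hC i
      gcongr
      · exact hC₁' i
      · exact hC₁' i
      · exact hκ₀' i))
  have h4 : ‖fun k => (ν k : ℝ)‖ ≤ ‖coset l ν + vy p.1‖ + (‖l‖ + R) := by
    have : (fun k => (ν k : ℝ)) = (coset l ν + vy p.1) - (l + vy p.1) := by
      funext k; simp [coset]
    rw [this]
    exact (norm_sub_le _ _).trans (by linarith [norm_add_le l (vy p.1)])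
  calc _ ≤ _ := h3
    _ ≤ |A| * (C₁ * exp (C₁ * (π * t))) ^ d * exp (2 * π * t * M) *
        (exp (κ' * (‖l‖ + R)) * exp (-(κ' * ‖fun k => (ν k : ℝ)‖))) := by
        rw [← Real.exp_add]
        gcongr
        · exact le_abs_self A
        · exact hq _ h2
        · nlinarith
    _ = C₂ * exp (C₃ * t) * exp (-(κ' * ‖fun k => (ν k : ℝ)‖)) := by
        have e : exp (C₃ * t) = exp (C₁ * (π * t)) ^ d * exp (2 * π * t * M) := by
          rw [← Real.exp_nat_mul, ← Real.exp_add]; congr 1; rw [hC₃]; ring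
        rw [e, hC₂, mul_pow]; ring
    _ ≤ _ := by
        have e1 : 0 ≤ C₂ := by positivity
        have e2 : 0 ≤ C₃ := by positivity
        gcongr <;> linarith

/-- The points near which `v / y` is close to `a₀`, with small imaginary perturbations. -/
def nearSet (T₁ : ℝ) (a₀ : Fin N → ℝ) (ε : ℝ) : Set (Jac[N] × Jac[N]) :=
  {p | 0 < p.1.1.im ∧ T₁ ≤ π * p.1.1.im ∧ ‖vy p.1 - a₀‖ ≤ ε ∧ ‖aC p.1 p.2 - toC (vy p.1)‖ ≤ ε ∧
    ‖yC p.1 p.2 - (sqrt (π * p.1.1.im) : ℝ)‖ ≤ sqrt (π * p.1.1.im) / 100}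

lemma nearSet_mono {T₁ ε ε' : ℝ} {a₀ : Fin N → ℝ} (h : ε ≤ ε') :
    nearSet T₁ a₀ ε ⊆ nearSet T₁ a₀ ε' :=
  fun _ hp => ⟨hp.1, hp.2.1, hp.2.2.1.trans h, hp.2.2.2.1.trans h, hp.2.2.2.2⟩

namespace Side

variable (B : Side F)

lemma exists_discrete (hi : B.β i ^ 2 = 1) (a₀ : Fin N → ℝ) :
    ∃ δ > 0, ∀ ν, L.bil (B.dir i) (coset l ν + a₀) ≠ 0 → δ ≤ |L.bil (B.dir i) (coset l ν + a₀)| := by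
  obtain ⟨c, hc⟩ := B.integral i hi
  have hκ := B.κ_pos i
  set θ := B.κ i * L.bil (B.dir i) (l + a₀) with hθ
  have key : ∀ ν : Fin N → ℤ, ∃ n : ℤ, B.κ i * L.bil (B.dir i) (coset l ν + a₀) = θ + n := by
    intro ν
    refine ⟨c ⬝ᵥ L.gram *ᵥ ν, ?_⟩
    have h1 : coset l ν + a₀ = (fun k => (ν k : ℝ)) + (l + a₀) := by
      funext k; simp [coset]; ring
    have h2 : B.κ i • B.dir i = fun k => (c k : ℝ) := by
      funext k; rw [← hc]; simp [dir]
    rw [h1, bil_add_right, mul_add, ← bil_smul_left, h2, bil_intCast, hθ, add_comm]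
  have hmul : ∀ x : ℝ, B.κ i * |x| = |B.κ i * x| := fun x => by rw [abs_mul, abs_of_pos hκ]
  by_cases h : θ = round θ
  · refine ⟨1 / B.κ i, by positivity, fun ν hν => ?_⟩
    obtain ⟨n, hn⟩ := key ν
    rw [div_le_iff₀ hκ, mul_comm, hmul, hn]
    rw [h] at hn ⊢
    have h3 : round θ + n ≠ 0 := by
      intro h3
      have : ((round θ + n : ℤ) : ℝ) = 0 := by rw [h3]; simp
      push_cast at this
      rw [← hn] at this
      exact hν ((mul_eq_zero.1 this).resolve_left hκ.ne')
    have := Int.one_le_abs h3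
    exact_mod_cast this
  · refine ⟨|θ - round θ| / B.κ i, div_pos (abs_pos.2 (sub_ne_zero.2 h)) hκ, fun ν hν => ?_⟩
    obtain ⟨n, hn⟩ := key ν
    rw [div_le_iff₀ hκ, mul_comm, hmul, hn]
    have := round_le θ (-n)
    push_cast at this
    rwa [sub_neg_eq_add] at this

lemma hfac_bound (a₀ : Fin N → ℝ) (T₁ : ℝ) {ε : ℝ} : ∃ C, 0 ≤ C ∧ ∀ p ∈ nearSet T₁ a₀ ε,
    ‖B.hfac a₀ l i p.1‖ ≤ C * exp (C * (π * p.1.1.im)) := by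
  obtain ⟨M, hM, hb⟩ := exists_bil_bound (L := L) (B.dir i)
  have hκ := B.κ_pos i
  refine ⟨2 + |2 * B.κ i * M * ε|, by positivity, fun p hp => ?_⟩
  obtain ⟨h0, -, h1, -, -⟩ := hp
  set C := |2 * B.κ i * M * ε|
  set t := π * p.1.1.im with ht
  have ht0 : 0 ≤ t := by positivity
  have h1C : 1 ≤ exp ((2 + C) * t) := Real.one_le_exp (by positivity)
  rw [hfac]
  split_ifs with h
  · refine (norm_sub_le _ _).trans ?_
    rw [norm_one, norm_ee]
    have h2 : ((B.κ i : ℂ) * (L.bil (toC (B.dir i)) p.1.2 - (L.bil (B.dir i) a₀ : ℝ) * p.1.1)).im =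
        B.κ i * p.1.1.im * L.bil (B.dir i) (vy p.1 - a₀) := by
      have h3 : (fun k => (p.1.2 k).im) = p.1.1.im • vy p.1 := by
        funext k; simp only [vy, Pi.smul_apply, smul_eq_mul]; field_simp
      rw [Complex.im_ofReal_mul, Complex.sub_im, Complex.im_ofReal_mul, bil_toC_im, h3,
        bil_smul_right, bil_sub_right]
      ring
    have h4 : -(2 * π * (B.κ i * p.1.1.im * L.bil (B.dir i) (vy p.1 - a₀))) ≤ (2 + C) * t := by
      have h5 := (hb (vy p.1 - a₀)).trans (mul_le_mul_of_nonneg_left h1 hM.le)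
      rw [Real.norm_eq_abs] at h5
      have h6 := neg_abs_le (L.bil (B.dir i) (vy p.1 - a₀))
      have h7 : -L.bil (B.dir i) (vy p.1 - a₀) ≤ M * ε := by linarith
      have h8 : 2 * B.κ i * t * (-L.bil (B.dir i) (vy p.1 - a₀)) ≤ 2 * B.κ i * t * (M * ε) :=
        mul_le_mul_of_nonneg_left h7 (by positivity)
      have h9 : 2 * B.κ i * M * ε * t ≤ C * t := mul_le_mul_of_nonneg_right (le_abs_self _) ht0
      rw [ht] at *
      nlinarith
    rw [h2]
    have := Real.exp_le_exp.2 h4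
    nlinarith [abs_nonneg (2 * B.κ i * M * ε)]
  · rw [norm_one]
    nlinarith [abs_nonneg (2 * B.κ i * M * ε)]

/-- The kernels of the theta series are controlled near the points where `v / y = a₀`. -/
theorem kern_controlled (a₀ : Fin N → ℝ) : ∃ ε > 0, ∀ T₁ > 0,
    Controlled F l i (nearSet T₁ a₀ ε) fun p ν =>
      B.kern i (yC p.1 p.2) (toC (coset l ν) + aC p.1 p.2) (coset l ν + a₀)
        (B.hfac a₀ l i p.1) := by
  obtain ⟨M, hM, hb⟩ := exists_bil_bound (L := L) (B.dir i)
  obtain ⟨M', hM', hb'⟩ := exists_bil_bound (L := L) (toC (F.n i))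
  obtain ⟨M'', hM'', hb''⟩ := exists_bil_bound (L := L) (toC (B.dir i))
  have split : ∀ (u : Fin N → ℝ) (p : Jac[N] × Jac[N]) (ν : Fin N → ℤ),
      L.bil (toC u) (toC (coset l ν) + aC p.1 p.2) = (L.bil u (coset l ν + vy p.1) : ℝ) +
        L.bil (toC u) (aC p.1 p.2 - toC (vy p.1)) := by
    intro u p ν
    rw [← bil_toC, toC_add, bil_add_right, bil_add_right, bil_sub_right]
    ring
  have hsplit : ∀ (p : Jac[N] × Jac[N]) (ν : Fin N → ℤ),
      L.bil (B.dir i) (coset l ν + vy p.1) = L.bil (B.dir i) (coset l ν + a₀) +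
        L.bil (B.dir i) (vy p.1 - a₀) := by
    intro p ν
    rw [← bil_add_right]; congr 1; abel
  by_cases hi : B.β i ^ 2 = 1
  · obtain ⟨δ, hδ, hdisc⟩ := B.exists_discrete (l := l) hi a₀
    refine ⟨min (1 / 100 / M') (min (δ / 2 / M) (1 / M)), by positivity, fun T₁ hT₁ => ?_⟩
    obtain ⟨κ₁, hκ₁, h₁⟩ := kernel_bound_isotropic hi (half_pos hδ) (Real.sqrt_pos.2 hT₁)
    obtain ⟨κ₂, hκ₂, C₂, h₂⟩ := kernel_bound_wall (2 * B.κ i) hi (Real.sqrt_pos.2 hT₁)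
    obtain ⟨C₃, hC₃, h₃⟩ := B.hfac_bound (l := l) (i := i) a₀ T₁
      (ε := min (1 / 100 / M') (min (δ / 2 / M) (1 / M)))
    refine ⟨min κ₁ κ₂, by positivity, 12 + 12 * C₃ + C₃ + |C₂| + 4, by positivity, fun p hp ν => ?_⟩
    have h₃' := h₃ p hp
    obtain ⟨h0, h1, h2, h3, h4⟩ := hp
    have ht0 : 0 ≤ π * p.1.1.im := by positivity
    have hT : sqrt T₁ ≤ sqrt (π * p.1.1.im) := Real.sqrt_le_sqrt h1
    have hTsq : sqrt (π * p.1.1.im) ^ 2 = π * p.1.1.im := Real.sq_sqrt ht0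
    set t := π * p.1.1.im
    set ξ := F.xi l i p.1 ν with hξ
    set η := F.eta l i p.1 ν with hη
    set dξ := L.bil (toC (F.n i)) (aC p.1 p.2 - toC (vy p.1))
    have hdξ : ‖dξ‖ ≤ 1 / 100 := by
      have e := h3.trans (min_le_left _ _)
      rw [le_div_iff₀ hM'] at e
      exact (hb' _).trans (by linarith)
    have hds : |L.bil (B.dir i) (vy p.1 - a₀)| ≤ min (δ / 2) 1 := by
      have e1 := h2.trans ((min_le_right _ _).trans (min_le_left _ _))
      have e2 := h2.trans ((min_le_right _ _).trans (min_le_right _ _))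
      rw [le_div_iff₀ hM] at e1 e2
      exact (hb _).trans (le_min (by linarith) (by linarith))
    have hs : ξ + B.β i * η = L.bil (B.dir i) (coset l ν + a₀) +
        L.bil (B.dir i) (vy p.1 - a₀) := by rw [← hsplit, bil_dir]
    have hX0 : 0 ≤ |ξ| + |η| := by positivity
    beta_reduce
    rw [kern, if_pos hi, split]
    split_ifs with hw
    · have e := h₂ _ ξ η (yC p.1 p.2) dξ hT h4 hdξ (by
        rw [hs, hw, zero_add]; exact hds.trans (min_le_right _ _))
      rw [hTsq] at e
      push_cast at e ⊢
      refine e.trans ?_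
      have e3 : C₂ * t ≤ (12 + 12 * C₃ + C₃ + |C₂| + 4) * t :=
        mul_le_mul_of_nonneg_right (by linarith [le_abs_self C₂]) ht0
      gcongr
      · linarith [abs_nonneg C₂]
      · exact min_le_right _ _
    · set s₀ := L.bil (B.dir i) (coset l ν + a₀) with hs₀
      have hσ : Real.sign s₀ = 1 ∨ Real.sign s₀ = -1 := by
        rcases lt_or_gt_of_ne hw with h | h
        · exact Or.inr (Real.sign_of_neg h)
        · exact Or.inl (Real.sign_of_pos h)
      have hσ' : δ / 2 ≤ Real.sign s₀ * (ξ + B.β i * η) := by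
        have e1 := hdisc ν hw
        have e2 := abs_le.1 (hds.trans (min_le_left _ _))
        rw [hs]
        rcases lt_or_gt_of_ne hw with h | h
        · rw [Real.sign_of_neg h]; rw [abs_of_neg h] at e1; linarith
        · rw [Real.sign_of_pos h]; rw [abs_of_pos h] at e1; linarith
      have e := h₁ _ ξ η (Real.sign s₀) (yC p.1 p.2) dξ hT h4 hdξ hσ hσ'
      rw [hTsq] at e
      rw [norm_mul, mul_assoc]
      calc _ ≤ C₃ * exp (C₃ * t) * (12 * exp (4 * t) * exp (-(κ₁ * (|ξ| + |η|)))) := by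
            exact mul_le_mul h₃' e (by positivity) (by positivity)
        _ = 12 * C₃ * exp ((C₃ + 4) * t) * exp (-(κ₁ * (|ξ| + |η|))) := by
            rw [add_mul, Real.exp_add]; ring
        _ ≤ _ := by
            gcongr
            · linarith [abs_nonneg C₂]
            · linarith [abs_nonneg C₂]
            · exact min_le_left _ _
  · have hβ1 : |B.β i| < 1 := by
      rw [← sq_lt_one_iff_abs_lt_one]
      exact lt_of_le_of_ne (B.sq_le i) hi
    set D := sqrt (1 - B.β i ^ 2) with hD
    have hD0 : 0 < D := Real.sqrt_pos.2 (sub_pos.2 (lt_of_le_of_ne (B.sq_le i) hi))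
    refine ⟨min (1 / 100 / M') (D * (1 / 100) / M''), by positivity, fun T₁ hT₁ => ?_⟩
    obtain ⟨κ₁, hκ₁, h₁⟩ := kernel_bound_negative hβ1 (Real.sqrt_pos.2 hT₁)
    refine ⟨κ₁, hκ₁, 12, by positivity, fun p hp ν => ?_⟩
    obtain ⟨h0, h1, h2, h3, h4⟩ := hp
    have ht0 : 0 ≤ π * p.1.1.im := by positivity
    have hT : sqrt T₁ ≤ sqrt (π * p.1.1.im) := Real.sqrt_le_sqrt h1
    have hTsq : sqrt (π * p.1.1.im) ^ 2 = π * p.1.1.im := Real.sq_sqrt ht0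
    set t := π * p.1.1.im
    set ξ := F.xi l i p.1 ν with hξ
    set η := F.eta l i p.1 ν with hη
    have hdξ : ‖L.bil (toC (F.n i)) (aC p.1 p.2 - toC (vy p.1))‖ ≤ 1 / 100 := by
      have e := h3.trans (min_le_left _ _)
      rw [le_div_iff₀ hM'] at e
      exact (hb' _).trans (by linarith)
    have hds : ‖L.bil (toC (B.dir i)) (aC p.1 p.2 - toC (vy p.1)) / (D : ℂ)‖ ≤ 1 / 100 := by
      have e := h3.trans (min_le_right _ _)
      rw [le_div_iff₀ hM''] at e
      rw [norm_div, Complex.norm_real, Real.norm_of_nonneg hD0.le, div_le_iff₀ hD0]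
      exact (hb'' _).trans (by linarith)
    have e := h₁ _ ξ η (yC p.1 p.2) _ _ hT h4 hds hdξ
    rw [hTsq] at e
    beta_reduce
    rw [kern, if_neg hi, split, split, add_div]
    have e2 : ((L.bil (B.dir i) (coset l ν + vy p.1) : ℝ) : ℂ) / (sqrt (1 - B.β i ^ 2) : ℝ) =
        (((ξ + B.β i * η) / D : ℝ) : ℂ) := by
      rw [bil_dir]; push_cast; rfl
    rw [e2]
    refine e.trans ?_
    gcongr
    linarith

end Side

/-! ### The frozen theta series -/

variable {N : ℕ} {L : EvenLattice N} {d m : ℕ} {F : L.AdaptedFrame d m} {l a₀ a : Fin N → ℝ}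
  {i : Fin d}

namespace Side

variable (B B' : Side F)

/-- The kernel of the `i`-th vector at `ν`, with the signs frozen at `a₀`. -/
def kfac (a₀ l : Fin N → ℝ) (i : Fin d) (ν : Fin N → ℤ) (p : Jac[N] × Jac[N]) : ℂ :=
  B.kern i (yC p.1 p.2) (toC (coset l ν) + aC p.1 p.2) (coset l ν + a₀) (B.hfac a₀ l i p.1)

/-- The difference of the kernels of the `i`-th vectors of both frames, cleared of its poles. -/
def mfac (a₀ a₀' l : Fin N → ℝ) (i : Fin d) (ν : Fin N → ℤ) (p : Jac[N] × Jac[N]) : ℂ :=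
  B'.hfac a₀' l i p.1 * B.kfac a₀ l i ν p - B.hfac a₀ l i p.1 * B'.kfac a₀' l i ν p

/-- The terms of the theta series, with signs frozen at `A` and `A'`, cleared of the poles. -/
def term (A A' : Fin d → Fin N → ℝ) (l : Fin N → ℝ) (ν : Fin N → ℤ) (p : Jac[N] × Jac[N]) : ℂ :=
  (∏ i, mfac B B' (A i) (A' i) l i ν p) * qexp L (coset l ν) p.1

/-- The signs at `a` agree with those at `a₀` off the walls through `a₀`. -/
def Close (l a₀ : Fin N → ℝ) (i : Fin d) (a : Fin N → ℝ) : Prop :=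
  B.β i ^ 2 = 1 → ∀ ν, L.bil (B.dir i) (coset l ν + a₀) ≠ 0 →
    Real.sign (L.bil (B.dir i) (coset l ν + a)) = Real.sign (L.bil (B.dir i) (coset l ν + a₀))

lemma bil_coset_add (u l a₀ a : Fin N → ℝ) (ν : Fin N → ℤ) : L.bil u (coset l ν + a) =
    L.bil u (coset l ν + a₀) + L.bil u (a - a₀) := by
  rw [← bil_add_right]; congr 1; abel

lemma eventually_close (l a₀ : Fin N → ℝ) (i : Fin d) : ∀ᶠ a in 𝓝 a₀, B.Close l a₀ i a := by
  by_cases hi : B.β i ^ 2 = 1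
  · obtain ⟨δ, hδ, hd⟩ := B.exists_discrete (l := l) hi a₀
    have hc : Continuous fun a : Fin N → ℝ => L.bil (B.dir i) (a - a₀) := by
      unfold bil; fun_prop
    have h0 : L.bil (B.dir i) (a₀ - a₀) = 0 := by rw [sub_self, bil_zero_right]
    have := (hc.tendsto a₀).eventually (Metric.ball_mem_nhds _ hδ)
    filter_upwards [this] with a ha _ ν hν
    rw [h0, dist_zero_right, Real.norm_eq_abs, abs_lt] at ha
    have h1 := hd ν hν
    rw [bil_coset_add _ l a₀ a]
    rcases lt_or_gt_of_ne hν with h | h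
    · rw [abs_of_neg h] at h1
      rw [Real.sign_of_neg h, Real.sign_of_neg (by linarith)]
    · rw [abs_of_pos h] at h1
      rw [Real.sign_of_pos h, Real.sign_of_pos (by linarith)]
  · exact Eventually.of_forall fun a h => absurd h hi

variable {B B'}

lemma Close.eq_of_onWall (h : B.Close l a₀ i a) (ha : B.OnWall a l i) :
    L.bil (B.dir i) a = L.bil (B.dir i) a₀ ∧ B.OnWall a₀ l i := by
  obtain ⟨hi, ν, hν⟩ := ha
  have h1 : L.bil (B.dir i) (coset l ν + a₀) = 0 := by
    by_contra h2
    have h3 := h hi ν h2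
    rw [hν, Real.sign_zero, eq_comm, Real.sign_eq_zero_iff] at h3
    exact h2 h3
  refine ⟨?_, hi, ν, h1⟩
  rw [bil_add_right] at h1 hν
  linarith

lemma Close.hfac_eq (h : B.Close l a₀ i a) (ha : B.OnWall a l i) (P : Jac[N]) :
    B.hfac a l i P = B.hfac a₀ l i P := by
  obtain ⟨h1, h2⟩ := h.eq_of_onWall ha
  rw [hfac, hfac, if_pos ha, if_pos h2, h1]

lemma hfac_of_not_onWall (h : ¬ B.OnWall a l i) (P : Jac[N]) : B.hfac a l i P = 1 := by
  rw [hfac, if_neg h]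

lemma Close.hfac_ne_zero (h : B.Close l a₀ i a) {P : Jac[N]}
    (h0 : B.hfac a₀ l i P ≠ 0) : B.hfac a l i P ≠ 0 := by
  by_cases ha : B.OnWall a l i
  · rwa [h.hfac_eq ha]
  · rw [hfac_of_not_onWall ha]; exact one_ne_zero

lemma Controlled.mfac {A A' : Fin N → ℝ} {S : Set (Jac[N] × Jac[N])}
    (hS : ∀ p ∈ S, 0 < p.1.1.im) {C C' : ℝ} (hC : 0 ≤ C) (hC' : 0 ≤ C')
    (hb : ∀ p ∈ S, ‖B.hfac A l i p.1‖ ≤ C * exp (C * (π * p.1.1.im)))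
    (hb' : ∀ p ∈ S, ‖B'.hfac A' l i p.1‖ ≤ C' * exp (C' * (π * p.1.1.im)))
    (h : Controlled F l i S fun p ν => B.kfac A l i ν p)
    (h' : Controlled F l i S fun p ν => B'.kfac A' l i ν p) :
    Controlled F l i S fun p ν => mfac B B' A A' l i ν p :=
  (h.mul_left hS hC' fun p hp _ => hb' p hp).sub hS (h'.mul_left hS hC fun p hp _ => hb p hp)

lemma mfac_controlled (B B' : Side F) (l a₀ : Fin N → ℝ) (i : Fin d) : ∃ ε > 0, ∀ T₁ > 0,
    Controlled F l i (nearSet T₁ a₀ ε) fun p ν => mfac B B' a₀ a₀ l i ν p := by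
  obtain ⟨ε, hε, h⟩ := B.kern_controlled (l := l) (i := i) a₀
  obtain ⟨ε', hε', h'⟩ := B'.kern_controlled (l := l) (i := i) a₀
  refine ⟨min ε ε', lt_min hε hε', fun T₁ hT₁ => ?_⟩
  obtain ⟨C, hC, hb⟩ := B.hfac_bound (l := l) (i := i) a₀ T₁ (ε := min ε ε')
  obtain ⟨C', hC', hb'⟩ := B'.hfac_bound (l := l) (i := i) a₀ T₁ (ε := min ε ε')
  exact Controlled.mfac (fun p hp => hp.1) hC hC' hb hb'
    ((h T₁ hT₁).mono (nearSet_mono (min_le_left _ _)))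
    ((h' T₁ hT₁).mono (nearSet_mono (min_le_right _ _)))

/-- The frozen theta series converges normally, and grows at most exponentially. -/
theorem term_bound (B B' : Side F) (l a₀ : Fin N → ℝ) : ∃ ε > 0, ∀ T₁ > 0, ∃ κ > 0, ∃ C, 0 ≤ C ∧
    ∀ p ∈ nearSet T₁ a₀ ε, ∀ ν, ‖term B B' (fun _ => a₀) (fun _ => a₀) l ν p‖ ≤
      C * exp (C * p.1.1.im) * exp (-(κ * ‖fun k => (ν k : ℝ)‖)) := by
  choose ε hε h using mfac_controlled B B' l a₀
  obtain ⟨ε₀, hε₀, hle⟩ := exists_pos_le_of_finite hε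
  refine ⟨ε₀, hε₀, fun T₁ hT₁ => ?_⟩
  refine Controlled.prod_bound (R := ‖a₀‖ + ε₀) hT₁ (fun p hp => ⟨hp.1, hp.2.1, ?_⟩)
    fun i => (h i T₁ hT₁).mono (nearSet_mono (hle i))
  have h1 : vy p.1 = a₀ + (vy p.1 - a₀) := by abel
  rw [h1]
  exact (norm_add_le _ _).trans (by linarith [hp.2.2.1])

/-! ### Real points -/

lemma aC_star (p : Jac[N]) : aC p (star p) = toC (vy p) := by
  funext k
  have h1 : p.2 k - star (p.2 k) = 2 * 𝕚 * ((p.2 k).im : ℂ) := by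
    rw [Complex.star_def, Complex.sub_conj]; push_cast; ring
  have h2 : p.1 - star p.1 = 2 * 𝕚 * (p.1.im : ℂ) := by
    rw [Complex.star_def, Complex.sub_conj]; push_cast; ring
  simp only [aC, toC, vy, Prod.fst_star, Prod.snd_star, Pi.star_apply, h1, h2]
  rw [mul_div_mul_left _ _ (by simp)]
  push_cast; rfl

lemma yC_star {p : Jac[N]} (hp : 0 < p.1.im) :
    yC p (star p) = (sqrt (π * p.1.im) : ℝ) := by
  have h2 : p.1 - star p.1 = 2 * 𝕚 * (p.1.im : ℂ) := by
    rw [Complex.star_def, Complex.sub_conj]; push_cast; ring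
  rw [yC, Prod.fst_star, h2, mul_div_cancel_left₀ _ (by simp), Real.sqrt_eq_rpow,
    Complex.ofReal_cpow (by positivity)]
  push_cast; rfl

lemma mem_nearSet_star {p : Jac[N]} (hp : 0 < p.1.im) {T₁ ε : ℝ}
    (hT : T₁ ≤ π * p.1.im) (ha : ‖vy p - a₀‖ ≤ ε) : (p, star p) ∈ nearSet T₁ a₀ ε := by
  refine ⟨hp, hT, ha, ?_, ?_⟩
  · rw [aC_star, sub_self, norm_zero]; exact (norm_nonneg _).trans ha
  · rw [yC_star hp, sub_self, norm_zero]; positivity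

lemma continuousAt_vy {p : Jac[N]} (hp : 0 < p.1.im) : ContinuousAt vy p := by
  refine continuousAt_pi.2 fun k => ?_
  exact ContinuousAt.div (by fun_prop) (by fun_prop) hp.ne'

lemma sub_fst_star_ne_zero {p : Jac[N]} (hp : 0 < p.1.im) : p.1 - (star p).1 ≠ 0 := by
  intro h
  have := congrArg Complex.im h
  simp at this
  exact hp.ne' this

lemma contDiffAt_aC {p : Jac[N] × Jac[N]} (hp : p.1.1 - p.2.1 ≠ 0) {n : WithTop ℕ∞} :
    ContDiffAt ℂ n (fun p : Jac[N] × Jac[N] => aC p.1 p.2) p := by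
  refine contDiffAt_pi.2 fun k => ?_
  unfold aC
  refine ContDiffAt.div ?_ ?_ hp
  · exact ContDiffAt.sub (contDiffAt_pi.1 (contDiffAt_fst.snd) k)
      (contDiffAt_pi.1 (contDiffAt_snd.snd) k)
  · fun_prop

lemma contDiffAt_yC {p : Jac[N] × Jac[N]}
    (hp : π * ((p.1.1 - p.2.1) / (2 * 𝕚)) ∈ Complex.slitPlane) {n : WithTop ℕ∞} :
    ContDiffAt ℂ n (fun p : Jac[N] × Jac[N] => yC p.1 p.2) p := by
  unfold yC
  have h1 : AnalyticAt ℂ (fun z : ℂ => z ^ (1 / 2 : ℂ))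
      (π * ((p.1.1 - p.2.1) / (2 * 𝕚))) :=
    analyticAt_id.cpow analyticAt_const hp
  have h2 : ContDiff ℂ n fun p : Jac[N] × Jac[N] =>
      (π * ((p.1.1 - p.2.1) / (2 * 𝕚)) : ℂ) := by fun_prop
  exact ContDiffAt.comp (g := fun z : ℂ => z ^ (1 / 2 : ℂ)) p h1.contDiffAt h2.contDiffAt

lemma contDiff_bil (u : Fin N → ℂ) {n : WithTop ℕ∞} : ContDiff ℂ n fun z : Fin N → ℂ => L.bil u z :=
  (L.bilin u).toContinuousLinearMap.contDiff

lemma contDiff_qexp (x : Fin N → ℝ) {n : WithTop ℕ∞} : ContDiff ℂ n (qexp L x) := by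
  unfold qexp
  exact contDiff_ee.comp ((contDiff_const.mul contDiff_fst).add ((contDiff_bil _).comp contDiff_snd))

lemma contDiff_hfac (B : Side F) (a₀ l : Fin N → ℝ) (i : Fin d) {n : WithTop ℕ∞} :
    ContDiff ℂ n (B.hfac a₀ l i) := by
  unfold hfac
  split_ifs
  · exact contDiff_const.sub (contDiff_ee.comp (contDiff_const.mul
      (((contDiff_bil _).comp contDiff_snd).sub (contDiff_const.mul contDiff_fst))))
  · exact contDiff_const

lemma contDiffAt_kfac (B : Side F) (a₀ l : Fin N → ℝ) (i : Fin d) (ν : Fin N → ℤ)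
    {p : Jac[N] × Jac[N]} (hp : p.1.1 - p.2.1 ≠ 0)
    (hp' : π * ((p.1.1 - p.2.1) / (2 * 𝕚)) ∈ Complex.slitPlane) {n : WithTop ℕ∞} :
    ContDiffAt ℂ n (B.kfac a₀ l i ν) p := by
  have hY := contDiffAt_yC (n := n) hp'
  have hX : ∀ u : Fin N → ℂ, ContDiffAt ℂ n (fun p : Jac[N] × Jac[N] =>
      L.bil u (toC (coset l ν) + aC p.1 p.2)) p := fun u =>
    (contDiff_bil u).contDiffAt.comp p (contDiffAt_const.add (contDiffAt_aC hp))
  have hh : ContDiffAt ℂ n (fun p : Jac[N] × Jac[N] =>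
      B.hfac a₀ l i p.1) p := ((contDiff_hfac B a₀ l i).comp contDiff_fst).contDiffAt
  have hE : ∀ {f : Jac[N] × Jac[N] → ℂ}, ContDiffAt ℂ n f p →
      ContDiffAt ℂ n (fun p => cerf (f p)) p := fun hf => contDiff_cerf.contDiffAt.comp p hf
  unfold kfac kern
  split_ifs
  · exact (hE (hY.mul ((hX _).add contDiffAt_const))).sub (hE (hY.mul (hX _)))
  · exact hh.mul (contDiffAt_const.sub (hE (hY.mul (hX _))))
  · exact (hE (hY.mul ((hX _).div_const _))).sub (hE (hY.mul (hX _)))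

lemma contDiffAt_term (B B' : Side F) (A A' : Fin d → Fin N → ℝ) (l : Fin N → ℝ) (ν : Fin N → ℤ)
    {p : Jac[N] × Jac[N]} (hp : p.1.1 - p.2.1 ≠ 0)
    (hp' : π * ((p.1.1 - p.2.1) / (2 * 𝕚)) ∈ Complex.slitPlane) {n : WithTop ℕ∞} :
    ContDiffAt ℂ n (term B B' A A' l ν) p := by
  have hh : ∀ (B : Side F) (a₀ : Fin N → ℝ) i, ContDiffAt ℂ n
      (fun p : Jac[N] × Jac[N] => B.hfac a₀ l i p.1) p :=
    fun B a₀ i => ((contDiff_hfac B a₀ l i).comp contDiff_fst).contDiffAt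
  unfold term mfac
  refine ContDiffAt.mul (contDiffAt_prod fun i _ => ?_)
    ((contDiff_qexp _).comp contDiff_fst).contDiffAt
  exact ((hh _ _ _).mul (contDiffAt_kfac B _ l i ν hp hp')).sub
    ((hh _ _ _).mul (contDiffAt_kfac B' _ l i ν hp hp'))

/-- The frozen theta series is a normally convergent series of real-analytic functions. -/
theorem sumFamily_term (B B' : Side F) (l : Fin N → ℝ) {p₀ : Jac[N]} (h0 : 0 < p₀.1.im) :
    SumFamily (fun ν p => term B B' (fun _ => vy p₀) (fun _ => vy p₀) l ν (p, star p)) p₀ := by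
  obtain ⟨ε, hε, h⟩ := term_bound B B' l (vy p₀)
  obtain ⟨κ, hκ, C, hC, hb⟩ := h (π * (p₀.1.im / 2)) (by positivity)
  set q₀ : Jac[N] × Jac[N] := (p₀, star p₀) with hq₀
  have hne : q₀.1.1 - q₀.2.1 ≠ 0 := sub_fst_star_ne_zero h0
  have hbase : (π * ((q₀.1.1 - q₀.2.1) / (2 * 𝕚)) : ℂ) = (π * p₀.1.im : ℝ) := by
    have h2 : p₀.1 - star p₀.1 = 2 * 𝕚 * (p₀.1.im : ℂ) := by
      rw [Complex.star_def, Complex.sub_conj]; push_cast; ring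
    simp only [hq₀, Prod.fst_star, h2]
    rw [mul_div_cancel_left₀ _ (by simp)]; push_cast; rfl
  have hslit : (π * ((q₀.1.1 - q₀.2.1) / (2 * 𝕚)) : ℂ) ∈ Complex.slitPlane := by
    rw [hbase, Complex.ofReal_mem_slitPlane]; positivity
  have c1 : Continuous fun q : Jac[N] × Jac[N] => q.1.1 - q.2.1 := by fun_prop
  have c2 : Continuous fun q : Jac[N] × Jac[N] =>
      (π * ((q.1.1 - q.2.1) / (2 * 𝕚)) : ℂ) := by fun_prop
  have c3 : Continuous fun q : Jac[N] × Jac[N] => q.1.1.im := by fun_prop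
  have c4 : ContinuousAt (fun q : Jac[N] × Jac[N] => vy q.1) q₀ :=
    ContinuousAt.comp (f := Prod.fst) (g := vy) (continuousAt_vy h0) continuousAt_fst
  have c5 : ContinuousAt (fun q : Jac[N] × Jac[N] =>
      aC q.1 q.2 - toC (vy q.1)) q₀ := by
    have : Continuous (toC : (Fin N → ℝ) → Fin N → ℂ) := by unfold toC; fun_prop
    exact (contDiffAt_aC (n := 0) hne).continuousAt.sub
      (ContinuousAt.comp (g := toC) this.continuousAt c4)
  have c6 : ContinuousAt (fun q : Jac[N] × Jac[N] =>
      ‖yC q.1 q.2 - (sqrt (π * q.1.1.im) : ℝ)‖ - sqrt (π * q.1.1.im) / 100) q₀ :=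
    (((contDiffAt_yC (n := 0) hslit).continuousAt.sub (by fun_prop)).norm).sub (by fun_prop)
  have hev : ∀ᶠ q in 𝓝 q₀, (q.1.1 - q.2.1 ≠ 0 ∧
      (π * ((q.1.1 - q.2.1) / (2 * 𝕚)) : ℂ) ∈ Complex.slitPlane) ∧
      q.1.1.im < p₀.1.im + 1 ∧ q ∈ nearSet (π * (p₀.1.im / 2)) (vy p₀) ε := by
    filter_upwards [c1.continuousAt.eventually_ne hne,
      c2.continuousAt.eventually (Complex.isOpen_slitPlane.mem_nhds hslit),
      c3.continuousAt.eventually (gt_mem_nhds (show q₀.1.1.im < p₀.1.im + 1 by simp [hq₀])),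
      c3.continuousAt.eventually (lt_mem_nhds (show p₀.1.im / 2 < q₀.1.1.im by simp [hq₀]; linarith)),
      c4.eventually (Metric.closedBall_mem_nhds _ hε),
      c5.eventually (Metric.closedBall_mem_nhds _ hε),
      c6.eventually (gt_mem_nhds (show _ < (0 : ℝ) by
        simp only [hq₀]
        rw [yC_star h0, sub_self, norm_zero, zero_sub, neg_lt_zero]
        have := Real.sqrt_pos.2 (mul_pos Real.pi_pos h0)
        positivity))] with q h1 h2 h3 h4 h5 h6 h7
    refine ⟨⟨h1, h2⟩, h3, by linarith [half_pos h0], by gcongr, ?_, ?_, by linarith⟩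
    · simpa [dist_eq_norm, hq₀] using h5
    · simp only [hq₀, aC_star, sub_self] at h6
      simpa [dist_eq_norm] using h6
  obtain ⟨r, hr, hball⟩ := Metric.eventually_nhds_iff_ball.1 hev
  refine ⟨term B B' (fun _ => vy p₀) (fun _ => vy p₀) l,
    ⟨fun ν => C * exp (C * (p₀.1.im + 1)) * exp (-(κ * ‖fun k => (ν k : ℝ)‖)), r,
      (summable_exp_neg_norm hκ).mul_left _, hr, fun ν q hq => ?_, fun ν q hq => ?_⟩,
    Eventually.of_forall fun p ν => rfl⟩
  · exact (contDiffAt_term B B' _ _ l ν (hball q hq).1.1 (hball q hq).1.2).contDiffWithinAt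
  · refine (hb q (hball q hq).2.2 ν).trans ?_
    have h1 : C * q.1.1.im ≤ C * (p₀.1.im + 1) := mul_le_mul_of_nonneg_left (hball q hq).2.1.le hC
    exact mul_le_mul_of_nonneg_right (mul_le_mul_of_nonneg_left (Real.exp_le_exp.2 h1) hC)
      (Real.exp_pos _).le

end Side

/-! ### Crossing the walls -/

variable {N : ℕ} {L : EvenLattice N} {d m : ℕ} {F : L.AdaptedFrame d m} {l a₀ a : Fin N → ℝ}
  {i : Fin d}

lemma Controlled.summable {p : Jac[N]} (hp : 0 < p.1.im)
    {k : Fin d → Jac[N] × Jac[N] → (Fin N → ℤ) → ℂ}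
    (hk : ∀ i, Controlled F l i {(p, star p)} (k i)) :
    Summable fun ν => (∏ i, k i (p, star p) ν) * qexp L (coset l ν) p := by
  obtain ⟨κ, hκ, C, hC, h⟩ := Controlled.prod_bound (S := {(p, star p)}) (T₁ := π * p.1.im)
    (R := ‖vy p‖) (by positivity) (by rintro _ rfl; exact ⟨hp, le_rfl, le_rfl⟩) hk
  exact Summable.of_norm_bounded ((summable_exp_neg_norm hκ).mul_left _) fun ν => h _ rfl ν

lemma coset_sub (l : Fin N → ℝ) (ν c : Fin N → ℤ) :
    coset l (ν - c) = coset l ν - fun k => (c k : ℝ) := by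
  funext k; simp [coset]; ring

lemma qexp_sub {x c : Fin N → ℝ} (hc : L.quad c = 0) (P : Jac[N]) :
    qexp L (x - c) P = qexp L x P * ee (-((L.bil x c : ℝ) * P.1 + L.bil (toC c) P.2)) := by
  rw [qexp, qexp, ← ee_add]
  congr 1
  have h1 : L.quad (x - c) = L.quad x - L.bil x c := by
    have h2 : L.quad (-c) = 0 := by
      have := L.quad_smul (-1 : ℝ) c
      rw [neg_one_smul, hc, mul_zero] at this; exact this
    rw [sub_eq_add_neg, quad_add, h2, bil_neg_right]; ring
  have h3 : toC (x - c) = toC x - toC c := by funext k; simp [toC]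
  rw [h1, h3, bil_sub_left]
  push_cast; ring

namespace Side

variable (B B' : Side F)

lemma bil_dir_dir (i : Fin d) : L.bil (B.dir i) (B.dir i) = 2 * (B.β i ^ 2 - 1) := by
  have h1 := F.nn i i
  have h2 := F.gg i i
  have h3 := F.ng i i
  simp only [if_true] at h1 h2
  simp only [dir, bil_add_left, bil_add_right, bil_smul_left, bil_smul_right, h1, h2, h3,
    L.bil_comm (F.g i) (F.n i)]
  ring

lemma bil_n_dir (i j : Fin d) : L.bil (F.n i) (B.dir j) = if i = j then -2 else 0 := by
  rw [dir, bil_add_right, bil_smul_right, F.nn, F.ng]; simp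

lemma bil_dir_dir_of_ne {i j : Fin d} (h : i ≠ j) : L.bil (B.dir i) (B'.dir j) = 0 := by
  simp only [dir, bil_add_left, bil_add_right, bil_smul_left, bil_smul_right, F.nn, F.gg, F.ng,
    L.bil_comm (F.g i) (F.n j), if_neg h]
  ring

variable {B B'}

lemma kfac_sub (a₀ : Fin N → ℝ) (ν c : Fin N → ℤ) (p : Jac[N] × Jac[N])
    (hn : L.bil (F.n i) (fun k => (c k : ℝ)) = 0)
    (hd : L.bil (B.dir i) (fun k => (c k : ℝ)) = 0) :
    B.kfac a₀ l i (ν - c) p = B.kfac a₀ l i ν p := by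
  have h1 : ∀ {u : Fin N → ℝ} (x : Fin N → ℂ), L.bil u (fun k => (c k : ℝ)) = 0 →
      L.bil (toC u) (toC (coset l (ν - c)) + x) = L.bil (toC u) (toC (coset l ν) + x) := by
    intro u x hu
    rw [bil_add_right, bil_add_right, bil_toC, bil_toC, coset_sub, bil_sub_right, hu, sub_zero]
  have h2 : L.bil (B.dir i) (coset l (ν - c) + a₀) = L.bil (B.dir i) (coset l ν + a₀) := by
    rw [bil_add_right, bil_add_right, coset_sub, bil_sub_right, hd, sub_zero]
  rw [kfac, kfac, kern, kern, h1 _ hn, h1 _ hd, h2]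

lemma mfac_sub (a₀ a₀' : Fin N → ℝ) (ν c : Fin N → ℤ) (p : Jac[N] × Jac[N])
    (hn : L.bil (F.n i) (fun k => (c k : ℝ)) = 0)
    (hd : L.bil (B.dir i) (fun k => (c k : ℝ)) = 0)
    (hd' : L.bil (B'.dir i) (fun k => (c k : ℝ)) = 0) :
    mfac B B' a₀ a₀' l i (ν - c) p = mfac B B' a₀ a₀' l i ν p := by
  rw [mfac, mfac, kfac_sub _ _ _ _ hn hd, kfac_sub _ _ _ _ hn hd']

lemma not_onWall_iff (hi : B.β i ^ 2 = 1) :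
    ¬ B.OnWall a l i ↔ ∀ ν, L.bil (B.dir i) (coset l ν + a) ≠ 0 := by
  rw [OnWall]; push Not
  exact ⟨fun h => h hi, fun h _ => h⟩

/-- Unless a wall is left, freezing the signs does not change the kernel. -/
lemma Close.kfac_eq (h : B.Close l a₀ i a) (hw : B.OnWall a₀ l i → B.OnWall a l i)
    (ν : Fin N → ℤ) (p : Jac[N] × Jac[N]) :
    B.hfac a l i p.1 = B.hfac a₀ l i p.1 ∧ B.kfac a l i ν p = B.kfac a₀ l i ν p := by
  by_cases hi : B.β i ^ 2 = 1
  · have h1 : B.hfac a l i p.1 = B.hfac a₀ l i p.1 := by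
      by_cases ha : B.OnWall a l i
      · exact h.hfac_eq ha p.1
      · rw [hfac_of_not_onWall ha, hfac_of_not_onWall (fun h0 => ha (hw h0))]
    refine ⟨h1, ?_⟩
    have h2 : L.bil (B.dir i) (coset l ν + a₀) = 0 ↔ L.bil (B.dir i) (coset l ν + a) = 0 := by
      constructor
      · intro h0
        have h3 := (h.eq_of_onWall (hw ⟨hi, ν, h0⟩)).1
        rw [bil_add_right] at h0 ⊢
        rw [h3, h0]
      · intro h0
        by_contra h3
        have := h hi ν h3
        rw [h0, Real.sign_zero, eq_comm, Real.sign_eq_zero_iff] at this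
        exact h3 this
    rw [kfac, kfac, kern, kern, h1]
    by_cases h3 : L.bil (B.dir i) (coset l ν + a₀) = 0
    · simp only [if_pos hi, if_pos h3, if_pos (h2.1 h3)]
    · simp only [if_pos hi, if_neg h3, if_neg (mt h2.2 h3), h hi ν h3]
  · have h1 : ∀ a : Fin N → ℝ, ¬ B.OnWall a l i := fun a h => hi h.1
    rw [kfac, kfac, kern, kern, if_neg hi, if_neg hi, hfac_of_not_onWall (h1 a),
      hfac_of_not_onWall (h1 a₀)]
    exact ⟨rfl, rfl⟩

/-- The defect that arises when a wall is left is a difference along the isotropic vector. -/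
lemma Close.defect (h : B.Close l a₀ i a) (h0 : B.OnWall a₀ l i) (ha : ¬ B.OnWall a l i)
    {c : Fin N → ℤ} (hc : (fun k => (c k : ℝ)) = B.κ i • B.dir i) (ν : Fin N → ℤ)
    (p : Jac[N] × Jac[N]) :
    (B.hfac a₀ l i p.1 * B.kfac a l i ν p - B.hfac a l i p.1 * B.kfac a₀ l i ν p) *
        qexp L (coset l ν) p.1 =
      ee (B.κ i * (L.bil (toC (B.dir i)) p.1.2 - (L.bil (B.dir i) a₀ : ℝ) * p.1.1)) *
        (Set.indicator {ν | L.bil (B.dir i) (coset l ν + a₀) = 0}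
            (fun ν => B.kfac a l i ν p * qexp L (coset l ν) p.1) (ν - c) -
          Set.indicator {ν | L.bil (B.dir i) (coset l ν + a₀) = 0}
            (fun ν => B.kfac a l i ν p * qexp L (coset l ν) p.1) ν) := by
  have hi := h0.1
  have ha' := (not_onWall_iff hi).1 ha
  have hdc : L.bil (B.dir i) (fun k => (c k : ℝ)) = 0 := by
    rw [hc, bil_smul_right, bil_dir_dir, hi, sub_self, mul_zero, mul_zero]
  have hs : ∀ a : Fin N → ℝ, L.bil (B.dir i) (coset l (ν - c) + a) =
      L.bil (B.dir i) (coset l ν + a) := by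
    intro a
    rw [bil_add_right, bil_add_right, coset_sub, bil_sub_right, hdc, sub_zero]
  set w := ee (B.κ i * (L.bil (toC (B.dir i)) p.1.2 - (L.bil (B.dir i) a₀ : ℝ) * p.1.1)) with hw
  have hk : ∀ ν, B.kfac a l i ν p = (Real.sign (L.bil (B.dir i) (coset l ν + a)) : ℝ) -
      cerf (yC p.1 p.2 * L.bil (toC (F.n i)) (toC (coset l ν) + aC p.1 p.2)) := by
    intro ν
    rw [kfac, kern, if_pos hi, if_neg (ha' ν), hfac_of_not_onWall ha, one_mul]
  have hh : B.hfac a₀ l i p.1 = 1 - w := by rw [hfac, if_pos h0]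
  by_cases hν : L.bil (B.dir i) (coset l ν + a₀) = 0
  · have m1 : ν ∈ {ν | L.bil (B.dir i) (coset l ν + a₀) = 0} := hν
    have m2 : ν - c ∈ {ν | L.bil (B.dir i) (coset l ν + a₀) = 0} := by
      change _ = _
      rw [hs, hν]
    have hq : qexp L (coset l (ν - c)) p.1 = qexp L (coset l ν) p.1 * w⁻¹ := by
      have h1 : L.quad (fun k => (c k : ℝ)) = 0 := by
        rw [quad, hc, bil_smul_left, bil_smul_right, bil_dir_dir, hi]; simp
      have h2 : L.bil (coset l ν) (B.dir i) = -L.bil (B.dir i) a₀ := by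
        rw [bil_add_right] at hν
        rw [bil_comm]; linarith
      rw [coset_sub, qexp_sub h1, hw, ← ee_neg, hc, bil_smul_right, h2, toC_smul, bil_smul_left]
      congr 2
      push_cast; ring
    have hξ : L.bil (toC (F.n i)) (toC (coset l (ν - c)) + aC p.1 p.2) =
        L.bil (toC (F.n i)) (toC (coset l ν) + aC p.1 p.2) + (2 * B.κ i : ℝ) := by
      rw [bil_add_right, bil_add_right, bil_toC, bil_toC, coset_sub, bil_sub_right, hc,
        bil_smul_right, bil_n_dir, if_pos rfl]
      push_cast; ring
    rw [Set.indicator_of_mem m1, Set.indicator_of_mem m2, hk, hk, hs, hξ, hq, hh,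
      hfac_of_not_onWall ha, kfac, kern, if_pos hi, if_pos hν]
    have hw0 : w ≠ 0 := ee_ne_zero _
    field_simp
    ring
  · have m1 : ν ∉ {ν | L.bil (B.dir i) (coset l ν + a₀) = 0} := hν
    have m2 : ν - c ∉ {ν | L.bil (B.dir i) (coset l ν + a₀) = 0} := by
      change ¬ _ = _
      rwa [hs]
    rw [Set.indicator_of_notMem m1, Set.indicator_of_notMem m2, hk, hfac_of_not_onWall ha,
      h hi ν hν, kfac, kern, if_pos hi, if_neg hν]
    ring

lemma controlled_mfac_point {p : Jac[N]} (hp : 0 < p.1.im) {A A' : Fin N → ℝ}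
    (h : Controlled F l i {(p, star p)} fun p ν => B.kfac A l i ν p)
    (h' : Controlled F l i {(p, star p)} fun p ν => B'.kfac A' l i ν p) :
    Controlled F l i {(p, star p)} fun p ν => mfac B B' A A' l i ν p := by
  have hb : ∀ z : ℂ, ‖z‖ ≤ ‖z‖ * exp (‖z‖ * (π * p.1.im)) := fun z =>
    le_mul_of_one_le_right (norm_nonneg _) (Real.one_le_exp (by positivity))
  exact Controlled.mfac (by rintro _ rfl; exact hp) (norm_nonneg (B.hfac A l i p))
    (norm_nonneg (B'.hfac A' l i p)) (by rintro _ rfl; exact hb _) (by rintro _ rfl; exact hb _)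
    h h'

lemma summable_term {p : Jac[N]} (hp : 0 < p.1.im) {A A' : Fin d → Fin N → ℝ}
    (h : ∀ i, Controlled F l i {(p, star p)} fun p ν => B.kfac (A i) l i ν p)
    (h' : ∀ i, Controlled F l i {(p, star p)} fun p ν => B'.kfac (A' i) l i ν p) :
    Summable fun ν => term B B' A A' l ν (p, star p) :=
  Controlled.summable hp (k := fun i p ν => mfac B B' (A i) (A' i) l i ν p)
    fun i => controlled_mfac_point hp (h i) (h' i)

/-- Summation by parts: the frozen theta series does not depend on where the signs are frozen. -/
lemma tsum_step {p : Jac[N]} (hp : 0 < p.1.im) {A A' : Fin d → Fin N → ℝ} (j : Fin d)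
    (hc : B.Close l a₀ j (A j))
    (h : ∀ i, Controlled F l i {(p, star p)} fun p ν => B.kfac (A i) l i ν p)
    (h₀ : Controlled F l j {(p, star p)} fun p ν => B.kfac a₀ l j ν p)
    (h' : ∀ i, Controlled F l i {(p, star p)} fun p ν => B'.kfac (A' i) l i ν p) :
    B.hfac a₀ l j p * ∑' ν, term B B' A A' l ν (p, star p) =
      B.hfac (A j) l j p * ∑' ν, term B B' (Function.update A j a₀) A' l ν (p, star p) := by
  have hu : ∀ i, Controlled F l i {(p, star p)} fun p ν =>
      B.kfac (Function.update A j a₀ i) l i ν p := by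
    intro i
    by_cases hij : i = j
    · subst hij; rwa [Function.update_self]
    · rw [Function.update_of_ne hij]; exact h i
  have hs₁ := summable_term hp h h'
  have hs₂ := summable_term hp hu h'
  set G : (Fin N → ℤ) → ℂ := fun ν => B'.hfac (A' j) l j p *
    ∏ i ∈ Finset.univ.erase j, mfac B B' (A i) (A' i) l i ν (p, star p) with hG
  have hD : ∀ ν, B.hfac a₀ l j p * term B B' A A' l ν (p, star p) -
      B.hfac (A j) l j p * term B B' (Function.update A j a₀) A' l ν (p, star p) =
      G ν * ((B.hfac a₀ l j p * B.kfac (A j) l j ν (p, star p) -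
        B.hfac (A j) l j p * B.kfac a₀ l j ν (p, star p)) * qexp L (coset l ν) p) := by
    intro ν
    have e : ∏ i ∈ Finset.univ.erase j, mfac B B' (Function.update A j a₀ i) (A' i) l i ν
        (p, star p) = ∏ i ∈ Finset.univ.erase j, mfac B B' (A i) (A' i) l i ν (p, star p) :=
      prod_congr rfl fun i hi => by rw [Function.update_of_ne (Finset.ne_of_mem_erase hi)]
    rw [term, term, ← Finset.mul_prod_erase _ _ (Finset.mem_univ j),
      ← Finset.mul_prod_erase _ _ (Finset.mem_univ j), e, Function.update_self, hG]
    simp only [mfac]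
    ring
  suffices key : ∑' ν, G ν * ((B.hfac a₀ l j p * B.kfac (A j) l j ν (p, star p) -
      B.hfac (A j) l j p * B.kfac a₀ l j ν (p, star p)) * qexp L (coset l ν) p) = 0 by
    rw [← sub_eq_zero, ← tsum_mul_left, ← tsum_mul_left,
      ← (hs₁.mul_left _).tsum_sub (hs₂.mul_left _), ← key]
    exact tsum_congr hD
  by_cases hw : B.OnWall a₀ l j → B.OnWall (A j) l j
  · have : ∀ ν, B.hfac a₀ l j p * B.kfac (A j) l j ν (p, star p) -
        B.hfac (A j) l j p * B.kfac a₀ l j ν (p, star p) = 0 := by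
      intro ν
      obtain ⟨e1, e2⟩ := hc.kfac_eq hw ν (p, star p)
      rw [e2, e1, sub_self]
    simp [this]
  · push Not at hw
    obtain ⟨c, hcc⟩ := B.integral j hw.1.1
    have hc' : (fun k => (c k : ℝ)) = B.κ j • B.dir j := by
      funext k; rw [← hcc]; simp [dir]
    have hGc : ∀ ν, G (ν - c) = G ν := by
      intro ν
      simp only [hG]
      congr 1
      refine prod_congr rfl fun i hi => mfac_sub _ _ _ _ _ ?_ ?_ ?_ <;>
        rw [hc', bil_smul_right]
      · rw [bil_n_dir, if_neg (Finset.ne_of_mem_erase hi), mul_zero]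
      · rw [bil_dir_dir_of_ne _ _ (Finset.ne_of_mem_erase hi), mul_zero]
      · rw [bil_dir_dir_of_ne _ _ (Finset.ne_of_mem_erase hi), mul_zero]
    set U : (Fin N → ℤ) → ℂ := Set.indicator {ν | L.bil (B.dir j) (coset l ν + a₀) = 0}
      (fun ν => G ν * (B.kfac (A j) l j ν (p, star p) * qexp L (coset l ν) p)) with hU
    have hUs : Summable U := by
      refine Summable.indicator ?_ _
      have := (Controlled.summable hp (k := fun i => if i = j then fun p ν => B.kfac (A j) l j ν p
        else fun p ν => mfac B B' (A i) (A' i) l i ν p) (l := l) (F := F) (fun i => by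
          by_cases hij : i = j
          · subst hij; rw [if_pos rfl]; exact h i
          · rw [if_neg hij]; exact controlled_mfac_point hp (h i) (h' i))).mul_left
        (B'.hfac (A' j) l j p)
      refine this.congr fun ν => ?_
      rw [← Finset.mul_prod_erase _ _ (Finset.mem_univ j), if_pos rfl, hG]
      have e : ∏ i ∈ Finset.univ.erase j, (if i = j then fun p ν => B.kfac (A j) l j ν p
          else fun p ν => mfac B B' (A i) (A' i) l i ν p) (p, star p) ν =
          ∏ i ∈ Finset.univ.erase j, mfac B B' (A i) (A' i) l i ν (p, star p) :=
        prod_congr rfl fun i hi => by rw [if_neg (Finset.ne_of_mem_erase hi)]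
      rw [e]; ring
    have hterm : ∀ ν, G ν * ((B.hfac a₀ l j p * B.kfac (A j) l j ν (p, star p) -
        B.hfac (A j) l j p * B.kfac a₀ l j ν (p, star p)) * qexp L (coset l ν) p) =
        ee (B.κ j * (L.bil (toC (B.dir j)) p.2 - (L.bil (B.dir j) a₀ : ℝ) * p.1)) *
          (U (ν - c) - U ν) := by
      intro ν
      have e := hc.defect hw.1 hw.2 hc' ν (p, star p)
      simp only at e
      rw [e, hU]
      simp only [Set.indicator_apply]
      rw [hGc]
      split_ifs <;> ring
    clear_value U
    have hshift : ∑' ν, U (ν - c) = ∑' ν, U ν := (Equiv.subRight c).tsum_eq U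
    rw [tsum_congr hterm, tsum_mul_left, Summable.tsum_sub _ hUs, hshift, sub_self, mul_zero]
    exact (Equiv.summable_iff (Equiv.subRight c)).2 hUs

end Side

/-! ### The components of the theta series and their singularities -/

variable {N : ℕ} {L : EvenLattice N} {d m : ℕ} {F : L.AdaptedFrame d m} {l a₀ a : Fin N → ℝ}
  {i : Fin d}

namespace Side

variable (B B' : Side F)

/-- The product of all factors which clear the poles at the walls through `a₀`. -/
def hprod (a₀ l : Fin N → ℝ) (P : Jac[N]) : ℂ := (∏ i, B.hfac a₀ l i P) * ∏ i, B'.hfac a₀ l i P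

/-- The theta series with signs frozen at `a₀`, cleared of its poles. -/
def frozen (a₀ l : Fin N → ℝ) (p : Jac[N]) : ℂ :=
  ∑' ν, term B B' (fun _ => a₀) (fun _ => a₀) l ν (p, star p)

/-- The component of the theta series at the coset `l + ℤ^N`. -/
def phi (l : Fin N → ℝ) (p : Jac[N]) : ℂ := frozen B B' (vy p) l p / hprod B B' (vy p) l p

lemma kfac_controlled_point (l a₀ : Fin N → ℝ) (i : Fin d) : ∃ ε > 0, ∀ p : Jac[N],
    0 < p.1.im → ‖vy p - a₀‖ ≤ ε → Controlled F l i {(p, star p)} fun p ν => B.kfac a₀ l i ν p := by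
  obtain ⟨ε, hε, h⟩ := B.kern_controlled (l := l) (i := i) a₀
  refine ⟨ε, hε, fun p hp ha => (h (π * p.1.im) (by positivity)).mono ?_⟩
  rw [Set.singleton_subset_iff]
  exact mem_nearSet_star hp le_rfl ha

lemma kfac_controlled_self (l : Fin N → ℝ) (i : Fin d) {p : Jac[N]} (hp : 0 < p.1.im) :
    Controlled F l i {(p, star p)} fun q ν => B.kfac (vy p) l i ν q := by
  obtain ⟨ε, hε, h⟩ := B.kfac_controlled_point l (vy p) i
  exact h p hp (by rw [sub_self, norm_zero]; exact hε.le)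

variable {B B'}

lemma tsum_steps {p : Jac[N]} (hp : 0 < p.1.im) {A' : Fin d → Fin N → ℝ}
    (hc : ∀ i, B.Close l a₀ i (vy p))
    (h₀ : ∀ i, Controlled F l i {(p, star p)} fun p ν => B.kfac a₀ l i ν p)
    (h' : ∀ i, Controlled F l i {(p, star p)} fun p ν => B'.kfac (A' i) l i ν p)
    (s : Finset (Fin d)) :
    (∏ i ∈ s, B.hfac a₀ l i p) * ∑' ν, term B B' (fun _ => vy p) A' l ν (p, star p) =
      (∏ i ∈ s, B.hfac (vy p) l i p) *
        ∑' ν, term B B' (s.piecewise (fun _ => a₀) fun _ => vy p) A' l ν (p, star p) := by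
  induction s using Finset.induction_on with
  | empty => simp
  | insert j s hj ih =>
    have h1 := tsum_step (B := B) (B' := B') (l := l) (a₀ := a₀) (A' := A') hp
      (A := s.piecewise (fun _ => a₀) fun _ => vy p) j
      (by rw [Finset.piecewise_eq_of_notMem _ _ _ hj]; exact hc j)
      (fun i => by
        by_cases hi : i ∈ s
        · rw [Finset.piecewise_eq_of_mem _ _ _ hi]; exact h₀ i
        · rw [Finset.piecewise_eq_of_notMem _ _ _ hi]; exact B.kfac_controlled_self l i hp)
      (h₀ j) h'
    rw [Finset.piecewise_eq_of_notMem _ _ _ hj] at h1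
    rw [Finset.prod_insert hj, Finset.prod_insert hj, Finset.piecewise_insert, mul_assoc, ih,
      mul_left_comm, h1]
    ring

lemma tsum_steps_univ {p : Jac[N]} (hp : 0 < p.1.im) {A' : Fin d → Fin N → ℝ}
    (hc : ∀ i, B.Close l a₀ i (vy p))
    (h₀ : ∀ i, Controlled F l i {(p, star p)} fun p ν => B.kfac a₀ l i ν p)
    (h' : ∀ i, Controlled F l i {(p, star p)} fun p ν => B'.kfac (A' i) l i ν p) :
    (∏ i, B.hfac a₀ l i p) * ∑' ν, term B B' (fun _ => vy p) A' l ν (p, star p) =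
      (∏ i, B.hfac (vy p) l i p) * ∑' ν, term B B' (fun _ => a₀) A' l ν (p, star p) := by
  have := tsum_steps hp hc h₀ h' Finset.univ
  rwa [Finset.piecewise_univ] at this

lemma term_swap (A A' : Fin d → Fin N → ℝ) (ν : Fin N → ℤ) (p : Jac[N] × Jac[N]) :
    term B B' A A' l ν p = (-1) ^ d * term B' B A' A l ν p := by
  have h : ∀ i, mfac B B' (A i) (A' i) l i ν p = -1 * mfac B' B (A' i) (A i) l i ν p := by
    intro i; rw [mfac, mfac]; ring
  rw [term, term, prod_congr rfl fun i _ => h i, prod_mul_distrib,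
    Finset.prod_const, Finset.card_univ, Fintype.card_fin, mul_assoc]

variable (B B')

/-- Near `a₀` the component is the quotient of the frozen series by the clearing factor. -/
theorem eventually_phi_eq (l a₀ : Fin N → ℝ) : ∀ᶠ a in 𝓝 a₀, ∀ p : Jac[N],
    0 < p.1.im → vy p = a → hprod B B' a₀ l p ≠ 0 →
      phi B B' l p = frozen B B' a₀ l p / hprod B B' a₀ l p := by
  choose ε hε hk using B.kfac_controlled_point l a₀
  choose ε' hε' hk' using B'.kfac_controlled_point l a₀
  have h1 : ∀ i, ∀ᶠ a in 𝓝 a₀, ‖a - a₀‖ ≤ ε i := fun i => by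
    filter_upwards [Metric.closedBall_mem_nhds a₀ (hε i)] with a ha
    rwa [Metric.mem_closedBall, dist_eq_norm] at ha
  have h2 : ∀ i, ∀ᶠ a in 𝓝 a₀, ‖a - a₀‖ ≤ ε' i := fun i => by
    filter_upwards [Metric.closedBall_mem_nhds a₀ (hε' i)] with a ha
    rwa [Metric.mem_closedBall, dist_eq_norm] at ha
  filter_upwards [eventually_all.2 h1, eventually_all.2 h2, eventually_all.2 (B.eventually_close l a₀),
    eventually_all.2 (B'.eventually_close l a₀)] with a h1 h2 hc hc' p hp hpa h0
  subst hpa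
  have e1 := tsum_steps_univ (B := B) (B' := B') (A' := fun _ => vy p) hp hc
    (fun i => hk i p hp (h1 i)) fun i => B'.kfac_controlled_self l i hp
  have e2 := tsum_steps_univ (B := B') (B' := B) (A' := fun _ => a₀) hp hc'
    (fun i => hk' i p hp (h2 i)) fun i => hk i p hp (h1 i)
  have hswap : ∀ A A' : Fin d → Fin N → ℝ, ∑' ν, term B' B A A' l ν (p, star p) =
      (-1) ^ d * ∑' ν, term B B' A' A l ν (p, star p) := by
    intro A A'
    rw [← tsum_mul_left]
    exact tsum_congr fun ν => term_swap A A' ν _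
  rw [hswap, hswap] at e2
  have e3 : (∏ i, B'.hfac a₀ l i p) *
      ∑' ν, term B B' (fun _ => a₀) (fun _ => vy p) l ν (p, star p) =
      (∏ i, B'.hfac (vy p) l i p) * frozen B B' a₀ l p := by
    have hsgn : ((-1 : ℂ) ^ d) ≠ 0 := pow_ne_zero _ (by norm_num)
    apply mul_left_cancel₀ hsgn
    rw [frozen]
    linear_combination e2
  rw [hprod, mul_ne_zero_iff, prod_ne_zero_iff, prod_ne_zero_iff] at h0
  have n1 : ∏ i, B.hfac (vy p) l i p ≠ 0 :=
    Finset.prod_ne_zero_iff.2 fun i hi => (hc i).hfac_ne_zero (h0.1 i hi)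
  have n2 : ∏ i, B'.hfac (vy p) l i p ≠ 0 :=
    Finset.prod_ne_zero_iff.2 fun i hi => (hc' i).hfac_ne_zero (h0.2 i hi)
  have n3 := Finset.prod_ne_zero_iff.2 h0.1
  have n4 := Finset.prod_ne_zero_iff.2 h0.2
  rw [phi, hprod, hprod, div_eq_div_iff (mul_ne_zero n1 n2) (mul_ne_zero n3 n4)]
  have e1' : (∏ i, B.hfac a₀ l i p) * frozen B B' (vy p) l p = _ := e1
  linear_combination (∏ i, B'.hfac a₀ l i p) * e1' + (∏ i, B.hfac (vy p) l i p) * e3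

lemma contDiff_hprod (a₀ l : Fin N → ℝ) {n : WithTop ℕ∞} : ContDiff ℂ n (hprod B B' a₀ l) := by
  unfold hprod
  exact (contDiff_prod fun i _ => contDiff_hfac B a₀ l i).mul
    (contDiff_prod fun i _ => contDiff_hfac B' a₀ l i)

lemma analyticAt_hprod (a₀ l : Fin N → ℝ) (p : Jac[N]) :
    AnalyticAt ℂ (hprod B B' a₀ l) p :=
  (contDiff_hprod B B' a₀ l (n := ⊤)).contDiffAt.analyticAt

lemma analyticAt_frozen (l : Fin N → ℝ) {p₀ : Jac[N]} (h0 : 0 < p₀.1.im) :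
    AnalyticAt ℝ (frozen B B' (vy p₀) l) p₀ := (sumFamily_term B B' l h0).analyticAt

lemma eventually_phi (l : Fin N → ℝ) {p₀ : Jac[N]} (h0 : 0 < p₀.1.im) :
    ∀ᶠ p in 𝓝 p₀, hprod B B' (vy p₀) l p ≠ 0 →
      phi B B' l p = frozen B B' (vy p₀) l p / hprod B B' (vy p₀) l p := by
  have h1 : ∀ᶠ p : Jac[N] in 𝓝 p₀, 0 < p.1.im :=
    (by fun_prop : Continuous fun p : Jac[N] => p.1.im).continuousAt.eventually
      (lt_mem_nhds h0)
  filter_upwards [h1, (continuousAt_vy h0).eventually (eventually_phi_eq B B' l (vy p₀))]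
    with p hp h hne
  exact h p hp rfl hne

lemma analyticAt_phi (l : Fin N → ℝ) {p₀ : Jac[N]} (h0 : 0 < p₀.1.im)
    (hne : hprod B B' (vy p₀) l p₀ ≠ 0) : AnalyticAt ℝ (phi B B' l) p₀ := by
  have h1 : AnalyticAt ℝ (hprod B B' (vy p₀) l) p₀ := (analyticAt_hprod B B' _ l p₀).restrictScalars
  refine ((analyticAt_frozen B B' l h0).div h1 hne).congr ?_
  filter_upwards [eventually_phi B B' l h0, h1.continuousAt.eventually_ne hne] with p h h2
  exact (h h2).symm

/-- The points which do not lie on any wall. -/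
def regular (l : Fin N → ℝ) : Set Jac[N] :=
  {p | 0 < p.1.im ∧ ∀ i, ¬ B.OnWall (vy p) l i ∧ ¬ B'.OnWall (vy p) l i}

variable {B B'}

lemma eventually_not_onWall (h : ¬ B.OnWall a₀ l i) : ∀ᶠ a in 𝓝 a₀, ¬ B.OnWall a l i := by
  filter_upwards [B.eventually_close l a₀ i] with a ha h'
  exact h (ha.eq_of_onWall h').2

lemma isOpen_regular : IsOpen (regular B B' l) := by
  rw [isOpen_iff_mem_nhds]
  rintro p ⟨hp, h⟩
  have h1 : ∀ᶠ p : Jac[N] in 𝓝 p, 0 < p.1.im :=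
    (by fun_prop : Continuous fun p : Jac[N] => p.1.im).continuousAt.eventually
      (lt_mem_nhds hp)
  filter_upwards [h1, (continuousAt_vy hp).eventually
    (eventually_all.2 fun i => (eventually_not_onWall (h i).1).and (eventually_not_onWall (h i).2))]
    with q hq h2
  exact ⟨hq, h2⟩

lemma hprod_of_regular {p : Jac[N]} (h : ∀ i, ¬ B.OnWall a₀ l i ∧ ¬ B'.OnWall a₀ l i) :
    hprod B B' a₀ l p = 1 := by
  rw [hprod, prod_congr rfl fun i _ => hfac_of_not_onWall (h i).1 p,
    prod_congr rfl fun i _ => hfac_of_not_onWall (h i).2 p]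
  simp

/-- Moving along the sum of the negative vectors leaves all walls. -/
lemma Close.not_onWall_add {ε : ℝ} (hε : ε ≠ 0) (h : B.Close l a₀ i (a₀ + ε • ∑ j, F.n j)) :
    ¬ B.OnWall (a₀ + ε • ∑ j, F.n j) l i := by
  intro hw
  have h1 := (h.eq_of_onWall hw).1
  have h2 : L.bil (B.dir i) (∑ j, F.n j) = -2 := by
    rw [bil_sum_right, sum_congr rfl fun j _ => L.bil_comm (B.dir i) (F.n j),
      sum_congr rfl fun j _ => B.bil_n_dir j i]
    simp
  rw [bil_add_right, bil_smul_right, h2] at h1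
  apply hε
  linarith

lemma vy_add {p : Jac[N]} (hp : 0 < p.1.im) (u : Fin N → ℝ) (ε : ℝ) :
    vy (p + (0, ((ε * p.1.im : ℝ) : ℂ) • 𝕚 • toC u)) = vy p + ε • u := by
  funext k
  have : p.1.im ≠ 0 := hp.ne'
  simp [vy, toC]
  field_simp

lemma frequently_regular (B B' : Side F) (l : Fin N → ℝ) {p₀ : Jac[N]}
    (h0 : 0 < p₀.1.im) : ∃ᶠ p in 𝓝 p₀, p ∈ regular B B' l := by
  set f : ℝ → Jac[N] := fun ε => p₀ + (0, ((ε * p₀.1.im : ℝ) : ℂ) • 𝕚 • toC (∑ j, F.n j)) with hf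
  have hfc : Continuous f := by
    simp only [hf]
    fun_prop
  have hf0 : f 0 = p₀ := by simp [hf]
  have hcl : ∀ᶠ ε in 𝓝 (0 : ℝ), ∀ i, B.Close l (vy p₀) i (vy p₀ + ε • ∑ j, F.n j) ∧
      B'.Close l (vy p₀) i (vy p₀ + ε • ∑ j, F.n j) := by
    have hc : Tendsto (fun ε : ℝ => vy p₀ + ε • ∑ j, F.n j) (𝓝 0) (𝓝 (vy p₀)) := by
      have : Continuous fun ε : ℝ => vy p₀ + ε • ∑ j, F.n j := by fun_prop
      simpa using this.tendsto 0
    exact hc.eventually (eventually_all.2 fun i =>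
      (B.eventually_close l _ i).and (B'.eventually_close l _ i))
  have hev : ∀ᶠ ε in 𝓝[≠] (0 : ℝ), f ε ∈ regular B B' l := by
    filter_upwards [hcl.filter_mono nhdsWithin_le_nhds, self_mem_nhdsWithin] with ε h hε
    have hvy : vy (f ε) = vy p₀ + ε • ∑ j, F.n j := vy_add h0 _ _
    refine ⟨by simpa [hf] using h0, fun i => ?_⟩
    rw [hvy]
    exact ⟨(h i).1.not_onWall_add hε, (h i).2.not_onWall_add hε⟩
  have ht : Tendsto f (𝓝[≠] (0 : ℝ)) (𝓝 p₀) := by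
    have := hfc.tendsto 0
    rw [hf0] at this
    exact this.mono_left nhdsWithin_le_nhds
  exact ht.frequently hev.frequently

lemma hfac_ne_zero_of_not_onWall {p : Jac[N]} (hp : 0 < p.1.im)
    (hw : ¬ B.OnWall (vy p) l i) : B.hfac a₀ l i p ≠ 0 := by
  rw [hfac]
  split_ifs with h0
  · obtain ⟨hi, ν, hν⟩ := h0
    intro h1
    have h2 : ‖ee (B.κ i * (L.bil (toC (B.dir i)) p.2 - (L.bil (B.dir i) a₀ : ℝ) * p.1))‖ = 1 := by
      rw [← sub_eq_zero.1 h1, norm_one]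
    rw [norm_ee, Real.exp_eq_one_iff] at h2
    have h3 : (fun k => (p.2 k).im) = p.1.im • vy p := by
      funext k; simp only [vy, Pi.smul_apply, smul_eq_mul]; field_simp
    rw [Complex.im_ofReal_mul, Complex.sub_im, Complex.im_ofReal_mul, bil_toC_im, h3,
      bil_smul_right] at h2
    have h4 : π * B.κ i * p.1.im * (L.bil (B.dir i) (vy p) - L.bil (B.dir i) a₀) = 0 := by
      linear_combination -h2 / 2
    have hκ := B.κ_pos i
    have h5 := (mul_eq_zero.1 h4).resolve_left (by positivity)
    refine hw ⟨hi, ν, ?_⟩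
    rw [bil_add_right] at hν ⊢
    linarith
  · exact one_ne_zero

/-- The components have almost meromorphic singularities. -/
theorem phi_almostMeromorphic (B B' : Side F) (l : Fin N → ℝ) :
    HasAlmostMeromorphicSingularities (phi B B' l) := by
  intro τ z
  have h0 : 0 < ((τ : ℂ), z).1.im := τ.im_pos
  refine ⟨_, _, analyticAt_frozen B B' l h0, analyticAt_hprod B B' _ l _, ?_,
    eventually_phi B B' l h0⟩
  intro hz
  obtain ⟨p, ⟨hp, hw⟩, hz⟩ := ((frequently_regular B B' l h0).and_eventually hz).exists
  refine mul_ne_zero (Finset.prod_ne_zero_iff.2 fun i _ => ?_)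
    (Finset.prod_ne_zero_iff.2 fun i _ => ?_) hz
  · exact hfac_ne_zero_of_not_onWall hp (hw i).1
  · exact hfac_ne_zero_of_not_onWall hp (hw i).2

/-- The components grow at most exponentially along the lines `z = α τ + β`. -/
theorem phi_growth (B B' : Side F) (l : Fin N → ℝ) : HasWeakGrowth (phi B B' l) := by
  intro α β _
  obtain ⟨ε, hε, h⟩ := term_bound B B' l α
  obtain ⟨κ, hκ, C, hC, hb⟩ := h π Real.pi_pos
  have hvy : ∀ τ : ℍ, vy ((τ : ℂ), fun k => (α k : ℂ) * (τ : ℂ) + β k) = α := by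
    intro τ
    funext k
    have := τ.im_pos.ne'
    simp [vy, mul_div_cancel_right₀ _ this]
  obtain ⟨c, hc⟩ : ∃ c : ℂ, ∀ τ : ℍ,
      hprod B B' α l ((τ : ℂ), fun k => (α k : ℂ) * (τ : ℂ) + β k) = c := by
    have h1 : ∀ (u : Fin N → ℝ) (τ : ℍ), L.bil (toC u) (fun k => (α k : ℂ) * (τ : ℂ) + β k) -
        (L.bil u α : ℝ) * (τ : ℂ) = (L.bil u β : ℝ) := by
      intro u τ
      have : (fun k => (α k : ℂ) * (τ : ℂ) + β k) = (τ : ℂ) • toC α + toC β := by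
        funext k; simp [toC, mul_comm]
      rw [this, bil_add_right, bil_smul_right, bil_toC, bil_toC]
      ring
    have h2 : ∀ (B : Side F) i (τ : ℍ), B.hfac α l i
        ((τ : ℂ), fun k => (α k : ℂ) * (τ : ℂ) + β k) = B.hfac α l i (UpperHalfPlane.I,
          fun k => (α k : ℂ) * (UpperHalfPlane.I : ℂ) + β k) := by
      intro B i τ
      simp only [hfac, h1]
    exact ⟨_, fun τ => by simp only [hprod, h2]; rfl⟩
  set K := ∑' ν : Fin N → ℤ, exp (-(κ * ‖fun k => (ν k : ℝ)‖)) with hK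
  have hsum := summable_exp_neg_norm (N := N) hκ
  refine ⟨C + 1, by positivity, Asymptotics.IsBigO.of_bound (C * K / ‖c‖) ?_⟩
  filter_upwards [UpperHalfPlane.atImInfty_mem _ |>.2 ⟨1, fun τ hτ => hτ⟩] with τ (hτ : 1 ≤ τ.im)
  set p : Jac[N] := ((τ : ℂ), fun k => (α k : ℂ) * (τ : ℂ) + β k) with hp
  have hfro : ‖frozen B B' α l p‖ ≤ C * exp (C * τ.im) * K := by
    have hmem : (p, star p) ∈ nearSet π α ε := mem_nearSet_star τ.im_pos
      (le_mul_of_one_le_right Real.pi_pos.le hτ) (by rw [hvy, sub_self, norm_zero]; exact hε.le)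
    rw [hK, ← tsum_mul_left]
    exact tsum_of_norm_bounded (hsum.mul_left _).hasSum fun ν => hb _ hmem ν
  rw [phi, hvy, hc, norm_div, Real.norm_of_nonneg (Real.exp_pos _).le]
  calc _ ≤ C * exp (C * τ.im) * K / ‖c‖ := by gcongr
    _ = C * K / ‖c‖ * exp (C * τ.im) := by ring
    _ ≤ _ := by
      have hK0 : 0 ≤ K := tsum_nonneg fun ν => (Real.exp_pos _).le
      have := τ.im_pos
      gcongr
      linarith

lemma exists_nonMoving (B : Side F) (l : Fin N → ℝ) (i : Fin d) :
    ∃ s : Finset ((Fin N → ℝ) × ℝ × ℝ), (∀ t ∈ s, t.1 ≠ 0) ∧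
      ∀ (a₀ : Fin N → ℝ) (τ : ℂ) (z : Fin N → ℂ), B.hfac a₀ l i (τ, z) = 0 →
        ∃ t ∈ s, ∃ l m : Fin N → ℤ,
          ∑ i, (t.1 i : ℂ) * (z i - m i - l i * τ) = t.2.1 + t.2.2 * τ := by
  by_cases hi : B.β i ^ 2 = 1
  swap
  · refine ⟨∅, by simp, fun a₀ τ z h => ?_⟩
    rw [hfac_of_not_onWall (fun h => hi h.1)] at h
    exact absurd h one_ne_zero
  obtain ⟨c, hcc⟩ := B.integral i hi
  have hκ := B.κ_pos i
  have hc : (fun k => (c k : ℝ)) = B.κ i • B.dir i := by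
    funext k; rw [← hcc]; simp [dir]
  set t : Fin N → ℤ := c ᵥ* L.gram with ht
  have htR : ∀ x : Fin N → ℂ, ∑ k, (t k : ℂ) * x k = L.bil (toC fun k => (c k : ℝ)) x := by
    intro x
    simp only [ht, bil, toC, Matrix.vecMul, dotProduct]
    push_cast
    rw [sum_comm]
    exact sum_congr rfl fun k _ => by rw [sum_mul]
  obtain ⟨k₀, hk₀⟩ : ∃ k, t k ≠ 0 := by
    by_contra! h
    have h1 := htR (toC (F.n i))
    simp only [h, Int.cast_zero, zero_mul, Finset.sum_const_zero, bil_toC, hc, bil_smul_left] at h1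
    rw [L.bil_comm, B.bil_n_dir, if_pos rfl] at h1
    have h2 : B.κ i * -2 = 0 := by exact_mod_cast h1.symm
    linarith
  refine ⟨(Finset.range (t k₀).natAbs).image
    fun r : ℕ => (fun k => (t k : ℝ), (r : ℝ), -L.bil (fun k => (c k : ℝ)) l), ?_, ?_⟩
  · intro x hx
    obtain ⟨r, -, rfl⟩ := Finset.mem_image.1 hx
    intro h
    have h2 : (t k₀ : ℝ) = 0 := congrFun h k₀
    exact hk₀ (by exact_mod_cast h2)
  intro a₀ τ z h
  rw [hfac] at h
  split_ifs at h with hw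
  · obtain ⟨-, ν, hν⟩ := hw
    have h1 : ee (B.κ i * (L.bil (toC (B.dir i)) z - (L.bil (B.dir i) a₀ : ℝ) * τ)) = 1 :=
      (sub_eq_zero.1 h).symm
    rw [ee, Complex.exp_eq_one_iff] at h1
    obtain ⟨n, hn⟩ := h1
    have h2 : B.κ i * (L.bil (toC (B.dir i)) z - (L.bil (B.dir i) a₀ : ℝ) * τ) = n := by
      have : (2 * π * 𝕚 : ℂ) ≠ 0 := by simp [Real.pi_ne_zero]
      apply mul_left_cancel₀ this
      rw [hn]; ring
    have h3 : B.κ i * L.bil (B.dir i) a₀ = -L.bil (fun k => (c k : ℝ)) l -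
        L.bil (fun k => (c k : ℝ)) (fun k => (ν k : ℝ)) := by
      have e : coset l ν + a₀ = (fun k => (ν k : ℝ)) + (l + a₀) := by funext k; simp [coset]; ring
      rw [e, bil_add_right, bil_add_right] at hν
      rw [hc, bil_smul_left, bil_smul_left]
      linear_combination B.κ i * hν
    have h4 : L.bil (toC fun k => (c k : ℝ)) z = B.κ i * L.bil (toC (B.dir i)) z := by
      rw [hc, toC_smul, bil_smul_left]
    have h5 : ((B.κ i * L.bil (B.dir i) a₀ : ℝ) : ℂ) = ((-L.bil (fun k => (c k : ℝ)) l -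
        L.bil (fun k => (c k : ℝ)) (fun k => (ν k : ℝ)) : ℝ) : ℂ) := by rw [h3]
    push_cast at h5
    refine ⟨_, Finset.mem_image.2 ⟨(n % t k₀).natAbs, ?_, rfl⟩, -ν, (n / t k₀) • Pi.single k₀ 1, ?_⟩
    · rw [Finset.mem_range]
      have h6 := Int.emod_lt_abs n hk₀
      rw [Int.abs_eq_natAbs] at h6
      have := Int.emod_nonneg n hk₀
      omega
    · have e1 : (((n % t k₀).natAbs : ℝ) : ℂ) = (n : ℂ) - (n / t k₀ : ℤ) * t k₀ := by
        have : (((n % t k₀).natAbs : ℤ)) = n - (n / t k₀) * t k₀ := by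
          rw [Int.natAbs_of_nonneg (Int.emod_nonneg n hk₀), Int.emod_def, mul_comm (t k₀)]
        have h6 := congrArg (fun x : ℤ => (x : ℂ)) this
        rw [Complex.ofReal_natCast, ← Int.cast_natCast, h6]
        push_cast; ring
      have e2 : ∑ k, (t k : ℂ) * (((n / t k₀) • (Pi.single k₀ 1 : Fin N → ℤ)) k : ℤ) =
          (n / t k₀ : ℤ) * t k₀ := by
        rw [Finset.sum_eq_single k₀]
        · simp [mul_comm]
        · intro k _ hk; simp [hk]
        · simp
      have e3 : ∑ k, (t k : ℂ) * ((-ν) k : ℤ) =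
          -((L.bil (fun k => (c k : ℝ)) (fun k => (ν k : ℝ)) : ℝ) : ℂ) := by
        rw [← bil_toC, ← htR]
        simp [toC, sum_neg_distrib]
      have e4 : ∑ k, ((t k : ℝ) : ℂ) * (z k - (((n / t k₀) • (Pi.single k₀ 1 : Fin N → ℤ)) k : ℤ) -
          ((-ν) k : ℤ) * τ) = ∑ k, (t k : ℂ) * z k -
          ∑ k, (t k : ℂ) * (((n / t k₀) • (Pi.single k₀ 1 : Fin N → ℤ)) k : ℤ) -
          (∑ k, (t k : ℂ) * ((-ν) k : ℤ)) * τ := by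
        rw [sum_mul, ← sum_sub_distrib, ← sum_sub_distrib]
        exact sum_congr rfl fun k _ => by push_cast; ring
      simp only
      rw [e4, e1, e2, e3, htR, h4]
      push_cast
      linear_combination h2 + τ * h5
  · exact absurd h one_ne_zero

/-- The singularities of the components are non-moving. -/
theorem phi_nonMoving (B B' : Side F) (l : Fin N → ℝ) : HasNonMovingSingularities (phi B B' l) := by
  choose s hs h using fun i => exists_nonMoving B l i
  choose s' hs' h' using fun i => exists_nonMoving B' l i
  classical
  refine ⟨Finset.univ.biUnion s ∪ Finset.univ.biUnion s', fun t ht => ?_, fun τ z hz => ?_⟩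
  · simp only [Finset.mem_union, Finset.mem_biUnion, Finset.mem_univ, true_and] at ht
    rcases ht with ⟨i, ht⟩ | ⟨i, ht⟩
    · exact hs i t ht
    · exact hs' i t ht
  · have h0 : hprod B B' (vy ((τ : ℂ), z)) l ((τ : ℂ), z) = 0 := by
      by_contra h0
      exact hz (analyticAt_phi B B' l τ.im_pos h0)
    rw [hprod, mul_eq_zero, Finset.prod_eq_zero_iff, Finset.prod_eq_zero_iff] at h0
    rcases h0 with ⟨i, -, hi⟩ | ⟨i, -, hi⟩
    · obtain ⟨t, ht, h2⟩ := h i _ _ _ hi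
      exact ⟨t, Finset.mem_union_left _ (Finset.mem_biUnion.2 ⟨i, Finset.mem_univ i, ht⟩), h2⟩
    · obtain ⟨t, ht, h2⟩ := h' i _ _ _ hi
      exact ⟨t, Finset.mem_union_right _ (Finset.mem_biUnion.2 ⟨i, Finset.mem_univ i, ht⟩), h2⟩

end Side

/-! ### The components are the translates of the indefinite theta series -/

variable {N : ℕ} {L : EvenLattice N} {d m : ℕ} {F : L.AdaptedFrame d m} {l a₀ a : Fin N → ℝ}
  {i : Fin d}

namespace Side

/-- The function `ρ^e` for the `i`-th vector of the frame. -/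
def rhoC (B : Side F) (i : Fin d) (x : Fin N → ℝ) (p : Jac[N]) : ℂ :=
  open scoped Classical in
  if B.β i ^ 2 = 1 then ((Real.sign (L.bil (B.dir i) (x + vy p)) : ℝ) : ℂ)
  else cerf ((sqrt (π * p.1.im) * (L.bil (B.dir i) (x + vy p) / sqrt (1 - B.β i ^ 2)) : ℝ))

/-- The terms of the theta series. -/
def summand (B B' : Side F) (x : Fin N → ℝ) (p : Jac[N]) : ℂ :=
  (∏ i, (B.rhoC i x p - B'.rhoC i x p)) * qexp L x p

variable {B B' : Side F}

lemma kfac_of_not_onWall {p : Jac[N]} (hp : 0 < p.1.im) (h : ¬ B.OnWall (vy p) l i)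
    (ν : Fin N → ℤ) : B.kfac (vy p) l i ν (p, star p) = B.rhoC i (coset l ν) p -
      cerf ((sqrt (π * p.1.im) * L.bil (F.n i) (coset l ν + vy p) : ℝ)) := by
  rw [kfac, kern, rhoC, hfac_of_not_onWall h, yC_star hp, aC_star, ← toC_add, bil_toC, bil_toC]
  by_cases hi : B.β i ^ 2 = 1
  · rw [if_pos hi, if_pos hi, if_neg ((not_onWall_iff hi).1 h ν), one_mul]
    push_cast; rfl
  · rw [if_neg hi, if_neg hi]
    push_cast; rfl

lemma term_of_regular {p : Jac[N]} (hp : p ∈ regular B B' l) (ν : Fin N → ℤ) :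
    term B B' (fun _ => vy p) (fun _ => vy p) l ν (p, star p) = summand B B' (coset l ν) p := by
  rw [term, summand]
  congr 1
  refine prod_congr rfl fun i _ => ?_
  rw [mfac, kfac_of_not_onWall hp.1 (hp.2 i).1, kfac_of_not_onWall hp.1 (hp.2 i).2,
    hfac_of_not_onWall (hp.2 i).1, hfac_of_not_onWall (hp.2 i).2]
  ring

lemma phi_of_regular {p : Jac[N]} (hp : p ∈ regular B B' l) :
    phi B B' l p = ∑' ν, summand B B' (coset l ν) p := by
  rw [phi, hprod_of_regular hp.2, div_one, frozen]
  exact tsum_congr fun ν => term_of_regular hp ν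

lemma sumFamily_summand {p₀ : Jac[N]} (h0 : p₀ ∈ regular B B' l) :
    SumFamily (fun ν => summand B B' (coset l ν)) p₀ := by
  refine (sumFamily_term B B' l h0.1).congr ?_
  have hcl : ∀ᶠ p in 𝓝 p₀, ∀ i, B.Close l (vy p₀) i (vy p) ∧ B'.Close l (vy p₀) i (vy p) :=
    (continuousAt_vy h0.1).eventually (eventually_all.2 fun i =>
      (B.eventually_close l _ i).and (B'.eventually_close l _ i))
  filter_upwards [isOpen_regular.mem_nhds h0, hcl] with p hp hc ν
  rw [← term_of_regular hp, term, term]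
  congr 1
  refine prod_congr rfl fun i _ => ?_
  obtain ⟨e1, e2⟩ := (hc i).1.kfac_eq (fun h => absurd h (h0.2 i).1) ν (p, star p)
  obtain ⟨e3, e4⟩ := (hc i).2.kfac_eq (fun h => absurd h (h0.2 i).2) ν (p, star p)
  rw [mfac, mfac, e1, e2, e3, e4]

lemma summable_summand {p : Jac[N]} (hp : p ∈ regular B B' l) :
    Summable fun ν => summand B B' (coset l ν) p := (sumFamily_summand hp).summable.self_of_nhds

lemma eventually_phi_of_regular {p₀ : Jac[N]} (h0 : p₀ ∈ regular B B' l) :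
    phi B B' l =ᶠ[𝓝 p₀] fun p => ∑' ν, summand B B' (coset l ν) p := by
  filter_upwards [isOpen_regular.mem_nhds h0] with p hp
  exact phi_of_regular hp

lemma sign_mul_rerf (T x : ℝ) : Real.sign x * rerf (T * |x|) = rerf (T * x) := by
  rcases lt_trichotomy x 0 with h | h | h
  · rw [Real.sign_of_neg h, abs_of_neg h, mul_neg, rerf_neg]; ring
  · simp [h, rerf_zero]
  · rw [Real.sign_of_pos h, abs_of_pos h, one_mul]

/-- The functions `ρ^e` do not depend on the length of `e`. -/
lemma rho_eq_rhoC {e : Fin N → ℝ} {c : ℝ} (hc : 0 < c) (he : e = c • B.dir i)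
    {p : Jac[N]} (hp : 0 < p.1.im) (x : Fin N → ℝ) :
    ((L.rho e p x : ℝ) : ℂ) = B.rhoC i x p := by
  have hq : L.quad e = c ^ 2 * (B.β i ^ 2 - 1) := by
    rw [he, quad_smul, quad, bil_dir_dir]; ring
  have hsh : shifted p x = x + vy p := rfl
  have hs : L.bil e (shifted p x) = c * L.bil (B.dir i) (x + vy p) := by
    rw [he, bil_smul_left, hsh]
  have hsgn : ∀ t : ℝ, Real.sign (c * t) = Real.sign t := by
    intro t
    rcases lt_trichotomy t 0 with h | h | h
    · rw [Real.sign_of_neg h, Real.sign_of_neg (mul_neg_of_pos_of_neg hc h)]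
    · simp [h]
    · rw [Real.sign_of_pos h, Real.sign_of_pos (mul_pos hc h)]
  rw [rho, rhoC, hs, hsgn]
  by_cases hi : B.β i ^ 2 = 1
  · rw [if_pos (by rw [hq, hi, sub_self, mul_zero]), if_pos hi]
  · have hD : 0 < 1 - B.β i ^ 2 := sub_pos.2 (lt_of_le_of_ne (B.sq_le i) hi)
    have hq' : L.quad e ≠ 0 := by
      rw [hq]; exact mul_ne_zero (by positivity) (by linarith)
    rw [if_neg hq', if_neg hi, cerf_ofReal]
    congr 1
    set s := L.bil (B.dir i) (x + vy p)
    have e1 : -(π * p.1.im * (c * s) ^ 2) / L.quad e =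
        (sqrt (π * p.1.im) / sqrt (1 - B.β i ^ 2) * |s|) ^ 2 := by
      have hne : B.β i ^ 2 - 1 ≠ 0 := by linarith
      rw [mul_pow (_ / _), div_pow, Real.sq_sqrt (by positivity), Real.sq_sqrt hD.le, sq_abs, hq,
        mul_pow, div_mul_eq_mul_div,
        div_eq_div_iff (mul_ne_zero (by positivity) hne) hD.ne']
      ring
    rw [e1, lowerGammaHalf_sq _ (by positivity)]
    have hpi : sqrt π ≠ 0 := (Real.sqrt_pos.2 Real.pi_pos).ne'
    calc _ = Real.sign s * rerf (sqrt (π * p.1.im) / sqrt (1 - B.β i ^ 2) * |s|) := by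
          field_simp
      _ = rerf (sqrt (π * p.1.im) / sqrt (1 - B.β i ^ 2) * s) := sign_mul_rerf _ _
      _ = _ := by congr 1; ring

end Side

variable {E E' : Fin d → Fin N → ℝ}

/-- A compatible pair in terms of an adapted frame. -/
theorem IsCompatiblePair.exists_sides (h : L.IsCompatiblePair E E') :
    ∃ (m : ℕ) (F : L.AdaptedFrame d m) (B B' : Side F) (c c' : Fin d → ℝ),
      (∀ i, 0 < c i) ∧ (∀ i, 0 < c' i) ∧ (∀ i, E i = c i • B.dir i) ∧
        ∀ i, E' i = c' i • B'.dir i := by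
  obtain ⟨m, F, a, b, a', b', ha, ha', hE, hE'⟩ := L.exists_adaptedFrame h
  have key : ∀ {E : Fin d → Fin N → ℝ} {a b : Fin d → ℝ}, L.IsThetaFrame E →
      (∀ i, L.quad (E i) ≤ 0) → (∀ i, 0 < a i) → (∀ i, E i = a i • (F.n i + b i • F.g i)) →
      ∃ B : Side F, ∀ i, E i = a i • B.dir i := by
    intro E a b hT hq ha hE
    have hquad : ∀ i, L.quad (E i) = a i ^ 2 * (b i ^ 2 - 1) := by
      intro i
      have h1 := F.nn i i
      have h2 := F.gg i i
      simp only [if_true] at h1 h2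
      rw [hE, quad_smul, quad, bil_add_left, bil_add_right, bil_add_right, bil_smul_left,
        bil_smul_left, bil_smul_right, bil_smul_right, h1, h2, L.bil_comm (F.g i) (F.n i), F.ng]
      ring
    have hκ : ∀ i, ∃ κ : ℝ, 0 < κ ∧ (b i ^ 2 = 1 → ∃ ν : Fin N → ℤ, ∀ k,
        κ * (F.n i k + b i * F.g i k) = ν k) := by
      intro i
      by_cases hi : b i ^ 2 = 1
      · obtain ⟨c, hc, ν, hν⟩ := hT.rational i (by rw [hquad, hi, sub_self, mul_zero])
        have h1 : ∀ k, c * a i * (F.n i k + b i * F.g i k) = ν k := by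
          intro k; rw [← hν, hE]; simp [mul_assoc]
        rcases lt_or_gt_of_ne (mul_ne_zero hc (ha i).ne') with h | h
        · refine ⟨-(c * a i), by linarith, fun _ => ⟨-ν, fun k => ?_⟩⟩
          rw [Pi.neg_apply, Int.cast_neg, ← h1]; ring
        · exact ⟨c * a i, h, fun _ => ⟨ν, h1⟩⟩
      · exact ⟨1, one_pos, fun h => absurd h hi⟩
    choose κ hκ0 hκ using hκ
    refine ⟨⟨b, κ, fun i => ?_, hκ0, hκ⟩, hE⟩
    have h1 := hq i
    rw [hquad] at h1
    have h2 : 0 < a i ^ 2 := by have := ha i; positivity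
    have := nonpos_of_mul_nonpos_right h1 h2
    linarith
  obtain ⟨B, hB⟩ := key h.left h.quad_left_nonpos ha hE
  obtain ⟨B', hB'⟩ := key h.right h.swap.quad_left_nonpos ha' hE'
  exact ⟨m, F, B, B', a, a', ha, ha', hB, hB'⟩

lemma exists_int_rep (l : L.dual) : ∃ c : Fin N → ℤ, L.rep (QuotientAddGroup.mk l) =
    l.1 + fun k => (c k : ℝ) := by
  have h1 : (QuotientAddGroup.mk (Quotient.out (QuotientAddGroup.mk l : L.Disc)) : L.Disc) =
      QuotientAddGroup.mk l := Quotient.out_eq _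
  have h2 := QuotientAddGroup.eq.1 h1.symm
  rw [AddSubgroup.mem_addSubgroupOf] at h2
  obtain ⟨c, hc⟩ := h2
  refine ⟨c, ?_⟩
  have h3 : (fun k => (c k : ℝ)) = -l.1 + L.rep (QuotientAddGroup.mk l) := by
    rw [rep]; exact hc
  rw [h3]; abel

lemma coset_add_int (l : Fin N → ℝ) (c ν : Fin N → ℤ) :
    coset (l + fun k => (c k : ℝ)) ν = coset l (ν + c) := by
  funext k; simp [coset]; ring

/-- The components are the translates of the theta series. -/
theorem isThetaTranslates_phi {B B' : Side F} {c c' : Fin d → ℝ}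
    (hc : ∀ i, 0 < c i) (hc' : ∀ i, 0 < c' i) (hE : ∀ i, E i = c i • B.dir i)
    (hE' : ∀ i, E' i = c' i • B'.dir i) :
    L.IsThetaTranslates E E' fun x => Side.phi B B' (L.rep x) := by
  intro l τ z ⟨hD, hD'⟩
  set p : Jac[N] := ((τ : ℂ), z) with hp
  set p' := jacobiAct 1 l.1 0 τ z with hp'
  have hp0 : 0 < p.1.im := τ.im_pos
  have hp'e : p' = ((τ : ℂ), fun k => z k + l.1 k * (τ : ℂ)) := by
    simp [hp', jacobiAct, cocyc_one]
  have hp'0 : 0 < p'.1.im := by rw [hp'e]; exact τ.im_pos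
  have hvy : vy p' = l.1 + vy p := by
    funext k
    have : τ.im ≠ 0 := τ.im_pos.ne'
    simp [hp'e, vy, hp]
    field_simp
    ring
  obtain ⟨e, he⟩ := exists_int_rep l
  have hwall : ∀ {E : Fin d → Fin N → ℝ} {B : Side F} {c : Fin d → ℝ}, (∀ i, 0 < c i) →
      (∀ i, E i = c i • B.dir i) → p' ∈ L.domD E →
      ∀ i, ¬ B.OnWall (vy p) (L.rep (QuotientAddGroup.mk l)) i := by
    rintro E B c hc hE hD i ⟨hi, ν, hν⟩
    have hq : L.quad (E i) = 0 := by
      rw [hE, quad_smul, quad, B.bil_dir_dir, hi]; simp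
    refine hD.2 i hq (ν + e) ?_
    have h1 : shifted p' (fun k => ((ν + e) k : ℤ)) =
        coset (L.rep (QuotientAddGroup.mk l)) ν + vy p := by
      have : shifted p' (fun k => ((ν + e) k : ℤ)) = (fun k => (((ν + e) k : ℤ) : ℝ)) + vy p' := rfl
      rw [this, hvy, he, coset_add_int]
      funext k; simp [coset]; ring
    rw [h1, hE, bil_smul_left, hν, mul_zero]
  have hreg : p ∈ Side.regular B B' (L.rep (QuotientAddGroup.mk l)) :=
    ⟨hp0, fun i => ⟨hwall hc hE hD i, hwall hc' hE' hD' i⟩⟩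
  have hterm : ∀ ν : Fin N → ℤ, ee (L.bil (toC l.1) z + (L.quad l.1 : ℝ) * (τ : ℂ)) *
      L.thetaTerm E E' p' ν = Side.summand B B' (coset l.1 ν) p := by
    intro ν
    have hrho : ∀ {e : Fin N → ℝ} {B : Side F} {c : ℝ} {i : Fin d}, 0 < c → e = c • B.dir i →
        ((L.rho e p' (fun k => ν k) : ℝ) : ℂ) = B.rhoC i (coset l.1 ν) p := by
      intro e B c i hc he
      rw [Side.rho_eq_rhoC hc he hp'0, Side.rhoC, Side.rhoC]
      have h1 : (fun k => (ν k : ℝ)) + vy p' = coset l.1 ν + vy p := by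
        rw [hvy]; funext k; simp [coset]; ring
      have h2 : p'.1.im = p.1.im := by rw [hp'e]
      rw [h1, h2]
    rw [thetaTerm, Side.summand, Complex.ofReal_prod, mul_left_comm]
    congr 1
    · refine prod_congr rfl fun i _ => ?_
      rw [Complex.ofReal_sub, hrho (hc i) (hE i), hrho (hc' i) (hE' i)]
    · rw [← ee_add, qexp]
      congr 1
      have h1 : coset l.1 ν = (fun k => (ν k : ℝ)) + l.1 := rfl
      have h2 : p'.2 = z + (τ : ℂ) • toC l.1 := by
        rw [hp'e]; funext k; simp [toC, mul_comm]
      have h3 : p'.1 = (τ : ℂ) := by rw [hp'e]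
      have h4 : (fun k => (ν k : ℂ)) = toC fun k => (ν k : ℝ) := by funext k; simp [toC]
      rw [h1, quad_add, toC_add, bil_add_left, h2, h3, h4, quad_toC, bil_add_left, bil_smul_left,
        bil_toC, L.bil_comm z, L.bil_comm l.1]
      push_cast
      simp only [hp]
      ring
  have hsum : Summable fun ν => Side.summand B B' (coset l.1 ν) p := by
    have h1 := Side.summable_summand hreg
    simp only [he, coset_add_int] at h1
    exact (Equiv.addRight e).summable_iff (f := fun ν => Side.summand B B' (coset l.1 ν) p) |>.1 h1
  have hne := ee_ne_zero (L.bil (toC l.1) z + (L.quad l.1 : ℝ) * (τ : ℂ))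
  refine ⟨?_, ?_⟩
  · have := hsum.mul_left (ee (L.bil (toC l.1) z + (L.quad l.1 : ℝ) * (τ : ℂ)))⁻¹
    refine this.congr fun ν => ?_
    rw [← hterm, inv_mul_cancel_left₀ hne]
  · beta_reduce
    rw [Side.phi_of_regular hreg]
    have h1 : ∑' ν, Side.summand B B' (coset (L.rep (QuotientAddGroup.mk l)) ν) p =
        ∑' ν, Side.summand B B' (coset l.1 ν) p := by
      simp only [he, coset_add_int]
      exact (Equiv.addRight e).tsum_eq fun ν => Side.summand B B' (coset l.1 ν) p
    rw [h1, ← tsum_congr hterm, tsum_mul_left]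
    simp only [jacobiSlash, theta, one_mul]
    congr 2
    simp
    rfl

end EvenLattice

/-! ### Factorization of the Casimir operator -/

section algebra

variable {R : Type*} [Ring R] [Algebra ℂ R] {ι : Type*} [Fintype ι] [DecidableEq ι]

/-- The factorization of the Casimir operator, in a ring that contains the coordinates `y`, `v_i`
and the Wirtinger derivatives. -/
theorem casimir_factorization (Y T Tb : R) (V D Db : ι → R) (μ : ι → ι → ℂ)
    (hμ : ∀ i j, μ i j = μ j i)
    (hTY : T * Y = Y * T + (-(𝕚 / 2)) • (1 : R)) (hTV : ∀ i, T * V i = V i * T)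
    (hDY : ∀ i, D i * Y = Y * D i) (hDbY : ∀ i, Db i * Y = Y * Db i) (hVY : ∀ i, V i * Y = Y * V i)
    (hDV : ∀ i j, D i * V j = V j * D i + (if i = j then -(𝕚 / 2) else 0) • (1 : R))
    (hDbV : ∀ i j, Db i * V j = V j * Db i + (if i = j then 𝕚 / 2 else 0) • (1 : R))
    (hTDb : ∀ i, Db i * T = T * Db i)
    (hTbD : ∀ i, D i * Tb = Tb * D i)
    (hDbDb : ∀ i j, Db i * Db j = Db j * Db i)
    (hDDb : ∀ i j, D i * Db j = Db j * D i)
    (P Pb A X XX H K : R)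
    (hP : P = ∑ i, ∑ j, μ i j • (D i * D j)) (hPb : Pb = ∑ i, ∑ j, μ i j • (Db i * Db j))
    (hA : A = ∑ i, ∑ j, μ i j • (Db i * D j)) (hX : X = ∑ i, V i * Db i)
    (hXX : XX = ∑ i, ∑ j, V i * V j * (Db i * Db j))
    (hH : H = Y * Tb + X - (1 / 4 : ℂ) • (Y * Pb)) (hK : K = (1 / 2 : ℂ) • (Y * A) + X) :
    (-8 : ℂ) • (Y * Y * (T * Tb)) + (2 : ℂ) • (Y * Y * (Tb * P + T * Pb)) -
        (8 : ℂ) • (Y * (X * T)) - (1 / 2 : ℂ) • (Y * Y * (Pb * P - A * A)) +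
        (2 : ℂ) • (Y * (X * (P + A))) - (1 / 2 * 𝕚) • (Y * (A + Pb)) + (2 : ℂ) • XX -
        𝕚 • X =
      (-8 : ℂ) • (Y * (T * H)) - (4 * 𝕚) • H + (2 : ℂ) • (Y * (P * H)) +
        (2 : ℂ) • (K * K) + (2 * 𝕚) • K := by
  have hDX : ∀ j, D j * X = X * D j + (-(𝕚 / 2)) • Db j := by
    intro j
    have : ∀ k, D j * (V k * Db k) = V k * Db k * D j + (if j = k then -(𝕚 / 2) else 0) • Db k := by
      intro k
      rw [← mul_assoc, hDV, add_mul, mul_assoc, hDDb, smul_mul_assoc, one_mul, mul_assoc]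
    rw [hX, mul_sum, sum_congr rfl fun k _ => this k, sum_add_distrib, sum_mul]
    simp
  have hDbX : ∀ j, Db j * X = X * Db j + (𝕚 / 2) • Db j := by
    intro j
    have : ∀ k, Db j * (V k * Db k) = V k * Db k * Db j + (if j = k then 𝕚 / 2 else 0) • Db k := by
      intro k
      rw [← mul_assoc, hDbV, add_mul, mul_assoc, hDbDb, smul_mul_assoc, one_mul, mul_assoc]
    rw [hX, mul_sum, sum_congr rfl fun k _ => this k, sum_add_distrib, sum_mul]
    simp
  have hA' : ∑ i, ∑ j, μ i j • (D i * Db j) = A := by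
    rw [hA, sum_comm]
    exact sum_congr rfl fun i _ => sum_congr rfl fun j _ => by rw [hμ, hDDb]
  have hPX : P * X = X * P + (-𝕚) • A := by
    have : ∀ i j, μ i j • (D i * D j) * X = X * (μ i j • (D i * D j)) +
        (-(𝕚 / 2)) • (μ i j • (Db i * D j)) +
        (-(𝕚 / 2)) • (μ i j • (D i * Db j)) := by
      intro i j
      rw [smul_mul_assoc, mul_assoc, hDX, mul_add, ← mul_assoc, hDX, add_mul, mul_smul_comm,
        mul_smul_comm, smul_mul_assoc, mul_assoc]
      module
    have h2 : P * X = X * P + (-(𝕚 / 2)) • A + (-(𝕚 / 2)) • ∑ i, ∑ j, μ i j • (D i * Db j) := by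
      conv_lhs => rw [hP]
      rw [hP, hA]
      simp only [sum_mul, mul_sum, Finset.smul_sum, this, sum_add_distrib]
    rw [h2, hA']
    module
  have hAX : A * X = X * A + (𝕚 / 2) • A + (-(𝕚 / 2)) • Pb := by
    have : ∀ i j, μ i j • (Db i * D j) * X = X * (μ i j • (Db i * D j)) +
        (𝕚 / 2) • (μ i j • (Db i * D j)) +
        (-(𝕚 / 2)) • (μ i j • (Db i * Db j)) := by
      intro i j
      rw [smul_mul_assoc, mul_assoc, hDX, mul_add, ← mul_assoc, hDbX, add_mul, mul_smul_comm,
        mul_smul_comm, smul_mul_assoc, mul_assoc]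
      module
    conv_lhs => rw [hA]
    rw [hA, hPb]
    simp only [sum_mul, mul_sum, Finset.smul_sum, this, sum_add_distrib]
  have hXX' : X * X = XX + (𝕚 / 2) • X := by
    have : ∀ i, V i * Db i * X = ∑ j, V i * V j * (Db i * Db j) + (𝕚 / 2) • (V i * Db i) := by
      intro i
      rw [mul_assoc, hDbX, mul_add, mul_smul_comm, hX, sum_mul, mul_sum]
      congr 1
      exact sum_congr rfl fun j _ => by rw [hDbDb i j]; simp only [mul_assoc]
    conv_lhs => rw [hX, sum_mul]
    rw [← hX, sum_congr rfl fun i _ => this i, sum_add_distrib, ← Finset.smul_sum, ← hX, hXX]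
  have hTX : T * X = X * T := by
    rw [hX, mul_sum, sum_mul]
    exact sum_congr rfl fun i _ => by rw [← mul_assoc, hTV, mul_assoc, mul_assoc, hTDb]
  have hXY : X * Y = Y * X := by
    rw [hX, mul_sum, sum_mul]
    exact sum_congr rfl fun i _ => by rw [mul_assoc, hDbY, ← mul_assoc, hVY, mul_assoc]
  have hAY : A * Y = Y * A := by
    rw [hA]
    simp only [sum_mul, mul_sum]
    refine sum_congr rfl fun i _ => sum_congr rfl fun j _ => ?_
    rw [smul_mul_assoc, mul_assoc, hDY, ← mul_assoc, hDbY, mul_smul_comm, mul_assoc]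
  have hPY : P * Y = Y * P := by
    rw [hP]
    simp only [sum_mul, mul_sum]
    refine sum_congr rfl fun i _ => sum_congr rfl fun j _ => ?_
    rw [smul_mul_assoc, mul_assoc, hDY, ← mul_assoc, hDY, mul_smul_comm, mul_assoc]
  have hPTb : P * Tb = Tb * P := by
    rw [hP]
    simp only [sum_mul, mul_sum]
    refine sum_congr rfl fun i _ => sum_congr rfl fun j _ => ?_
    rw [smul_mul_assoc, mul_assoc, hTbD, ← mul_assoc, hTbD, mul_smul_comm, mul_assoc]
  have hPPb : P * Pb = Pb * P := by
    have h1 : ∀ k, P * Db k = Db k * P := by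
      intro k
      rw [hP]
      simp only [sum_mul, mul_sum]
      refine sum_congr rfl fun i _ => sum_congr rfl fun j _ => ?_
      rw [smul_mul_assoc, mul_assoc, hDDb, ← mul_assoc, hDDb, mul_smul_comm, mul_assoc]
    rw [hPb]
    simp only [sum_mul, mul_sum]
    refine sum_congr rfl fun i _ => sum_congr rfl fun j _ => ?_
    rw [mul_smul_comm, ← mul_assoc, h1, mul_assoc, h1, smul_mul_assoc, mul_assoc]
  have e1 : T * H = Y * (T * Tb) + (-(𝕚 / 2)) • Tb + X * T - (1 / 4 : ℂ) •
      (Y * (T * Pb) + (-(𝕚 / 2)) • Pb) := by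
    rw [hH, mul_sub, mul_add, mul_smul_comm, ← mul_assoc, ← mul_assoc, hTY, hTX, add_mul, add_mul,
      smul_mul_assoc, smul_mul_assoc, one_mul, one_mul, mul_assoc, mul_assoc]
  have e2 : P * H = Y * (Tb * P) + X * P + (-𝕚) • A - (1 / 4 : ℂ) • (Y * (Pb * P)) := by
    rw [hH, mul_sub, mul_add, mul_smul_comm, ← mul_assoc, ← mul_assoc, hPY, hPX, mul_assoc,
      mul_assoc, hPTb, hPPb]
    abel
  have e3 : K * K = (1 / 4 : ℂ) • (Y * Y * (A * A)) + (1 / 2 : ℂ) • (Y * (X * A)) +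
      (1 / 2 : ℂ) • (Y * (X * A + (𝕚 / 2) • A + (-(𝕚 / 2)) • Pb)) +
      XX + (𝕚 / 2) • X := by
    have f1 : Y * A * (Y * A) = Y * Y * (A * A) := by
      rw [mul_assoc Y A, ← mul_assoc A Y, hAY]; simp only [mul_assoc]
    have f2 : Y * A * X = Y * (X * A + (𝕚 / 2) • A + (-(𝕚 / 2)) • Pb) := by
      rw [mul_assoc, hAX]
    have f3 : X * (Y * A) = Y * (X * A) := by rw [← mul_assoc, hXY, mul_assoc]
    rw [hK, mul_add, add_mul, add_mul, smul_mul_assoc, smul_mul_assoc, mul_smul_comm,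
      mul_smul_comm, f1, f2, f3, hXX']
    module
  rw [e1, e2, e3, hH, hK]
  have hI : 𝕚 * 𝕚 = -1 := Complex.I_mul_I
  simp only [mul_add, mul_sub, mul_smul_comm, smul_add, smul_sub, smul_smul, mul_assoc]
  match_scalars <;> ring_nf

end algebra

/-! ### Differential operators on smooth functions -/

section smooth

open scoped ContDiff

variable {N : ℕ}

/-- The smooth functions on `ℂ × ℂ^N`. -/
def smoothFns (N : ℕ) : Submodule ℂ (Jac[N] → ℂ) where
  carrier := {φ | ContDiff ℝ ∞ φ}
  add_mem' {φ ψ} (h : ContDiff ℝ ∞ φ) (h' : ContDiff ℝ ∞ ψ) := h.add h'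
  zero_mem' := (contDiff_const : ContDiff ℝ ∞ fun _ => (0 : ℂ))
  smul_mem' c φ (h : ContDiff ℝ ∞ φ) := h.const_smul c

/-- The linear operators on smooth functions. -/
abbrev DiffOp (N : ℕ) := Module.End ℂ (smoothFns N)

lemma mem_smoothFns {φ : Jac[N] → ℂ} : φ ∈ smoothFns N ↔ ContDiff ℝ ∞ φ := Iff.rfl

lemma smoothFns_contDiff (φ : smoothFns N) : ContDiff ℝ ∞ (φ : Jac[N] → ℂ) := mem_smoothFns.1 φ.2

lemma smoothFns_differentiable (φ : smoothFns N) :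
    Differentiable ℝ (φ : Jac[N] → ℂ) := (smoothFns_contDiff φ).differentiable (by simp)

lemma contDiff_fderiv_apply {φ : Jac[N] → ℂ} (h : ContDiff ℝ ∞ φ)
    (w : Jac[N]) : ContDiff ℝ ∞ fun p => fderiv ℝ φ p w :=
  (h.fderiv_right (m := ∞) (by simp)).clm_apply contDiff_const

/-- The derivative of smooth functions in a real direction. -/
def dirD (w : Jac[N]) : DiffOp N where
  toFun φ := ⟨fun p => fderiv ℝ φ.1 p w,
    mem_smoothFns.2 (contDiff_fderiv_apply (smoothFns_contDiff φ) w)⟩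
  map_add' φ ψ := by
    ext p
    have := fderiv_add (smoothFns_differentiable φ p) (smoothFns_differentiable ψ p)
    simp [this]
  map_smul' c φ := by
    ext p
    have := fderiv_const_smul (smoothFns_differentiable φ p) c
    simp [this]

/-- Multiplication of smooth functions by a real-linear function. -/
def mulOp (f : Jac[N] →L[ℝ] ℂ) : DiffOp N where
  toFun φ := ⟨fun p => f p * φ.1 p, mem_smoothFns.2 (f.contDiff.mul (smoothFns_contDiff φ))⟩
  map_add' φ ψ := by ext p; simp [mul_add]
  map_smul' c φ := by ext p; simp [mul_left_comm]

lemma dirD_apply (w : Jac[N]) (φ : smoothFns N) (p : Jac[N]) :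
    (dirD w φ).1 p = fderiv ℝ φ.1 p w := rfl

lemma mulOp_apply (f : Jac[N] →L[ℝ] ℂ) (φ : smoothFns N) (p : Jac[N]) :
    (mulOp f φ).1 p = f p * φ.1 p := rfl

lemma mulOp_comm (f g : Jac[N] →L[ℝ] ℂ) : mulOp f * mulOp g = mulOp g * mulOp f := by
  ext φ p
  simp [mulOp_apply, mul_left_comm]

lemma dirD_comm (w w' : Jac[N]) : dirD w * dirD w' = dirD w' * dirD w := by
  ext φ p
  have h1 : DifferentiableAt ℝ (fderiv ℝ φ.1) p :=
    ((smoothFns_contDiff φ).fderiv_right (m := 1) (by norm_cast)).differentiable (by simp) p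
  have h2 : IsSymmSndFDerivAt ℝ φ.1 p := (smoothFns_contDiff φ).contDiffAt.isSymmSndFDerivAt
    (by simp only [minSmoothness_of_isRCLikeNormedField]; exact WithTop.coe_le_coe.2 (le_top : (2 : ℕ∞) ≤ ⊤))
  have h3 : ∀ w w' : Jac[N], fderiv ℝ (fun q => fderiv ℝ φ.1 q w') p w =
      fderiv ℝ (fderiv ℝ φ.1) p w w' := by
    intro w w'
    rw [fderiv_clm_apply h1 (differentiableAt_const _)]
    simp
  change fderiv ℝ (fun q => fderiv ℝ φ.1 q w') p w = fderiv ℝ (fun q => fderiv ℝ φ.1 q w) p w'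
  rw [h3, h3]
  exact h2 w w'

lemma dirD_mulOp (w : Jac[N]) (f : Jac[N] →L[ℝ] ℂ) :
    dirD w * mulOp f = mulOp f * dirD w + f w • (1 : DiffOp N) := by
  ext φ p
  change fderiv ℝ (fun q => f q * φ.1 q) p w = f p * fderiv ℝ φ.1 p w + f w * φ.1 p
  rw [fderiv_fun_mul f.differentiableAt (smoothFns_differentiable φ p)]
  simp
  ring

/-- The holomorphic Wirtinger derivative of smooth functions. -/
def wirt (w : Jac[N]) : DiffOp N := (1 / 2 : ℂ) • (dirD w + (-𝕚) • dirD (𝕚 • w))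

/-- The antiholomorphic Wirtinger derivative of smooth functions. -/
def wirtBar (w : Jac[N]) : DiffOp N := (1 / 2 : ℂ) • (dirD w + 𝕚 • dirD (𝕚 • w))

lemma wirt_apply (w : Jac[N]) (φ : smoothFns N) : (wirt w φ).1 = wD w φ.1 := by
  funext p
  simp [wirt, wD, dirD_apply]
  ring

lemma wirtBar_apply (w : Jac[N]) (φ : smoothFns N) :
    (wirtBar w φ).1 = wDbar w φ.1 := by
  funext p
  simp [wirtBar, wDbar, dirD_apply]
  ring

lemma wirtBar_comm (w w' : Jac[N]) : wirtBar w * wirtBar w' = wirtBar w' * wirtBar w := by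
  simp only [wirtBar, smul_mul_assoc, mul_smul_comm, add_mul, mul_add, smul_add]
  rw [dirD_comm w w', dirD_comm w (𝕚 • w'), dirD_comm (𝕚 • w) w', dirD_comm (𝕚 • w) (𝕚 • w')]
  module

lemma wirt_wirtBar_comm (w w' : Jac[N]) : wirt w * wirtBar w' = wirtBar w' * wirt w := by
  simp only [wirt, wirtBar, smul_mul_assoc, mul_smul_comm, add_mul, mul_add, smul_add]
  rw [dirD_comm w w', dirD_comm w (𝕚 • w'), dirD_comm (𝕚 • w) w', dirD_comm (𝕚 • w) (𝕚 • w')]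
  module

lemma wirt_mulOp (w : Jac[N]) (f : Jac[N] →L[ℝ] ℂ) :
    wirt w * mulOp f = mulOp f * wirt w + ((f w - 𝕚 * f (𝕚 • w)) / 2) • (1 : DiffOp N) := by
  simp only [wirt, smul_mul_assoc, mul_smul_comm, add_mul, mul_add, smul_add, dirD_mulOp]
  module

lemma wirtBar_mulOp (w : Jac[N]) (f : Jac[N] →L[ℝ] ℂ) :
    wirtBar w * mulOp f = mulOp f * wirtBar w + ((f w + 𝕚 * f (𝕚 • w)) / 2) • (1 : DiffOp N) := by
  simp only [wirtBar, smul_mul_assoc, mul_smul_comm, add_mul, mul_add, smul_add, dirD_mulOp]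
  module

/-- The function `Im τ`. -/
def imTau : Jac[N] →L[ℝ] ℂ :=
  Complex.ofRealCLM.comp (Complex.imCLM.comp (ContinuousLinearMap.fst ℝ ℂ (Fin N → ℂ)))

/-- The function `Im z_i`. -/
def imZ (i : Fin N) : Jac[N] →L[ℝ] ℂ :=
  Complex.ofRealCLM.comp (Complex.imCLM.comp ((ContinuousLinearMap.proj i).comp
    (ContinuousLinearMap.snd ℝ ℂ (Fin N → ℂ))))

lemma imTau_apply (p : Jac[N]) : imTau p = (p.1.im : ℂ) := rfl

lemma imZ_apply (i : Fin N) (p : Jac[N]) : imZ i p = ((p.2 i).im : ℂ) := rfl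

variable (L : EvenLattice N)

lemma mat_isSymm : L.mat.IsSymm := by
  ext i j
  simp [EvenLattice.mat, L.symm.apply i j]

lemma invL_symm (i j : Fin N) : invL L i j = invL L j i := by
  have h : (invL L)ᵀ = invL L := by
    rw [invL, Matrix.transpose_nonsing_inv, Matrix.transpose_smul, ← Matrix.transpose_map,
      (mat_isSymm L).eq]
  conv_lhs => rw [← h]
  rfl

/-- The operator `y ∂_τ̄ + v ∂_z̄ - y M⁻¹[∂_z̄] / 4`. -/
def opH (φ : Jac[N] → ℂ) (p : Jac[N]) : ℂ :=
  (p.1.im : ℂ) * wDbar dirTau φ p + ∑ i, ((p.2 i).im : ℂ) * dZbar i φ p -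
    1 / 4 * ((p.1.im : ℂ) * contract L dZbar dZbar φ p)

/-- The operator `y ∂_z̄ᵀ M⁻¹ ∂_z / 2 + v ∂_z̄`. -/
def opK (φ : Jac[N] → ℂ) (p : Jac[N]) : ℂ :=
  1 / 2 * ((p.1.im : ℂ) * contract L dZbar dZ φ p) + ∑ i, ((p.2 i).im : ℂ) * dZbar i φ p

lemma sum_apply_val {ι : Type*} [Fintype ι] (A : ι → DiffOp N)
    (φ : smoothFns N) (p : Jac[N]) : ((∑ i, A i) φ).1 p = ∑ i, (A i φ).1 p := by
  rw [LinearMap.sum_apply, Submodule.coe_sum, Finset.sum_apply]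

lemma contract_apply {A B : Fin N → (Jac[N] → ℂ) → (Jac[N] → ℂ)}
    {A' B' : Fin N → DiffOp N} (hA : ∀ i φ, (A' i φ).1 = A i φ.1)
    (hB : ∀ i φ, (B' i φ).1 = B i φ.1) (φ : smoothFns N) :
    ((∑ i, ∑ j, invL L i j • (A' i * B' j)) φ).1 = contract L A B φ.1 := by
  funext p
  rw [sum_apply_val, contract]
  refine sum_congr rfl fun i _ => ?_
  rw [sum_apply_val]
  refine sum_congr rfl fun j _ => ?_
  rw [← hB, ← hA]
  rfl

lemma wirt_imTau (w : Jac[N]) : wirt w * mulOp imTau = mulOp imTau * wirt w +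
    (-(𝕚 / 2) * w.1) • (1 : DiffOp N) := by
  rw [wirt_mulOp, imTau_apply, imTau_apply]
  congr 2
  apply Complex.ext <;> simp <;> ring

lemma wirtBar_imTau (w : Jac[N]) : wirtBar w * mulOp imTau = mulOp imTau * wirtBar w +
    (𝕚 / 2 * star w.1) • (1 : DiffOp N) := by
  rw [wirtBar_mulOp, imTau_apply, imTau_apply]
  congr 2
  apply Complex.ext <;> simp <;> ring

lemma wirt_imZ (w : Jac[N]) (i : Fin N) : wirt w * mulOp (imZ i) =
    mulOp (imZ i) * wirt w + (-(𝕚 / 2) * w.2 i) • (1 : DiffOp N) := by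
  rw [wirt_mulOp, imZ_apply, imZ_apply]
  congr 2
  apply Complex.ext <;> simp <;> ring

lemma wirtBar_imZ (w : Jac[N]) (i : Fin N) : wirtBar w * mulOp (imZ i) = mulOp (imZ i) * wirtBar w +
      (𝕚 / 2 * star (w.2 i)) • (1 : DiffOp N) := by
  rw [wirtBar_mulOp, imZ_apply, imZ_apply]
  congr 2
  apply Complex.ext <;> simp <;> ring

/-- The Casimir operator kills the smooth functions which `opH` and `opK` kill near a point. -/
lemma casimir_eq_zero_of_smooth (φ : smoothFns N) {p : Jac[N]}
    (hH : ∀ᶠ q in 𝓝 p, opH L φ.1 q = 0) (hK : ∀ᶠ q in 𝓝 p, opK L φ.1 q = 0) :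
    casimir L (N / 2) φ.1 p = 0 := by
  set Y : DiffOp N := mulOp imTau with hY
  set V : Fin N → DiffOp N := fun i => mulOp (imZ i) with hV
  set T : DiffOp N := wirt dirTau with hT
  set Tb : DiffOp N := wirtBar dirTau with hTb
  set D : Fin N → DiffOp N := fun i => wirt (dirZ i) with hD
  set Db : Fin N → DiffOp N := fun i => wirtBar (dirZ i) with hDb
  set P := ∑ i, ∑ j, invL L i j • (D i * D j) with hP
  set Pb := ∑ i, ∑ j, invL L i j • (Db i * Db j) with hPb
  set A := ∑ i, ∑ j, invL L i j • (Db i * D j) with hA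
  set X := ∑ i, V i * Db i with hX
  set XX := ∑ i, ∑ j, V i * V j * (Db i * Db j) with hXX
  set H := Y * Tb + X - (1 / 4 : ℂ) • (Y * Pb) with hHd
  set K := (1 / 2 : ℂ) • (Y * A) + X with hKd
  have key := casimir_factorization Y T Tb V D Db (invL L) (invL_symm L)
    (by rw [hT, hY, wirt_imTau]; simp [dirTau])
    (fun i => by rw [hT, hV, wirt_imZ]; simp [dirTau])
    (fun i => by simp only [hD, hY]; rw [wirt_imTau]; simp [dirZ])
    (fun i => by simp only [hDb, hY]; rw [wirtBar_imTau]; simp [dirZ])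
    (fun i => mulOp_comm _ _)
    (fun i j => by
      simp only [hD, hV]; rw [wirt_imZ]
      congr 2
      simp only [dirZ, Pi.single_apply, eq_comm (a := j)]; split_ifs <;> simp)
    (fun i j => by
      simp only [hDb, hV]; rw [wirtBar_imZ]
      congr 2
      simp only [dirZ, Pi.single_apply, eq_comm (a := j)]; split_ifs <;> simp)
    (fun i => (wirt_wirtBar_comm _ _).symm)
    (fun i => wirt_wirtBar_comm _ _) (fun i j => wirtBar_comm _ _)
    (fun i j => wirt_wirtBar_comm _ _) P Pb A X XX H K hP hPb hA hX hXX hHd hKd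
  have aD : ∀ i φ, (D i φ).1 = dZ i φ.1 := fun i φ => wirt_apply _ _
  have aDb : ∀ i φ, (Db i φ).1 = dZbar i φ.1 := fun i φ => wirtBar_apply _ _
  have aU : ∀ i φ, ((D i + Db i) φ).1 = dU i φ.1 := by
    intro i φ
    have h1 : D i + Db i = dirD (dirZ i) := by
      simp only [hD, hDb, wirt, wirtBar]; module
    rw [h1]; rfl
  have aP : ∀ φ, (P φ).1 = contract L dZ dZ φ.1 := contract_apply L aD aD
  have aPb : ∀ φ, (Pb φ).1 = contract L dZbar dZbar φ.1 := contract_apply L aDb aDb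
  have aA : ∀ φ, (A φ).1 = contract L dZbar dZ φ.1 := contract_apply L aDb aD
  have aPA : ∀ φ, ((P + A) φ).1 = contract L dZ dU φ.1 := by
    intro φ
    rw [← contract_apply L aD aU]
    congr 2
    have hA' : ∑ i, ∑ j, invL L i j • (D i * Db j) = A := by
      rw [hA, sum_comm]
      refine sum_congr rfl fun i _ => sum_congr rfl fun j _ => ?_
      rw [invL_symm]
      congr 1
      exact wirt_wirtBar_comm _ _
    simp only [mul_add, smul_add, sum_add_distrib]
    rw [hA', hP]
  have aAPb : ∀ φ, ((A + Pb) φ).1 = contract L dZbar dU φ.1 := by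
    intro φ
    rw [← contract_apply L aDb aU]
    congr 2
    simp only [mul_add, smul_add, sum_add_distrib]
    rw [hA, hPb]
  have aX : ∀ φ q, (X φ).1 q = ∑ i, ((q.2 i).im : ℂ) * dZbar i φ.1 q := by
    intro φ q
    rw [hX, sum_apply_val]
    refine sum_congr rfl fun i _ => ?_
    rw [← aDb]; rfl
  have aH : (H φ).1 = opH L φ.1 := by
    funext q
    rw [opH, ← aX, ← aPb, ← wirtBar_apply]
    rfl
  have aK : (K φ).1 = opK L φ.1 := by
    funext q
    rw [opK, ← aX, ← aA]
    rfl
  have zT : ∀ (ψ : smoothFns N), (∀ᶠ q in 𝓝 p, ψ.1 q = 0) → ∀ w, ∀ᶠ q in 𝓝 p, (wirt w ψ).1 q = 0 := by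
    intro ψ h w
    have h1 := wD_congr (show ψ.1 =ᶠ[𝓝 p] fun _ => 0 from h) w
    filter_upwards [h1] with q hq
    rw [wirt_apply, hq]; simp [wD]
  have zTb : ∀ (ψ : smoothFns N), (∀ᶠ q in 𝓝 p, ψ.1 q = 0) → ∀ w,
      ∀ᶠ q in 𝓝 p, (wirtBar w ψ).1 q = 0 := by
    intro ψ h w
    have h1 := wDbar_congr (show ψ.1 =ᶠ[𝓝 p] fun _ => 0 from h) w
    filter_upwards [h1] with q hq
    rw [wirtBar_apply, hq]; simp [wDbar]
  have zPH : (P (H φ)).1 p = 0 := by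
    rw [hP, sum_apply_val]
    refine sum_eq_zero fun i _ => ?_
    rw [sum_apply_val]
    refine sum_eq_zero fun j _ => ?_
    have := (zT _ (zT (H φ) (by rw [aH]; exact hH) (dirZ j)) (dirZ i)).self_of_nhds
    change invL L i j * (wirt (dirZ i) (wirt (dirZ j) (H φ))).1 p = 0
    rw [this, mul_zero]
  have zKK : (K (K φ)).1 p = 0 := by
    have h1 : ∀ᶠ q in 𝓝 p, (K φ).1 q = 0 := by rw [aK]; exact hK
    have h2 : (A (K φ)).1 p = 0 := by
      rw [hA, sum_apply_val]
      refine sum_eq_zero fun i _ => ?_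
      rw [sum_apply_val]
      refine sum_eq_zero fun j _ => ?_
      have := (zTb _ (zT (K φ) h1 (dirZ j)) (dirZ i)).self_of_nhds
      change invL L i j * (wirtBar (dirZ i) (wirt (dirZ j) (K φ))).1 p = 0
      rw [this, mul_zero]
    have h3 : (X (K φ)).1 p = 0 := by
      rw [hX, sum_apply_val]
      refine sum_eq_zero fun i _ => ?_
      have := (zTb (K φ) h1 (dirZ i)).self_of_nhds
      change imZ i p * (wirtBar (dirZ i) (K φ)).1 p = 0
      rw [this, mul_zero]
    change 1 / 2 * (imTau p * (A (K φ)).1 p) + (X (K φ)).1 p = 0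
    rw [h2, h3, mul_zero, mul_zero, add_zero]
  have zTH : (T (H φ)).1 p = 0 := (zT (H φ) (by rw [aH]; exact hH) dirTau).self_of_nhds
  have zH : (H φ).1 p = 0 := by rw [aH]; exact hH.self_of_nhds
  have zK : (K φ).1 p = 0 := by rw [aK]; exact hK.self_of_nhds
  have key2 := congrArg (fun B : DiffOp N => (B φ).1 p) key
  have e1 : (T (Tb φ)).1 = wD dirTau (wDbar dirTau φ.1) := by
    rw [hT, hTb, wirt_apply, wirtBar_apply]
  have e2 : (Tb (P φ)).1 = wDbar dirTau (contract L dZ dZ φ.1) := by rw [hTb, wirtBar_apply, aP]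
  have e3 : (T (Pb φ)).1 = wD dirTau (contract L dZbar dZbar φ.1) := by rw [hT, wirt_apply, aPb]
  have e4 : (X (T φ)).1 p = ∑ i, ((p.2 i).im : ℂ) * wD dirTau (dZbar i φ.1) p := by
    rw [hX, sum_apply_val]
    refine sum_congr rfl fun i _ => ?_
    have h1 : Db i (T φ) = T (Db i φ) := by
      have := congrArg (fun B => B φ) (wirt_wirtBar_comm dirTau (dirZ i) (N := N))
      exact this.symm
    change imZ i p * (Db i (T φ)).1 p = _
    rw [h1, hT, wirt_apply, aDb]; rfl
  have e5 : (Pb (P φ)).1 = contract L dZbar dZbar (contract L dZ dZ φ.1) := by rw [aPb, aP]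
  have e6 : (A (A φ)).1 = contract L dZbar dZ (contract L dZbar dZ φ.1) := by rw [aA, aA]
  have e7 : (X ((P + A) φ)).1 p = ∑ i, ((p.2 i).im : ℂ) * dZbar i (contract L dZ dU φ.1) p := by
    rw [aX, aPA]
  have e8 : (XX φ).1 p = ∑ i, ∑ j, ((p.2 i).im : ℂ) * ((p.2 j).im : ℂ) *
      dZbar i (dZbar j φ.1) p := by
    rw [hXX, sum_apply_val]
    refine sum_congr rfl fun i _ => ?_
    rw [sum_apply_val]
    refine sum_congr rfl fun j _ => ?_
    rw [← aDb, ← aDb, mul_assoc ((p.2 i).im : ℂ)]; rfl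
  have lhs : casimir L (N / 2) φ.1 p = -8 * (imTau p * (imTau p * (T (Tb φ)).1 p)) +
      2 * (imTau p * (imTau p * ((Tb (P φ)).1 p + (T (Pb φ)).1 p))) -
      8 * (imTau p * (X (T φ)).1 p) -
      1 / 2 * (imTau p * (imTau p * ((Pb (P φ)).1 p - (A (A φ)).1 p))) +
      2 * (imTau p * (X ((P + A) φ)).1 p) -
      1 / 2 * 𝕚 * (imTau p * ((A + Pb) φ).1 p) + 2 * (XX φ).1 p -
      𝕚 * (X φ).1 p := by
    rw [e1, e2, e3, e4, e5, e6, e7, e8, aAPb, aX, casimir, laplaceWeight, imTau_apply]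
    push_cast
    ring
  rw [lhs]
  refine key2.trans ?_
  change -8 * (imTau p * (T (H φ)).1 p) - 4 * 𝕚 * (H φ).1 p +
    2 * (imTau p * (P (H φ)).1 p) + 2 * (K (K φ)).1 p + 2 * 𝕚 * (K φ).1 p = 0
  rw [zTH, zH, zPH, zKK, zK]
  simp

/-- A function which is smooth near `p` agrees near `p` with a smooth function. -/
lemma exists_smoothFns_eq {φ : Jac[N] → ℂ} {p : Jac[N]}
    (h : AnalyticAt ℝ φ p) : ∃ ψ : smoothFns N, ψ.1 =ᶠ[𝓝 p] φ := by
  obtain ⟨r, hr, hball⟩ := Metric.eventually_nhds_iff_ball.1 h.eventually_analyticAt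
  let f : ContDiffBump p := ⟨r / 4, r / 2, by linarith, by linarith⟩
  have hsm : ContDiff ℝ ∞ fun q => (f q : ℂ) * φ q := by
    rw [contDiff_iff_contDiffAt]
    intro q
    by_cases hq : q ∈ Metric.ball p r
    · exact (Complex.ofRealCLM.contDiff.contDiffAt.comp q f.contDiffAt).mul (hball q hq).contDiffAt
    · have h1 : (fun q => (f q : ℂ) * φ q) =ᶠ[𝓝 q] fun _ => 0 := by
        have h2 : q ∈ (Metric.closedBall p (r / 2))ᶜ := by
          intro h3
          exact hq (lt_of_le_of_lt (Metric.mem_closedBall.1 h3) (by linarith))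
        filter_upwards [Metric.isClosed_closedBall.isOpen_compl.mem_nhds h2] with q' hq'
        have h3 : f q' = 0 := f.zero_of_le_dist (le_of_lt (not_le.1 hq'))
        simp [h3]
      exact contDiffAt_const.congr_of_eventuallyEq h1
  refine ⟨⟨_, mem_smoothFns.2 hsm⟩, ?_⟩
  filter_upwards [f.eventuallyEq_one] with q hq
  simp [hq]

variable {L} {φ ψ : Jac[N] → ℂ} {p : Jac[N]}

lemma contract_congr {A B : Fin N → (Jac[N] → ℂ) → (Jac[N] → ℂ)}
    (hA : ∀ {φ ψ : Jac[N] → ℂ} i, φ =ᶠ[𝓝 p] ψ → A i φ =ᶠ[𝓝 p] A i ψ)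
    (hB : ∀ {φ ψ : Jac[N] → ℂ} i, φ =ᶠ[𝓝 p] ψ → B i φ =ᶠ[𝓝 p] B i ψ)
    (h : φ =ᶠ[𝓝 p] ψ) : contract L A B φ =ᶠ[𝓝 p] contract L A B ψ := by
  have : ∀ᶠ q in 𝓝 p, ∀ i j, A i (B j φ) q = A i (B j ψ) q :=
    eventually_all.2 fun i => eventually_all.2 fun j => hA i (hB j h)
  filter_upwards [this] with q hq
  simp only [contract, hq]

lemma dU_congr (i : Fin N) (h : φ =ᶠ[𝓝 p] ψ) : dU i φ =ᶠ[𝓝 p] dU i ψ := by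
  filter_upwards [h.eventuallyEq_nhds] with q hq
  rw [dU, dU, hq.fderiv_eq]

lemma dZ_congr (i : Fin N) (h : φ =ᶠ[𝓝 p] ψ) : dZ i φ =ᶠ[𝓝 p] dZ i ψ := wD_congr h _

lemma dZbar_congr (i : Fin N) (h : φ =ᶠ[𝓝 p] ψ) : dZbar i φ =ᶠ[𝓝 p] dZbar i ψ := wDbar_congr h _

lemma casimir_congr (k : ℝ) (h : φ =ᶠ[𝓝 p] ψ) : casimir L k φ p = casimir L k ψ p := by
  have zz := contract_congr (L := L) dZ_congr dZ_congr h
  have bb := contract_congr (L := L) dZbar_congr dZbar_congr h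
  have bz := contract_congr (L := L) dZbar_congr dZ_congr h
  have zu := contract_congr (L := L) dZ_congr dU_congr h
  have bu := contract_congr (L := L) dZbar_congr dU_congr h
  simp only [casimir, laplaceWeight, (wD_congr (wDbar_congr h dirTau) dirTau).eq_of_nhds,
    (wDbar_congr h dirTau).eq_of_nhds, (wDbar_congr zz dirTau).eq_of_nhds,
    (wD_congr bb dirTau).eq_of_nhds, fun i => (wD_congr (dZbar_congr i h) dirTau).eq_of_nhds,
    (contract_congr (L := L) dZbar_congr dZbar_congr zz).eq_of_nhds,
    (contract_congr (L := L) dZbar_congr dZ_congr bz).eq_of_nhds,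
    fun i => (dZbar_congr i zu).eq_of_nhds, bu.eq_of_nhds,
    fun i j => (dZbar_congr i (dZbar_congr j h)).eq_of_nhds, fun i => (dZbar_congr i h).eq_of_nhds]

lemma opH_congr (h : φ =ᶠ[𝓝 p] ψ) : opH L φ =ᶠ[𝓝 p] opH L ψ := by
  filter_upwards [wDbar_congr h dirTau, eventually_all.2 fun i => dZbar_congr i h,
    contract_congr (L := L) dZbar_congr dZbar_congr h] with q h1 h2 h3
  simp only [opH, h1, h2, h3]

lemma opK_congr (h : φ =ᶠ[𝓝 p] ψ) : opK L φ =ᶠ[𝓝 p] opK L ψ := by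
  filter_upwards [eventually_all.2 fun i => dZbar_congr i h,
    contract_congr (L := L) dZbar_congr dZ_congr h] with q h2 h3
  simp only [opK, h2, h3]

/-- The Casimir operator kills the functions which `opH` and `opK` kill near a point. -/
theorem casimir_eq_zero (h : AnalyticAt ℝ φ p) (hH : ∀ᶠ q in 𝓝 p, opH L φ q = 0)
    (hK : ∀ᶠ q in 𝓝 p, opK L φ q = 0) : casimir L (N / 2) φ p = 0 := by
  obtain ⟨ψ, hψ⟩ := exists_smoothFns_eq h
  rw [← casimir_congr _ hψ]
  refine casimir_eq_zero_of_smooth L ψ ?_ ?_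
  · filter_upwards [hH, opH_congr (L := L) hψ] with q h1 h2; rw [h2, h1]
  · filter_upwards [hK, opK_congr (L := L) hψ] with q h1 h2; rw [h2, h1]

lemma AnalyticAt.fderiv_apply (h : AnalyticAt ℝ φ p) (w : Jac[N]) :
    AnalyticAt ℝ (fun q => fderiv ℝ φ q w) p :=
  ((ContinuousLinearMap.apply ℝ ℂ w).analyticAt _).comp h.fderiv

lemma AnalyticAt.wD (h : AnalyticAt ℝ φ p) (w : Jac[N]) : AnalyticAt ℝ (wD w φ) p := by
  unfold _root_.wD
  exact ((h.fderiv_apply w).sub (analyticAt_const.mul (h.fderiv_apply _))).div_const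

lemma AnalyticAt.wDbar (h : AnalyticAt ℝ φ p) (w : Jac[N]) :
    AnalyticAt ℝ (wDbar w φ) p := by
  unfold _root_.wDbar
  exact ((h.fderiv_apply w).add (analyticAt_const.mul (h.fderiv_apply _))).div_const

lemma AnalyticAt.contract {A B : Fin N → (Jac[N] → ℂ) → (Jac[N] → ℂ)}
    (hA : ∀ i {φ : Jac[N] → ℂ}, AnalyticAt ℝ φ p → AnalyticAt ℝ (A i φ) p)
    (hB : ∀ i {φ : Jac[N] → ℂ}, AnalyticAt ℝ φ p → AnalyticAt ℝ (B i φ) p)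
    (h : AnalyticAt ℝ φ p) : AnalyticAt ℝ (contract L A B φ) p := by
  unfold _root_.contract
  exact Finset.analyticAt_fun_sum _ fun i _ => Finset.analyticAt_fun_sum _ fun j _ =>
    analyticAt_const.mul (hA i (hB j h))

lemma continuousAt_casimir (k : ℝ) (h : AnalyticAt ℝ φ p) :
    ContinuousAt (casimir L k φ) p := by
  have hz : ∀ i {φ : Jac[N] → ℂ}, AnalyticAt ℝ φ p → AnalyticAt ℝ (dZ i φ) p := fun i φ h => h.wD _
  have hb : ∀ i {φ : Jac[N] → ℂ}, AnalyticAt ℝ φ p → AnalyticAt ℝ (dZbar i φ) p :=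
    fun i φ h => h.wDbar _
  have hu : ∀ i {φ : Jac[N] → ℂ}, AnalyticAt ℝ φ p → AnalyticAt ℝ (dU i φ) p :=
    fun i φ h => h.fderiv_apply _
  have c1 := ((h.wDbar dirTau).wD dirTau).continuousAt
  have c2 := (h.wDbar dirTau).continuousAt
  have c3 := ((h.contract (L := L) hz hz).wDbar dirTau).continuousAt
  have c4 := ((h.contract (L := L) hb hb).wD dirTau).continuousAt
  have c5 := fun i => ((hb i h).wD dirTau).continuousAt
  have c6 := ((h.contract (L := L) hz hz).contract (L := L) hb hb).continuousAt
  have c7 := ((h.contract (L := L) hb hz).contract (L := L) hb hz).continuousAt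
  have c8 := fun i => (hb i (h.contract (L := L) hz hu)).continuousAt
  have c9 := (h.contract (L := L) hb hu).continuousAt
  have c10 := fun i j => (hb i (hb j h)).continuousAt
  have c11 := fun i => (hb i h).continuousAt
  have cy : ContinuousAt (fun q : Jac[N] => (q.1.im : ℂ)) p := by fun_prop
  have cv : ∀ i, ContinuousAt (fun q : Jac[N] => ((q.2 i).im : ℂ)) p := by
    intro i; fun_prop
  have cs : ∀ {f : Fin N → Jac[N] → ℂ}, (∀ i, ContinuousAt (f i) p) →
      ContinuousAt (fun q => ∑ i, f i q) p := fun hf => tendsto_finsetSum _ fun i _ => hf i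
  have cc : ∀ c : ℂ, ContinuousAt (fun _ : Jac[N] => c) p := fun c => continuousAt_const
  unfold casimir laplaceWeight
  refine ((((((((?_ : ContinuousAt _ p).add ?_).sub ?_).sub ?_).add ?_).sub ?_).add ?_).add ?_)
  · exact (cc _).mul ((((cc _).mul (cy.pow 2)).mul c1).sub ((((cc _).mul cy)).mul c2))
  · exact ((cc _).mul (cy.pow 2)).mul (c3.add c4)
  · exact ((cc _).mul cy).mul (cs fun i => (cv i).mul (c5 i))
  · exact ((cc _).mul (cy.pow 2)).mul (c6.sub c7)
  · exact ((cc _).mul cy).mul (cs fun i => (cv i).mul (c8 i))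
  · exact ((cc _).mul cy).mul c9
  · exact (cc _).mul (cs fun i => cs fun j => ((cv i).mul (cv j)).mul (c10 i j))
  · exact (cc _).mul (cs fun i => (cv i).mul (c11 i))

lemma continuousAt_heisenbergLaplace (e : Fin N → ℝ) (h : AnalyticAt ℝ φ p) :
    ContinuousAt (heisenbergLaplace L e φ) p := by
  have c1 := ((h.wDbar (dirVec e)).wD (dirVec e)).continuousAt
  have c2 := (h.wDbar (dirVec e)).continuousAt
  have cy : ContinuousAt (fun q : Jac[N] => (q.1.im : ℂ)) p := by fun_prop
  have cb : ContinuousAt (fun q : Jac[N] =>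
      ((L.bil (fun i => (q.2 i).im) e : ℝ) : ℂ)) p := by
    unfold EvenLattice.bil; fun_prop
  unfold heisenbergLaplace
  exact (cy.mul c1).add ((continuousAt_const.mul cb).mul c2)

end smooth

/-! ### Derivatives of the terms of the theta series -/

section leibniz

variable {N : ℕ} {φ ψ : Jac[N] → ℂ} {p : Jac[N]}

lemma wD_mul (hφ : DifferentiableAt ℝ φ p) (hψ : DifferentiableAt ℝ ψ p) (w : Jac[N]) :
    wD w (fun q => φ q * ψ q) p = φ p * wD w ψ p + wD w φ p * ψ p := by
  rw [wD, wD, wD, fderiv_fun_mul hφ hψ]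
  simp
  ring

lemma wDbar_mul (hφ : DifferentiableAt ℝ φ p) (hψ : DifferentiableAt ℝ ψ p) (w : Jac[N]) :
    wDbar w (fun q => φ q * ψ q) p = φ p * wDbar w ψ p + wDbar w φ p * ψ p := by
  rw [wDbar, wDbar, wDbar, fderiv_fun_mul hφ hψ]
  simp
  ring

lemma wD_sub (hφ : DifferentiableAt ℝ φ p) (hψ : DifferentiableAt ℝ ψ p) (w : Jac[N]) :
    wD w (fun q => φ q - ψ q) p = wD w φ p - wD w ψ p := by
  rw [wD, wD, wD, fderiv_fun_sub hφ hψ]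
  simp
  ring

lemma wDbar_sub (hφ : DifferentiableAt ℝ φ p) (hψ : DifferentiableAt ℝ ψ p)
    (w : Jac[N]) : wDbar w (fun q => φ q - ψ q) p = wDbar w φ p - wDbar w ψ p := by
  rw [wDbar, wDbar, wDbar, fderiv_fun_sub hφ hψ]
  simp
  ring

lemma wD_const_mul (c : ℂ) (hφ : DifferentiableAt ℝ φ p) (w : Jac[N]) :
    wD w (fun q => c * φ q) p = c * wD w φ p := by
  rw [wD, wD, fderiv_const_mul hφ]
  simp
  ring

lemma wDbar_const_mul (c : ℂ) (hφ : DifferentiableAt ℝ φ p) (w : Jac[N]) :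
    wDbar w (fun q => c * φ q) p = c * wDbar w φ p := by
  rw [wDbar, wDbar, fderiv_const_mul hφ]
  simp
  ring

lemma wDbar_prod {ι : Type*} [DecidableEq ι] (s : Finset ι) {f : ι → Jac[N] → ℂ}
    (hf : ∀ i ∈ s, DifferentiableAt ℝ (f i) p) (w : Jac[N]) :
    wDbar w (fun q => ∏ i ∈ s, f i q) p = ∑ i ∈ s, (∏ j ∈ s.erase i, f j p) * wDbar w (f i) p := by
  rw [wDbar, fderiv_finsetProd hf]
  simp only [sum_apply, smul_apply, smul_eq_mul, mul_sum, ← sum_add_distrib, sum_div, wDbar]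
  exact sum_congr rfl fun i _ => by ring

lemma wD_prod {ι : Type*} [DecidableEq ι] (s : Finset ι) {f : ι → Jac[N] → ℂ}
    (hf : ∀ i ∈ s, DifferentiableAt ℝ (f i) p) (w : Jac[N]) :
    wD w (fun q => ∏ i ∈ s, f i q) p = ∑ i ∈ s, (∏ j ∈ s.erase i, f j p) * wD w (f i) p := by
  rw [wD, fderiv_finsetProd hf]
  simp only [sum_apply, smul_apply, smul_eq_mul, mul_sum, ← sum_sub_distrib, sum_div, wD]
  exact sum_congr rfl fun i _ => by ring

lemma wDbar_holomorphic (h : DifferentiableAt ℂ φ p) (w : Jac[N]) : wDbar w φ p = 0 := by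
  have h1 := (h.hasFDerivAt.restrictScalars ℝ).fderiv
  rw [wDbar, h1]
  simp only [ContinuousLinearMap.coe_restrictScalars', map_smul, smul_eq_mul]
  linear_combination (fderiv ℂ φ p) w / 2 * Complex.I_sq

lemma wD_holomorphic (h : DifferentiableAt ℂ φ p) (w : Jac[N]) :
    wD w φ p = fderiv ℂ φ p w := by
  have h1 := (h.hasFDerivAt.restrictScalars ℝ).fderiv
  rw [wD, h1]
  simp only [ContinuousLinearMap.coe_restrictScalars', map_smul, smul_eq_mul]
  linear_combination -(fderiv ℂ φ p) w / 2 * Complex.I_sq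

end leibniz

namespace EvenLattice

variable {N : ℕ} {L : EvenLattice N} {d m : ℕ} {F : L.AdaptedFrame d m} {l a₀ a : Fin N → ℝ}
  {i : Fin d}

/-- The real-linear form `c₀ Im τ + c ⟨u, Im z⟩`. -/
def dlin (L : EvenLattice N) (c₀ c : ℂ) (u : Fin N → ℝ) : Jac[N] →L[ℝ] ℂ :=
  c₀ • imTau + c • ∑ j, ((∑ i, u i * L.gram i j : ℝ) : ℂ) • imZ j

lemma dlin_apply (c₀ c : ℂ) (u : Fin N → ℝ) (p : Jac[N]) :
    dlin L c₀ c u p = c₀ * p.1.im + c * ((L.bil u fun k => (p.2 k).im : ℝ) : ℂ) := by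
  simp only [dlin, bil, add_apply, smul_apply, sum_apply, imTau_apply, imZ_apply, smul_eq_mul]
  rw [sum_comm (f := fun i j => u i * (L.gram i j : ℝ) * (p.2 j).im)]
  push_cast
  simp only [sum_mul]

variable {φ : Jac[N] → ℂ} {p : Jac[N]} {c₀ c : ℂ} {u : Fin N → ℝ}

lemma dlin_dirVec (b : Fin N → ℝ) : dlin L c₀ c u (dirVec b) = 0 := by
  have : (fun k => ((dirVec b).2 k).im) = 0 := by funext k; simp [dirVec]
  rw [dlin_apply, this, bil_zero_right]
  simp [dirVec]

lemma dlin_I_dirVec (b : Fin N → ℝ) :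
    dlin L c₀ c u (𝕚 • dirVec b) = c * (L.bil u b : ℝ) := by
  have : (fun k => ((𝕚 • dirVec b).2 k).im) = b := by funext k; simp [dirVec]
  rw [dlin_apply, this]
  simp [dirVec]

lemma wD_dlin (h : HasFDerivAt φ (dlin L c₀ c u) p) (b : Fin N → ℝ) :
    wD (dirVec b) φ p = -(𝕚 / 2) * c * (L.bil u b : ℝ) := by
  rw [wD, h.fderiv, dlin_dirVec, dlin_I_dirVec]; ring

lemma wDbar_dlin (h : HasFDerivAt φ (dlin L c₀ c u) p) (b : Fin N → ℝ) :
    wDbar (dirVec b) φ p = 𝕚 / 2 * c * (L.bil u b : ℝ) := by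
  rw [wDbar, h.fderiv, dlin_dirVec, dlin_I_dirVec]; ring

lemma wDbar_tau_dlin (h : HasFDerivAt φ (dlin L c₀ c u) p) :
    wDbar dirTau φ p = 𝕚 / 2 * c₀ := by
  have h1 : (fun k => ((dirTau : Jac[N]).2 k).im) = 0 := by funext k; simp [dirTau]
  have h2 : (fun k => ((𝕚 • dirTau : Jac[N]).2 k).im) = 0 := by
    funext k; simp [dirTau]
  rw [wDbar, h.fderiv, dlin_apply, dlin_apply, h1, h2, bil_zero_right]
  simp [dirTau]
  ring

lemma bil_dir_add_vy (u x : Fin N → ℝ) (p : Jac[N]) :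
    L.bil u (x + vy p) = L.bil u x + (L.bil u fun k => (p.2 k).im) / p.1.im := by
  have : vy p = (p.1.im)⁻¹ • fun k => (p.2 k).im := by
    funext k; simp [vy, div_eq_inv_mul]
  rw [bil_add_right, this, bil_smul_right]
  ring

namespace Side

variable (B : Side F)

/-- The sign of the `i`-th vector, if it is isotropic, is defined at `x + v / y`. -/
def Good (B : Side F) (i : Fin d) (x : Fin N → ℝ) (p : Jac[N]) : Prop :=
  0 < p.1.im ∧ (B.β i ^ 2 = 1 → L.bil (B.dir i) (x + vy p) ≠ 0)

/-- The derivative of `ρ^e` with respect to `⟨e, v⟩`. -/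
def rhoD (B : Side F) (i : Fin d) (x : Fin N → ℝ) (p : Jac[N]) : ℂ :=
  open scoped Classical in
  if B.β i ^ 2 = 1 then 0
  else ((2 / (sqrt (1 - B.β i ^ 2) * sqrt p.1.im) * exp (-(sqrt (π * p.1.im) *
      (L.bil (B.dir i) (x + vy p) / sqrt (1 - B.β i ^ 2))) ^ 2) : ℝ) : ℂ)

variable {B} {x : Fin N → ℝ}

lemma Good.eventually (h : B.Good i x p) : ∀ᶠ q in 𝓝 p, B.Good i x q := by
  have h1 : ∀ᶠ q : Jac[N] in 𝓝 p, 0 < q.1.im :=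
    (by fun_prop : Continuous fun q : Jac[N] => q.1.im).continuousAt.eventually
      (lt_mem_nhds h.1)
  have hc : Continuous fun a : Fin N → ℝ => L.bil (B.dir i) (x + a) := by
    unfold bil; fun_prop
  have h2 : ContinuousAt (fun q : Jac[N] => L.bil (B.dir i) (x + vy q)) p :=
    hc.continuousAt.comp (continuousAt_vy h.1)
  by_cases hi : B.β i ^ 2 = 1
  · filter_upwards [h1, h2.eventually_ne (h.2 hi)] with q hq hq2
    exact ⟨hq, fun _ => hq2⟩
  · filter_upwards [h1] with q hq
    exact ⟨hq, fun h => absurd h hi⟩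

lemma hasFDerivAt_arg (i : Fin d) (x : Fin N → ℝ) (hp : 0 < p.1.im) (D : ℝ) :
    ∃ A : Jac[N] →L[ℝ] ℝ, HasFDerivAt (fun q : Jac[N] =>
      sqrt (π * q.1.im) * (L.bil (B.dir i) (x + vy q) / D)) A p ∧
      ∀ w, A w = sqrt π / (D * sqrt p.1.im) *
        (1 / 2 * (L.bil (B.dir i) x - L.bil (B.dir i) (vy p)) * w.1.im +
          L.bil (B.dir i) fun k => (w.2 k).im) := by
  set im1 : Jac[N] →L[ℝ] ℝ := Complex.imCLM.comp (ContinuousLinearMap.fst ℝ ℂ _)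
    with him1
  set ℓ : Jac[N] →L[ℝ] ℝ := (L.bilin (B.dir i)).toContinuousLinearMap.comp
    (ContinuousLinearMap.pi fun k => Complex.imCLM.comp ((ContinuousLinearMap.proj k).comp
      (ContinuousLinearMap.snd ℝ ℂ _))) with hℓ
  have hℓa : ∀ w, ℓ w = L.bil (B.dir i) fun k => (w.2 k).im := fun w => rfl
  have h1 : HasFDerivAt (fun q : Jac[N] => sqrt q.1.im)
      ((1 / (2 * sqrt p.1.im)) • im1) p := im1.hasFDerivAt.sqrt hp.ne'
  set y := p.1.im with hy
  have hy0 : sqrt y ≠ 0 := (Real.sqrt_pos.2 hp).ne'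
  have hinv := (hasDerivAt_inv hy0).comp_hasFDerivAt p h1
  have h2 := (((h1.mul_const (L.bil (B.dir i) x)).add (ℓ.hasFDerivAt.mul hinv)).const_mul
    (sqrt π / D))
  refine ⟨_, h2.congr_of_eventuallyEq ?_, ?_⟩
  · have h3 : ∀ᶠ q : Jac[N] in 𝓝 p, 0 < q.1.im :=
      (by fun_prop : Continuous fun q : Jac[N] => q.1.im).continuousAt.eventually
        (lt_mem_nhds hp)
    filter_upwards [h3] with q hq
    have hq0 : sqrt q.1.im ≠ 0 := (Real.sqrt_pos.2 hq).ne'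
    have hq1 := Real.mul_self_sqrt hq.le
    rw [bil_dir_add_vy, Real.sqrt_mul Real.pi_pos.le]
    simp only [Pi.add_apply, Pi.mul_apply, Function.comp, hℓa]
    conv_lhs => rw [show q.1.im = sqrt q.1.im * sqrt q.1.im from hq1.symm]
    rw [Real.sqrt_mul_self (Real.sqrt_nonneg _)]
    field_simp
  · intro w
    have hv : L.bil (B.dir i) (vy p) = ℓ p / y := by
      have : vy p = y⁻¹ • fun k => (p.2 k).im := by
        funext k; simp [vy, div_eq_inv_mul, hy]
      rw [this, bil_smul_right, hℓa]; ring
    have hy1 := Real.sq_sqrt hp.le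
    simp only [smul_apply, add_apply, smul_eq_mul, Function.comp, hv, ← hℓa]
    have : im1 w = w.1.im := rfl
    have hy2 : y = sqrt y ^ 2 := hy1.symm
    rw [this]
    simp only [← hy]
    generalize sqrt y = t at hy0 hy2 ⊢
    rw [hy2]
    by_cases hD : D = 0
    · simp [hD]
    field_simp
    ring

lemma hasFDerivAt_rhoC (h : B.Good i x p) : HasFDerivAt (B.rhoC i x)
    (dlin L (1 / 2 * ((L.bil (B.dir i) x - L.bil (B.dir i) (vy p) : ℝ) : ℂ) * B.rhoD i x p)
      (B.rhoD i x p) (B.dir i)) p := by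
  by_cases hi : B.β i ^ 2 = 1
  · have h1 : B.rhoC i x =ᶠ[𝓝 p] fun _ => B.rhoC i x p := by
      have hc : Continuous fun a : Fin N → ℝ => L.bil (B.dir i) (x + a) := by
        unfold bil; fun_prop
      have h2 : ContinuousAt (fun q : Jac[N] => L.bil (B.dir i) (x + vy q)) p :=
        hc.continuousAt.comp (continuousAt_vy h.1)
      rcases lt_or_gt_of_ne (h.2 hi) with hs | hs
      · filter_upwards [h2.eventually (gt_mem_nhds hs)] with q hq
        rw [rhoC, rhoC, if_pos hi, if_pos hi, Real.sign_of_neg hq, Real.sign_of_neg hs]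
      · filter_upwards [h2.eventually (lt_mem_nhds hs)] with q hq
        rw [rhoC, rhoC, if_pos hi, if_pos hi, Real.sign_of_pos hq, Real.sign_of_pos hs]
    have h3 : dlin L (1 / 2 * ((L.bil (B.dir i) x - L.bil (B.dir i) (vy p) : ℝ) : ℂ) *
        B.rhoD i x p) (B.rhoD i x p) (B.dir i) = 0 := by
      ext w <;> simp [dlin, rhoD, hi]
    rw [h3]
    exact (hasFDerivAt_const _ _).congr_of_eventuallyEq h1
  · obtain ⟨A, hA, hAw⟩ := hasFDerivAt_arg (B := B) i x h.1 (sqrt (1 - B.β i ^ 2))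
    have h1 := (hasDerivAt_rerf _).comp_hasFDerivAt p hA
    have h2 := (Complex.ofRealCLM.hasFDerivAt.comp p h1)
    have h3 : B.rhoC i x = fun q => ((rerf (sqrt (π * q.1.im) *
        (L.bil (B.dir i) (x + vy q) / sqrt (1 - B.β i ^ 2))) : ℝ) : ℂ) := by
      funext q
      rw [rhoC, if_neg hi, cerf_ofReal]
    rw [h3]
    refine h2.congr_fderiv ?_
    refine ContinuousLinearMap.ext fun w => ?_
    rw [dlin_apply]
    simp only [ContinuousLinearMap.comp_apply, smul_apply, smul_eq_mul,
      Complex.ofRealCLM_apply, hAw, rhoD, if_neg hi]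
    have hpi : sqrt π ≠ 0 := (Real.sqrt_pos.2 Real.pi_pos).ne'
    have hpi' : ((sqrt π : ℝ) : ℂ) ≠ 0 := by exact_mod_cast hpi
    push_cast
    field_simp

/-- The second derivative of `ρ^e` with respect to `⟨e, v⟩`. -/
def rhoDD (B : Side F) (i : Fin d) (x : Fin N → ℝ) (p : Jac[N]) : ℂ :=
  -((2 * π * L.bil (B.dir i) (x + vy p) / (1 - B.β i ^ 2) : ℝ) : ℂ) * B.rhoD i x p

lemma hasFDerivAt_rhoD (h : B.Good i x p) :
    ∃ c₀, HasFDerivAt (B.rhoD i x) (dlin L c₀ (B.rhoDD i x p) (B.dir i)) p := by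
  by_cases hi : B.β i ^ 2 = 1
  · refine ⟨0, ?_⟩
    have h1 : B.rhoD i x = fun _ => 0 := by funext q; rw [rhoD, if_pos hi]
    have h3 : dlin L 0 (B.rhoDD i x p) (B.dir i) = 0 := by
      ext w <;> simp [dlin, rhoDD, rhoD, hi]
    rw [h1, h3]
    exact hasFDerivAt_const _ _
  · set D := sqrt (1 - B.β i ^ 2) with hD
    have hD1 : 0 < 1 - B.β i ^ 2 := sub_pos.2 (lt_of_le_of_ne (B.sq_le i) hi)
    have hD0 : 0 < D := Real.sqrt_pos.2 hD1
    have hDsq : D ^ 2 = 1 - B.β i ^ 2 := Real.sq_sqrt hD1.le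
    obtain ⟨A, hA, hAw⟩ := hasFDerivAt_arg (B := B) i x h.1 D
    set u := sqrt (π * p.1.im) * (L.bil (B.dir i) (x + vy p) / D) with hu
    have hexp : HasDerivAt (fun t : ℝ => exp (-t ^ 2)) (-(2 * u) * exp (-u ^ 2)) u := by
      have := ((hasDerivAt_id u).pow 2).neg.exp
      simp only [id, Nat.cast_ofNat] at this
      refine this.congr_deriv ?_
      simp; ring
    set im1 : Jac[N] →L[ℝ] ℝ := Complex.imCLM.comp (ContinuousLinearMap.fst ℝ ℂ _)
      with him1
    have hs : HasFDerivAt (fun q : Jac[N] => sqrt q.1.im)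
        ((1 / (2 * sqrt p.1.im)) • im1) p := im1.hasFDerivAt.sqrt h.1.ne'
    have hy0 : sqrt p.1.im ≠ 0 := (Real.sqrt_pos.2 h.1).ne'
    have h1 := ((((hasDerivAt_inv hy0).comp_hasFDerivAt p hs).const_mul (2 / D)).mul
      (hexp.comp_hasFDerivAt p hA))
    have h2 := (Complex.ofRealCLM.hasFDerivAt.comp p h1)
    have h3 : B.rhoD i x = fun q => ((2 / D * (sqrt q.1.im)⁻¹ * exp
        (-(sqrt (π * q.1.im) * (L.bil (B.dir i) (x + vy q) / D)) ^ 2) : ℝ) : ℂ) := by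
      funext q
      rw [rhoD, if_neg hi]
      rw [← hD, div_mul_eq_div_div, div_eq_mul_inv (2 / D)]
    set ε := exp (-u ^ 2) with hε
    set t := sqrt p.1.im with ht
    set X := L.bil (B.dir i) x - L.bil (B.dir i) (vy p) with hX
    refine ⟨((-(1 / (t ^ 3 * D) * ε) - 2 * u / (t ^ 2 * D ^ 2) * ε * sqrt π * X * 1 : ℝ) : ℂ), ?_⟩
    rw [h3]
    refine h2.congr_fderiv ?_
    refine ContinuousLinearMap.ext fun w => ?_
    have hu' : u = sqrt π * t * (L.bil (B.dir i) (x + vy p) / D) := by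
      rw [hu, Real.sqrt_mul Real.pi_pos.le]
    have hpi : (sqrt π) ^ 2 = π := Real.sq_sqrt Real.pi_pos.le
    have him : im1 w = w.1.im := rfl
    rw [dlin_apply]
    simp only [ContinuousLinearMap.comp_apply, smul_apply, smul_eq_mul,
      add_apply, Complex.ofRealCLM_apply, hAw, rhoDD, rhoD, if_neg hi, him,
      Function.comp, ← hD, ← hu, ← ht, ← hε]
    rw [← Complex.ofReal_neg, ← Complex.ofReal_mul, ← Complex.ofReal_mul, ← Complex.ofReal_mul,
      ← Complex.ofReal_add]
    congr 1
    rw [← hDsq, show 2 * π * L.bil (B.dir i) (x + vy p) / D ^ 2 =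
      2 * sqrt π ^ 2 * L.bil (B.dir i) (x + vy p) / D ^ 2 by rw [hpi]]
    clear_value ε X
    rw [hu']
    field_simp
    ring

end Side

variable {N : ℕ} {L : EvenLattice N} {d m : ℕ} {F : L.AdaptedFrame d m} {l : Fin N → ℝ}
  {i j : Fin d} {p : Jac[N]}

lemma differentiable_qexp (x : Fin N → ℝ) : Differentiable ℂ (qexp L x) :=
  (Side.contDiff_qexp (L := L) (n := 1) x).differentiable (by simp)

lemma wDbar_qexp (x : Fin N → ℝ) (w : Jac[N]) : wDbar w (qexp L x) p = 0 :=
  wDbar_holomorphic (differentiable_qexp x p) w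

lemma wD_qexp (x b : Fin N → ℝ) :
    wD (dirVec b) (qexp L x) p = 2 * π * 𝕚 * (L.bil x b : ℝ) * qexp L x p := by
  rw [wD_holomorphic (differentiable_qexp x p)]
  have h1 : HasDerivAt (fun t : ℂ => p + t • (dirVec b : Jac[N])) (dirVec b) 0 := by
    have := ((hasDerivAt_id (0 : ℂ)).smul_const (dirVec b : Jac[N])).const_add p
    simpa using this
  have h2 : HasDerivAt (fun t : ℂ => qexp L x (p + t • (dirVec b : Jac[N])))
      (fderiv ℂ (qexp L x) p (dirVec b)) 0 := by
    have h3 : HasFDerivAt (qexp L x) (fderiv ℂ (qexp L x) p)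
        (p + (0 : ℂ) • (dirVec b : Jac[N])) := by
      rw [zero_smul, add_zero]; exact (differentiable_qexp x p).hasFDerivAt
    exact h3.comp_hasDerivAt (0 : ℂ) h1
  have h4 : (fun t : ℂ => qexp L x (p + t • (dirVec b : Jac[N]))) =
      fun t => qexp L x p * Complex.exp (2 * π * 𝕚 * (L.bil x b : ℝ) * t) := by
    funext t
    have hz : (p + t • (dirVec b : Jac[N])).2 = p.2 + t • toC b := by
      funext k; simp [dirVec, toC]
    have hτ : (p + t • (dirVec b : Jac[N])).1 = p.1 := by simp [dirVec]
    rw [qexp, qexp, hz, hτ, bil_add_right, bil_smul_right, bil_toC, ee, ee, ← Complex.exp_add]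
    congr 1; ring
  rw [h4] at h2
  have h5 : HasDerivAt (fun t : ℂ => qexp L x p * Complex.exp (2 * π * 𝕚 * (L.bil x b : ℝ) * t))
      (qexp L x p * (2 * π * 𝕚 * (L.bil x b : ℝ))) 0 := by
    have := (((hasDerivAt_id (0 : ℂ)).const_mul
      (2 * π * 𝕚 * (L.bil x b : ℝ))).cexp).const_mul (qexp L x p)
    simpa using this
  rw [h2.unique h5]; ring

namespace Side

/-- A factor of the kernel of the theta series. -/
def chi (B B' : Side F) (x : Fin N → ℝ) (i : Fin d) (p : Jac[N]) : ℂ := B.rhoC i x p - B'.rhoC i x p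

/-- The derivative of a factor of the kernel with respect to `v` in direction `b`. -/
def chiD (B B' : Side F) (x b : Fin N → ℝ) (i : Fin d) (p : Jac[N]) : ℂ :=
  B.rhoD i x p * (L.bil (B.dir i) b : ℝ) - B'.rhoD i x p * (L.bil (B'.dir i) b : ℝ)

/-- The second derivative of a factor of the kernel with respect to `v` in direction `b`. -/
def chiDD (B B' : Side F) (x b : Fin N → ℝ) (i : Fin d) (p : Jac[N]) : ℂ :=
  B.rhoDD i x p * (L.bil (B.dir i) b : ℝ) ^ 2 - B'.rhoDD i x p * (L.bil (B'.dir i) b : ℝ) ^ 2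

/-- All signs of the kernel are defined. -/
def AllGood (B B' : Side F) (x : Fin N → ℝ) (p : Jac[N]) : Prop :=
  0 < p.1.im ∧ ∀ i, B.Good i x p ∧ B'.Good i x p

variable {B B' : Side F} {x b : Fin N → ℝ}

lemma summand_eq : summand B B' x = fun p => (∏ i, chi B B' x i p) * qexp L x p := rfl

lemma AllGood.eventually (h : AllGood B B' x p) : ∀ᶠ q in 𝓝 p, AllGood B B' x q := by
  have h1 : ∀ᶠ q : Jac[N] in 𝓝 p, 0 < q.1.im :=
    (by fun_prop : Continuous fun q : Jac[N] => q.1.im).continuousAt.eventually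
      (lt_mem_nhds h.1)
  filter_upwards [h1, eventually_all.2 fun i => (h.2 i).1.eventually.and (h.2 i).2.eventually]
    with q hq hq2
  exact ⟨hq, hq2⟩

lemma allGood_of_regular (hp : p ∈ regular B B' l) (ν : Fin N → ℤ) :
    AllGood B B' (coset l ν) p :=
  ⟨hp.1, fun i => ⟨⟨hp.1, fun h => (not_onWall_iff h).1 (hp.2 i).1 ν⟩,
    ⟨hp.1, fun h => (not_onWall_iff h).1 (hp.2 i).2 ν⟩⟩⟩

lemma AllGood.differentiableAt_chi (h : AllGood B B' x p) (i : Fin d) :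
    DifferentiableAt ℝ (chi B B' x i) p :=
  (hasFDerivAt_rhoC (h.2 i).1).differentiableAt.sub (hasFDerivAt_rhoC (h.2 i).2).differentiableAt

lemma AllGood.wDbar_chi (h : AllGood B B' x p) (i : Fin d) (b : Fin N → ℝ) :
    wDbar (dirVec b) (chi B B' x i) p = 𝕚 / 2 * chiD B B' x b i p := by
  have h1 := hasFDerivAt_rhoC (h.2 i).1
  have h2 := hasFDerivAt_rhoC (h.2 i).2
  unfold chi
  rw [wDbar_sub h1.differentiableAt h2.differentiableAt, wDbar_dlin h1, wDbar_dlin h2, chiD]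
  ring

lemma AllGood.wD_chi (h : AllGood B B' x p) (i : Fin d) (b : Fin N → ℝ) :
    wD (dirVec b) (chi B B' x i) p = -(𝕚 / 2) * chiD B B' x b i p := by
  have h1 := hasFDerivAt_rhoC (h.2 i).1
  have h2 := hasFDerivAt_rhoC (h.2 i).2
  unfold chi
  rw [wD_sub h1.differentiableAt h2.differentiableAt, wD_dlin h1, wD_dlin h2, chiD]
  ring

lemma AllGood.wDbar_tau_chi (h : AllGood B B' x p) (i : Fin d) :
    wDbar dirTau (chi B B' x i) p = 𝕚 / 4 *
      (((L.bil (B.dir i) x - L.bil (B.dir i) (vy p) : ℝ) : ℂ) * B.rhoD i x p -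
        ((L.bil (B'.dir i) x - L.bil (B'.dir i) (vy p) : ℝ) : ℂ) * B'.rhoD i x p) := by
  have h1 := hasFDerivAt_rhoC (h.2 i).1
  have h2 := hasFDerivAt_rhoC (h.2 i).2
  unfold chi
  rw [wDbar_sub h1.differentiableAt h2.differentiableAt, wDbar_tau_dlin h1, wDbar_tau_dlin h2]
  ring

lemma AllGood.hasDeriv_chiD (h : AllGood B B' x p) (i : Fin d) (b : Fin N → ℝ) :
    DifferentiableAt ℝ (chiD B B' x b i) p ∧
    wDbar (dirVec b) (chiD B B' x b i) p = 𝕚 / 2 * chiDD B B' x b i p ∧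
    wD (dirVec b) (chiD B B' x b i) p = -(𝕚 / 2) * chiDD B B' x b i p := by
  obtain ⟨c, h1⟩ := hasFDerivAt_rhoD (h.2 i).1
  obtain ⟨c', h2⟩ := hasFDerivAt_rhoD (h.2 i).2
  have e : chiD B B' x b i = fun q => ((L.bil (B.dir i) b : ℝ) : ℂ) * B.rhoD i x q -
      ((L.bil (B'.dir i) b : ℝ) : ℂ) * B'.rhoD i x q := by
    funext q; rw [chiD]; ring
  have d1 := h1.differentiableAt.const_mul ((L.bil (B.dir i) b : ℝ) : ℂ)
  have d2 := h2.differentiableAt.const_mul ((L.bil (B'.dir i) b : ℝ) : ℂ)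
  rw [e]
  refine ⟨d1.sub d2, ?_, ?_⟩
  · rw [wDbar_sub d1 d2, wDbar_const_mul _ h1.differentiableAt,
      wDbar_const_mul _ h2.differentiableAt, wDbar_dlin h1, wDbar_dlin h2, chiDD]
    ring
  · rw [wD_sub d1 d2, wD_const_mul _ h1.differentiableAt,
      wD_const_mul _ h2.differentiableAt, wD_dlin h1, wD_dlin h2, chiDD]
    ring

lemma differentiableAt_qexp (x : Fin N → ℝ) (p : Jac[N]) :
    DifferentiableAt ℝ (qexp L x) p := (differentiable_qexp x p).restrictScalars ℝ

/-- The product of the other factors with the exponential. -/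
def cofac (B B' : Side F) (x : Fin N → ℝ) (j : Fin d) (p : Jac[N]) : ℂ :=
  (∏ i ∈ Finset.univ.erase j, chi B B' x i p) * qexp L x p

lemma AllGood.differentiableAt_prod (h : AllGood B B' x p) (s : Finset (Fin d)) :
    DifferentiableAt ℝ (fun q => ∏ i ∈ s, chi B B' x i q) p :=
  (HasFDerivAt.finsetProd fun i _ => (h.differentiableAt_chi i).hasFDerivAt).differentiableAt

lemma AllGood.wDbar_summand (h : AllGood B B' x p) (w : Jac[N]) :
    wDbar w (summand B B' x) p = ∑ i, cofac B B' x i p * wDbar w (chi B B' x i) p := by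
  rw [summand_eq, wDbar_mul (h.differentiableAt_prod _) (differentiableAt_qexp x p), wDbar_qexp,
    wDbar_prod _ fun i _ => h.differentiableAt_chi i, mul_zero, zero_add, sum_mul]
  exact sum_congr rfl fun i _ => by rw [cofac]; ring

lemma AllGood.wDbar_vec_summand (h : AllGood B B' x p)
    (hb : ∀ i, i ≠ j → L.bil (B.dir i) b = 0 ∧ L.bil (B'.dir i) b = 0) :
    wDbar (dirVec b) (summand B B' x) p = cofac B B' x j p * (𝕚 / 2 * chiD B B' x b j p) := by
  rw [h.wDbar_summand, Finset.sum_eq_single j]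
  · rw [h.wDbar_chi]
  · intro i _ hij
    rw [h.wDbar_chi, chiD, (hb i hij).1, (hb i hij).2]; simp
  · simp

lemma AllGood.cofac_deriv (h : AllGood B B' x p)
    (hb : ∀ i, i ≠ j → L.bil (B.dir i) b = 0 ∧ L.bil (B'.dir i) b = 0) :
    DifferentiableAt ℝ (cofac B B' x j) p ∧ wDbar (dirVec b) (cofac B B' x j) p = 0 ∧
    wD (dirVec b) (cofac B B' x j) p = 2 * π * 𝕚 * (L.bil x b : ℝ) * cofac B B' x j p := by
  have hd := h.differentiableAt_prod (Finset.univ.erase j)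
  unfold cofac
  have z : ∀ i ∈ Finset.univ.erase j, chiD B B' x b i p = 0 := by
    intro i hi
    have := hb i (Finset.ne_of_mem_erase hi)
    rw [chiD, this.1, this.2]; simp
  refine ⟨hd.mul (differentiableAt_qexp x p), ?_, ?_⟩
  · rw [wDbar_mul hd (differentiableAt_qexp x p), wDbar_qexp,
      wDbar_prod _ fun i _ => h.differentiableAt_chi i, sum_eq_zero]
    · simp
    · intro i hi; rw [h.wDbar_chi, z i hi]; simp
  · rw [wD_mul hd (differentiableAt_qexp x p), wD_qexp,
      wD_prod _ fun i _ => h.differentiableAt_chi i, sum_eq_zero]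
    · ring
    · intro i hi; rw [h.wD_chi, z i hi]; simp

lemma AllGood.second_deriv (h : AllGood B B' x p)
    (hb : ∀ i, i ≠ j → L.bil (B.dir i) b = 0 ∧ L.bil (B'.dir i) b = 0) :
    wDbar (dirVec b) (wDbar (dirVec b) (summand B B' x)) p =
      cofac B B' x j p * (-(1 / 4) * chiDD B B' x b j p) ∧
    wD (dirVec b) (wDbar (dirVec b) (summand B B' x)) p = cofac B B' x j p *
      (-π * (L.bil x b : ℝ) * chiD B B' x b j p + 1 / 4 * chiDD B B' x b j p) := by
  have e : wDbar (dirVec b) (summand B B' x) =ᶠ[𝓝 p] fun q =>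
      cofac B B' x j q * (𝕚 / 2 * chiD B B' x b j q) := by
    filter_upwards [h.eventually] with q hq using hq.wDbar_vec_summand hb
  obtain ⟨c1, c2, c3⟩ := h.cofac_deriv hb
  obtain ⟨d1, d2, d3⟩ := h.hasDeriv_chiD j b
  have d0 := d1.const_mul (𝕚 / 2)
  refine ⟨?_, ?_⟩
  · rw [(wDbar_congr e _).self_of_nhds, wDbar_mul c1 d0, wDbar_const_mul _ d1, c2, d2]
    linear_combination cofac B B' x j p * chiDD B B' x b j p / 4 * Complex.I_sq
  · rw [(wD_congr e _).self_of_nhds, wD_mul c1 d0, wD_const_mul _ d1, c3, d3]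
    linear_combination (cofac B B' x j p * (-chiDD B B' x b j p / 4 +
      π * (L.bil x b : ℝ) * chiD B B' x b j p)) * Complex.I_sq

lemma im_eq_smul_vy (hp : 0 < p.1.im) : (fun k => (p.2 k).im) = p.1.im • vy p := by
  funext k; simp [vy]; field_simp

lemma AllGood.heisenbergLaplace_summand (h : AllGood B B' x p)
    (hb : ∀ i, i ≠ j → L.bil (B.dir i) b = 0 ∧ L.bil (B'.dir i) b = 0) :
    heisenbergLaplace L b (summand B B' x) p = cofac B B' x j p * p.1.im *
      (1 / 4 * chiDD B B' x b j p - π * (L.bil b (x + vy p) : ℝ) * chiD B B' x b j p) := by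
  rw [heisenbergLaplace, (h.second_deriv hb).2, h.wDbar_vec_summand hb, im_eq_smul_vy h.1,
    bil_smul_left, bil_add_right, L.bil_comm b x, L.bil_comm b (vy p)]
  push_cast
  linear_combination (cofac B B' x j p * π * p.1.im * (L.bil (vy p) b : ℝ) *
    chiD B B' x b j p) * Complex.I_sq

lemma rhoDD_mul (i : Fin d) (x : Fin N → ℝ) (p : Jac[N]) :
    B.rhoDD i x p * (L.bil (B.dir i) (B.dir i) : ℝ) =
      4 * π * (L.bil (B.dir i) (x + vy p) : ℝ) * B.rhoD i x p := by
  by_cases hi : B.β i ^ 2 = 1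
  · simp [rhoDD, rhoD, hi]
  · have : (1 : ℂ) - (B.β i : ℂ) ^ 2 ≠ 0 := by
      intro h0; apply hi
      exact_mod_cast (sub_eq_zero.1 h0).symm
    rw [rhoDD, bil_dir_dir]
    push_cast
    field_simp
    ring

end Side

end EvenLattice

section coordinates

variable {N : ℕ} {φ : Jac[N] → ℂ} {p : Jac[N]}

lemma dirVec_eq_sum (b : Fin N → ℝ) : (dirVec b : Jac[N]) = ∑ i, b i • dirZ i := by
  refine Prod.ext ?_ ?_
  · simp [dirVec, dirZ, Prod.fst_sum]
  · funext k
    simp [dirVec, dirZ, Prod.snd_sum, Finset.sum_apply, Pi.single_apply]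

lemma wDbar_dirVec (b : Fin N → ℝ) (φ : Jac[N] → ℂ) (p : Jac[N]) :
    wDbar (dirVec b) φ p = ∑ i, (b i : ℂ) * dZbar i φ p := by
  simp only [wDbar, dZbar, dirVec_eq_sum, Finset.smul_sum, map_sum, smul_comm 𝕚 (b _),
    map_smul, Complex.real_smul, mul_sum, ← sum_add_distrib, sum_div]
  exact sum_congr rfl fun i _ => by ring

lemma wD_dirVec (b : Fin N → ℝ) (φ : Jac[N] → ℂ) (p : Jac[N]) :
    wD (dirVec b) φ p = ∑ i, (b i : ℂ) * dZ i φ p := by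
  simp only [wD, dZ, dirVec_eq_sum, Finset.smul_sum, map_sum, smul_comm 𝕚 (b _),
    map_smul, Complex.real_smul, mul_sum, ← sum_sub_distrib, sum_div]
  exact sum_congr rfl fun i _ => by ring

lemma wDbar_sum_mul {ι : Type*} [Fintype ι] (c : ι → ℂ) {f : ι → Jac[N] → ℂ}
    (hf : ∀ i, DifferentiableAt ℝ (f i) p) (w : Jac[N]) :
    wDbar w (fun q => ∑ i, c i * f i q) p = ∑ i, c i * wDbar w (f i) p := by
  rw [wDbar, fderiv_fun_sum fun i _ => (hf i).const_mul (c i)]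
  simp only [fun i => fderiv_const_mul (hf i) (c i), sum_apply,
    smul_apply, smul_eq_mul, mul_sum, ← sum_add_distrib,
    sum_div, wDbar]
  exact sum_congr rfl fun i _ => by ring

lemma wD_wDbar_comm (h : AnalyticAt ℝ φ p) (w w' : Jac[N]) :
    wD w (wDbar w' φ) p = wDbar w' (wD w φ) p := by
  obtain ⟨ψ, hψ⟩ := exists_smoothFns_eq h
  rw [← (wD_congr (wDbar_congr hψ w') w).self_of_nhds,
    ← (wDbar_congr (wD_congr hψ w) w').self_of_nhds]
  have := congrFun (congrArg Subtype.val (LinearMap.congr_fun (wirt_wirtBar_comm w w') ψ)) p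
  simpa only [Module.End.mul_apply, wirt_apply, wirtBar_apply] using this

lemma wDbar_wDbar_dirVec (h : AnalyticAt ℝ φ p) (b : Fin N → ℝ) :
    wDbar (dirVec b) (wDbar (dirVec b) φ) p =
      ∑ i, ∑ j, (b i : ℂ) * b j * dZbar i (dZbar j φ) p := by
  rw [wDbar_dirVec]
  refine sum_congr rfl fun i _ => ?_
  have : wDbar (dirVec b) φ = fun q => ∑ j, (b j : ℂ) * dZbar j φ q := by
    funext q; exact wDbar_dirVec b φ q
  rw [this, dZbar, wDbar_sum_mul (f := fun j => dZbar j φ) _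
    fun j => (h.wDbar (dirZ j)).differentiableAt, mul_sum]
  exact sum_congr rfl fun j _ => by rw [mul_assoc]

lemma wD_wDbar_dirVec (h : AnalyticAt ℝ φ p) (b : Fin N → ℝ) :
    wD (dirVec b) (wDbar (dirVec b) φ) p = ∑ i, ∑ j, (b i : ℂ) * b j * dZbar i (dZ j φ) p := by
  rw [wD_wDbar_comm h, wDbar_dirVec]
  refine sum_congr rfl fun i _ => ?_
  have : wD (dirVec b) φ = fun q => ∑ j, (b j : ℂ) * dZ j φ q := by
    funext q; exact wD_dirVec b φ q
  rw [this, dZbar, wDbar_sum_mul (f := fun j => dZ j φ) _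
    fun j => (h.wD (dirZ j)).differentiableAt, mul_sum]
  exact sum_congr rfl fun j _ => by rw [mul_assoc]

end coordinates

namespace EvenLattice

variable {N : ℕ} {L : EvenLattice N} {d m : ℕ} {F : L.AdaptedFrame d m} {l : Fin N → ℝ}
  {i j : Fin d} {φ : Jac[N] → ℂ} {p : Jac[N]}

namespace AdaptedFrame

lemma invL_eq (F : L.AdaptedFrame d m) (i j : Fin N) : invL L i j =
    1 / (2 * π * 𝕚) * ∑ k, ((sgn k * F.vec k i * F.vec k j : ℝ) : ℂ) := by
  set A : Matrix (Fin N) (Fin N) ℝ := Matrix.of fun i j => ∑ k, sgn k * F.vec k i * F.vec k j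
    with hA
  have h1 : A * L.mat = 1 := by
    rw [← Matrix.mulVec_injective.eq_iff]
    funext x
    rw [← Matrix.mulVec_mulVec, Matrix.one_mulVec]
    conv_rhs => rw [F.expand x]
    funext i
    simp only [hA, Matrix.mulVec, dotProduct, Matrix.of_apply, Finset.sum_apply, Pi.smul_apply,
      smul_eq_mul, sum_mul]
    rw [sum_comm]
    refine sum_congr rfl fun k _ => ?_
    rw [bil, mul_sum, sum_mul]
    refine sum_congr rfl fun j _ => ?_
    simp only [EvenLattice.mat, Matrix.smul_apply, Matrix.map_apply, smul_eq_mul, mul_sum, sum_mul]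
    refine sum_congr rfl fun j' _ => ?_
    ring
  have h2 : A.map (fun a : ℝ => (a : ℂ)) * L.mat.map (fun a : ℝ => (a : ℂ)) = 1 := by
    have := congrArg (fun M : Matrix (Fin N) (Fin N) ℝ => M.map (Complex.ofRealHom)) h1
    rw [Matrix.map_mul, Matrix.map_one _ (map_zero _) (map_one _)] at this
    exact this
  have hpi : (2 * π * 𝕚 : ℂ) ≠ 0 := Complex.two_pi_I_ne_zero
  have h3 : invL L = (1 / (2 * π * 𝕚 : ℂ)) • A.map (fun a : ℝ => (a : ℂ)) := by
    rw [invL]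
    refine Matrix.inv_eq_left_inv ?_
    rw [Matrix.smul_mul, Matrix.mul_smul, h2, smul_smul, one_div, inv_mul_cancel₀ hpi, one_smul]
  rw [h3]
  simp [hA]

lemma sum_im_mul (F : L.AdaptedFrame d m) (φ : Jac[N] → ℂ) (p : Jac[N]) :
    ∑ i, ((p.2 i).im : ℂ) * dZbar i φ p =
      ∑ k, ((sgn k / 2 * L.bil (F.vec k) (fun i => (p.2 i).im) : ℝ) : ℂ) *
        wDbar (dirVec (F.vec k)) φ p := by
  have := F.expand fun i => (p.2 i).im
  simp only [wDbar_dirVec, mul_sum]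
  rw [sum_comm]
  refine sum_congr rfl fun i _ => ?_
  conv_lhs => rw [congrFun this i]
  simp only [Finset.sum_apply, Pi.smul_apply, smul_eq_mul]
  push_cast
  rw [sum_mul]
  exact sum_congr rfl fun k _ => by ring

lemma opK_eq (F : L.AdaptedFrame d m) (h : AnalyticAt ℝ φ p) : opK L φ p =
    ∑ k, (sgn k : ℂ) / (4 * π * 𝕚) * heisenbergLaplace L (F.vec k) φ p := by
  have hpi : (π : ℂ) ≠ 0 := by exact_mod_cast Real.pi_ne_zero
  have hc : contract L dZbar dZ φ p = ∑ k, (sgn k : ℂ) / (2 * π * 𝕚) *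
      wD (dirVec (F.vec k)) (wDbar (dirVec (F.vec k)) φ) p := by
    simp only [contract, F.invL_eq, wD_wDbar_dirVec h, mul_sum, sum_mul]
    rw [sum_congr rfl fun i _ => sum_comm, sum_comm]
    refine sum_congr rfl fun k _ => sum_congr rfl fun i _ =>
      sum_congr rfl fun j _ => ?_
    push_cast; ring
  rw [opK, hc, F.sum_im_mul, mul_sum, mul_sum, ← sum_add_distrib]
  refine sum_congr rfl fun k _ => ?_
  rw [heisenbergLaplace, L.bil_comm (fun i => (p.2 i).im)]
  push_cast
  field_simp
  ring

lemma opH_eq (F : L.AdaptedFrame d m) (h : AnalyticAt ℝ φ p) : opH L φ p =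
    (p.1.im : ℂ) * wDbar dirTau φ p +
    ∑ k, (sgn k : ℂ) * ((L.bil (F.vec k) (fun i => (p.2 i).im) : ℝ) / 2 *
      wDbar (dirVec (F.vec k)) φ p - (p.1.im : ℂ) / (8 * π * 𝕚) *
        wDbar (dirVec (F.vec k)) (wDbar (dirVec (F.vec k)) φ) p) := by
  have hpi : (π : ℂ) ≠ 0 := by exact_mod_cast Real.pi_ne_zero
  have hc : contract L dZbar dZbar φ p = ∑ k, (sgn k : ℂ) / (2 * π * 𝕚) *
      wDbar (dirVec (F.vec k)) (wDbar (dirVec (F.vec k)) φ) p := by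
    simp only [contract, F.invL_eq, wDbar_wDbar_dirVec h, mul_sum, sum_mul]
    rw [sum_congr rfl fun i _ => sum_comm, sum_comm]
    refine sum_congr rfl fun k _ => sum_congr rfl fun i _ =>
      sum_congr rfl fun j _ => ?_
    push_cast; ring
  rw [opH, hc, F.sum_im_mul, add_sub_assoc, mul_sum, mul_sum, ← sum_sub_distrib]
  congr 1
  refine sum_congr rfl fun k _ => ?_
  push_cast
  field_simp
  ring

end AdaptedFrame

namespace Side

variable {B B' : Side F} {x b : Fin N → ℝ}

lemma bil_dir_w (i : Fin d) (k : Fin m) : L.bil (B.dir i) (F.w k) = 0 := by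
  rw [dir, bil_add_left, bil_smul_left, F.nw, F.gw]; ring

lemma bil_dir_n (i j : Fin d) : L.bil (B.dir i) (F.n j) = if i = j then -2 else 0 := by
  rw [L.bil_comm, bil_n_dir]; simp only [eq_comm]

lemma bil_dir_g (i j : Fin d) : L.bil (B.dir i) (F.g j) = if i = j then 2 * B.β i else 0 := by
  rw [dir, bil_add_left, bil_smul_left, F.ng, F.gg]; split_ifs <;> ring

lemma AllGood.wDbar_eq_zero (h : AllGood B B' x p) (hb : ∀ i, chiD B B' x b i p = 0) :
    wDbar (dirVec b) (summand B B' x) p = 0 := by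
  rw [h.wDbar_summand]
  exact sum_eq_zero fun i _ => by rw [h.wDbar_chi, hb]; simp

lemma chiD_w (k : Fin m) (i : Fin d) (p : Jac[N]) : chiD B B' x (F.w k) i p = 0 := by
  rw [chiD, bil_dir_w, bil_dir_w]; simp

lemma AllGood.wDbar_w (h : AllGood B B' x p) (k : Fin m) :
    wDbar (dirVec (F.w k)) (summand B B' x) =ᶠ[𝓝 p] fun _ => 0 := by
  filter_upwards [h.eventually] with q hq using hq.wDbar_eq_zero fun i => chiD_w k i q

lemma AllGood.opK_summand (h : AllGood B B' x p) :
    ∑ k, (AdaptedFrame.sgn k : ℂ) / (4 * π * 𝕚) *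
      heisenbergLaplace L (F.vec k) (summand B B' x) p = 0 := by
  have hn : ∀ j i, i ≠ j → L.bil (B.dir i) (F.n j) = 0 ∧ L.bil (B'.dir i) (F.n j) = 0 := by
    intro j i hij; simp [bil_dir_n, hij]
  have hg : ∀ j i, i ≠ j → L.bil (B.dir i) (F.g j) = 0 ∧ L.bil (B'.dir i) (F.g j) = 0 := by
    intro j i hij; simp [bil_dir_g, hij]
  rw [Fintype.sum_sum_type, Fintype.sum_sum_type, ← sum_add_distrib]
  have hw : ∀ k, heisenbergLaplace L (F.w k) (summand B B' x) p = 0 := by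
    intro k
    rw [heisenbergLaplace, (wD_congr (h.wDbar_w k) _).self_of_nhds, (h.wDbar_w k).self_of_nhds]
    simp [wD]
  simp only [AdaptedFrame.vec, AdaptedFrame.sgn, Sum.elim_inl, Sum.elim_inr, hw, mul_zero,
    Finset.sum_const_zero, add_zero]
  refine sum_eq_zero fun j _ => ?_
  rw [h.heisenbergLaplace_summand (hn j), h.heisenbergLaplace_summand (hg j)]
  have r1 := rhoDD_mul (B := B) j x p
  have r2 := rhoDD_mul (B := B') j x p
  rw [bil_dir_dir, bil_dir] at r1 r2
  simp only [chiD, chiDD, bil_dir_n, bil_dir_g, if_true]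
  push_cast at *
  linear_combination cofac B B' x j p * p.1.im / (4 * π * 𝕚) / 2 * (r1 - r2)

lemma AllGood.opH_summand (h : AllGood B B' x p) :
    (p.1.im : ℂ) * wDbar dirTau (summand B B' x) p +
    ∑ k, (AdaptedFrame.sgn k : ℂ) * ((L.bil (F.vec k) (fun i => (p.2 i).im) : ℝ) / 2 *
      wDbar (dirVec (F.vec k)) (summand B B' x) p - (p.1.im : ℂ) / (8 * π * 𝕚) *
        wDbar (dirVec (F.vec k)) (wDbar (dirVec (F.vec k)) (summand B B' x)) p) = 0 := by
  have hpi : (π : ℂ) ≠ 0 := by exact_mod_cast Real.pi_ne_zero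
  have hn : ∀ j i, i ≠ j → L.bil (B.dir i) (F.n j) = 0 ∧ L.bil (B'.dir i) (F.n j) = 0 := by
    intro j i hij; simp [bil_dir_n, hij]
  have hg : ∀ j i, i ≠ j → L.bil (B.dir i) (F.g j) = 0 ∧ L.bil (B'.dir i) (F.g j) = 0 := by
    intro j i hij; simp [bil_dir_g, hij]
  rw [Fintype.sum_sum_type, Fintype.sum_sum_type, ← sum_add_distrib]
  have hw : ∀ k, wDbar (dirVec (F.w k)) (wDbar (dirVec (F.w k)) (summand B B' x)) p = 0 := by
    intro k
    rw [(wDbar_congr (h.wDbar_w k) _).self_of_nhds]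
    simp [wDbar]
  have hw' := fun k => (h.wDbar_w k).self_of_nhds
  simp only [AdaptedFrame.vec, AdaptedFrame.sgn, Sum.elim_inl, Sum.elim_inr, hw, hw', mul_zero,
    Finset.sum_const_zero, add_zero, sub_zero]
  rw [h.wDbar_summand, mul_sum, ← sum_add_distrib]
  refine sum_eq_zero fun j _ => ?_
  rw [h.wDbar_tau_chi, h.wDbar_vec_summand (hn j), h.wDbar_vec_summand (hg j),
    (h.second_deriv (hn j)).1, (h.second_deriv (hg j)).1, im_eq_smul_vy h.1]
  have r1 := rhoDD_mul (B := B) j x p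
  have r2 := rhoDD_mul (B := B') j x p
  rw [bil_dir_dir, bil_dir, bil_add_right, bil_add_right] at r1 r2
  simp only [chiD, chiDD, bil_dir_n, bil_dir_g, if_true]
  simp only [bil_dir, bil_smul_right]
  push_cast at *
  have q1 := congrArg (fun t => t / (π : ℂ)) r1
  have q2 := congrArg (fun t => t / (π : ℂ)) r2
  simp only [mul_assoc (4 : ℂ) (π : ℂ), mul_left_comm (4 : ℂ) (π : ℂ)] at q1 q2
  simp only [mul_assoc (π : ℂ), mul_div_cancel_left₀ _ hpi] at q1 q2
  have hI : (𝕚)⁻¹ = -𝕚 := Complex.inv_I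
  have e : (p.1.im : ℂ) / (8 * π * 𝕚) = -(p.1.im * 𝕚 / (8 * π)) := by
    rw [div_eq_mul_inv, mul_inv, hI]; field_simp
  rw [e]
  linear_combination -(cofac B B' x j p * p.1.im * 𝕚 / 16) * (q1 - q2)

end Side

end EvenLattice

section sums

variable {N : ℕ} {α : Type*} {f : α → Jac[N] → ℂ} {p₀ : Jac[N]}

lemma hasSum_wDbar (h : SumFamily f p₀) (w : Jac[N]) :
    ∀ᶠ p in 𝓝 p₀, HasSum (fun a => wDbar w (f a) p) (wDbar w (fun q => ∑' a, f a q) p) := by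
  filter_upwards [(h.wDbar w).1.summable, (h.wDbar w).2] with p h1 h2
  rw [h2]; exact h1.hasSum

lemma hasSum_wD_wDbar (h : SumFamily f p₀) (w w' : Jac[N]) :
    ∀ᶠ p in 𝓝 p₀, HasSum (fun a => wD w (wDbar w' (f a)) p)
      (wD w (wDbar w' fun q => ∑' a, f a q) p) := by
  have h' := (h.wDbar w').1
  filter_upwards [(h'.wD w).1.summable, (h'.wD w).2, wD_congr (h.wDbar w').2 w] with p h1 h2 h3
  rw [h3, h2]; exact h1.hasSum

lemma hasSum_wDbar_wDbar (h : SumFamily f p₀) (w w' : Jac[N]) :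
    ∀ᶠ p in 𝓝 p₀, HasSum (fun a => wDbar w (wDbar w' (f a)) p)
      (wDbar w (wDbar w' fun q => ∑' a, f a q) p) := by
  have h' := (h.wDbar w').1
  filter_upwards [(h'.wDbar w).1.summable, (h'.wDbar w).2, wDbar_congr (h.wDbar w').2 w]
    with p h1 h2 h3
  rw [h3, h2]; exact h1.hasSum

lemma hasSum_heisenbergLaplace (L : EvenLattice N) (h : SumFamily f p₀)
    (b : Fin N → ℝ) : ∀ᶠ p in 𝓝 p₀, HasSum (fun a => heisenbergLaplace L b (f a) p)
      (heisenbergLaplace L b (fun q => ∑' a, f a q) p) := by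
  filter_upwards [hasSum_wDbar h (dirVec b), hasSum_wD_wDbar h (dirVec b) (dirVec b)]
    with p h1 h2
  exact (h2.mul_left _).add (h1.mul_left _)

end sums

namespace EvenLattice

namespace Side

variable {N : ℕ} {L : EvenLattice N} {d m : ℕ} {F : L.AdaptedFrame d m} {B B' : Side F}
  {l : Fin N → ℝ} {p : Jac[N]}

lemma casimir_phi_of_regular (hp : p ∈ regular B B' l) :
    casimir L (N / 2) (phi B B' l) p = 0 := by
  have hS := sumFamily_summand hp
  have hreg := isOpen_regular.mem_nhds hp
  rw [casimir_congr _ (eventually_phi_of_regular hp)]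
  refine casimir_eq_zero hS.analyticAt ?_ ?_
  · filter_upwards [hS.analyticAt.eventually_analyticAt, hreg, hasSum_wDbar hS dirTau,
      eventually_all.2 fun k => hasSum_wDbar hS (dirVec (F.vec k)),
      eventually_all.2 fun k => hasSum_wDbar_wDbar hS (dirVec (F.vec k)) (dirVec (F.vec k))]
      with q hq hqr ht h1 h2
    rw [F.opH_eq hq]
    have := (ht.mul_left (q.1.im : ℂ)).add (hasSum_sum (s := Finset.univ) fun k _ =>
      (((h1 k).mul_left (((L.bil (F.vec k) (fun i => (q.2 i).im) : ℝ) : ℂ) / 2)).sub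
        ((h2 k).mul_left ((q.1.im : ℂ) / (8 * π * 𝕚)))).mul_left
          ((AdaptedFrame.sgn k : ℝ) : ℂ))
    refine this.unique ?_
    simp only [fun ν => (allGood_of_regular hqr ν).opH_summand]
    exact hasSum_zero
  · filter_upwards [hS.analyticAt.eventually_analyticAt, hreg,
      eventually_all.2 fun k => hasSum_heisenbergLaplace L hS (F.vec k)] with q hq hqr h1
    rw [F.opK_eq hq]
    have := hasSum_sum (s := Finset.univ) fun k _ => (h1 k).mul_left
      (((AdaptedFrame.sgn k : ℝ) : ℂ) / (4 * π * 𝕚))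
    refine this.unique ?_
    simp only [fun ν => (allGood_of_regular hqr ν).opK_summand]
    exact hasSum_zero

lemma eq_zero_of_regular (B B' : Side F) (l : Fin N → ℝ) {f : Jac[N] → ℂ}
    (hp : 0 < p.1.im) (hf : ContinuousAt f p) (h : ∀ q ∈ regular B B' l, f q = 0) : f p = 0 := by
  by_contra h0
  obtain ⟨q, hq, hq'⟩ := ((frequently_regular B B' l hp).and_eventually (hf.eventually_ne h0)).exists
  exact hq' (h q hq)

theorem phi_casimir (B B' : Side F) (l : Fin N → ℝ) :
    IsAnnihilatedBy (casimir L (N / 2)) (phi B B' l) := fun τ _ h =>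
  eq_zero_of_regular B B' l τ.im_pos (continuousAt_casimir _ h) fun _ hq =>
    casimir_phi_of_regular hq

theorem phi_heisenberg (l : Fin N → ℝ) (hB' : ∀ i, B'.β i ^ 2 = 1) (i : Fin d) (c : ℝ) :
    IsAnnihilatedBy (heisenbergLaplace L (c • B.dir i)) (phi B B' l) := by
  refine fun τ z h => eq_zero_of_regular B B' l τ.im_pos (continuousAt_heisenbergLaplace _ h)
    fun p hp => ?_
  have e := eventually_phi_of_regular hp
  have e1 : heisenbergLaplace L (c • B.dir i) (phi B B' l) p = heisenbergLaplace L (c • B.dir i)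
      (fun q => ∑' ν, summand B B' (coset l ν) q) p := by
    rw [heisenbergLaplace, heisenbergLaplace, (wD_congr (wDbar_congr e _) _).self_of_nhds,
      (wDbar_congr e _).self_of_nhds]
  rw [e1]
  refine (hasSum_heisenbergLaplace L (sumFamily_summand hp) (c • B.dir i)).self_of_nhds.unique ?_
  have hz : ∀ ν, heisenbergLaplace L (c • B.dir i) (summand B B' (coset l ν)) p = 0 := by
    intro ν
    have hb : ∀ j, j ≠ i → L.bil (B.dir j) (c • B.dir i) = 0 ∧
        L.bil (B'.dir j) (c • B.dir i) = 0 := fun j hj => by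
      rw [bil_smul_right, bil_smul_right, bil_dir_dir_of_ne _ _ hj, bil_dir_dir_of_ne _ _ hj]; simp
    rw [(allGood_of_regular hp ν).heisenbergLaplace_summand hb]
    have r := rhoDD_mul (B := B) i (coset l ν) p
    have r0 : B'.rhoD i (coset l ν) p = 0 := if_pos (hB' i)
    have r1 : B'.rhoDD i (coset l ν) p = 0 := by rw [rhoDD, r0, mul_zero]
    simp only [chiD, chiDD, r0, r1] at r ⊢
    rw [bil_smul_left, bil_smul_right]
    push_cast at *
    linear_combination cofac B B' (coset l ν) i p * p.1.im * c ^ 2 / 4 *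
      (L.bil (B.dir i) (B.dir i) : ℝ) * r
  simp only [hz]
  exact hasSum_zero

theorem phi_holomorphic (l : Fin N → ℝ) (hB' : ∀ i, B'.β i ^ 2 = 1) {w : Fin N → ℝ}
    (hw : ∀ i, L.bil w (B.dir i) = 0) :
    IsAnnihilatedBy (wDbar (dirVec w)) (phi B B' l) := by
  refine fun τ z h => eq_zero_of_regular B B' l τ.im_pos (h.wDbar _).continuousAt fun p hp => ?_
  rw [(wDbar_congr (eventually_phi_of_regular hp) _).self_of_nhds]
  refine (hasSum_wDbar (sumFamily_summand hp) (dirVec w)).self_of_nhds.unique ?_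
  have hz : ∀ ν, wDbar (dirVec w) (summand B B' (coset l ν)) p = 0 := by
    intro ν
    refine (allGood_of_regular hp ν).wDbar_eq_zero fun i => ?_
    rw [chiD, L.bil_comm, hw i]
    simp [rhoD, hB' i]
  simp only [hz]
  exact hasSum_zero

end Side

end EvenLattice

/-! ### Poisson summation in several variables -/

section poisson

open MeasureTheory EvenLattice

variable {N : ℕ}

/-- The half-open unit cube with corner `ν`. -/
def cube (ν : Fin N → ℤ) : Set (Fin N → ℝ) := {x | ∀ i, x i ∈ Set.Ioc (ν i : ℝ) (ν i + 1)}

lemma measurableSet_cube (ν : Fin N → ℤ) : MeasurableSet (cube ν) := by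
  have : cube ν = Set.univ.pi fun i => Set.Ioc (ν i : ℝ) (ν i + 1) := by ext x; simp [cube]
  rw [this]
  exact MeasurableSet.univ_pi fun i => measurableSet_Ioc

lemma mem_cube_iff {ν : Fin N → ℤ} {x : Fin N → ℝ} : x ∈ cube ν ↔ ν = fun i => ⌈x i⌉ - 1 := by
  rw [cube, Set.mem_ofPred_eq, funext_iff]
  refine forall_congr' fun i => ?_
  rw [Set.mem_Ioc, eq_sub_iff_add_eq, eq_comm (a := ν i + 1), Int.ceil_eq_iff]
  push_cast
  constructor <;> rintro ⟨h1, h2⟩ <;> constructor <;> linarith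

lemma pairwise_disjoint_cube : Pairwise (Function.onFun Disjoint (cube (N := N))) := by
  intro ν μ h
  rw [Function.onFun, Set.disjoint_left]
  intro x h1 h2
  exact h ((mem_cube_iff.1 h1).trans (mem_cube_iff.1 h2).symm)

lemma iUnion_cube : ⋃ ν, cube (N := N) ν = Set.univ := by
  ext x; simp [mem_cube_iff]

lemma setIntegral_cube {E : Type*} [NormedAddCommGroup E] [NormedSpace ℝ E]
    (F : (Fin N → ℝ) → E) (ν : Fin N → ℤ) :
    ∫ x in cube ν, F x = ∫ x in cube 0, F (x + fun i => (ν i : ℝ)) := by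
  rw [← integral_indicator (measurableSet_cube ν), ← integral_indicator (measurableSet_cube 0),
    ← integral_add_right_eq_self _ (fun i => (ν i : ℝ))]
  congr 1
  funext x
  have : x + (fun i => (ν i : ℝ)) ∈ cube ν ↔ x ∈ cube (0 : Fin N → ℤ) := by
    simp only [cube, Set.mem_ofPred_eq, Pi.add_apply, Set.mem_Ioc, Pi.zero_apply, Int.cast_zero,
      zero_add]
    refine forall_congr' fun i => ?_
    constructor <;> rintro ⟨h1, h2⟩ <;> constructor <;> linarith
  by_cases h : x ∈ cube (0 : Fin N → ℤ)
  · rw [Set.indicator_of_mem h, Set.indicator_of_mem (this.2 h)]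
  · rw [Set.indicator_of_notMem h, Set.indicator_of_notMem (mt this.1 h)]

lemma hasSum_setIntegral_cube {E : Type*} [NormedAddCommGroup E] [NormedSpace ℝ E]
    {F : (Fin N → ℝ) → E} (hF : Integrable F) :
    HasSum (fun ν : Fin N → ℤ => ∫ x in cube 0, F (x + fun i => (ν i : ℝ))) (∫ x, F x) := by
  have := hasSum_integral_iUnion (μ := volume) (f := F) (s := cube (N := N)) measurableSet_cube
    pairwise_disjoint_cube (by rw [iUnion_cube]; exact hF.integrableOn)
  rw [iUnion_cube, setIntegral_univ] at this
  rwa [show (fun ν => ∫ x in cube ν, F x) = _ from funext fun ν => setIntegral_cube F ν] at this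

lemma setIntegral_tsum_eq {F : (Fin N → ℝ) → ℂ} (hF : Integrable F) :
    ∫ x in cube 0, ∑' ν : Fin N → ℤ, F (x + fun i => (ν i : ℝ)) = ∫ x, F x := by
  have h := hasSum_integral_of_summable_integral_norm (μ := volume.restrict (cube (0 : Fin N → ℤ)))
    (F := fun (ν : Fin N → ℤ) x => F (x + fun i => (ν i : ℝ)))
    (fun ν => (hF.comp_add_right _).integrableOn) (hasSum_setIntegral_cube hF.norm).summable
  exact h.unique (hasSum_setIntegral_cube hF)

variable {f : (Fin N → ℝ) → ℂ} {C κ : ℝ}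

lemma norm_translate_le (hκ : 0 < κ) (hdec : ∀ x, ‖f x‖ ≤ C * exp (-(κ * ‖x‖))) {R : ℝ}
    {x : Fin N → ℝ} (hx : ‖x‖ ≤ R) (ν : Fin N → ℤ) : ‖f (x + fun i => (ν i : ℝ))‖ ≤
      C * exp (κ * R) * exp (-(κ * ‖fun i => (ν i : ℝ)‖)) := by
  have hC : 0 ≤ C := by
    have := (norm_nonneg _).trans (hdec 0)
    exact nonneg_of_mul_nonneg_left this (Real.exp_pos _)
  refine (hdec _).trans ?_
  rw [mul_assoc, ← Real.exp_add]
  refine mul_le_mul_of_nonneg_left (Real.exp_le_exp.2 ?_) hC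
  have : ‖fun i => (ν i : ℝ)‖ ≤ ‖x + fun i => (ν i : ℝ)‖ + ‖x‖ := by
    have := norm_sub_le (x + fun i => (ν i : ℝ)) x
    rwa [add_sub_cancel_left] at this
  nlinarith

lemma continuous_tsum_translate (hf : Continuous f) (hκ : 0 < κ)
    (hdec : ∀ x, ‖f x‖ ≤ C * exp (-(κ * ‖x‖))) :
    Continuous fun x => ∑' ν : Fin N → ℤ, f (x + fun i => (ν i : ℝ)) := by
  rw [continuous_iff_continuousAt]
  intro x₀
  have h : ContinuousOn (fun x => ∑' ν : Fin N → ℤ, f (x + fun i => (ν i : ℝ)))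
      (Metric.ball 0 (‖x₀‖ + 1)) :=
    continuousOn_tsum (fun ν => (hf.comp (continuous_id.add continuous_const)).continuousOn)
      ((summable_exp_neg_norm hκ).mul_left (C * exp (κ * (‖x₀‖ + 1))))
      fun ν x hx => norm_translate_le hκ hdec (by
        rw [mem_ball_zero_iff] at hx; exact hx.le) ν
  exact h.continuousAt (Metric.isOpen_ball.mem_nhds (by simp))

lemma mFourier_coe (n : Fin N → ℤ) (x : Fin N → ℝ) :
    UnitAddTorus.mFourier n (fun i => (x i : UnitAddCircle)) = ee (∑ i, (n i : ℂ) * (x i : ℂ)) := by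
  simp only [UnitAddTorus.mFourier, ContinuousMap.coe_mk, ee, mul_sum, Complex.exp_sum]
  refine prod_congr rfl fun i _ => ?_
  rw [fourier_coe_apply]
  congr 1
  push_cast
  ring

/-- **Poisson summation** for exponentially decreasing functions on `ℝ^N`. -/
theorem hasSum_poisson (hf : Continuous f) (hfi : Integrable f) (hκ : 0 < κ)
    (hdec : ∀ x, ‖f x‖ ≤ C * exp (-(κ * ‖x‖)))
    (hsum : Summable fun n : Fin N → ℤ => ∫ x, ee (-∑ i, (n i : ℂ) * (x i : ℂ)) * f x)
    (a : Fin N → ℝ) :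
    HasSum (fun n : Fin N → ℤ => (∫ x, ee (-∑ i, (n i : ℂ) * (x i : ℂ)) * f x) *
      ee (∑ i, (n i : ℂ) * (a i : ℂ))) (∑' ν : Fin N → ℤ, f (a + fun i => (ν i : ℝ))) := by
  set pr : (Fin N → ℝ) → UnitAddTorus (Fin N) := fun x i => (x i : UnitAddCircle) with hpr
  have hq : IsOpenQuotientMap pr :=
    IsOpenQuotientMap.piMap fun _ => QuotientAddGroup.isOpenQuotientMap_mk
  set g : (Fin N → ℝ) → ℂ := fun x => ∑' ν : Fin N → ℤ, f (x + fun i => (ν i : ℝ)) with hg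
  have hper : ∀ (x : Fin N → ℝ) (μ : Fin N → ℤ), g (x + fun i => (μ i : ℝ)) = g x := by
    intro x μ
    rw [hg]
    beta_reduce
    refine (tsum_congr fun ν => ?_).trans
      ((Equiv.addRight μ).tsum_eq fun ν : Fin N → ℤ => f (x + fun i => (ν i : ℝ)))
    congr 1
    funext i
    simp [Equiv.addRight]; ring
  set G : UnitAddTorus (Fin N) → ℂ := fun t => g (Function.surjInv hq.surjective t) with hG
  have hGpr : ∀ x, G (pr x) = g x := by
    intro x
    have h1 := Function.surjInv_eq hq.surjective (pr x)
    set x' := Function.surjInv hq.surjective (pr x)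
    have h2 : ∀ i, ∃ k : ℤ, x' i = x i + k := by
      intro i
      have := congrFun h1 i
      have h3 := (QuotientAddGroup.eq (s := AddSubgroup.zmultiples (1 : ℝ))).1 this
      obtain ⟨k, hk⟩ := AddSubgroup.mem_zmultiples_iff.1 h3
      refine ⟨-k, ?_⟩
      simp only [zsmul_eq_mul, mul_one] at hk
      push_cast
      linarith
    choose k hk using h2
    have : x' = x + fun i => (k i : ℝ) := funext hk
    simp only [hG]
    change g x' = g x
    rw [this, hper]
  have hGc : Continuous G := by
    rw [hq.isQuotientMap.continuous_iff]
    have : G ∘ pr = g := funext hGpr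
    rw [this]
    exact continuous_tsum_translate hf hκ hdec
  let Gc : C(UnitAddTorus (Fin N), ℂ) := ⟨G, hGc⟩
  have hcoef : ∀ n, UnitAddTorus.mFourierCoeff Gc n =
      ∫ x, ee (-∑ i, (n i : ℂ) * (x i : ℂ)) * f x := by
    intro n
    rw [UnitAddTorus.mFourierCoeff_eq_integral _ _ 0]
    have hFi : Integrable fun x => ee (-∑ i, (n i : ℂ) * (x i : ℂ)) * f x := by
      refine hfi.bdd_mul (c := 1) ?_ (ae_of_all _ fun x => ?_)
      · refine Continuous.aestronglyMeasurable ?_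
        unfold ee; fun_prop
      · rw [norm_ee]
        simp [Complex.im_sum]
    rw [← setIntegral_tsum_eq hFi]
    have hset : {x : Fin N → ℝ | ∀ i, x i ∈ Set.Ioc ((0 : Fin N → ℝ) i) ((0 : Fin N → ℝ) i + 1)} =
        cube (0 : Fin N → ℤ) := by ext x; simp [cube]
    rw [hset]
    congr 1
    funext x
    have h1 := mFourier_coe (-n) x
    have h2 : Gc (fun i => (x i : UnitAddCircle)) = g x := hGpr x
    rw [h1, h2, smul_eq_mul, hg]
    beta_reduce
    rw [← tsum_mul_left]
    refine tsum_congr fun ν => ?_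
    congr 1
    have : -∑ i, (n i : ℂ) * ((x + fun i => (ν i : ℝ)) i : ℝ) =
        (∑ i, ((-n) i : ℂ) * (x i : ℂ)) + ((-∑ i, n i * ν i : ℤ) : ℂ) := by
      push_cast
      rw [← sum_neg_distrib, ← sum_neg_distrib, ← sum_add_distrib]
      exact sum_congr rfl fun i _ => by simp; ring
    rw [this, ee_add, ee_intCast, mul_one]
  have hs : Summable (UnitAddTorus.mFourierCoeff Gc) := by
    simpa only [funext hcoef] using hsum
  have := UnitAddTorus.hasSum_mFourier_series_apply_of_summable hs (pr a)
  have hGa : Gc (pr a) = g a := hGpr a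
  rw [hGa] at this
  simp only [hcoef, hpr, mFourier_coe, smul_eq_mul] at this
  exact this

end poisson

/-! ### Fourier transforms of Gaussians -/

section gaussian

open MeasureTheory ComplexConjugate

/-- The one-dimensional holomorphic Gaussian. -/
def gaussP (τ ζ : ℂ) (c : ℝ) : ℂ := Complex.exp (π * 𝕚 * τ / 2 * c ^ 2 + π * 𝕚 * ζ * c)

/-- The one-dimensional Gaussian with a linear factor. -/
def gaussR (τ ζ : ℂ) (c : ℝ) : ℂ := ((sqrt τ.im * (c + ζ.im / τ.im) : ℝ) : ℂ) * gaussP τ ζ c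

/-- The one-dimensional antiholomorphic Gaussian. -/
def gaussM (τ ζ : ℂ) (c : ℝ) : ℂ := conj (gaussP τ ζ c) * ((exp (-(π * ζ.im ^ 2 / τ.im)) : ℝ) : ℂ)

lemma continuous_gaussP (τ ζ : ℂ) : Continuous (gaussP τ ζ) := by unfold gaussP; fun_prop

lemma continuous_gaussR (τ ζ : ℂ) : Continuous (gaussR τ ζ) :=
  (by fun_prop : Continuous fun c : ℝ => ((sqrt τ.im * (c + ζ.im / τ.im) : ℝ) : ℂ)).mul
    (continuous_gaussP τ ζ)

lemma continuous_gaussM (τ ζ : ℂ) : Continuous (gaussM τ ζ) :=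
  (Complex.continuous_conj.comp (continuous_gaussP τ ζ)).mul continuous_const

/-- The square root of `τ / i`. -/
def rootI (τ : ℂ) : ℂ := (-𝕚 * τ) ^ (1 / 2 : ℂ)

variable {τ ζ : ℂ}

lemma integral_gaussP {b η : ℂ} (hb : b.re < 0) :
    Integrable (fun c : ℝ => Complex.exp (b * c ^ 2 + η * c)) ∧
    ∫ c : ℝ, Complex.exp (b * c ^ 2 + η * c) =
      (π / -b) ^ (1 / 2 : ℂ) * Complex.exp (-(η ^ 2 / (4 * b))) := by
  have h1 := integral_cexp_quadratic hb η 0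
  have h2 := integrable_cexp_quadratic (b := -b) (by simpa using hb) η 0
  simp only [add_zero, zero_sub, neg_neg] at h1 h2
  exact ⟨h2, h1⟩

lemma integral_mul_gaussP {b η : ℂ} (hb : b.re < 0) :
    Integrable (fun c : ℝ => (c : ℂ) * Complex.exp (b * c ^ 2 + η * c)) ∧
    ∫ c : ℝ, (c : ℂ) * Complex.exp (b * c ^ 2 + η * c) =
      -(η / (2 * b)) * ∫ c : ℝ, Complex.exp (b * c ^ 2 + η * c) := by
  have hb0 : b ≠ 0 := by rintro rfl; simp at hb
  have h0 := (integral_gaussP (η := η) hb).1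
  have hi : Integrable (fun c : ℝ => (c : ℂ) * Complex.exp (b * c ^ 2 + η * c)) := by
    have hq : Integrable fun c : ℝ => (|c| * exp (-(-b.re / 2 * c ^ 2)) : ℝ) := by
      have := integrable_mul_exp_neg_mul_sq (b := -b.re / 2) (by linarith)
      refine this.norm.congr (ae_of_all _ fun c => ?_)
      simp [Real.abs_exp]
    refine (hq.const_mul (exp (η.re ^ 2 / (-2 * b.re)))).mono'
      (Continuous.aestronglyMeasurable (by fun_prop)) (ae_of_all _ fun c => ?_)
    rw [norm_mul, Complex.norm_real, Complex.norm_exp, Real.norm_eq_abs, mul_left_comm,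
      ← Real.exp_add]
    refine mul_le_mul_of_nonneg_left (Real.exp_le_exp.2 ?_) (abs_nonneg c)
    have e : (b * (c : ℂ) ^ 2 + η * c).re = b.re * c ^ 2 + η.re * c := by
      simp [sq]
    rw [e, ← sub_nonneg]
    have : η.re ^ 2 / (-2 * b.re) + -(-b.re / 2 * c ^ 2) - (b.re * c ^ 2 + η.re * c) =
        (η.re + b.re * c) ^ 2 / (-2 * b.re) := by
      have := hb.ne
      field_simp; ring
    rw [this]
    exact div_nonneg (sq_nonneg _) (by linarith)
  refine ⟨hi, ?_⟩
  have hd : ∀ c : ℝ, HasDerivAt (fun c : ℝ => Complex.exp (b * c ^ 2 + η * c))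
      (2 * b * ((c : ℂ) * Complex.exp (b * c ^ 2 + η * c)) +
        η * Complex.exp (b * c ^ 2 + η * c)) c := by
    intro c
    have h1 : HasDerivAt (fun z : ℂ => Complex.exp (b * z ^ 2 + η * z))
        (2 * b * ((c : ℂ) * Complex.exp (b * c ^ 2 + η * c)) +
        η * Complex.exp (b * c ^ 2 + η * c)) (c : ℂ) := by
      refine (((((hasDerivAt_id (c : ℂ)).pow 2).const_mul b).add
        ((hasDerivAt_id (c : ℂ)).const_mul η)).cexp).congr_deriv ?_
      simp; ring
    exact h1.comp_ofReal
  have h := integral_eq_zero_of_hasDerivAt_of_integrable hd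
    ((hi.const_mul (2 * b)).add (h0.const_mul η)) h0
  rw [integral_add (hi.const_mul _) (h0.const_mul _), integral_const_mul, integral_const_mul] at h
  generalize (∫ c : ℝ, (c : ℂ) * Complex.exp (b * c ^ 2 + η * c)) = J at h ⊢
  generalize (∫ c : ℝ, Complex.exp (b * c ^ 2 + η * c)) = J₀ at h ⊢
  field_simp
  linear_combination h

lemma rootI_eq (hτ : 0 < τ.im) :
    rootI τ = Complex.exp (-(π * 𝕚 / 4)) * τ ^ (1 / 2 : ℂ) := by
  have h0 : τ ≠ 0 := by rintro rfl; simp at hτ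
  have hI : -𝕚 ≠ 0 := by simp
  have hlog : Complex.log (-𝕚 * τ) = Complex.log (-𝕚) + Complex.log τ := by
    rw [Complex.log_mul hI h0]
    have h1 : 0 < τ.arg := by
      rcases (Complex.arg_nonneg_iff.2 hτ.le).lt_or_eq with h | h
      · exact h
      · exact absurd (Complex.arg_eq_zero_iff.1 h.symm).2 hτ.ne'
    have h2 := Complex.arg_le_pi τ
    rw [Complex.arg_neg_I]
    constructor <;> linarith [Real.pi_pos]
  rw [rootI, Complex.cpow_def_of_ne_zero (mul_ne_zero hI h0), hlog, Complex.log_neg_I, add_mul,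
    Complex.exp_add, ← Complex.cpow_def_of_ne_zero h0]
  congr 2
  ring

lemma rootI_mul_conj (τ : ℂ) : rootI τ * conj (rootI τ) = (‖τ‖ : ℂ) := by
  have h : rootI τ ^ 2 = -𝕚 * τ := by
    rw [rootI, ← Complex.cpow_nat_mul]; simp
  rw [Complex.mul_conj, Complex.normSq_eq_norm_sq, ← norm_pow, h]
  simp

lemma gauss_re (hτ : 0 < τ.im) : (π * 𝕚 * (-1 / τ) / 2 : ℂ).re < 0 := by
  have h0 : τ ≠ 0 := by rintro rfl; simp at hτ
  have h1 : (-1 / τ : ℂ).im = τ.im / Complex.normSq τ := by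
    rw [neg_div, one_div, Complex.neg_im, Complex.inv_im]; ring
  have h2 : (π * 𝕚 * (-1 / τ) / 2 : ℂ).re = -(π * (-1 / τ : ℂ).im / 2) := by
    rw [show (π * 𝕚 * (-1 / τ) / 2 : ℂ) = ((π / 2 : ℝ) : ℂ) *
      (𝕚 * (-1 / τ)) by push_cast; ring, Complex.re_ofReal_mul, Complex.I_mul_re]
    ring
  rw [h2, h1]
  have := Complex.normSq_pos.2 h0
  have := Real.pi_pos
  simp only [Left.neg_neg_iff]
  positivity

lemma cpow_two_mul_half {z : ℂ} (hz : z ≠ 0) :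
    (((2 : ℝ) : ℂ) * z) ^ (1 / 2 : ℂ) = ((sqrt 2 : ℝ) : ℂ) * z ^ (1 / 2 : ℂ) := by
  have h2 : (((2 : ℝ) : ℂ)) ≠ 0 := by norm_num
  rw [Real.sqrt_eq_rpow, Complex.ofReal_cpow (by norm_num),
    Complex.cpow_def_of_ne_zero (mul_ne_zero h2 hz), Complex.log_ofReal_mul (by norm_num) hz,
    add_mul, Complex.exp_add, Complex.cpow_def_of_ne_zero hz, Complex.cpow_def_of_ne_zero h2,
    Complex.ofReal_log (by norm_num)]
  push_cast
  rfl

/-- The common factor of the transformed Gaussians. -/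
def gaussFac (τ ζ : ℂ) : ℂ := Complex.exp (π * 𝕚 * ζ ^ 2 / (2 * τ))

lemma gaussP_mul_exp (κ c : ℝ) :
    gaussP (-1 / τ) (ζ / τ) c * Complex.exp (-(π * 𝕚 * c * κ)) =
      Complex.exp (π * 𝕚 * (-1 / τ) / 2 * c ^ 2 + π * 𝕚 * (ζ / τ - κ) * c) := by
  rw [gaussP, ← Complex.exp_add]; congr 1; ring

lemma fourier_gaussP (hτ : 0 < τ.im) (κ : ℝ) :
    Integrable (fun c : ℝ => gaussP (-1 / τ) (ζ / τ) c * Complex.exp (-(π * 𝕚 * c * κ))) ∧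
    ∫ c : ℝ, gaussP (-1 / τ) (ζ / τ) c * Complex.exp (-(π * 𝕚 * c * κ)) =
      ((sqrt 2 : ℝ) : ℂ) * rootI τ * gaussFac τ ζ * gaussP τ ζ (-κ) := by
  have h0 : τ ≠ 0 := by rintro rfl; simp at hτ
  have hpi : (π : ℂ) ≠ 0 := by exact_mod_cast Real.pi_ne_zero
  have h := integral_gaussP (η := π * 𝕚 * (ζ / τ - κ)) (gauss_re hτ)
  simp only [gaussP_mul_exp]
  refine ⟨h.1, h.2.trans ?_⟩
  have h1 : (π / -(π * 𝕚 * (-1 / τ) / 2) : ℂ) = ((2 : ℝ) : ℂ) * (-𝕚 * τ) := by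
    have := Complex.I_ne_zero
    field_simp
    push_cast
    linear_combination 2 * Complex.I_sq
  rw [h1, cpow_two_mul_half (mul_ne_zero (by simp) h0), ← rootI, gaussP, gaussFac,
    mul_assoc _ (Complex.exp _) (Complex.exp _), ← Complex.exp_add]
  congr 2
  have := Complex.I_ne_zero
  push_cast
  field_simp
  ring

lemma fourier_gaussR (hτ : 0 < τ.im) (κ : ℝ) :
    Integrable (fun c : ℝ => gaussR (-1 / τ) (ζ / τ) c * Complex.exp (-(π * 𝕚 * c * κ))) ∧
    ∫ c : ℝ, gaussR (-1 / τ) (ζ / τ) c * Complex.exp (-(π * 𝕚 * c * κ)) =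
      ((sqrt 2 : ℝ) : ℂ) * rootI τ * (τ / ‖τ‖) * gaussFac τ ζ * gaussR τ ζ (-κ) := by
  have h0 : τ ≠ 0 := by rintro rfl; simp at hτ
  have hpi : (π : ℂ) ≠ 0 := by exact_mod_cast Real.pi_ne_zero
  have hP := fourier_gaussP (ζ := ζ) hτ κ
  have hM := integral_mul_gaussP (η := π * 𝕚 * (ζ / τ - κ)) (gauss_re hτ)
  simp only [← gaussP_mul_exp] at hM
  have e : ∀ c : ℝ, gaussR (-1 / τ) (ζ / τ) c * Complex.exp (-(π * 𝕚 * c * κ)) =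
      ((sqrt (-1 / τ : ℂ).im : ℝ) : ℂ) * ((c : ℂ) * (gaussP (-1 / τ) (ζ / τ) c *
        Complex.exp (-(π * 𝕚 * c * κ)))) +
      ((sqrt (-1 / τ : ℂ).im * ((ζ / τ).im / (-1 / τ : ℂ).im) : ℝ) : ℂ) *
        (gaussP (-1 / τ) (ζ / τ) c * Complex.exp (-(π * 𝕚 * c * κ))) := by
    intro c
    rw [gaussR]; push_cast; ring
  simp only [e]
  refine ⟨(hM.1.const_mul _).add (hP.1.const_mul _), ?_⟩
  rw [integral_add (hM.1.const_mul _) (hP.1.const_mul _), integral_const_mul, integral_const_mul,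
    hM.2, hP.2, gaussR]
  have hn : 0 < ‖τ‖ := norm_pos_iff.2 h0
  have him : (-1 / τ : ℂ).im = τ.im / ‖τ‖ ^ 2 := by
    rw [neg_div, one_div, Complex.neg_im, Complex.inv_im, Complex.normSq_eq_norm_sq]; ring
  have hsq : sqrt (-1 / τ : ℂ).im = sqrt τ.im / ‖τ‖ := by
    rw [him, Real.sqrt_div hτ.le, Real.sqrt_sq hn.le]
  have ha : (ζ / τ).im / (-1 / τ : ℂ).im = (ζ.im * τ.re - ζ.re * τ.im) / τ.im := by
    rw [him, Complex.div_im, Complex.normSq_eq_norm_sq]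
    have := hτ.ne'
    field_simp
  have hmain : -(π * 𝕚 * (ζ / τ - κ) / (2 * (π * 𝕚 * (-1 / τ) / 2))) +
      (((ζ.im * τ.re - ζ.re * τ.im) / τ.im : ℝ) : ℂ) = τ * ((-κ + ζ.im / τ.im : ℝ) : ℂ) := by
    have hI := Complex.I_ne_zero
    have hy : (τ.im : ℂ) ≠ 0 := by exact_mod_cast hτ.ne'
    have e1 : -(π * 𝕚 * (ζ / τ - κ) / (2 * (π * 𝕚 * (-1 / τ) / 2))) = ζ - κ * τ := by
      field_simp
    rw [e1]
    have e2 := Complex.re_add_im τ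
    have e3 := Complex.re_add_im ζ
    push_cast
    field_simp
    linear_combination (ζ.im : ℂ) * e2 - (τ.im : ℂ) * e3
  rw [hsq, ha]
  have hn' : (‖τ‖ : ℂ) ≠ 0 := by exact_mod_cast hn.ne'
  push_cast at hmain ⊢
  linear_combination ((sqrt τ.im : ℝ) : ℂ) / ‖τ‖ * (((sqrt 2 : ℝ) : ℂ) * rootI τ *
    gaussFac τ ζ * gaussP τ ζ (-κ)) * hmain

lemma fourier_gaussM (hτ : 0 < τ.im) (κ : ℝ) :
    Integrable (fun c : ℝ => gaussM (-1 / τ) (ζ / τ) c * Complex.exp (π * 𝕚 * c * κ)) ∧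
    ∫ c : ℝ, gaussM (-1 / τ) (ζ / τ) c * Complex.exp (π * 𝕚 * c * κ) =
      ((sqrt 2 : ℝ) : ℂ) * conj (rootI τ) * (gaussFac τ ζ)⁻¹ * gaussM τ ζ (-κ) := by
  have h0 : τ ≠ 0 := by rintro rfl; simp at hτ
  have hn : 0 < ‖τ‖ := norm_pos_iff.2 h0
  have hP := fourier_gaussP (ζ := ζ) hτ κ
  have e : ∀ c : ℝ, gaussM (-1 / τ) (ζ / τ) c * Complex.exp (π * 𝕚 * c * κ) =
      ((exp (-(π * (ζ / τ).im ^ 2 / (-1 / τ : ℂ).im)) : ℝ) : ℂ) *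
      conj (gaussP (-1 / τ) (ζ / τ) c * Complex.exp (-(π * 𝕚 * c * κ))) := by
    intro c
    rw [gaussM, map_mul, ← Complex.exp_conj]
    simp only [map_neg, map_mul, Complex.conj_ofReal, Complex.conj_I]
    rw [show -(π * -𝕚 * c * κ : ℂ) = π * 𝕚 * c * κ by ring]
    ring
  simp only [e]
  have hc : Integrable (fun c : ℝ => conj (gaussP (-1 / τ) (ζ / τ) c *
      Complex.exp (-(π * 𝕚 * c * κ)))) :=
    (Complex.conjLIE.toLinearIsometry.toContinuousLinearMap.integrable_comp hP.1)
  refine ⟨hc.const_mul _, ?_⟩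
  rw [integral_const_mul, integral_conj, hP.2, gaussM]
  simp only [map_mul, Complex.conj_ofReal]
  have him : (-1 / τ : ℂ).im = τ.im / ‖τ‖ ^ 2 := by
    rw [neg_div, one_div, Complex.neg_im, Complex.inv_im, Complex.normSq_eq_norm_sq]; ring
  have key : ((exp (-(π * (ζ / τ).im ^ 2 / (-1 / τ : ℂ).im)) : ℝ) : ℂ) *
      conj (gaussFac τ ζ) = (gaussFac τ ζ)⁻¹ * ((exp (-(π * ζ.im ^ 2 / τ.im)) : ℝ) : ℂ) := by
    have hg : conj (gaussFac τ ζ) = (gaussFac τ ζ)⁻¹ * ((exp (-(π * (ζ ^ 2 / τ).im)) : ℝ) : ℂ) := by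
      rw [gaussFac, ← Complex.exp_conj, ← Complex.exp_neg, Complex.ofReal_exp, ← Complex.exp_add]
      congr 1
      have hz : conj (ζ ^ 2 / τ) = ζ ^ 2 / τ - 2 * 𝕚 * ((ζ ^ 2 / τ).im : ℂ) := by
        have := Complex.sub_conj (ζ ^ 2 / τ)
        push_cast at this
        linear_combination -this
      rw [show (π * 𝕚 * ζ ^ 2 / (2 * τ) : ℂ) = π * 𝕚 / 2 * (ζ ^ 2 / τ) by field_simp, map_mul, hz]
      simp only [map_div₀, map_mul, Complex.conj_ofReal, Complex.conj_I, map_ofNat]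
      push_cast
      linear_combination (π : ℂ) * ((ζ ^ 2 / τ).im : ℂ) * Complex.I_sq
    rw [hg, mul_left_comm, ← Complex.ofReal_mul, ← Real.exp_add]
    congr 4
    have hq : (ζ ^ 2 / τ).im = (2 * ζ.re * ζ.im * τ.re - (ζ.re ^ 2 - ζ.im ^ 2) * τ.im) / ‖τ‖ ^ 2 := by
      rw [Complex.div_im, Complex.normSq_eq_norm_sq]
      simp only [sq, Complex.mul_re, Complex.mul_im]
      ring
    have hz : (ζ / τ).im = (ζ.im * τ.re - ζ.re * τ.im) / ‖τ‖ ^ 2 := by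
      rw [Complex.div_im, Complex.normSq_eq_norm_sq]; ring
    have hnn : ‖τ‖ ^ 2 = τ.re ^ 2 + τ.im ^ 2 := by
      rw [← Complex.normSq_eq_norm_sq, Complex.normSq_apply]; ring
    have hpos : 0 < ‖τ‖ ^ 2 := by positivity
    rw [hq, hz, him]
    generalize ‖τ‖ ^ 2 = M at *
    have := hτ.ne'
    field_simp
    rw [hnn]
    ring
  linear_combination ((sqrt 2 : ℝ) : ℂ) * conj (rootI τ) * conj (gaussP τ ζ (-κ)) * key

end gaussian

namespace EvenLattice

open MeasureTheory ComplexConjugate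

variable {N : ℕ} {L : EvenLattice N} {d m : ℕ}

/-- The image of a point of the Jacobi upper half plane under `S`. -/
def sPt (p : Jac[N]) : Jac[N] := (-1 / p.1, fun k => p.2 k / p.1)

namespace AdaptedFrame

variable (F : L.AdaptedFrame d m)

/-- The term of the theta series attached to a frame. -/
def frameTerm (x : Fin N → ℝ) (p : Jac[N]) : ℂ :=
  (∏ i, ((sqrt p.1.im * L.bil (F.g i) (x + vy p) *
    exp (-(π * p.1.im * L.bil (F.n i) (x + vy p) ^ 2)) : ℝ) : ℂ)) * qexp L x p

/-- The one-dimensional factors of the terms of the theta series attached to a frame. -/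
def fct : (Fin d ⊕ Fin d) ⊕ Fin m → ℂ → ℂ → ℝ → ℂ :=
  Sum.elim (Sum.elim (fun _ => gaussM) fun _ => gaussR) fun _ => gaussP

lemma continuous_fct (k : (Fin d ⊕ Fin d) ⊕ Fin m) (τ ζ : ℂ) : Continuous (fct k τ ζ) := by
  rcases k with (k | k) | k
  · exact continuous_gaussM τ ζ
  · exact continuous_gaussR τ ζ
  · exact continuous_gaussP τ ζ

/-- The constants in the transformation of the one-dimensional factors. -/
def cst (τ : ℂ) : (Fin d ⊕ Fin d) ⊕ Fin m → ℂ :=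
  Sum.elim (Sum.elim (fun _ => conj (rootI τ)) fun _ => rootI τ * (τ / ‖τ‖)) fun _ => rootI τ

lemma fourier_fct (k : (Fin d ⊕ Fin d) ⊕ Fin m) {τ : ℂ} (hτ : 0 < τ.im) (ζ : ℂ) (κ : ℝ) :
    Integrable (fun c : ℝ => fct k (-1 / τ) (ζ / τ) c * Complex.exp (-(sgn k * (π * 𝕚 * c * κ)))) ∧
    ∫ c : ℝ, fct k (-1 / τ) (ζ / τ) c * Complex.exp (-(sgn k * (π * 𝕚 * c * κ))) =
      (((sqrt 2 : ℝ) : ℂ) * cst τ k) *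
        Complex.exp (sgn k * (π * 𝕚 * ζ ^ 2 / (2 * τ))) * fct k τ ζ (-κ) := by
  rcases k with (k | k) | k
  · have := fourier_gaussM (ζ := ζ) hτ κ
    simp only [fct, cst, sgn, Sum.elim_inl, Complex.ofReal_neg, Complex.ofReal_one,
      neg_mul, one_mul, neg_neg, Complex.exp_neg]
    exact this
  · have := fourier_gaussR (ζ := ζ) hτ κ
    simp only [fct, cst, sgn, Sum.elim_inl, Sum.elim_inr, Complex.ofReal_one, one_mul]
    rw [← mul_assoc (((sqrt 2 : ℝ) : ℂ))]
    exact this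
  · have := fourier_gaussP (ζ := ζ) hτ κ
    simp only [fct, cst, sgn, Sum.elim_inr, Complex.ofReal_one, one_mul]
    exact this

lemma toC_expand (x : Fin N → ℝ) :
    toC x = ∑ k, ((sgn k / 2 * L.bil (F.vec k) x : ℝ) : ℂ) • toC (F.vec k) := by
  conv_lhs => rw [F.expand x]
  funext i
  simp [toC, Finset.sum_apply]

lemma bil_toC_eq_sum (x : Fin N → ℝ) (z : Fin N → ℂ) : L.bil (toC x) z =
    ∑ k, ((sgn k / 2 * L.bil (F.vec k) x : ℝ) : ℂ) * L.bil (toC (F.vec k)) z := by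
  conv_lhs => rw [F.toC_expand x]
  rw [bil_sum_left]
  simp only [bil_smul_left]

lemma bil_self_eq_sum (z : Fin N → ℂ) :
    L.bil z z = ∑ k, (sgn k / 2 : ℂ) * L.bil (toC (F.vec k)) z ^ 2 := by
  set a : Fin N → ℝ := fun k => (z k).re
  set b : Fin N → ℝ := fun k => (z k).im
  have hz : z = toC a + 𝕚 • toC b := by
    funext k; simp [toC, a, b, mul_comm 𝕚, Complex.re_add_im]
  have key : ∀ w : Fin N → ℂ, L.bil z w =
      ∑ k, (sgn k / 2 : ℂ) * L.bil (toC (F.vec k)) z * L.bil (toC (F.vec k)) w := by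
    intro w
    rw [hz]
    simp only [bil_add_left, bil_smul_left, F.bil_toC_eq_sum a, F.bil_toC_eq_sum b,
      bil_add_right, bil_smul_right, bil_toC, mul_sum, ← sum_add_distrib]
    refine sum_congr rfl fun k _ => ?_
    push_cast; ring
  rw [key]
  exact sum_congr rfl fun k _ => by ring

lemma frameTerm_eq_prod (x : Fin N → ℝ) {p : Jac[N]} (hp : 0 < p.1.im) :
    F.frameTerm x p = ∏ k, fct k p.1 (L.bil (toC (F.vec k)) p.2) (L.bil (F.vec k) x) := by
  have hq : qexp L x p = ∏ k, Complex.exp (sgn k * (π * 𝕚 * p.1 / 2 *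
      (L.bil (F.vec k) x : ℝ) ^ 2 + π * 𝕚 * L.bil (toC (F.vec k)) p.2 *
        (L.bil (F.vec k) x : ℝ))) := by
    rw [qexp, ee, ← Complex.exp_sum, quad, F.bil_eq_sum x x, F.bil_toC_eq_sum]
    congr 1
    push_cast
    rw [sum_div, sum_mul, ← sum_add_distrib, mul_sum]
    exact sum_congr rfl fun k _ => by ring
  have hv : ∀ b : Fin N → ℝ, L.bil b (vy p) = (L.bil (toC b) p.2).im / p.1.im := by
    intro b
    have : vy p = (p.1.im)⁻¹ • fun k => (p.2 k).im := by
      funext k; simp [vy, div_eq_inv_mul]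
    rw [this, bil_smul_right, bil_toC_im]
    ring
  rw [frameTerm, hq, Fintype.prod_sum_type, Fintype.prod_sum_type, Fintype.prod_sum_type,
    Fintype.prod_sum_type, ← mul_assoc]
  congr 1
  · rw [← prod_mul_distrib, ← prod_mul_distrib, ← prod_mul_distrib]
    refine prod_congr rfl fun i _ => ?_
    simp only [fct, vec, sgn, Sum.elim_inl, Sum.elim_inr, bil_add_right, hv]
    set ξ := L.bil (F.n i) x
    set ρ := L.bil (F.g i) x
    set ζ := L.bil (toC (F.n i)) p.2
    set η := L.bil (toC (F.g i)) p.2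
    have hM : gaussM p.1 ζ ξ = ((exp (-(π * p.1.im * (ξ + ζ.im / p.1.im) ^ 2)) : ℝ) : ℂ) *
        Complex.exp (-(π * 𝕚 * p.1 / 2 * ξ ^ 2 + π * 𝕚 * ζ * ξ)) := by
      rw [gaussM, gaussP, ← Complex.exp_conj, Complex.ofReal_exp, Complex.ofReal_exp,
        ← Complex.exp_add, ← Complex.exp_add]
      congr 1
      have hy : (p.1.im : ℂ) ≠ 0 := by exact_mod_cast hp.ne'
      simp only [map_add, map_mul, map_div₀, map_pow, Complex.conj_ofReal, Complex.conj_I,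
        map_ofNat]
      have h1 : conj p.1 = p.1 - 2 * 𝕚 * p.1.im := by
        have := Complex.sub_conj p.1; push_cast at this; linear_combination -this
      have h2 : conj ζ = ζ - 2 * 𝕚 * ζ.im := by
        have := Complex.sub_conj ζ; push_cast at this; linear_combination -this
      rw [h1, h2]
      push_cast
      field_simp
      linear_combination (2 * ξ ^ 2 * p.1.im ^ 2 + 4 * ξ * ζ.im * p.1.im : ℂ) * Complex.I_sq
    rw [hM, gaussR, gaussP]
    push_cast
    ring_nf
  · refine prod_congr rfl fun i _ => ?_
    simp only [fct, vec, sgn, Sum.elim_inr, gaussP, Complex.ofReal_one, one_mul]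

end AdaptedFrame

open MeasureTheory ComplexConjugate

variable {N : ℕ} {L : EvenLattice N} {d m : ℕ}

lemma sPt_im_pos {p : Jac[N]} (hp : 0 < p.1.im) : 0 < (sPt p).1.im := by
  have h0 : p.1 ≠ 0 := by intro h; rw [h] at hp; simp at hp
  have : (sPt p).1.im = p.1.im / Complex.normSq p.1 := by
    rw [sPt, neg_div, one_div, Complex.neg_im, Complex.inv_im]; ring
  rw [this]
  exact div_pos hp (Complex.normSq_pos.2 h0)

namespace AdaptedFrame

variable (F : L.AdaptedFrame d m)

lemma continuous_frameTerm {p : Jac[N]} (hp : 0 < p.1.im) :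
    Continuous fun x => F.frameTerm x p := by
  simp only [fun x => F.frameTerm_eq_prod x hp]
  refine continuous_finsetProd _ fun k _ => (continuous_fct k _ _).comp ?_
  unfold bil; fun_prop

lemma exists_frameTerm_bound {p : Jac[N]} (hp : 0 < p.1.im) :
    ∃ C κ : ℝ, 0 < κ ∧ ∀ x, ‖F.frameTerm x p‖ ≤ C * exp (-(κ * ‖x‖)) := by
  have hy : 0 < π * p.1.im := mul_pos Real.pi_pos hp
  obtain ⟨κ, hκ, A, hA⟩ := exists_prod_bound F hy one_pos
  set t := π * p.1.im with ht
  set C := sqrt p.1.im * exp (4 / t) with hC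
  refine ⟨|A * C ^ d * exp (2 * π * p.1.im * L.quad (vy p))| * exp (κ * ‖vy p‖), κ, hκ, fun x => ?_⟩
  have h := hA p x (fun i => ((sqrt p.1.im * L.bil (F.g i) (x + vy p) *
    exp (-(π * p.1.im * L.bil (F.n i) (x + vy p) ^ 2)) : ℝ) : ℂ)) C hp le_rfl ?_
  · set D := A * C ^ d * exp (2 * π * p.1.im * L.quad (vy p))
    refine h.trans ((mul_le_mul_of_nonneg_right (le_abs_self D) (Real.exp_pos _).le).trans ?_)
    rw [mul_assoc |D|]
    refine mul_le_mul_of_nonneg_left ?_ (abs_nonneg D)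
    rw [← Real.exp_add, Real.exp_le_exp]
    have : ‖x‖ ≤ ‖x + vy p‖ + ‖vy p‖ := by
      have := norm_sub_le (x + vy p) (vy p)
      rwa [add_sub_cancel_right] at this
    nlinarith
  · intro i
    set ξ := L.bil (F.n i) (x + vy p)
    set ρ := L.bil (F.g i) (x + vy p)
    rw [Complex.norm_real, Real.norm_eq_abs, abs_mul, abs_mul, abs_of_nonneg (Real.sqrt_nonneg _),
      Real.abs_exp, hC]
    have h1 : ∀ s : ℝ, 2 * |s| ≤ t / 2 * s ^ 2 + 2 / t := by
      intro s
      have : 0 ≤ (t * |s| - 2) ^ 2 / (2 * t) := by positivity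
      have h2 : (t * |s| - 2) ^ 2 / (2 * t) = t / 2 * s ^ 2 + 2 / t - 2 * |s| := by
        rw [← sq_abs s]; field_simp; ring
      linarith
    have h2 : |ρ| ≤ exp |ρ| := by linarith [Real.add_one_le_exp |ρ|]
    calc sqrt p.1.im * |ρ| * exp (-(t * ξ ^ 2)) * exp (t * ((ξ ^ 2 - ρ ^ 2) / 2))
        = sqrt p.1.im * (|ρ| * exp (-(t * ξ ^ 2) + t * ((ξ ^ 2 - ρ ^ 2) / 2))) := by
          rw [Real.exp_add]; ring
      _ ≤ sqrt p.1.im * (exp |ρ| * exp (-(t * ξ ^ 2) + t * ((ξ ^ 2 - ρ ^ 2) / 2))) := by gcongr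
      _ ≤ sqrt p.1.im * (exp (4 / t) * exp (-(1 * (|ξ| + |ρ|)))) := by
          rw [← Real.exp_add, ← Real.exp_add]
          refine mul_le_mul_of_nonneg_left (Real.exp_le_exp.2 ?_) (Real.sqrt_nonneg _)
          have a1 := h1 ξ
          have a2 := h1 ρ
          have a3 := abs_nonneg ξ
          have : 4 / t = 2 / t + 2 / t := by ring
          rw [this]
          nlinarith
      _ = _ := by ring

lemma summable_frameTerm {p : Jac[N]} (hp : 0 < p.1.im) (l : Fin N → ℝ) :
    Summable fun ν : Fin N → ℤ => F.frameTerm (coset l ν) p := by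
  obtain ⟨C, κ, hκ, h⟩ := F.exists_frameTerm_bound hp
  refine Summable.of_norm_bounded ((summable_exp_neg_norm hκ).mul_left (C * exp (κ * ‖l‖)))
    fun ν => ?_
  have e : coset l ν = l + fun i => (ν i : ℝ) := by funext k; simp [coset, add_comm]
  rw [e]
  exact norm_translate_le hκ h le_rfl ν

/-- The matrix of coordinates with respect to the frame. -/
def coordMatrix (e : ((Fin d ⊕ Fin d) ⊕ Fin m) ≃ Fin N) : Matrix (Fin N) (Fin N) ℝ :=
  (Matrix.of fun j => F.vec (e.symm j)) * L.gram.map (fun a : ℤ => (a : ℝ))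

variable {F}

lemma coordMatrix_mulVec (e : ((Fin d ⊕ Fin d) ⊕ Fin m) ≃ Fin N) (x : Fin N → ℝ) (j : Fin N) :
    (F.coordMatrix e *ᵥ x) j = L.bil (F.vec (e.symm j)) x := by
  simp only [coordMatrix, Matrix.mulVec, dotProduct, Matrix.mul_apply, Matrix.of_apply,
    Matrix.map_apply, bil, sum_mul]
  rw [sum_comm]

lemma sq_abs_det_coordMatrix (e : ((Fin d ⊕ Fin d) ⊕ Fin m) ≃ Fin N) :
    |(F.coordMatrix e).det| ^ 2 = 2 ^ N * |(L.gram.det : ℝ)| := by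
  set V : Matrix (Fin N) (Fin N) ℝ := Matrix.of fun j => F.vec (e.symm j) with hV
  set G : Matrix (Fin N) (Fin N) ℝ := L.gram.map (fun a : ℤ => (a : ℝ)) with hG
  have h1 : V * G * Vᵀ = Matrix.diagonal fun j => 2 * sgn (e.symm j) := by
    ext j j'
    have h2 : (V * G * Vᵀ) j j' = L.bil (F.vec (e.symm j)) (F.vec (e.symm j')) := by
      rw [← coordMatrix_mulVec e, Matrix.mul_apply]
      rfl
    rw [h2, bil_vec, Matrix.diagonal_apply]
    simp
  have h2 := congrArg (fun A => |Matrix.det A|) h1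
  simp only [Matrix.det_mul, Matrix.det_transpose, Matrix.det_diagonal, abs_mul, Finset.abs_prod]
    at h2
  have h3 : ∀ k : (Fin d ⊕ Fin d) ⊕ Fin m, |(sgn k : ℝ)| = 1 := by
    intro k; rcases k with (k | k) | k <;> simp [sgn]
  simp only [h3, mul_one, Finset.prod_const, Finset.card_univ, Fintype.card_fin, abs_two] at h2
  have h4 : G.det = (L.gram.det : ℝ) := by
    rw [hG]
    exact (Int.cast_det L.gram).symm
  rw [← h4, ← h2, coordMatrix, Matrix.det_mul, abs_mul]
  ring

lemma prod_cst {τ : ℂ} (hτ : 0 < τ.im) (hN : d + d + m = N) :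
    ∏ k : (Fin d ⊕ Fin d) ⊕ Fin m, cst τ k =
      Complex.exp (-(π * 𝕚 * m / 4)) * (τ ^ (1 / 2 : ℂ)) ^ N := by
  have h0 : τ ≠ 0 := by rintro rfl; simp at hτ
  have hn : (‖τ‖ : ℂ) ≠ 0 := by exact_mod_cast norm_ne_zero_iff.2 h0
  have hsq : (τ ^ (1 / 2 : ℂ)) ^ 2 = τ := by rw [← Complex.cpow_nat_mul]; simp
  have h1 : conj (rootI τ) * (rootI τ * (τ / ‖τ‖)) = τ := by
    rw [← mul_assoc, mul_comm (conj (rootI τ)), rootI_mul_conj]; field_simp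
  rw [Fintype.prod_sum_type, Fintype.prod_sum_type]
  simp only [cst, Sum.elim_inl, Sum.elim_inr, Finset.prod_const, Finset.card_univ, Fintype.card_fin]
  rw [← mul_pow, h1, rootI_eq hτ, mul_pow, ← Complex.exp_nat_mul, ← hN, pow_add,
    show d + d = 2 * d by ring, pow_mul, hsq,
    show (m : ℂ) * -(π * 𝕚 / 4) = -(π * 𝕚 * m / 4) by ring]
  ring

variable (F) in
/-- The Fourier transform of the terms of the theta series attached to a frame. -/
theorem integral_frameTerm {p : Jac[N]} (hp : 0 < p.1.im) (κ : Fin N → ℝ) :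
    Integrable (fun x => ee (-((L.bil κ x : ℝ) : ℂ)) * F.frameTerm x (sPt p)) ∧
    ∫ x, ee (-((L.bil κ x : ℝ) : ℂ)) * F.frameTerm x (sPt p) =
      Complex.exp (-(π * 𝕚 * m / 4)) * (p.1 ^ (1 / 2 : ℂ)) ^ N /
        ((sqrt |(L.gram.det : ℝ)| : ℝ) : ℂ) * ee (L.quad p.2 / p.1) * F.frameTerm (-κ) p := by
  have hcard : Fintype.card ((Fin d ⊕ Fin d) ⊕ Fin m) = Fintype.card (Fin N) := by
    simp [← F.card]
  obtain ⟨e⟩ : Nonempty (((Fin d ⊕ Fin d) ⊕ Fin m) ≃ Fin N) := ⟨Fintype.equivOfCardEq hcard⟩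
  set M := F.coordMatrix e with hM
  have hMsq : |M.det| ^ 2 = 2 ^ N * |(L.gram.det : ℝ)| := sq_abs_det_coordMatrix e
  have hg : (0 : ℝ) < |(L.gram.det : ℝ)| := abs_pos.2 (by exact_mod_cast L.nondeg)
  have hMabs : |M.det| = sqrt 2 ^ N * sqrt |(L.gram.det : ℝ)| := by
    rw [← Real.sqrt_sq (abs_nonneg M.det), hMsq, Real.sqrt_mul (by positivity)]
    congr 1
    rw [← Real.sqrt_sq (by positivity : (0 : ℝ) ≤ sqrt 2 ^ N), ← pow_mul, mul_comm, pow_mul,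
      Real.sq_sqrt zero_le_two]
  have hM0 : M.det ≠ 0 := by
    intro h
    rw [h, abs_zero] at hMsq
    have : (0 : ℝ) < 2 ^ N * |(L.gram.det : ℝ)| := by positivity
    linarith [zero_pow (M₀ := ℝ) two_ne_zero]
  set h : Fin N → ℝ → ℂ := fun j c => fct (e.symm j) (-1 / p.1)
      (L.bil (toC (F.vec (e.symm j))) p.2 / p.1) c * Complex.exp (-(sgn (e.symm j) *
        (π * 𝕚 * c * (L.bil (F.vec (e.symm j)) κ : ℝ)))) with hh
  have hint := fun j => fourier_fct (e.symm j) hp (L.bil (toC (F.vec (e.symm j))) p.2)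
    (L.bil (F.vec (e.symm j)) κ)
  have hHi : Integrable fun u : Fin N → ℝ => ∏ j, h j (u j) :=
    Integrable.fintype_prod fun j => (hint j).1
  have hHint : ∫ u : Fin N → ℝ, ∏ j, h j (u j) = ∏ j, ∫ c, h j c :=
    integral_fintype_prod_volume_eq_prod h
  have hHc : Continuous fun u : Fin N → ℝ => ∏ j, h j (u j) := by
    refine continuous_finsetProd _ fun j _ => ?_
    refine Continuous.mul ((continuous_fct _ _ _).comp (continuous_apply j)) ?_
    fun_prop
  have hmap := Real.map_matrix_volume_pi_eq_smul_volume_pi hM0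
  have hlin : Continuous (Matrix.toLin' M) := LinearMap.continuous_of_finiteDimensional _
  have hfun : ∀ x, ee (-((L.bil κ x : ℝ) : ℂ)) * F.frameTerm x (sPt p) =
      ∏ j, h j (Matrix.toLin' M x j) := by
    intro x
    have hee : ee (-((L.bil κ x : ℝ) : ℂ)) = ∏ k, Complex.exp (-(sgn k *
        (π * 𝕚 * (L.bil (F.vec k) x : ℝ) * (L.bil (F.vec k) κ : ℝ)))) := by
      rw [ee, ← Complex.exp_sum, F.bil_eq_sum]
      congr 1
      push_cast
      rw [← sum_neg_distrib, mul_sum]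
      exact sum_congr rfl fun k _ => by ring
    rw [hee, F.frameTerm_eq_prod x (sPt_im_pos hp), ← prod_mul_distrib]
    refine (Fintype.prod_equiv e _ _ fun k => ?_)
    simp only [hh, Matrix.toLin'_apply, hM, coordMatrix_mulVec, Equiv.symm_apply_apply]
    rw [mul_comm]
    congr 2
    have : (sPt p).2 = (p.1)⁻¹ • p.2 := by funext k; simp [sPt, div_eq_inv_mul]
    rw [this, bil_smul_right]
    rw [div_eq_inv_mul]
  have hsm : Integrable (fun u : Fin N → ℝ => ∏ j, h j (u j))
      (Measure.map (⇑(Matrix.toLin' M)) volume) := by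
    rw [hmap]
    exact hHi.smul_measure ENNReal.ofReal_ne_top
  simp only [hfun]
  refine ⟨hsm.comp_measurable hlin.measurable, ?_⟩
  rw [← integral_map (φ := Matrix.toLin' M) hlin.aemeasurable (f := fun u => ∏ j, h j (u j))
    hHc.aestronglyMeasurable, hmap, integral_smul_measure, hHint]
  simp only [hh, fun j => (hint j).2]
  rw [Fintype.prod_equiv e.symm _ (fun k => (((sqrt 2 : ℝ) : ℂ) * cst p.1 k) *
        Complex.exp (sgn k * (π * 𝕚 * L.bil (toC (F.vec k)) p.2 ^ 2 / (2 * p.1))) *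
          fct k p.1 (L.bil (toC (F.vec k)) p.2) (-L.bil (F.vec k) κ)) fun j => rfl,
    prod_mul_distrib, prod_mul_distrib, prod_mul_distrib, prod_cst hp F.card,
    ← Complex.exp_sum, F.frameTerm_eq_prod _ hp, ENNReal.toReal_ofReal (abs_nonneg _), abs_inv,
    hMabs]
  have hexp : Complex.exp (∑ k, sgn k * (π * 𝕚 *
      L.bil (toC (F.vec k)) p.2 ^ 2 / (2 * p.1))) = ee (L.quad p.2 / p.1) := by
    rw [ee, quad, F.bil_self_eq_sum]
    congr 1
    rw [sum_div, sum_div, mul_sum]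
    exact sum_congr rfl fun k _ => by ring
  have hneg : ∀ b, L.bil b (-κ) = -L.bil b κ := fun b => by
    rw [← neg_one_smul ℝ κ, bil_smul_right]; ring
  rw [hexp]
  simp only [hneg, Finset.prod_const, Finset.card_univ, hcard, Fintype.card_fin]
  rw [Complex.real_smul]
  have h2 : (((sqrt 2 : ℝ) : ℂ)) ≠ 0 := by
    exact_mod_cast (Real.sqrt_pos.2 two_pos).ne'
  have h3 : ((sqrt |(L.gram.det : ℝ)| : ℝ) : ℂ) ≠ 0 := by
    exact_mod_cast (Real.sqrt_pos.2 hg).ne'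
  push_cast
  field_simp

end AdaptedFrame

variable {N : ℕ} (L : EvenLattice N) {d m : ℕ}

lemma single_cast (i : Fin N) : (fun j => ((Pi.single i 1 : Fin N → ℤ) j : ℝ)) = Pi.single i 1 := by
  funext j
  by_cases h : j = i
  · subst h; simp
  · simp [Pi.single_eq_of_ne h]

/-- The coordinates of a dual vector in the dual basis. -/
def dualCoord : L.dual →+ (Fin N → ℤ) where
  toFun l i := round (L.bil l.1 (Pi.single i 1))
  map_zero' := by
    funext i
    simp [bil_zero_left]
  map_add' := by
    intro a b
    funext i
    obtain ⟨m, hm⟩ := a.2 (Pi.single i 1)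
    obtain ⟨n, hn⟩ := b.2 (Pi.single i 1)
    rw [single_cast] at hm hn
    have : L.bil (a + b).1 (Pi.single i 1) = ((m + n : ℤ) : ℝ) := by
      push_cast
      rw [← hm, ← hn, ← bil_add_left, ← AddSubgroup.coe_add]
    simp only [Pi.add_apply, this, hm, hn, round_intCast]

variable {L}

lemma dualCoord_apply (l : L.dual) (i : Fin N) :
    (L.dualCoord l i : ℝ) = L.bil l.1 (Pi.single i 1) := by
  obtain ⟨m, hm⟩ := l.2 (Pi.single i 1)
  rw [single_cast] at hm
  simp only [dualCoord, AddMonoidHom.coe_mk, ZeroHom.coe_mk, hm, round_intCast]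

lemma bil_eq_sum_single (u x : Fin N → ℝ) : L.bil u x = ∑ i, L.bil u (Pi.single i 1) * x i := by
  have : x = ∑ i, x i • (Pi.single i 1 : Fin N → ℝ) := by
    funext j; simp [Finset.sum_apply, Pi.single_apply]
  conv_lhs => rw [this]
  rw [bil_sum_right]
  exact sum_congr rfl fun i _ => by rw [bil_smul_right, mul_comm]

lemma bil_dual (l : L.dual) (x : Fin N → ℝ) : L.bil l.1 x = ∑ i, (L.dualCoord l i : ℝ) * x i := by
  rw [bil_eq_sum_single]
  simp only [dualCoord_apply]

lemma bijective_dualCoord : Function.Bijective L.dualCoord := by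
  constructor
  · rw [injective_iff_map_eq_zero]
    intro l hl
    refine Subtype.ext (L.eq_zero_of_bil_eq_zero fun y => ?_)
    rw [bil_dual, hl]
    simp
  · intro n
    set G : Matrix (Fin N) (Fin N) ℝ := L.gram.map (fun a : ℤ => (a : ℝ)) with hG
    have hdet : IsUnit G.det := by
      have : G.det = (L.gram.det : ℝ) := (Int.cast_det L.gram).symm
      rw [this]
      exact (Int.cast_ne_zero.2 L.nondeg).isUnit
    set v : Fin N → ℝ := (fun i => (n i : ℝ)) ᵥ* G⁻¹ with hv
    have h1 : v ᵥ* G = fun i => (n i : ℝ) := by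
      rw [hv, Matrix.vecMul_vecMul, Matrix.nonsing_inv_mul _ hdet, Matrix.vecMul_one]
    have h2 : ∀ x, L.bil v x = ∑ i, (n i : ℝ) * x i := by
      intro x
      rw [← dotProduct, ← h1]
      simp only [dotProduct, Matrix.vecMul, bil, sum_mul, hG, Matrix.map_apply]
      rw [sum_comm]
    refine ⟨⟨v, fun ν => ⟨∑ i, n i * ν i, by rw [h2]; push_cast; rfl⟩⟩, ?_⟩
    funext i
    have : ((L.dualCoord ⟨v, fun ν => ⟨∑ i, n i * ν i, by rw [h2]; push_cast; rfl⟩⟩ i : ℤ) : ℝ) =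
        (n i : ℝ) := by
      rw [dualCoord_apply, h2]
      simp [Pi.single_apply]
    exact_mod_cast this

/-- The dual lattice in the coordinates of the dual basis. -/
def dualEquiv : L.dual ≃+ (Fin N → ℤ) := AddEquiv.ofBijective L.dualCoord bijective_dualCoord

lemma card_disc : (Fintype.card L.Disc : ℝ) = |(L.gram.det : ℝ)| := by
  set f : (Fin N → ℤ) →ₗ[ℤ] (Fin N → ℤ) := Matrix.toLin' L.gram with hf
  have hdet : LinearMap.det f = L.gram.det := LinearMap.det_toLin' _
  have hinj : Function.Injective f := by
    rw [injective_iff_map_eq_zero]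
    intro v hv
    exact Matrix.eq_zero_of_mulVec_eq_zero L.nondeg (by rwa [hf, Matrix.toLin'_apply] at hv)
  have h1 := Submodule.natAbs_det_equiv (LinearMap.range f) (LinearEquiv.ofInjective f hinj)
  have h2 : (LinearMap.range f).subtype ∘ₗ
      ((LinearEquiv.ofInjective f hinj : (Fin N → ℤ) ≃ₗ[ℤ] LinearMap.range f) :
        (Fin N → ℤ) →+ LinearMap.range f).toIntLinearMap = f := by
    ext; rfl
  have h3 : (((Int.castAddHom ℝ).compLeft (Fin N)).range.addSubgroupOf L.dual).map
      (L.dualEquiv : L.dual →+ (Fin N → ℤ)) = (LinearMap.range f).toAddSubgroup := by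
    ext n
    constructor
    · rintro ⟨l, hl, rfl⟩
      obtain ⟨ν, hν⟩ := (AddSubgroup.mem_addSubgroupOf.1 hl)
      refine ⟨ν, ?_⟩
      funext i
      have : ((f ν i : ℤ) : ℝ) = L.dualCoord l i := by
        rw [dualCoord_apply, ← hν, hf, L.bil_comm]
        simp [Matrix.toLin'_apply, Matrix.mulVec, dotProduct, bil, Pi.single_apply]
      exact_mod_cast this
    · rintro ⟨ν, rfl⟩
      have hd : (fun k => (ν k : ℝ)) ∈ L.dual := by
        intro μ
        exact ⟨∑ i, ∑ j, ν i * L.gram i j * μ j, by simp only [bil]; push_cast; rfl⟩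
      refine ⟨⟨_, hd⟩, AddSubgroup.mem_addSubgroupOf.2 ⟨ν, rfl⟩, ?_⟩
      funext i
      have : ((f ν i : ℤ) : ℝ) = L.dualCoord ⟨_, hd⟩ i := by
        rw [dualCoord_apply, hf, L.bil_comm]
        simp [Matrix.toLin'_apply, Matrix.mulVec, dotProduct, bil, Pi.single_apply]
      exact_mod_cast this.symm
  have h4 : Nat.card L.Disc = Nat.card ((Fin N → ℤ) ⧸ (LinearMap.range f).toAddSubgroup) :=
    Nat.card_congr (QuotientAddGroup.congr _ _ L.dualEquiv h3).toEquiv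
  have h5 : Fintype.card L.Disc = L.gram.det.natAbs := by
    rw [← Nat.card_eq_fintype_card, h4, ← hdet]
    conv_rhs => rw [← h2]
    exact h1.symm
  rw [h5, Nat.cast_natAbs, Int.cast_abs]

variable {N : ℕ} {L : EvenLattice N} {d m : ℕ}

lemma int_mem_dual (ν : Fin N → ℤ) : (fun k => (ν k : ℝ)) ∈ L.dual := fun μ =>
  ⟨∑ i, ∑ j, ν i * L.gram i j * μ j, by simp only [bil]; push_cast; rfl⟩

lemma rep_mem_dual (x : L.Disc) : L.rep x ∈ L.dual := (Quotient.out x : L.dual).2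

lemma mk_rep (x : L.Disc) : (QuotientAddGroup.mk ⟨L.rep x, rep_mem_dual x⟩ : L.Disc) = x :=
  Quotient.out_eq x

lemma coset_eq (l : Fin N → ℝ) (ν : Fin N → ℤ) : coset l ν = l + fun i => (ν i : ℝ) := by
  funext k; simp [coset, add_comm]

lemma coset_mem_dual {l : Fin N → ℝ} (hl : l ∈ L.dual) (ν : Fin N → ℤ) : coset l ν ∈ L.dual := by
  rw [coset_eq]; exact L.dual.add_mem hl (int_mem_dual ν)

/-- A dual vector is the sum of a representative and an integral vector. -/
def dualSplit (L : EvenLattice N) (q : L.Disc × (Fin N → ℤ)) : L.dual :=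
  ⟨coset (L.rep q.1) q.2, coset_mem_dual (rep_mem_dual q.1) q.2⟩

lemma mk_dualSplit (q : L.Disc × (Fin N → ℤ)) :
    (QuotientAddGroup.mk (L.dualSplit q) : L.Disc) = q.1 := by
  conv_rhs => rw [← mk_rep q.1]
  rw [QuotientAddGroup.eq, AddSubgroup.mem_addSubgroupOf]
  refine ⟨-q.2, ?_⟩
  funext k
  simp [dualSplit, coset_eq]

lemma bijective_dualSplit : Function.Bijective L.dualSplit := by
  constructor
  · intro q q' h
    have h1 : q.1 = q'.1 := by rw [← mk_dualSplit q, h, mk_dualSplit]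
    refine Prod.ext h1 ?_
    have h2 := congrArg Subtype.val h
    simp only [dualSplit, h1, coset_eq] at h2
    funext k
    have := congrFun h2 k
    simpa using this
  · intro l
    obtain ⟨c, hc⟩ := exists_int_rep l
    refine ⟨(QuotientAddGroup.mk l, -c), Subtype.ext ?_⟩
    simp only [dualSplit, coset_eq, hc]
    funext k; simp

namespace AdaptedFrame

variable (F : L.AdaptedFrame d m)

/-- The theta series attached to a frame. -/
def frameTheta (l : Fin N → ℝ) (p : Jac[N]) : ℂ := ∑' ν : Fin N → ℤ, F.frameTerm (coset l ν) p

/-- The transformation of the theta series attached to a frame under `S`. -/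
theorem frameTheta_sPt {p : Jac[N]} (hp : 0 < p.1.im) {l : Fin N → ℝ}
    (hl : l ∈ L.dual) : F.frameTheta l (sPt p) =
      Complex.exp (-(π * 𝕚 * m / 4)) * (p.1 ^ (1 / 2 : ℂ)) ^ N /
        ((sqrt (Fintype.card L.Disc) : ℝ) : ℂ) * ee (L.quad p.2 / p.1) *
          ∑ x : L.Disc, ee (-((L.bil l (L.rep x) : ℝ) : ℂ)) * F.frameTheta (L.rep x) p := by
  rw [card_disc]
  set c : ℂ := Complex.exp (-(π * 𝕚 * m / 4)) * (p.1 ^ (1 / 2 : ℂ)) ^ N /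
        ((sqrt |(L.gram.det : ℝ)| : ℝ) : ℂ) * ee (L.quad p.2 / p.1) with hc
  have hp' := sPt_im_pos hp
  obtain ⟨C, κ, hκ, hdec⟩ := F.exists_frameTerm_bound hp'
  have hfi : MeasureTheory.Integrable fun x => F.frameTerm x (sPt p) := by
    have := (F.integral_frameTerm hp 0).1
    simpa only [bil_zero_left, Complex.ofReal_zero, neg_zero, ee_zero, one_mul] using this
  have hint : ∀ κ : L.dual, ∫ x : Fin N → ℝ,
      ee (-∑ i, (L.dualCoord κ i : ℂ) * (x i : ℂ)) * F.frameTerm x (sPt p) =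
      c * F.frameTerm (-κ.1) p := by
    intro κ
    rw [hc, ← (F.integral_frameTerm hp κ.1).2]
    congr 1
    funext x
    rw [bil_dual]
    push_cast
    rfl
  let e : L.Disc × (Fin N → ℤ) ≃ (Fin N → ℤ) :=
    ((Equiv.ofBijective _ bijective_dualSplit).trans (Equiv.neg _)).trans L.dualEquiv.toEquiv
  have he : ∀ q, e q = L.dualCoord (-L.dualSplit q) := fun q => rfl
  have hval : ∀ q, ∫ x : Fin N → ℝ, ee (-∑ i, (e q i : ℂ) * (x i : ℂ)) * F.frameTerm x (sPt p) =
      c * F.frameTerm (coset (L.rep q.1) q.2) p := by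
    intro q
    rw [he, hint]
    congr 2
    simp [dualSplit]
  have hs : Summable fun q : L.Disc × (Fin N → ℤ) =>
      c * F.frameTerm (coset (L.rep q.1) q.2) p := by
    refine Summable.mul_left _ ?_
    refine Summable.of_norm ?_
    rw [summable_prod_of_nonneg fun q => norm_nonneg _]
    exact ⟨fun x => (F.summable_frameTerm hp (L.rep x)).norm, Summable.of_finite⟩
  have hsum : Summable fun n : Fin N → ℤ => ∫ x : Fin N → ℝ,
      ee (-∑ i, (n i : ℂ) * (x i : ℂ)) * F.frameTerm x (sPt p) := by
    rw [← e.summable_iff]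
    simpa only [Function.comp_def, hval] using hs
  have hP := hasSum_poisson (F.continuous_frameTerm hp') hfi hκ hdec hsum l
  rw [← e.hasSum_iff] at hP
  simp only [Function.comp_def, hval] at hP
  have hchar : ∀ q : L.Disc × (Fin N → ℤ), ee (∑ i, (e q i : ℂ) * (l i : ℂ)) =
      ee (-((L.bil l (L.rep q.1) : ℝ) : ℂ)) := by
    intro q
    obtain ⟨k, hk⟩ := hl q.2
    have h1 : ∑ i, (e q i : ℂ) * (l i : ℂ) = -((L.bil l (L.rep q.1) : ℝ) : ℂ) + ((-k : ℤ) : ℂ) := by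
      have h2 : ∑ i, (e q i : ℝ) * l i = -L.bil l (L.rep q.1) + ((-k : ℤ) : ℝ) := by
        rw [he, ← bil_dual]
        have h3 : ((-L.dualSplit q : L.dual) : Fin N → ℝ) =
            -(L.rep q.1 + fun i => (q.2 i : ℝ)) := by
          exact congrArg Neg.neg (coset_eq _ _)
        rw [h3, ← neg_one_smul ℝ, bil_smul_left, bil_add_left, L.bil_comm (L.rep q.1),
          L.bil_comm _ l, hk]
        push_cast; ring
      have := congrArg (fun r : ℝ => (r : ℂ)) h2
      push_cast at this ⊢
      exact this
    rw [h1, ee_add, ee_intCast, mul_one]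
  simp only [hchar] at hP
  have hG := hP.prod_fiberwise (g := fun x : L.Disc =>
    c * F.frameTheta (L.rep x) p * ee (-((L.bil l (L.rep x) : ℝ) : ℂ)))
    fun x => ((F.summable_frameTerm hp (L.rep x)).hasSum.mul_left c).mul_right _
  have h1 := hG.unique (hasSum_fintype _)
  rw [frameTheta]
  simp only [coset_eq]
  rw [h1, mul_sum]
  exact sum_congr rfl fun x _ => by ring

end AdaptedFrame

end EvenLattice

/-! ### Hyperbolic rotation of the error function -/

open MeasureTheory Set

/-- The first coordinate of a boosted vector. -/
def boostN (ξ ρ s : ℝ) : ℝ := Real.cosh s * ξ + Real.sinh s * ρ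

/-- The second coordinate of a boosted vector. -/
def boostG (ξ ρ s : ℝ) : ℝ := Real.sinh s * ξ + Real.cosh s * ρ

/-- The derivative of `rerf (T * boostN ξ ρ s)` in `s`. -/
def boostKer (T ξ ρ s : ℝ) : ℝ := 2 / sqrt π * exp (-(T * boostN ξ ρ s) ^ 2) * (T * boostG ξ ρ s)

lemma boost_sq_sub_sq (ξ ρ s : ℝ) : boostN ξ ρ s ^ 2 - boostG ξ ρ s ^ 2 = ξ ^ 2 - ρ ^ 2 := by
  have := Real.cosh_sq s
  simp only [boostN, boostG]
  linear_combination (ξ ^ 2 - ρ ^ 2) * this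

lemma hasDerivAt_boostN (ξ ρ s : ℝ) : HasDerivAt (boostN ξ ρ) (boostG ξ ρ s) s :=
  ((Real.hasDerivAt_cosh s).mul_const ξ).add ((Real.hasDerivAt_sinh s).mul_const ρ)

lemma hasDerivAt_rerf_boostN (T ξ ρ s : ℝ) :
    HasDerivAt (fun s => rerf (T * boostN ξ ρ s)) (boostKer T ξ ρ s) s :=
  (hasDerivAt_rerf _).comp s ((hasDerivAt_boostN ξ ρ s).const_mul T)

lemma continuous_boostKer (T ξ ρ : ℝ) : Continuous (boostKer T ξ ρ) := by
  unfold boostKer boostN boostG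
  have := Real.continuous_cosh
  have := Real.continuous_sinh
  fun_prop

/-- The signed indicator of the set of rapidities between `0` and `artanh β`. -/
def rapWt (β : ℝ) : ℝ → ℝ :=
  open scoped Classical in
  if β = 1 then indicator (Ioi 0) 1
  else if β = -1 then -indicator (Iic 0) 1
  else indicator (Ioc 0 (Real.artanh β)) 1 - indicator (Ioc (Real.artanh β) 0) 1

lemma measurable_rapWt (β : ℝ) : Measurable (rapWt β) := by
  unfold rapWt
  have h : ∀ {s : Set ℝ}, MeasurableSet s → Measurable (indicator s (1 : ℝ → ℝ)) := fun hs =>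
    measurable_one.indicator hs
  split_ifs
  · exact h measurableSet_Ioi
  · exact (h measurableSet_Iic).neg
  · exact (h measurableSet_Ioc).sub (h measurableSet_Ioc)

lemma abs_rapWt_le (β s : ℝ) : |rapWt β s| ≤ 1 := by
  unfold rapWt
  split_ifs
  · by_cases h : s ∈ Ioi (0 : ℝ) <;> simp [h]
  · by_cases h : s ∈ Iic (0 : ℝ) <;> simp [h]
  · by_cases h : s ∈ Ioc 0 (Real.artanh β)
    · have : s ∉ Ioc (Real.artanh β) 0 := fun h' => absurd h.1 (not_lt.2 h'.2)
      simp [h, this]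
    · by_cases h' : s ∈ Ioc (Real.artanh β) 0 <;> simp [h, h']

lemma abs_le_of_rapWt_ne_zero {β s : ℝ} (h1 : β ≠ 1) (h2 : β ≠ -1) (h : rapWt β s ≠ 0) :
    |s| ≤ |Real.artanh β| := by
  rw [rapWt, if_neg h1, if_neg h2] at h
  by_cases hs : s ∈ Ioc 0 (Real.artanh β)
  · rw [abs_of_pos hs.1]; exact hs.2.trans (le_abs_self _)
  · by_cases hs' : s ∈ Ioc (Real.artanh β) 0
    · rw [abs_of_nonpos hs'.2]; exact (neg_le_neg hs'.1.le).trans (neg_le_abs _)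
    · simp [hs, hs'] at h

lemma boost_coercive_of_pos {δ ξ ρ s : ℝ} (hδ : 0 < δ) (hs : 0 ≤ s) (h : δ ≤ |ξ + ρ|) :
    |ξ| + |ρ| + |s| ≤ (4 + 4 / δ ^ 2) * (boostN ξ ρ s ^ 2 + boostG ξ ρ s ^ 2 + 1) := by
  set a := exp s with ha
  have ha1 : 1 ≤ a := Real.one_le_exp hs
  have ha0 : 0 < a := Real.exp_pos s
  have has : s ≤ a := by have := Real.add_one_le_exp s; linarith
  set A := a * (ξ + ρ) with hA
  set B := (ρ - ξ) / a with hB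
  have hQ : boostN ξ ρ s ^ 2 + boostG ξ ρ s ^ 2 = (A ^ 2 + B ^ 2) / 2 := by
    rw [boostN, boostG, Real.cosh_eq, Real.sinh_eq, Real.exp_neg, ← ha, hA, hB]
    field_simp; ring
  have h1 : |ξ| + |ρ| ≤ |ξ + ρ| + |ρ - ξ| := by
    have e1 : ξ = ((ξ + ρ) - (ρ - ξ)) / 2 := by ring
    have e2 : ρ = ((ξ + ρ) + (ρ - ξ)) / 2 := by ring
    have i1 : |ξ| ≤ (|ξ + ρ| + |ρ - ξ|) / 2 := by
      conv_lhs => rw [e1, abs_div, abs_two]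
      exact div_le_div_of_nonneg_right (abs_sub _ _) two_pos.le
    have i2 : |ρ| ≤ (|ξ + ρ| + |ρ - ξ|) / 2 := by
      conv_lhs => rw [e2, abs_div, abs_two]
      exact div_le_div_of_nonneg_right (abs_add_le _ _) two_pos.le
    linarith
  have h2 : |ξ + ρ| ≤ A ^ 2 + 1 := by
    have : |ξ + ρ| ≤ |A| := by
      rw [hA, abs_mul, abs_of_pos ha0]; exact le_mul_of_one_le_left (abs_nonneg _) ha1
    nlinarith [sq_abs A, sq_nonneg (|A| - 1)]
  have h3 : a ^ 2 ≤ A ^ 2 / δ ^ 2 := by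
    rw [le_div_iff₀ (by positivity), hA, mul_pow, ← sq_abs (ξ + ρ)]
    gcongr
  have h4 : |ρ - ξ| ≤ (a ^ 2 + B ^ 2) / 2 := by
    have : |ρ - ξ| = a * |B| := by rw [hB, abs_div, abs_of_pos ha0]; field_simp
    rw [this]
    nlinarith [sq_abs B, sq_nonneg (a - |B|)]
  have h5 : s ≤ a ^ 2 := by nlinarith
  rw [hQ, abs_of_nonneg hs]
  have h6 : 0 ≤ A ^ 2 / δ ^ 2 := by positivity
  have h7 : 0 ≤ B ^ 2 / δ ^ 2 := by positivity
  have h8 : 0 ≤ 4 / δ ^ 2 := by positivity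
  have e : (4 + 4 / δ ^ 2) * ((A ^ 2 + B ^ 2) / 2 + 1) =
    2 * A ^ 2 + 2 * B ^ 2 + 4 + 2 * (A ^ 2 / δ ^ 2) + 2 * (B ^ 2 / δ ^ 2) + 4 / δ ^ 2 := by ring
  rw [e]
  nlinarith [sq_nonneg A, sq_nonneg B]

lemma boost_coercive_of_bounded {S ξ ρ s : ℝ} (hs : |s| ≤ S) :
    |ξ| + |ρ| + |s| ≤ (2 * exp S + S) * (boostN ξ ρ s ^ 2 + boostG ξ ρ s ^ 2 + 1) := by
  have hS : 0 ≤ S := (abs_nonneg s).trans hs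
  have hN : ξ = boostN (boostN ξ ρ s) (boostG ξ ρ s) (-s) := by
    have := Real.cosh_sq s
    simp only [boostN, boostG, Real.cosh_neg, Real.sinh_neg]
    linear_combination -ξ * this
  have hG : ρ = boostG (boostN ξ ρ s) (boostG ξ ρ s) (-s) := by
    have := Real.cosh_sq s
    simp only [boostN, boostG, Real.cosh_neg, Real.sinh_neg]
    linear_combination -ρ * this
  set x := boostN ξ ρ s
  set r := boostG ξ ρ s
  have hc : Real.cosh s + |Real.sinh s| ≤ exp S := by
    refine le_trans (le_of_eq ?_) (Real.exp_le_exp.2 hs)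
    rw [← Real.cosh_abs, Real.abs_sinh, Real.cosh_add_sinh]
  have h1 : |ξ| ≤ Real.cosh s * |x| + |Real.sinh s| * |r| := by
    rw [hN, boostN, Real.cosh_neg, Real.sinh_neg]
    refine (abs_add_le _ _).trans (le_of_eq ?_)
    rw [abs_mul, abs_mul, abs_neg, abs_of_pos (Real.cosh_pos s)]
  have h2 : |ρ| ≤ |Real.sinh s| * |x| + Real.cosh s * |r| := by
    rw [hG, boostG, Real.cosh_neg, Real.sinh_neg]
    refine (abs_add_le _ _).trans (le_of_eq ?_)
    rw [abs_mul, abs_mul, abs_neg, abs_of_pos (Real.cosh_pos s)]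
  have h3 : |x| + |r| ≤ 2 * (x ^ 2 + r ^ 2 + 1) := by
    nlinarith [sq_abs x, sq_abs r, sq_nonneg (|x| - 1), sq_nonneg (|r| - 1), sq_nonneg x, sq_nonneg r]
  have h4 : |ξ| + |ρ| ≤ exp S * (|x| + |r|) := by
    refine le_trans ?_ (mul_le_mul_of_nonneg_right hc (by positivity))
    linarith
  have h5 : exp S * (|x| + |r|) ≤ exp S * (2 * (x ^ 2 + r ^ 2 + 1)) :=
    mul_le_mul_of_nonneg_left h3 (Real.exp_pos S).le
  have h6 : S ≤ S * (x ^ 2 + r ^ 2 + 1) := le_mul_of_one_le_right hS (by nlinarith [sq_nonneg x, sq_nonneg r])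
  linarith

lemma exists_boost_coercive {β δ : ℝ} (hδ : 0 < δ) :
    ∃ K > 0, ∀ s ξ ρ, rapWt β s ≠ 0 → (β ^ 2 = 1 → δ ≤ |ξ + β * ρ|) →
      |ξ| + |ρ| + |s| ≤ K * (boostN ξ ρ s ^ 2 + boostG ξ ρ s ^ 2 + 1) := by
  by_cases h1 : β = 1
  · refine ⟨4 + 4 / δ ^ 2, by positivity, fun s ξ ρ hs h => ?_⟩
    refine boost_coercive_of_pos hδ ?_ (by simpa [h1] using h)
    by_contra hs'
    refine hs ?_
    rw [rapWt, if_pos h1, indicator_of_notMem]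
    simp only [mem_Ioi]; linarith
  by_cases h2 : β = -1
  · refine ⟨4 + 4 / δ ^ 2, by positivity, fun s ξ ρ hs h => ?_⟩
    have hs' : s ≤ 0 := by
      by_contra hs'
      refine hs ?_
      rw [rapWt, if_neg h1, if_pos h2, Pi.neg_apply, indicator_of_notMem, neg_zero]
      simpa using hs'
    have := boost_coercive_of_pos (ξ := -ξ) (ρ := ρ) (s := -s) hδ (by linarith) (by
      have := h (by rw [h2]; norm_num)
      rwa [h2, ← abs_neg, neg_add, ← neg_mul, neg_neg, one_mul] at this)
    have e1 : boostN (-ξ) ρ (-s) = -boostN ξ ρ s := by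
      simp only [boostN, Real.cosh_neg, Real.sinh_neg]; ring
    have e2 : boostG (-ξ) ρ (-s) = boostG ξ ρ s := by
      simp only [boostG, Real.cosh_neg, Real.sinh_neg]; ring
    rwa [e1, e2, abs_neg, abs_neg, neg_sq] at this
  · exact ⟨2 * exp |Real.artanh β| + |Real.artanh β|, by positivity, fun s ξ ρ hs _ =>
      boost_coercive_of_bounded (abs_le_of_rapWt_ne_zero h1 h2 hs)⟩

lemma exists_boostKer_bound {β δ T : ℝ} (hδ : 0 < δ) (hT : 0 < T) :
    ∃ κ > 0, ∃ C > 0, ∀ s ξ ρ, (β ^ 2 = 1 → δ ≤ |ξ + β * ρ|) →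
      |rapWt β s * boostKer T ξ ρ s| * exp (T ^ 2 * ((ξ ^ 2 - ρ ^ 2) / 2)) ≤
        C * exp (-(κ * (|ξ| + |ρ| + |s|))) := by
  obtain ⟨K, hK, h⟩ := exists_boost_coercive (β := β) hδ
  set a := T ^ 2 / 4 with ha
  have ha0 : 0 < a := by positivity
  set c := 2 / sqrt π * T with hc
  have hc0 : 0 < c := by have := Real.pi_pos; positivity
  refine ⟨a / K, by positivity, c * (1 / a * exp (2 * a)), by positivity, fun s ξ ρ hβ => ?_⟩
  by_cases hs : rapWt β s = 0
  · rw [hs, zero_mul, abs_zero, zero_mul]; positivity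
  have h1 := h s ξ ρ hs hβ
  have h2 := boost_sq_sub_sq ξ ρ s
  set x := boostN ξ ρ s with hx
  set r := boostG ξ ρ s with hr
  set Q := x ^ 2 + r ^ 2 with hQ
  have hQ0 : 0 ≤ Q := by positivity
  have hr1 : |r| ≤ Q + 1 := by nlinarith [sq_abs r, sq_nonneg (|r| - 1), sq_nonneg x]
  have e1 : |boostKer T ξ ρ s| = c * |r| * exp (-(T * x) ^ 2) := by
    rw [boostKer, abs_mul, abs_mul, abs_mul, Real.abs_exp, abs_of_pos hT,
      abs_of_nonneg (by positivity : 0 ≤ 2 / sqrt π), hc]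
    ring
  have e2 : exp (-(T * x) ^ 2) * exp (T ^ 2 * ((ξ ^ 2 - ρ ^ 2) / 2)) = exp (-(2 * a * Q)) := by
    rw [← Real.exp_add, ← h2, ha, hQ]; congr 1; ring
  have h3 : (Q + 1) * exp (-(2 * a * Q)) ≤ 1 / a * exp (2 * a) * exp (-(a * (Q + 1))) := by
    have h4 : Q + 1 ≤ 1 / a * exp (a * (Q + 1)) := by
      rw [one_div_mul_eq_div, le_div_iff₀ ha0, mul_comm]
      have := Real.add_one_le_exp (a * (Q + 1)); linarith
    refine (mul_le_mul_of_nonneg_right h4 (Real.exp_pos _).le).trans (le_of_eq ?_)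
    rw [mul_assoc, mul_assoc (1 / a), ← Real.exp_add, ← Real.exp_add]
    congr 2; ring
  have h5 : exp (-(a * (Q + 1))) ≤ exp (-(a / K * (|ξ| + |ρ| + |s|))) := by
    apply Real.exp_le_exp.2
    rw [neg_le_neg_iff, div_mul_eq_mul_div, div_le_iff₀ hK]
    have := mul_le_mul_of_nonneg_left h1 ha0.le
    linarith
  calc |rapWt β s * boostKer T ξ ρ s| * exp (T ^ 2 * ((ξ ^ 2 - ρ ^ 2) / 2))
      ≤ |boostKer T ξ ρ s| * exp (T ^ 2 * ((ξ ^ 2 - ρ ^ 2) / 2)) := by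
        refine mul_le_mul_of_nonneg_right ?_ (Real.exp_pos _).le
        rw [abs_mul]
        exact mul_le_of_le_one_left (abs_nonneg _) (abs_rapWt_le β s)
    _ = c * (|r| * exp (-(2 * a * Q))) := by rw [e1, ← e2]; ring
    _ ≤ c * ((Q + 1) * exp (-(2 * a * Q))) := by gcongr
    _ ≤ c * (1 / a * exp (2 * a) * exp (-(a * (Q + 1)))) := by gcongr
    _ ≤ c * (1 / a * exp (2 * a) * exp (-(a / K * (|ξ| + |ρ| + |s|)))) := by gcongr
    _ = _ := by ring

lemma integrable_exp_neg_mul_abs {κ : ℝ} (hκ : 0 < κ) :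
    Integrable fun s : ℝ => exp (-(κ * |s|)) := by
  rw [← integrableOn_univ, ← Iic_union_Ioi (a := (0 : ℝ))]
  refine IntegrableOn.union ?_ ?_
  · refine (integrableOn_exp_mul_Iic hκ 0).congr_fun (fun s hs => ?_) measurableSet_Iic
    simp only [abs_of_nonpos (mem_Iic.1 hs), mul_neg, neg_neg]
  · refine (integrableOn_exp_mul_Ioi (neg_lt_zero.2 hκ) 0).congr_fun (fun s hs => ?_)
      measurableSet_Ioi
    simp only [abs_of_pos (mem_Ioi.1 hs), neg_mul]

lemma integrable_rapWt_mul_boostKer {β T ξ ρ : ℝ} (hT : 0 < T) (h : β ^ 2 = 1 → ξ + β * ρ ≠ 0) :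
    Integrable fun s => rapWt β s * boostKer T ξ ρ s := by
  obtain ⟨δ, hδ, h'⟩ : ∃ δ > 0, β ^ 2 = 1 → δ ≤ |ξ + β * ρ| := by
    by_cases hβ : β ^ 2 = 1
    · exact ⟨_, abs_pos.2 (h hβ), fun _ => le_rfl⟩
    · exact ⟨1, one_pos, fun h => absurd h hβ⟩
  obtain ⟨κ, hκ, C, hC, hb⟩ := exists_boostKer_bound (β := β) hδ hT
  refine Integrable.mono' ((integrable_exp_neg_mul_abs hκ).const_mul
    (C * exp (-(T ^ 2 * ((ξ ^ 2 - ρ ^ 2) / 2)))))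
    ((measurable_rapWt β).mul (continuous_boostKer T ξ ρ).measurable).aestronglyMeasurable
    (Eventually.of_forall fun s => ?_)
  have h1 := hb s ξ ρ h'
  rw [Real.norm_eq_abs, ← mul_le_mul_iff_left₀ (Real.exp_pos (T ^ 2 * ((ξ ^ 2 - ρ ^ 2) / 2)))]
  refine h1.trans ?_
  have e : C * exp (-(T ^ 2 * ((ξ ^ 2 - ρ ^ 2) / 2))) * exp (-(κ * |s|)) *
      exp (T ^ 2 * ((ξ ^ 2 - ρ ^ 2) / 2)) = C * exp (-(κ * |s|)) := by
    rw [Real.exp_neg (T ^ 2 * _)]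
    field_simp
  rw [e]
  gcongr
  have := abs_nonneg ξ
  have := abs_nonneg ρ
  linarith

lemma tendsto_rerf_atBot : Tendsto rerf atBot (𝓝 (-1)) := by
  have := (tendsto_rerf.comp tendsto_neg_atBot_atTop).neg
  refine this.congr fun x => ?_
  rw [Function.comp_apply, rerf_neg, neg_neg]

lemma tendsto_boostN_atTop {ξ ρ : ℝ} (h : 0 < ξ + ρ) : Tendsto (boostN ξ ρ) atTop atTop := by
  have e : ∀ s, boostN ξ ρ s = (ξ + ρ) / 2 * exp s + (ξ - ρ) / 2 * exp (-s) := by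
    intro s; rw [boostN, Real.cosh_eq, Real.sinh_eq]; ring
  rw [funext e]
  refine Tendsto.atTop_add (Real.tendsto_exp_atTop.const_mul_atTop (by linarith))
    (C := (ξ - ρ) / 2 * 0) ?_
  exact (Real.tendsto_exp_neg_atTop_nhds_zero).const_mul _

lemma tendsto_rerf_boostN {T ξ ρ : ℝ} (hT : 0 < T) (h : ξ + ρ ≠ 0) :
    Tendsto (fun s => rerf (T * boostN ξ ρ s)) atTop (𝓝 (Real.sign (ξ + ρ))) := by
  rcases lt_or_gt_of_ne h with h | h
  · rw [Real.sign_of_neg h]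
    have := tendsto_rerf_atBot.comp (tendsto_neg_atTop_atBot.comp
      ((tendsto_boostN_atTop (ξ := -ξ) (ρ := -ρ) (by linarith)).const_mul_atTop hT))
    refine this.congr fun s => ?_
    simp only [Function.comp_apply, boostN]
    congr 1; ring
  · rw [Real.sign_of_pos h]
    exact tendsto_rerf.comp ((tendsto_boostN_atTop h).const_mul_atTop hT)

lemma integral_rapWt_mul_boostKer {β T ξ ρ : ℝ} (hβ : β ^ 2 ≤ 1) (hT : 0 < T)
    (h : β ^ 2 = 1 → ξ + β * ρ ≠ 0) :
    ∫ s, rapWt β s * boostKer T ξ ρ s = (open scoped Classical in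
      if β ^ 2 = 1 then Real.sign (ξ + β * ρ)
      else rerf (T * ((ξ + β * ρ) / sqrt (1 - β ^ 2)))) - rerf (T * ξ) := by
  have hint := integrable_rapWt_mul_boostKer hT h
  have hd := hasDerivAt_rerf_boostN T ξ ρ
  have h0 : boostN ξ ρ 0 = ξ := by simp [boostN]
  by_cases h1 : β = 1
  · subst h1
    have e : (fun s => rapWt 1 s * boostKer T ξ ρ s) = indicator (Ioi 0) (boostKer T ξ ρ) := by
      funext s
      rw [rapWt, if_pos rfl]
      by_cases hs : s ∈ Ioi (0 : ℝ) <;> simp [hs]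
    rw [e] at hint ⊢
    rw [integral_indicator measurableSet_Ioi, if_pos (one_pow 2), one_mul]
    rw [integrable_indicator_iff measurableSet_Ioi] at hint
    rw [integral_Ioi_of_hasDerivAt_of_tendsto' (fun s _ => hd s) hint
      (tendsto_rerf_boostN hT (by simpa using h)), h0]
  by_cases h2 : β = -1
  · subst h2
    have e : (fun s => rapWt (-1) s * boostKer T ξ ρ s) =
        fun s => -indicator (Iic 0) (boostKer T ξ ρ) s := by
      funext s
      rw [rapWt, if_neg h1, if_pos rfl]
      by_cases hs : s ∈ Iic (0 : ℝ) <;> simp [hs]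
    rw [e] at hint ⊢
    rw [integral_neg, integral_indicator measurableSet_Iic, if_pos (by norm_num)]
    have hint' := hint.neg
    simp only [Pi.neg_def, neg_neg] at hint'
    rw [integrable_indicator_iff measurableSet_Iic] at hint'
    have hne : ξ + -ρ ≠ 0 := by have := h (by norm_num); rwa [neg_one_mul] at this
    have ht : Tendsto (fun s => rerf (T * boostN ξ ρ s)) atBot (𝓝 (Real.sign (ξ + -ρ))) := by
      refine ((tendsto_rerf_boostN hT hne).comp tendsto_neg_atBot_atTop).congr fun s => ?_
      simp [boostN]
    rw [integral_Iic_of_hasDerivAt_of_tendsto' (fun s _ => hd s) hint' ht, h0, neg_one_mul]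
    ring
  · have hne : β ^ 2 ≠ 1 := by
      exact fun h3 => ((sq_eq_sq_iff_eq_or_eq_neg (b := (1 : ℝ))).1 (by rw [h3, one_pow])).elim h1 h2
    have hlt : β ^ 2 < 1 := lt_of_le_of_ne hβ hne
    have hmem : β ∈ Ioo (-1) 1 := by
      rw [mem_Ioo, ← abs_lt]; exact (sq_lt_one_iff_abs_lt_one β).1 hlt
    set a := Real.artanh β with ha
    have hii : ∀ x y, IntervalIntegrable (boostKer T ξ ρ) volume x y := fun x y =>
      (continuous_boostKer T ξ ρ).intervalIntegrable x y
    have e : (fun s => rapWt β s * boostKer T ξ ρ s) = fun s =>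
        indicator (Ioc 0 a) (boostKer T ξ ρ) s - indicator (Ioc a 0) (boostKer T ξ ρ) s := by
      funext s
      rw [rapWt, if_neg h1, if_neg h2, Pi.sub_apply, sub_mul, ← ha]
      by_cases hs : s ∈ Ioc 0 a <;> by_cases hs' : s ∈ Ioc a 0 <;> simp [hs, hs']
    rw [e, integral_sub ((integrable_indicator_iff measurableSet_Ioc).2 (hii 0 a).1)
      ((integrable_indicator_iff measurableSet_Ioc).2 (hii 0 a).2),
      integral_indicator measurableSet_Ioc, integral_indicator measurableSet_Ioc,
      ← intervalIntegral, intervalIntegral.integral_eq_sub_of_hasDerivAt (fun s _ => hd s) (hii 0 a),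
      h0, if_neg hne]
    congr 3
    rw [boostN, ha, Real.cosh_artanh hmem, Real.sinh_artanh hmem]
    ring

/-! ### The components as integrals of theta series attached to frames -/

namespace EvenLattice

open MeasureTheory

variable {N : ℕ} {L : EvenLattice N} {d m : ℕ} {F : L.AdaptedFrame d m}

/-- The hyperbolic rotation of an adapted frame. -/
def AdaptedFrame.boost (F : L.AdaptedFrame d m) (s : Fin d → ℝ) : L.AdaptedFrame d m where
  n i := Real.cosh (s i) • F.n i + Real.sinh (s i) • F.g i
  g i := Real.sinh (s i) • F.n i + Real.cosh (s i) • F.g i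
  w := F.w
  card := F.card
  nn i j := by
    have h := Real.cosh_sq (s i)
    simp only [bil_add_left, bil_add_right, bil_smul_left, bil_smul_right, F.nn, F.gg, F.ng,
      L.bil_comm (F.g i) (F.n j)]
    split_ifs with hij
    · subst hij; linear_combination -2 * h
    · ring
  gg i j := by
    have h := Real.cosh_sq (s i)
    simp only [bil_add_left, bil_add_right, bil_smul_left, bil_smul_right, F.nn, F.gg, F.ng,
      L.bil_comm (F.g i) (F.n j)]
    split_ifs with hij
    · subst hij; linear_combination 2 * h
    · ring
  ww := F.ww
  ng i j := by
    simp only [bil_add_left, bil_add_right, bil_smul_left, bil_smul_right, F.nn, F.gg, F.ng,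
      L.bil_comm (F.g i) (F.n j)]
    split_ifs with hij
    · subst hij; ring
    · ring
  nw i j := by simp only [bil_add_left, bil_smul_left, F.nw, F.gw]; ring
  gw i j := by simp only [bil_add_left, bil_smul_left, F.nw, F.gw]; ring

namespace Side

/-- The weight of the integral representation. -/
def boostWt (B B' : Side F) (s : Fin d → ℝ) : ℝ :=
  ∏ i, 2 * (rapWt (B.β i) (s i) - rapWt (B'.β i) (s i))

/-- The one-dimensional factors of the integral representation. -/
def boostFac (B B' : Side F) (x : Fin N → ℝ) (p : Jac[N]) (i : Fin d) (s : ℝ) : ℝ :=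
  (rapWt (B.β i) s - rapWt (B'.β i) s) * boostKer (sqrt (π * p.1.im))
    (L.bil (F.n i) (x + vy p)) (L.bil (F.g i) (x + vy p)) s

variable {B B' : Side F} {x : Fin N → ℝ} {p : Jac[N]}

lemma boostWt_mul_frameTerm (hp : 0 < p.1.im) (s : Fin d → ℝ) :
    (boostWt B B' s : ℂ) * (F.boost s).frameTerm x p =
      (∏ i, ((boostFac B B' x p i (s i) : ℝ) : ℂ)) * qexp L x p := by
  rw [AdaptedFrame.frameTerm, boostWt, ← mul_assoc, Complex.ofReal_prod, ← prod_mul_distrib]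
  congr 1
  refine prod_congr rfl fun i _ => ?_
  rw [← Complex.ofReal_mul]
  congr 1
  have hn : L.bil ((F.boost s).n i) (x + vy p) =
      boostN (L.bil (F.n i) (x + vy p)) (L.bil (F.g i) (x + vy p)) (s i) := by
    simp only [AdaptedFrame.boost, bil_add_left, bil_smul_left, boostN]
  have hg : L.bil ((F.boost s).g i) (x + vy p) =
      boostG (L.bil (F.n i) (x + vy p)) (L.bil (F.g i) (x + vy p)) (s i) := by
    simp only [AdaptedFrame.boost, bil_add_left, bil_smul_left, boostG]
  have hpi : sqrt π ≠ 0 := (Real.sqrt_pos.2 Real.pi_pos).ne'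
  rw [hn, hg, boostFac, boostKer, mul_pow, Real.sq_sqrt (by positivity),
    Real.sqrt_mul Real.pi_pos.le]
  field_simp

lemma AllGood.integrable_boostFac (h : AllGood B B' x p) (i : Fin d) :
    Integrable (boostFac B B' x p i) := by
  have hT : 0 < sqrt (π * p.1.im) := Real.sqrt_pos.2 (mul_pos Real.pi_pos h.1)
  unfold boostFac
  simp only [sub_mul]
  refine (integrable_rapWt_mul_boostKer hT fun hβ => ?_).sub
    (integrable_rapWt_mul_boostKer hT fun hβ => ?_)
  · rw [← B.bil_dir]; exact (h.2 i).1.2 hβ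
  · rw [← B'.bil_dir]; exact (h.2 i).2.2 hβ

lemma Good.integral_rapWt {i : Fin d} (h : B.Good i x p) :
    ((∫ s, rapWt (B.β i) s * boostKer (sqrt (π * p.1.im))
      (L.bil (F.n i) (x + vy p)) (L.bil (F.g i) (x + vy p)) s : ℝ) : ℂ) =
    B.rhoC i x p - ((rerf (sqrt (π * p.1.im) * L.bil (F.n i) (x + vy p)) : ℝ) : ℂ) := by
  have hT : 0 < sqrt (π * p.1.im) := Real.sqrt_pos.2 (mul_pos Real.pi_pos h.1)
  rw [integral_rapWt_mul_boostKer (B.sq_le i) hT fun hβ => by rw [← B.bil_dir]; exact h.2 hβ,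
    ← B.bil_dir, rhoC, Complex.ofReal_sub]
  congr 1
  split_ifs
  · rfl
  · rw [cerf_ofReal]

lemma AllGood.integral_boostFac (h : AllGood B B' x p) (i : Fin d) :
    ((∫ s, boostFac B B' x p i s : ℝ) : ℂ) = B.rhoC i x p - B'.rhoC i x p := by
  have hT : 0 < sqrt (π * p.1.im) := Real.sqrt_pos.2 (mul_pos Real.pi_pos h.1)
  unfold boostFac
  simp only [sub_mul]
  rw [integral_sub, Complex.ofReal_sub, (h.2 i).1.integral_rapWt, (h.2 i).2.integral_rapWt]
  · ring
  · exact integrable_rapWt_mul_boostKer hT fun hβ => by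
      rw [← B.bil_dir]; exact (h.2 i).1.2 hβ
  · exact integrable_rapWt_mul_boostKer hT fun hβ => by
      rw [← B'.bil_dir]; exact (h.2 i).2.2 hβ

lemma AllGood.integrable_frameTerm (h : AllGood B B' x p) :
    Integrable fun s => (boostWt B B' s : ℂ) * (F.boost s).frameTerm x p := by
  simp only [boostWt_mul_frameTerm h.1]
  exact (Integrable.fintype_prod fun i => (h.integrable_boostFac i).ofReal).mul_const _

lemma AllGood.integral_frameTerm (h : AllGood B B' x p) :
    ∫ s, (boostWt B B' s : ℂ) * (F.boost s).frameTerm x p = summand B B' x p := by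
  simp only [boostWt_mul_frameTerm h.1]
  rw [integral_mul_const,
    integral_fintype_prod_volume_eq_prod fun i s => ((boostFac B B' x p i s : ℝ) : ℂ), summand]
  congr 1
  refine prod_congr rfl fun i _ => ?_
  rw [← h.integral_boostFac]
  exact integral_ofReal

variable {l : Fin N → ℝ}

lemma exists_boostFac_bound (hp : p ∈ regular B B' l) :
    ∃ κ > 0, ∃ C > 0, ∀ ν i s, |boostFac B B' (coset l ν) p i s| * exp (π * p.1.im *
      ((L.bil (F.n i) (coset l ν + vy p) ^ 2 - L.bil (F.g i) (coset l ν + vy p) ^ 2) / 2)) ≤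
      C * exp (-(κ * (|L.bil (F.n i) (coset l ν + vy p)| +
        |L.bil (F.g i) (coset l ν + vy p)| + |s|))) := by
  have hT : 0 < sqrt (π * p.1.im) := Real.sqrt_pos.2 (mul_pos Real.pi_pos hp.1)
  have hT2 : sqrt (π * p.1.im) ^ 2 = π * p.1.im := Real.sq_sqrt (mul_pos Real.pi_pos hp.1).le
  have key : ∀ B : Side F, (∀ i, ¬ B.OnWall (vy p) l i) → ∃ κ > 0, ∃ C > 0, ∀ ν i s,
      |rapWt (B.β i) s * boostKer (sqrt (π * p.1.im))
        (L.bil (F.n i) (coset l ν + vy p)) (L.bil (F.g i) (coset l ν + vy p)) s| *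
        exp (π * p.1.im *
        ((L.bil (F.n i) (coset l ν + vy p) ^ 2 - L.bil (F.g i) (coset l ν + vy p) ^ 2) / 2)) ≤
        C * exp (-(κ * (|L.bil (F.n i) (coset l ν + vy p)| +
          |L.bil (F.g i) (coset l ν + vy p)| + |s|))) := by
    intro B hB
    have hδ : ∀ i, ∃ δ > 0, B.β i ^ 2 = 1 → ∀ ν, δ ≤ |L.bil (B.dir i) (coset l ν + vy p)| := by
      intro i
      by_cases hi : B.β i ^ 2 = 1
      · obtain ⟨δ, hδ, h⟩ := B.exists_discrete (l := l) hi (vy p)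
        exact ⟨δ, hδ, fun _ ν => h ν ((not_onWall_iff hi).1 (hB i) ν)⟩
      · exact ⟨1, one_pos, fun h => absurd h hi⟩
    choose δ hδ hδ' using hδ
    choose κ hκ C hC hb using fun i => exists_boostKer_bound (β := B.β i) (hδ i) hT
    obtain ⟨κ₀, hκ₀, hκ₀'⟩ := exists_pos_le_of_finite hκ
    obtain ⟨C₀, hC₀⟩ := Finite.exists_le C
    refine ⟨κ₀, hκ₀, max C₀ 1, by positivity, fun ν i s => ?_⟩
    have h1 := hb i s (L.bil (F.n i) (coset l ν + vy p)) (L.bil (F.g i) (coset l ν + vy p))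
      fun hi => by rw [← B.bil_dir]; exact hδ' i hi ν
    rw [hT2] at h1
    refine h1.trans ?_
    gcongr
    · exact (hC₀ i).trans (le_max_left _ _)
    · exact hκ₀' i
  obtain ⟨κ, hκ, C, hC, h⟩ := key B fun i => (hp.2 i).1
  obtain ⟨κ', hκ', C', hC', h'⟩ := key B' fun i => (hp.2 i).2
  refine ⟨min κ κ', by positivity, C + C', by positivity, fun ν i s => ?_⟩
  have h1 := h ν i s
  have h2 := h' ν i s
  have e1 : |boostFac B B' (coset l ν) p i s| ≤ |rapWt (B.β i) s * boostKer (sqrt (π * p.1.im))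
        (L.bil (F.n i) (coset l ν + vy p)) (L.bil (F.g i) (coset l ν + vy p)) s| +
      |rapWt (B'.β i) s * boostKer (sqrt (π * p.1.im))
        (L.bil (F.n i) (coset l ν + vy p)) (L.bil (F.g i) (coset l ν + vy p)) s| := by
    rw [boostFac, sub_mul]
    exact abs_sub _ _
  refine (mul_le_mul_of_nonneg_right e1 (Real.exp_pos _).le).trans ?_
  rw [add_mul, add_mul]
  refine add_le_add (h1.trans ?_) (h2.trans ?_)
  · gcongr; exact min_le_left _ _
  · gcongr; exact min_le_right _ _

lemma exists_frameTerm_bound (hp : p ∈ regular B B' l) :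
    ∃ κ > 0, ∃ C : ℝ, ∀ ν s, ‖(boostWt B B' s : ℂ) * (F.boost s).frameTerm (coset l ν) p‖ ≤
      C * exp (-(κ * ‖fun k => (ν k : ℝ)‖)) * ∏ i, exp (-(κ * |s i|)) := by
  obtain ⟨κ, hκ, C, hC, h⟩ := exists_boostFac_bound hp
  obtain ⟨κ', hκ', A, hA⟩ := exists_prod_bound F (mul_pos Real.pi_pos hp.1) hκ
  set c := min κ κ' with hc
  have hc0 : 0 < c := by positivity
  set D := |A * C ^ d * exp (2 * π * p.1.im * L.quad (vy p))| with hD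
  refine ⟨c, hc0, D * exp (c * (‖l‖ + ‖vy p‖)), fun ν s => ?_⟩
  have h1 := hA p (coset l ν)
    (fun i => ((boostFac B B' (coset l ν) p i (s i) * exp (κ * |s i|) : ℝ) : ℂ)) C hp.1 le_rfl
    fun i => by
      have h2 := mul_le_mul_of_nonneg_right (h ν i (s i)) (Real.exp_pos (κ * |s i|)).le
      rw [mul_add κ, neg_add, Real.exp_add, Real.exp_neg (κ * |s i|), ← mul_assoc,
        inv_mul_cancel_right₀ (Real.exp_pos _).ne'] at h2
      refine le_trans (le_of_eq ?_) h2
      rw [Complex.norm_real, Real.norm_eq_abs, abs_mul, Real.abs_exp]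
      ring
  rw [boostWt_mul_frameTerm hp.1]
  have e1 : (∏ i, ((boostFac B B' (coset l ν) p i (s i) : ℝ) : ℂ)) * qexp L (coset l ν) p =
      ((∏ i, exp (-(κ * |s i|)) : ℝ) : ℂ) * ((∏ i, ((boostFac B B' (coset l ν) p i (s i) *
        exp (κ * |s i|) : ℝ) : ℂ)) * qexp L (coset l ν) p) := by
    rw [← mul_assoc, Complex.ofReal_prod, ← prod_mul_distrib]
    congr 1
    refine prod_congr rfl fun i _ => ?_
    rw [← Complex.ofReal_mul, Real.exp_neg]
    congr 1
    field_simp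
  have hpos : 0 ≤ ∏ i, exp (-(κ * |s i|)) := Finset.prod_nonneg fun i _ => (Real.exp_pos _).le
  rw [e1, norm_mul, Complex.norm_real, Real.norm_of_nonneg hpos, mul_comm]
  have h3 : ‖(fun k => (ν k : ℝ))‖ ≤ ‖coset l ν + vy p‖ + (‖l‖ + ‖vy p‖) := by
    have : (fun k => (ν k : ℝ)) = (coset l ν + vy p) - (l + vy p) := by
      funext k; simp [coset]
    rw [this]
    exact (norm_sub_le _ _).trans (add_le_add le_rfl (norm_add_le _ _))
  have h4 : exp (-(κ' * ‖coset l ν + vy p‖)) ≤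
      exp (c * (‖l‖ + ‖vy p‖)) * exp (-(c * ‖fun k => (ν k : ℝ)‖)) := by
    rw [← Real.exp_add]
    apply Real.exp_le_exp.2
    have i1 := mul_le_mul_of_nonneg_left h3 hc0.le
    have i2 : c * ‖coset l ν + vy p‖ ≤ κ' * ‖coset l ν + vy p‖ := by
      gcongr; exact min_le_right _ _
    linarith
  have h5 : ∏ i, exp (-(κ * |s i|)) ≤ ∏ i, exp (-(c * |s i|)) := by
    refine Finset.prod_le_prod (fun i _ => (Real.exp_pos _).le) fun i _ => ?_
    gcongr; exact min_le_left _ _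
  refine mul_le_mul ?_ h5 hpos (by positivity)
  refine h1.trans ?_
  rw [mul_assoc D]
  exact mul_le_mul (le_abs_self _) h4 (Real.exp_pos _).le (abs_nonneg _)

/-- The components are integrals of the theta series attached to the rotated frames. -/
theorem sum_phi_eq_integral {ι : Type*} [Fintype ι] (a : ι → ℂ) (l : ι → Fin N → ℝ)
    (hp : ∀ x, p ∈ regular B B' (l x)) :
    ∑ x, a x * phi B B' (l x) p =
      ∫ s, (boostWt B B' s : ℂ) * ∑ x, a x * (F.boost s).frameTheta (l x) p := by
  rcases isEmpty_or_nonempty ι with hι | ⟨⟨x₀⟩⟩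
  · simp
  have hp0 : 0 < p.1.im := (hp x₀).1
  set G : ι × (Fin N → ℤ) → (Fin d → ℝ) → ℂ := fun q s =>
    a q.1 * ((boostWt B B' s : ℂ) * (F.boost s).frameTerm (coset (l q.1) q.2) p) with hG
  have hgood : ∀ q : ι × (Fin N → ℤ), AllGood B B' (coset (l q.1) q.2) p := fun q =>
    allGood_of_regular (hp q.1) q.2
  have hint : ∀ q, Integrable (G q) := fun q => (hgood q).integrable_frameTerm.const_mul _
  have hGint : ∀ q, ∫ s, G q s = a q.1 * summand B B' (coset (l q.1) q.2) p := fun q => by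
    rw [hG, integral_const_mul, (hgood q).integral_frameTerm]
  have hsum : Summable fun q => ∫ s, ‖G q s‖ := by
    rw [summable_prod_of_nonneg fun q => integral_nonneg fun s => norm_nonneg _]
    refine ⟨fun x => ?_, Summable.of_finite⟩
    obtain ⟨κ, hκ, C, hb⟩ := exists_frameTerm_bound (hp x)
    set I := ∫ s : Fin d → ℝ, ∏ i, exp (-(κ * |s i|)) with hI
    refine Summable.of_nonneg_of_le (fun ν => integral_nonneg fun s => norm_nonneg _) (fun ν => ?_)
      ((summable_exp_neg_norm hκ).mul_left (‖a x‖ * C * I))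
    have hi : Integrable fun s : Fin d → ℝ => ∏ i, exp (-(κ * |s i|)) :=
      Integrable.fintype_prod fun _ => integrable_exp_neg_mul_abs hκ
    refine (integral_mono (hint (x, ν)).norm
      (hi.const_mul (‖a x‖ * (C * exp (-(κ * ‖fun k => (ν k : ℝ)‖))))) fun s => ?_).trans
      (le_of_eq ?_)
    · simp only [hG, norm_mul (a x), mul_assoc]
      rw [← mul_assoc C]
      exact mul_le_mul_of_nonneg_left (hb ν s) (norm_nonneg _)
    · rw [integral_const_mul]; ring
  have h1 := hasSum_integral_of_summable_integral_norm hint hsum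
  simp only [hGint] at h1
  have h2 := h1.prod_fiberwise (g := fun x => a x * phi B B' (l x) p) fun x => by
    have := (summable_summand (hp x)).hasSum.mul_left (a x)
    rwa [← phi_of_regular (hp x)] at this
  rw [← h2.unique (hasSum_fintype _)]
  refine integral_congr_ae (Eventually.of_forall fun s => ?_)
  have h3 : ∀ x, HasSum (fun ν : Fin N → ℤ => G (x, ν) s)
      (a x * ((boostWt B B' s : ℂ) * (F.boost s).frameTheta (l x) p)) := fun x =>
    (((F.boost s).summable_frameTerm hp0 (l x)).hasSum.mul_left _).mul_left _
  have h4 : Summable fun q => G q s := by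
    refine Summable.of_norm ?_
    rw [summable_prod_of_nonneg fun q => norm_nonneg _]
    exact ⟨fun x => (h3 x).summable.norm, Summable.of_finite⟩
  have h5 := h4.hasSum.prod_fiberwise h3
  beta_reduce
  rw [h5.unique (hasSum_fintype _), mul_sum]
  exact sum_congr rfl fun x _ => by ring

/-- The transformation of the components under `S`. -/
theorem phi_sPt {l : Fin N → ℝ} (hl : l ∈ L.dual) (hp : ∀ x, p ∈ regular B B' (L.rep x))
    (hp' : sPt p ∈ regular B B' l) : phi B B' l (sPt p) =
      Complex.exp (-(π * 𝕚 * m / 4)) * (p.1 ^ (1 / 2 : ℂ)) ^ N /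
        ((sqrt (Fintype.card L.Disc) : ℝ) : ℂ) * ee (L.quad p.2 / p.1) *
          ∑ x : L.Disc, ee (-((L.bil l (L.rep x) : ℝ) : ℂ)) * phi B B' (L.rep x) p := by
  have h1 := sum_phi_eq_integral (fun _ : Unit => 1) (fun _ => l) fun _ => hp'
  simp only [Finset.univ_unique, Finset.sum_singleton, one_mul] at h1
  rw [h1, sum_phi_eq_integral _ _ hp, ← integral_const_mul]
  refine integral_congr_ae (Eventually.of_forall fun s => ?_)
  beta_reduce
  rw [(F.boost s).frameTheta_sPt (hp (QuotientAddGroup.mk 0)).1 hl]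
  ring

end Side

end EvenLattice

/-! ### Generation of the metaplectic group -/

lemma Mp2Z.ext_of_apply_eq {g h : Mp2Z} (hγ : g.γ = h.γ) {τ : ℍ} (hj : g.j τ = h.j τ) : g = h := by
  refine Mp2Z.ext hγ (funext fun σ => ?_)
  exact isPreconnected_univ.eq_of_sq_eq g.cont.continuousOn h.cont.continuousOn
    (fun x _ => by simp [g.sq, h.sq, hγ]) (fun {x} _ => h.j_ne_zero x) (Set.mem_univ τ) hj
    (Set.mem_univ σ)

lemma Mp2Z.mul_γ (g h : Mp2Z) : (g * h).γ = g.γ * h.γ := rfl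

lemma Mp2Z.mul_j (g h : Mp2Z) (τ : ℍ) : (g * h).j τ = g.j (h.γ • τ) * h.j τ := rfl

lemma modular_S_sq : ModularGroup.S * ModularGroup.S = -1 := by decide

lemma Mp2Z.S_pow_four_γ : (Mp2Z.S * Mp2Z.S * (Mp2Z.S * Mp2Z.S)).γ = 1 := by
  change ModularGroup.S * ModularGroup.S * (ModularGroup.S * ModularGroup.S) = 1
  rw [modular_S_sq, neg_mul_neg, one_mul]

lemma Mp2Z.S_pow_four_j : (Mp2Z.S * Mp2Z.S * (Mp2Z.S * Mp2Z.S)).j UpperHalfPlane.I = -1 := by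
  have h1 : ModularGroup.S • UpperHalfPlane.I = UpperHalfPlane.I := by
    ext
    rw [UpperHalfPlane.modular_S_smul]
    simp
  have h2 : Mp2Z.S.γ • UpperHalfPlane.I = UpperHalfPlane.I := h1
  have h3 : Mp2Z.S.j UpperHalfPlane.I ^ 2 = 𝕚 := by
    rw [Mp2Z.S.sq]; simp [cocyc, Mp2Z.S, ModularGroup.S]
  simp only [Mp2Z.mul_j, Mp2Z.mul_γ, mul_smul, h2]
  calc _ = (Mp2Z.S.j UpperHalfPlane.I ^ 2) ^ 2 := by ring
    _ = -1 := by rw [h3, Complex.I_sq]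

lemma modular_S_inv : (ModularGroup.S)⁻¹ = ModularGroup.S * (ModularGroup.S * ModularGroup.S) := by
  rw [inv_eq_iff_mul_eq_one, ← mul_assoc, modular_S_sq, neg_mul_neg, one_mul]

lemma modular_T_inv : (ModularGroup.T)⁻¹ = (ModularGroup.S)⁻¹ * (ModularGroup.T * (ModularGroup.S *
    (ModularGroup.T * ModularGroup.S))) := by
  rw [eq_comm, inv_mul_eq_iff_eq_mul, eq_mul_inv_iff_mul_eq]
  decide

namespace EvenLattice

variable {N : ℕ} (L : EvenLattice N)

lemma exists_isWeil_lift (γ : SL(2, ℤ)) : ∃ g A, L.IsWeil g A ∧ g.γ = γ := by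
  set H : Submonoid SL(2, ℤ) :=
    { carrier := {γ | ∃ g A, L.IsWeil g A ∧ g.γ = γ}
      one_mem' := ⟨1, 1, .one, rfl⟩
      mul_mem' := by
        rintro _ _ ⟨g, A, hg, rfl⟩ ⟨h, B, hh, rfl⟩
        exact ⟨g * h, A * B, .mul hg hh, rfl⟩ } with hH
  have hS : ModularGroup.S ∈ H := ⟨_, _, .gen_S, rfl⟩
  have hT : ModularGroup.T ∈ H := ⟨_, _, .gen_T, rfl⟩
  have hS' : (ModularGroup.S)⁻¹ ∈ H := by
    rw [modular_S_inv]; exact H.mul_mem hS (H.mul_mem hS hS)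
  have hT' : (ModularGroup.T)⁻¹ ∈ H := by
    rw [modular_T_inv]
    exact H.mul_mem hS' (H.mul_mem hT (H.mul_mem hS (H.mul_mem hT hS)))
  have h1 : γ ∈ (Subgroup.closure {ModularGroup.S, ModularGroup.T}).toSubmonoid := by
    rw [SpecialLinearGroup.SL2Z_generators]; trivial
  rw [Subgroup.closure_toSubmonoid] at h1
  refine (Submonoid.closure_le (S := H)).2 ?_ h1
  rintro x (hx | hx)
  · rcases hx with rfl | rfl
    exacts [hS, hT]
  · rw [Set.mem_inv] at hx
    rcases hx with hx | hx
    · rw [← inv_inv x, hx]; exact hS'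
    · rw [← inv_inv x, hx]; exact hT'

theorem weil_exists (g : Mp2Z) : ∃ A, L.IsWeil g A := by
  obtain ⟨h, A, hA, hγ⟩ := L.exists_isWeil_lift g.γ
  have hsq : g.j UpperHalfPlane.I ^ 2 = h.j UpperHalfPlane.I ^ 2 := by rw [g.sq, h.sq, hγ]
  rcases sq_eq_sq_iff_eq_or_eq_neg.1 hsq with e | e
  · exact ⟨A, Mp2Z.ext_of_apply_eq hγ.symm e ▸ hA⟩
  · have e1 : h * (Mp2Z.S * Mp2Z.S * (Mp2Z.S * Mp2Z.S)) = g := by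
      refine Mp2Z.ext_of_apply_eq (τ := UpperHalfPlane.I) ?_ ?_
      · rw [Mp2Z.mul_γ, Mp2Z.S_pow_four_γ, mul_one, hγ]
      · rw [Mp2Z.mul_j, Mp2Z.S_pow_four_γ, Mp2Z.S_pow_four_j, one_smul, e]; ring
    have hS : L.IsWeil (Mp2Z.S * Mp2Z.S) (L.weilS * L.weilS) := .mul .gen_S .gen_S
    rw [← e1]
    exact ⟨_, .mul hA (.mul hS hS)⟩

/-! ### The signature and unimodularity -/

lemma mat_form (x : Fin N → ℝ) : L.form x = L.quad x := by
  change Matrix.toLinearMap₂' ℝ L.mat x x = _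
  rw [Matrix.toLinearMap₂'_apply, quad, bil, sum_div]
  refine sum_congr rfl fun i _ => ?_
  rw [sum_div]
  refine sum_congr rfl fun j _ => ?_
  simp only [mat, Matrix.smul_apply, Matrix.map_apply, smul_eq_mul]
  ring

theorem AdaptedFrame.dPos_eq {L : EvenLattice N} {d m : ℕ} (F : L.AdaptedFrame d m) :
    L.dPos = d + m := by
  have h : QuadraticMap.Equivalent L.form (QuadraticMap.weightedSumSquares ℝ
      (AdaptedFrame.sgn (d := d) (m := m))) :=
    ⟨{ F.basis.equivFun with
      map_app' := fun x => by
        change QuadraticMap.weightedSumSquares ℝ _ (F.basis.equivFun x) = _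
        rw [QuadraticMap.weightedSumSquares_apply, mat_form, quad]
        conv_rhs => rw [← F.basis.sum_equivFun x]
        simp only [bil_sum_left, bil_sum_right, bil_smul_left, bil_smul_right, basis_apply, bil_vec,
          mul_ite, mul_zero, Finset.sum_ite_eq', Finset.mem_univ, if_true, smul_eq_mul]
        rw [sum_div]
        exact sum_congr rfl fun k _ => by ring }⟩
  have hs : {k : (Fin d ⊕ Fin d) ⊕ Fin m | 0 < (sgn k : ℝ)} = Set.range
      (Sum.elim (fun i : Fin d => Sum.inl (Sum.inr i)) fun i : Fin m => Sum.inr i) := by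
    ext ((k | k) | k) <;> simp [sgn]
  rw [dPos, QuadraticForm.sigPos_of_equiv_weightedSumSquares h, hs, ← Set.image_univ,
    Set.ncard_image_of_injective, Set.ncard_univ, Nat.card_eq_fintype_card, Fintype.card_sum,
    Fintype.card_fin, Fintype.card_fin]
  rintro (a | a) (b | b) h <;> simp_all

/-- The upper triangular matrix of the quadratic form. -/
def halfGram : Matrix (Fin N) (Fin N) ℤ := Matrix.of fun i j =>
  if i < j then L.gram i j else if i = j then L.gram i i / 2 else 0

lemma gram_eq_halfGram : L.gram = L.halfGram + L.halfGramᵀ := by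
  ext i j
  simp only [halfGram, Matrix.add_apply, Matrix.transpose_apply, Matrix.of_apply]
  rcases lt_trichotomy i j with hij | hij | hij
  · simp [hij, hij.not_gt, hij.ne']
  · subst hij
    obtain ⟨a, ha⟩ := L.even_diag i
    simp [ha]; omega
  · simp [hij, hij.not_gt, hij.ne', L.symm.apply j i]

lemma quad_intCast (ν : Fin N → ℤ) :
    L.quad (fun k => (ν k : ℝ)) = ((ν ⬝ᵥ L.halfGram *ᵥ ν : ℤ) : ℝ) := by
  rw [quad, bil_intCast, L.gram_eq_halfGram, Matrix.add_mulVec, dotProduct_add,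
    Matrix.mulVec_transpose, dotProduct_comm ν (ν ᵥ* _), ← Matrix.dotProduct_mulVec]
  push_cast; ring

/-- The rank of a unimodular even lattice is even. -/
theorem even_rank_of_isUnimodular (h : L.IsUnimodular) : Even N := by
  by_contra hN
  rw [Nat.not_even_iff_odd] at hN
  set U := L.halfGram
  have hdet : (U - Uᵀ).det = 0 := by
    have h1 : (U - Uᵀ)ᵀ = -(U - Uᵀ) := by simp
    have h2 := Matrix.det_transpose (U - Uᵀ)
    rw [h1, Matrix.det_neg, Fintype.card_fin, hN.neg_one_pow] at h2
    omega
  have hmod : (Int.castRingHom (ZMod 2)) L.gram.det = (Int.castRingHom (ZMod 2)) (U - Uᵀ).det := by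
    rw [RingHom.map_det, RingHom.map_det]
    congr 1
    ext i j
    rw [L.gram_eq_halfGram]
    simp only [RingHom.mapMatrix_apply, Matrix.map_apply, Matrix.add_apply, Matrix.sub_apply,
      map_add, map_sub, CharTwo.sub_eq_add, U]
  rw [hdet, map_zero] at hmod
  have h3 : (2 : ℤ) ∣ L.gram.det := (ZMod.intCast_zmod_eq_zero_iff_dvd _ 2).1 hmod
  rcases (abs_eq one_pos.le).1 h with h | h <;> rw [h] at h3 <;> omega

/-! ### The transformation of the components under the generators -/

variable {N : ℕ} {L : EvenLattice N} {d m : ℕ} {F : L.AdaptedFrame d m}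

lemma exists_quad_coset {l : Fin N → ℝ} (hl : l ∈ L.dual) (ν : Fin N → ℤ) :
    ∃ n : ℤ, L.quad (coset l ν) = L.quad l + n := by
  obtain ⟨k, hk⟩ := hl ν
  exact ⟨k + ν ⬝ᵥ L.halfGram *ᵥ ν, by
    rw [coset_eq, quad_add, hk, quad_intCast]; push_cast; ring⟩

namespace Side

variable {B B' : Side F} {p : Jac[N]} {l : Fin N → ℝ}

lemma rhoC_congr {i : Fin d} {x x' : Fin N → ℝ} {p' : Jac[N]} (h1 : p'.1.im = p.1.im)
    (h2 : x' + vy p' = x + vy p) : B.rhoC i x' p' = B.rhoC i x p := by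
  rw [rhoC, rhoC, h1, h2]

lemma regular_congr {p' : Jac[N]} (a : Fin N → ℤ) (h1 : p'.1.im = p.1.im)
    (h2 : vy p' = vy p + fun k => (a k : ℝ)) (hp : p ∈ regular B B' l) : p' ∈ regular B B' l := by
  have h3 : ∀ {B : Side F} {i : Fin d}, ¬ B.OnWall (vy p) l i → ¬ B.OnWall (vy p') l i := by
    rintro B i h ⟨hi, ν, hν⟩
    refine h ⟨hi, ν + a, ?_⟩
    rw [← hν, h2]
    congr 1
    funext k; simp [coset]; ring
  exact ⟨h1 ▸ hp.1, fun i => ⟨h3 (hp.2 i).1, h3 (hp.2 i).2⟩⟩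

/-- The transformation of the components under `T`. -/
theorem phi_add_one (hl : l ∈ L.dual) (hp : p ∈ regular B B' l) :
    phi B B' l (p.1 + 1, p.2) = ee ((L.quad l : ℝ) : ℂ) * phi B B' l p := by
  have h1 : ((p.1 + 1, p.2) : Jac[N]).1.im = p.1.im := by simp
  have h2 : vy ((p.1 + 1, p.2) : Jac[N]) = vy p := by
    funext k; simp [vy]
  have hp' : ((p.1 + 1, p.2) : Jac[N]) ∈ regular B B' l :=
    regular_congr 0 h1 (by rw [h2]; funext k; simp) hp
  rw [phi_of_regular hp, phi_of_regular hp', ← tsum_mul_left]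
  refine tsum_congr fun ν => ?_
  obtain ⟨n, hn⟩ := exists_quad_coset hl ν
  rw [summand, summand, mul_left_comm]
  congr 1
  · exact prod_congr rfl fun i _ => by
      rw [rhoC_congr h1 (by rw [h2]), rhoC_congr h1 (by rw [h2])]
  · have e : ((L.quad (coset l ν) : ℝ) : ℂ) * (p.1 + 1) + L.bil (toC (coset l ν)) p.2 =
        ((L.quad l : ℝ) : ℂ) + (((L.quad (coset l ν) : ℝ) : ℂ) * p.1 + L.bil (toC (coset l ν)) p.2) +
          (n : ℤ) := by
      rw [mul_add, mul_one]
      conv_lhs => enter [1, 2]; rw [hn]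
      push_cast; ring
    rw [qexp, qexp, e, ee_add, ee_add, ee_intCast, mul_one]

/-- The transformation of the components under the Heisenberg group. -/
theorem phi_heisenberg_translate (hl : l ∈ L.dual) (hp : p ∈ regular B B' l) (a b : Fin N → ℤ) :
    ee (L.bil (fun i => (a i : ℂ)) p.2 + L.quad (fun i => (a i : ℂ)) * p.1) *
      phi B B' l (p.1, fun k => p.2 k + a k * p.1 + b k) = phi B B' l p := by
  set p' : Jac[N] := (p.1, fun k => p.2 k + a k * p.1 + b k) with hp'
  have h1 : p'.1.im = p.1.im := rfl
  have h2 : vy p' = vy p + fun k => (a k : ℝ) := by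
    funext k
    have : p.1.im ≠ 0 := hp.1.ne'
    simp [vy, hp']
    field_simp
  rw [phi_of_regular hp, phi_of_regular (regular_congr a h1 h2 hp), ← tsum_mul_left,
    ← (Equiv.addRight a).tsum_eq fun ν => summand B B' (coset l ν) p]
  refine tsum_congr fun ν => ?_
  have h3 : coset l (ν + a) = coset l ν + fun k => (a k : ℝ) := by
    funext k; simp [coset]; ring
  rw [Equiv.coe_addRight, summand, summand, mul_left_comm]
  congr 1
  · exact prod_congr rfl fun i _ => by
      rw [rhoC_congr h1 (x := coset l (ν + a)) (by rw [h2, h3]; abel),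
        rhoC_congr h1 (x := coset l (ν + a)) (by rw [h2, h3]; abel)]
  · obtain ⟨n, hn⟩ := coset_mem_dual hl ν b
    have ha : (fun i => (a i : ℂ)) = toC fun k => (a k : ℝ) := by funext k; simp [toC]
    have hz : p'.2 = p.2 + p.1 • toC (fun k => (a k : ℝ)) + toC fun k => (b k : ℝ) := by
      funext k; simp [hp', toC]; ring
    rw [qexp, qexp, ← ee_add, ha, hz, h3, quad_toC, quad_add, toC_add]
    simp only [bil_add_left, bil_add_right, bil_smul_right, bil_toC, hn]
    have e : ∀ x y : ℂ, x = y + (n : ℤ) → ee x = ee y := by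
      rintro x y rfl; rw [ee_add, ee_intCast, mul_one]
    refine e _ _ ?_
    simp only [hp']
    push_cast; ring

lemma analyticAt_of_regular (hp : p ∈ regular B B' l) : AnalyticAt ℝ (phi B B' l) p :=
  analyticAt_phi B B' l hp.1 (by rw [hprod_of_regular hp.2]; exact one_ne_zero)

end Side

end EvenLattice

/-! ### The Jacobi action -/

section action

variable {N : ℕ}

/-- The inclusion of the Jacobi upper half plane. -/
def jIncl (x : ℍ × (Fin N → ℂ)) : Jac[N] := ((x.1 : ℂ), x.2)

/-- The action of `SL₂(ℤ)` on the Jacobi upper half plane. -/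
def jAct (γ : SL(2, ℤ)) (x : ℍ × (Fin N → ℂ)) : ℍ × (Fin N → ℂ) :=
  (γ • x.1, fun i => x.2 i / cocyc γ x.1)

/-- The translation of the elliptic variable. -/
def jTrans (l m : Fin N → ℤ) (x : ℍ × (Fin N → ℂ)) : ℍ × (Fin N → ℂ) :=
  (x.1, fun i => x.2 i + l i * (x.1 : ℂ) + m i)

lemma jacobiAct_eq (γ : SL(2, ℤ)) (l m : Fin N → ℤ) (x : ℍ × (Fin N → ℂ)) :
    jacobiAct γ (fun i => (l i : ℝ)) (fun i => (m i : ℝ)) x.1 x.2 =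
      jIncl (jAct γ (jTrans l m x)) := by
  simp [jacobiAct, jIncl, jAct, jTrans]

lemma isOpenEmbedding_jIncl : IsOpenEmbedding (jIncl : ℍ × (Fin N → ℂ) → _) :=
  UpperHalfPlane.isOpenEmbedding_coe.prodMap IsOpenEmbedding.id

lemma jAct_mul (γ δ : SL(2, ℤ)) (x : ℍ × (Fin N → ℂ)) : jAct (γ * δ) x = jAct γ (jAct δ x) := by
  simp only [jAct, mul_smul, cocyc_mul, div_div, mul_comm (cocyc δ x.1)]

lemma jAct_one (x : ℍ × (Fin N → ℂ)) : jAct 1 x = x := by simp [jAct, cocyc_one]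

lemma continuous_cocyc (γ : SL(2, ℤ)) : Continuous (cocyc γ) :=
  (continuous_const.mul UpperHalfPlane.continuous_coe).add continuous_const

lemma continuous_jAct (γ : SL(2, ℤ)) : Continuous (jAct γ : ℍ × (Fin N → ℂ) → _) :=
  ((continuous_sl_smul γ).comp continuous_fst).prodMk (continuous_pi fun i =>
    ((continuous_apply i).comp continuous_snd).div ((continuous_cocyc γ).comp continuous_fst)
      fun x => cocyc_ne_zero γ x.1)

lemma continuous_jTrans (l m : Fin N → ℤ) : Continuous (jTrans l m) :=
  continuous_fst.prodMk (continuous_pi fun i =>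
    (((continuous_apply i).comp continuous_snd).add (continuous_const.mul
      (UpperHalfPlane.continuous_coe.comp continuous_fst))).add continuous_const)

lemma dense_preimage_of_inverse {X : Type*} [TopologicalSpace X] {S : Set X} (hS : Dense S)
    {f g : X → X} (hf : Continuous f) (hg : Continuous g) (h1 : ∀ x, g (f x) = x)
    (h2 : ∀ x, f (g x) = x) : Dense (f ⁻¹' S) :=
  hS.preimage (Homeomorph.isOpenMap ⟨⟨f, g, h1, h2⟩, hf, hg⟩)

lemma dense_preimage_jAct {S : Set (ℍ × (Fin N → ℂ))} (hS : Dense S) (γ : SL(2, ℤ)) :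
    Dense (jAct γ ⁻¹' S) :=
  dense_preimage_of_inverse hS (continuous_jAct γ) (continuous_jAct γ⁻¹)
    (fun x => by rw [← jAct_mul, inv_mul_cancel, jAct_one])
    fun x => by rw [← jAct_mul, mul_inv_cancel, jAct_one]

lemma dense_preimage_jTrans {S : Set (ℍ × (Fin N → ℂ))} (hS : Dense S) (l m : Fin N → ℤ) :
    Dense (jTrans l m ⁻¹' S) :=
  dense_preimage_of_inverse hS (continuous_jTrans l m) (continuous_jTrans (-l) (-m))
    (fun x => by ext <;> simp [jTrans]; ring) fun x => by ext <;> simp [jTrans]; ring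

lemma eq_of_dense {X : Type*} [TopologicalSpace X] {S : Set X} (hS : Dense S) {f g : X → ℂ} {x : X}
    (hf : ContinuousAt f x) (hg : ContinuousAt g x) (h : ∀ᶠ y in 𝓝 x, y ∈ S → f y = g y) :
    f x = g x := by
  by_contra hne
  have h1 := (hf.sub hg).eventually_ne (sub_ne_zero.2 hne)
  obtain ⟨y, hy, hy1, hy2⟩ := ((mem_closure_iff_frequently.1 (hS x)).and_eventually (h.and h1)).exists
  exact hy2 (sub_eq_zero.2 (hy1 hy))

end action

/-! ### The slash action on vectors of functions -/

namespace EvenLattice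

variable {N : ℕ} {L : EvenLattice N}

/-- The points at which all components are analytic. -/
def regPts (Φ : L.Disc → Jac[N] → ℂ) : Set (ℍ × (Fin N → ℂ)) :=
  {x | ∀ y, AnalyticAt ℝ (Φ y) (jIncl x)}

variable {Φ : L.Disc → Jac[N] → ℂ}

lemma isOpen_regPts : IsOpen (regPts Φ) := by
  have : regPts Φ = ⋂ y, jIncl ⁻¹' {p | AnalyticAt ℝ (Φ y) p} := by ext; simp [regPts]
  rw [this]
  exact isOpen_iInter_of_finite fun y =>
    (isOpen_analyticAt ℝ (Φ y)).preimage isOpenEmbedding_jIncl.continuous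

lemma continuousAt_of_regPts {x : ℍ × (Fin N → ℂ)} (hx : x ∈ regPts Φ) (y : L.Disc) :
    ContinuousAt (fun x => Φ y (jIncl x)) x :=
  (hx y).continuousAt.comp isOpenEmbedding_jIncl.continuous.continuousAt

lemma continuousAt_end (A : Module.End ℂ (L.Disc → ℂ)) {x : ℍ × (Fin N → ℂ)} (hx : x ∈ regPts Φ)
    (y : L.Disc) : ContinuousAt (fun x => A (fun y' => Φ y' (jIncl x)) y) x :=
  ((continuous_apply y).comp (LinearMap.continuous_of_finiteDimensional A)).continuousAt.comp
    (continuousAt_pi.2 fun y' => continuousAt_of_regPts hx y')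

/-- The automorphy factor of weight `r / 2` and index `L`. -/
def autFac (L : EvenLattice N) (r : ℤ) (g : Mp2Z) (x : ℍ × (Fin N → ℂ)) : ℂ :=
  g.j x.1 ^ (-r) * ee (-(g.γ 1 0 : ℂ) * L.quad x.2 / cocyc g.γ x.1)

lemma continuous_quad : Continuous fun z : Fin N → ℂ => L.quad z := by
  unfold quad bil; fun_prop

lemma continuous_ee : Continuous ee := by unfold ee; fun_prop

lemma continuous_autFac (r : ℤ) (g : Mp2Z) : Continuous (autFac L r g) := by
  refine ((g.cont.comp continuous_fst).zpow₀ _ fun x => Or.inl (g.j_ne_zero _)).mul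
    (continuous_ee.comp ((continuous_const.mul (continuous_quad.comp continuous_snd)).div
      ((continuous_cocyc g.γ).comp continuous_fst) fun x => cocyc_ne_zero _ _))

lemma quad_div (z : Fin N → ℂ) (c : ℂ) : L.quad (fun i => z i / c) = L.quad z / c ^ 2 := by
  have : (fun i => z i / c) = c⁻¹ • z := by funext i; simp [div_eq_inv_mul]
  rw [this, quad_smul]; ring

lemma autFac_mul (r : ℤ) (g h : Mp2Z) (x : ℍ × (Fin N → ℂ)) :
    autFac L r (g * h) x = autFac L r g (jAct h.γ x) * autFac L r h x := by
  have hτ : ((h.γ • x.1 : ℍ) : ℂ) =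
      ((h.γ 0 0 : ℂ) * (x.1 : ℂ) + (h.γ 0 1 : ℂ)) / cocyc h.γ x.1 := by
    rw [UpperHalfPlane.coe_specialLinearGroup_apply]; simp [cocyc]
  have h1 := cocyc_ne_zero h.γ x.1
  have h2 := cocyc_ne_zero g.γ (h.γ • x.1)
  have h3 := cocyc_mul g.γ h.γ x.1
  have hdet : (h.γ 0 0 : ℂ) * h.γ 1 1 - h.γ 0 1 * h.γ 1 0 = 1 := by
    have := h.γ.det_coe
    rw [Matrix.det_fin_two] at this
    exact_mod_cast this
  have hc : (((g.γ * h.γ : SL(2, ℤ)) 1 0 : ℤ) : ℂ) = g.γ 1 0 * h.γ 0 0 + g.γ 1 1 * h.γ 1 0 := by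
    simp [Matrix.mul_apply, Fin.sum_univ_two]
  have e0 : cocyc g.γ (h.γ • x.1) * cocyc h.γ x.1 =
      g.γ 1 0 * (h.γ 0 0 * x.1 + h.γ 0 1) + g.γ 1 1 * cocyc h.γ x.1 := by
    rw [cocyc, hτ]; field_simp
  have e1 : (((g.γ * h.γ : SL(2, ℤ)) 1 0 : ℤ) : ℂ) / cocyc (g.γ * h.γ) x.1 =
      (g.γ 1 0 : ℂ) / cocyc h.γ x.1 ^ 2 / cocyc g.γ (h.γ • x.1) + h.γ 1 0 / cocyc h.γ x.1 := by
    rw [hc, h3, div_div, div_add_div _ _ (mul_ne_zero (pow_ne_zero 2 h1) h2) h1,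
      div_eq_div_iff (mul_ne_zero h2 h1) (mul_ne_zero (mul_ne_zero (pow_ne_zero 2 h1) h2) h1)]
    have e2 : (g.γ 1 0 * h.γ 0 0 + g.γ 1 1 * h.γ 1 0 : ℂ) * cocyc h.γ x.1 =
        g.γ 1 0 + h.γ 1 0 * (cocyc g.γ (h.γ • x.1) * cocyc h.γ x.1) := by
      rw [e0, cocyc]
      linear_combination (g.γ 1 0 : ℂ) * hdet
    linear_combination (cocyc g.γ (h.γ • x.1) * cocyc h.γ x.1 ^ 2) * e2
  rw [autFac, autFac, autFac, jAct, quad_div, Mp2Z.mul_j, mul_zpow, mul_mul_mul_comm, ← ee_add]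
  congr 2
  rw [Mp2Z.mul_γ]
  calc _ = -L.quad x.2 * ((((g.γ * h.γ : SL(2, ℤ)) 1 0 : ℤ) : ℂ) / cocyc (g.γ * h.γ) x.1) := by ring
    _ = _ := by rw [e1]; ring

/-- The slash equation for an element of the metaplectic group. -/
def SlashEq (Φ : L.Disc → Jac[N] → ℂ) (r : ℤ) (g : Mp2Z)
    (A : Module.End ℂ (L.Disc → ℂ)) (x : ℍ × (Fin N → ℂ)) : Prop :=
  ∀ y, autFac L r g x * Φ y (jIncl (jAct g.γ x)) = A (fun y' => Φ y' (jIncl x)) y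

lemma slashEq_of_dense {S : Set (ℍ × (Fin N → ℂ))} (hS : Dense S) {r : ℤ} {g : Mp2Z}
    {A : Module.End ℂ (L.Disc → ℂ)} {x : ℍ × (Fin N → ℂ)} (hx : x ∈ regPts Φ)
    (hgx : jAct g.γ x ∈ regPts Φ) (h : ∀ᶠ q in 𝓝 x, q ∈ S → SlashEq Φ r g A q) :
    SlashEq Φ r g A x := fun y =>
  eq_of_dense hS ((continuous_autFac r g).continuousAt.mul
    ((continuousAt_of_regPts hgx y).comp (continuous_jAct g.γ).continuousAt))
    (continuousAt_end A hx y) (h.mono fun _ hq hqS => hq hqS y)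

lemma eventually_regPts (γ : SL(2, ℤ)) {x : ℍ × (Fin N → ℂ)} (hx : jAct γ x ∈ regPts Φ) :
    ∀ᶠ q in 𝓝 x, jAct γ q ∈ regPts Φ :=
  (continuous_jAct γ).continuousAt.eventually (isOpen_regPts.mem_nhds hx)

/-- The slash equation follows from its validity for the generators at the points of a dense
set. -/
theorem slashEq_of_generators {S : Set (ℍ × (Fin N → ℂ))} (hS : Dense S) (hSr : S ⊆ regPts Φ)
    {r : ℤ} (h_T : ∀ x ∈ S, SlashEq Φ r Mp2Z.T L.weilT x)
    (h_S : ∀ x ∈ S, jAct Mp2Z.S.γ x ∈ S → SlashEq Φ r Mp2Z.S L.weilS x)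
    (hSo : IsOpen S) {g : Mp2Z} {A : Module.End ℂ (L.Disc → ℂ)} (hA : L.IsWeil g A) :
    ∀ x ∈ regPts Φ, jAct g.γ x ∈ regPts Φ → SlashEq Φ r g A x := by
  induction hA with
  | one =>
    intro x _ _ y
    have h1 : (1 : Mp2Z).γ = 1 := rfl
    have h2 : (1 : Mp2Z).j x.1 = 1 := rfl
    rw [autFac, h1, h2, jAct_one]
    simp [ee_zero]
  | gen_T => exact fun x hx hgx => slashEq_of_dense hS hx hgx (Eventually.of_forall h_T)
  | gen_S =>
    exact fun x hx hgx => slashEq_of_dense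
      (hS.inter_of_isOpen_left (dense_preimage_jAct hS Mp2Z.S.γ) hSo) hx hgx
      (Eventually.of_forall fun q hq => h_S q hq.1 hq.2)
  | @mul g h A B hA hB ihA ihB =>
    intro x hx hgx
    refine slashEq_of_dense (dense_preimage_jAct hS h.γ) hx hgx ?_
    filter_upwards [isOpen_regPts.mem_nhds hx, eventually_regPts _ hgx] with q hq hgq hhq y
    have hhq' : jAct h.γ q ∈ regPts Φ := hSr hhq
    rw [Mp2Z.mul_γ, jAct_mul] at hgq ⊢
    have h1 : B (fun y' => Φ y' (jIncl q)) = autFac L r h q • fun y' => Φ y' (jIncl (jAct h.γ q)) :=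
      funext fun y' => (ihB q hq hhq' y').symm
    rw [autFac_mul, Module.End.mul_apply, h1, map_smul, Pi.smul_apply, ← ihA _ hhq' hgq y,
      smul_eq_mul]
    ring

/-- The slash equation for the Jacobi group. -/
theorem jacobiSlash_eq {S : Set (ℍ × (Fin N → ℂ))} (hS : Dense S) (hSr : S ⊆ regPts Φ)
    (hSo : IsOpen S) {r : ℤ} (l m : Fin N → ℤ)
    (hH : ∀ x ∈ S, ∀ y, ee (L.bil (fun i => (l i : ℂ)) x.2 +
      L.quad (fun i => (l i : ℂ)) * (x.1 : ℂ)) * Φ y (jIncl (jTrans l m x)) = Φ y (jIncl x))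
    {g : Mp2Z} {A : Module.End ℂ (L.Disc → ℂ)}
    (hM : ∀ x ∈ regPts Φ, jAct g.γ x ∈ regPts Φ → SlashEq Φ r g A x)
    {x : ℍ × (Fin N → ℂ)} (hx : x ∈ regPts Φ) (hgx : jAct g.γ (jTrans l m x) ∈ regPts Φ)
    (y : L.Disc) :
    jacobiSlash L (fun τ => g.j τ ^ (-r)) g.γ (fun i => l i) (fun i => m i) (Φ y) x.1 x.2 =
      A (fun y' => Φ y' (jIncl x)) y := by
  have hc := continuous_jTrans l m
  have hexp : Continuous fun x : ℍ × (Fin N → ℂ) => ee (L.bil (fun i => (l i : ℂ)) x.2 +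
      L.quad (fun i => (l i : ℂ)) * (x.1 : ℂ)) := by
    refine continuous_ee.comp (Continuous.add ?_
      (continuous_const.mul (UpperHalfPlane.continuous_coe.comp continuous_fst)))
    unfold bil; fun_prop
  have hlq : ((L.quad (fun i => (l i : ℝ)) : ℝ) : ℂ) = L.quad fun i => (l i : ℂ) := by
    rw [← L.quad_ofReal]; simp
  have e : jacobiSlash L (fun τ => g.j τ ^ (-r)) g.γ (fun i => l i) (fun i => m i) (Φ y) x.1 x.2 =
      autFac L r g (jTrans l m x) * Φ y (jIncl (jAct g.γ (jTrans l m x))) *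
        ee (L.bil (fun i => (l i : ℂ)) x.2 + L.quad (fun i => (l i : ℂ)) * (x.1 : ℂ)) := by
    rw [jacobiSlash, jacobiAct_eq, hlq, autFac]
    simp only [jTrans, Complex.ofReal_intCast, add_assoc, ee_add]
    ring
  rw [e]
  have hcont : ContinuousAt (fun x => autFac L r g (jTrans l m x) *
      Φ y (jIncl (jAct g.γ (jTrans l m x))) *
        ee (L.bil (fun i => (l i : ℂ)) x.2 + L.quad (fun i => (l i : ℂ)) * (x.1 : ℂ))) x := by
    refine ContinuousAt.mul (ContinuousAt.mul ((continuous_autFac r g).comp hc).continuousAt ?_)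
      hexp.continuousAt
    exact ContinuousAt.comp (f := fun x => jAct g.γ (jTrans l m x))
      (g := fun x => Φ y (jIncl x)) (continuousAt_of_regPts hgx y)
      ((continuous_jAct g.γ).comp hc).continuousAt
  refine eq_of_dense (hS.inter_of_isOpen_left (dense_preimage_jTrans hS l m) hSo)
    (f := fun x => autFac L r g (jTrans l m x) * Φ y (jIncl (jAct g.γ (jTrans l m x))) *
        ee (L.bil (fun i => (l i : ℂ)) x.2 + L.quad (fun i => (l i : ℂ)) * (x.1 : ℂ)))
    hcont (continuousAt_end A hx y) ?_
  filter_upwards [hc.continuousAt.eventually (eventually_regPts g.γ hgx)] with q hq hqS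
  rw [hM _ (hSr hqS.2) hq y]
  have h1 : (fun y' => Φ y' (jIncl q)) = ee (L.bil (fun i => (l i : ℂ)) q.2 +
      L.quad (fun i => (l i : ℂ)) * (q.1 : ℂ)) • fun y' => Φ y' (jIncl (jTrans l m q)) :=
    funext fun y' => (hH q hqS.1 y').symm
  rw [h1, map_smul, Pi.smul_apply, smul_eq_mul, mul_comm]

/-! ### The vector-valued Maaß–Jacobi form -/

variable {N : ℕ} {L : EvenLattice N} {d m : ℕ} {F : L.AdaptedFrame d m}

namespace Side

variable (B B' : Side F)

/-- The points of the Jacobi upper half plane which are regular for all components. -/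
def regularPts : Set (ℍ × (Fin N → ℂ)) := ⋂ y : L.Disc, jIncl ⁻¹' regular B B' (L.rep y)

variable {B B'}

lemma mem_regularPts {x : ℍ × (Fin N → ℂ)} :
    x ∈ regularPts B B' ↔ ∀ y : L.Disc, jIncl x ∈ regular B B' (L.rep y) := Set.mem_iInter

lemma isOpen_regularPts : IsOpen (regularPts B B') :=
  isOpen_iInter_of_finite fun _ => isOpen_regular.preimage isOpenEmbedding_jIncl.continuous

lemma dense_regularPts : Dense (regularPts B B') := by
  refine dense_iInter_of_isOpen
    (fun _ => isOpen_regular.preimage isOpenEmbedding_jIncl.continuous) fun y x => ?_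
  rw [mem_closure_iff_frequently]
  have h := frequently_regular B B' (L.rep y) (p₀ := jIncl x) x.1.im_pos
  rwa [← isOpenEmbedding_jIncl.map_nhds_eq, frequently_map] at h

lemma regularPts_subset :
    regularPts B B' ⊆ regPts fun y : L.Disc => phi B B' (L.rep y) :=
  fun _ hx y => analyticAt_of_regular (mem_regularPts.1 hx y)

theorem slashEq_T {x : ℍ × (Fin N → ℂ)} (hx : x ∈ regularPts B B') :
    SlashEq (fun y : L.Disc => phi B B' (L.rep y)) N Mp2Z.T L.weilT x := by
  intro y
  have h1 : jIncl (jAct Mp2Z.T.γ x) = ((jIncl x).1 + 1, (jIncl x).2) := by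
    have h2 : ∀ i, x.2 i / cocyc ModularGroup.T x.1 = x.2 i := by
      intro i; simp [cocyc, ModularGroup.T]
    simp only [jIncl, jAct, Mp2Z.T, UpperHalfPlane.modular_T_smul, h2, UpperHalfPlane.coe_vadd]
    push_cast
    rw [add_comm]
  beta_reduce
  rw [h1, phi_add_one (rep_mem_dual y) (mem_regularPts.1 hx y), weilT, Matrix.toLin'_apply,
    Matrix.mulVec_diagonal, autFac]
  simp [Mp2Z.T, ModularGroup.T, ee_zero]

theorem slashEq_S (hd : d = L.dNeg) {x : ℍ × (Fin N → ℂ)} (hx : x ∈ regularPts B B')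
    (hSx : jAct Mp2Z.S.γ x ∈ regularPts B B') :
    SlashEq (fun y : L.Disc => phi B B' (L.rep y)) N Mp2Z.S L.weilS x := by
  intro y
  have h1 : jIncl (jAct Mp2Z.S.γ x) = sPt (jIncl x) := by
    have h2 : cocyc ModularGroup.S x.1 = x.1 := by simp [cocyc, ModularGroup.S]
    simp only [jIncl, jAct, Mp2Z.S, UpperHalfPlane.modular_S_smul, h2, sPt]
    congr 1
    simp [neg_div, inv_neg]
  have h3 := mem_regularPts.1 hSx y
  rw [h1] at h3
  have h4 : Complex.exp (-(π * 𝕚 * m / 4)) =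
      Complex.exp (π * 𝕚 * ((L.dNeg : ℂ) - (L.dPos : ℂ)) / 4) := by
    rw [F.dPos_eq, ← hd]; congr 1; push_cast; ring
  have h5 : (((jIncl x).1 ^ (1 / 2 : ℂ)) ^ N)⁻¹ * ((jIncl x).1 ^ (1 / 2 : ℂ)) ^ N = 1 := by
    refine inv_mul_cancel₀ (pow_ne_zero _ ?_)
    exact Mp2Z.S.j_ne_zero x.1
  have h6 : ee (-(L.quad (jIncl x).2 / (jIncl x).1)) * ee (L.quad (jIncl x).2 / (jIncl x).1) = 1 := by
    rw [← ee_add, neg_add_cancel, ee_zero]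
  have h7 : autFac L N Mp2Z.S x = (((jIncl x).1 ^ (1 / 2 : ℂ)) ^ N)⁻¹ *
      ee (-(L.quad (jIncl x).2 / (jIncl x).1)) := by
    rw [autFac, zpow_neg, zpow_natCast]
    simp [Mp2Z.S, ModularGroup.S, cocyc, jIncl, neg_div]
  beta_reduce
  rw [h7, h1, phi_sPt (rep_mem_dual y) (mem_regularPts.1 hx) h3, h4, weilS, Matrix.toLin'_apply,
    Matrix.mulVec, dotProduct, mul_sum, mul_sum]
  refine sum_congr rfl fun y' _ => ?_
  rw [Matrix.of_apply, L.bil_comm (L.rep y') (L.rep y)]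
  set j := ((jIncl x).1 ^ (1 / 2 : ℂ)) ^ N
  set e := ee (L.quad (jIncl x).2 / (jIncl x).1)
  set e' := ee (-(L.quad (jIncl x).2 / (jIncl x).1))
  linear_combination (Complex.exp (π * 𝕚 * ((L.dNeg : ℂ) - (L.dPos : ℂ)) / 4) /
      ((sqrt (Fintype.card L.Disc) : ℝ) : ℂ) *
      ee (-((L.bil (L.rep y) (L.rep y') : ℝ) : ℂ)) * phi B B' (L.rep y') (jIncl x)) *
      (e' * e * h5 + h6)

theorem slashEq_phi (hd : d = L.dNeg) {g : Mp2Z} {A : Module.End ℂ (L.Disc → ℂ)}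
    (hA : L.IsWeil g A) : ∀ x ∈ regPts fun y : L.Disc => phi B B' (L.rep y),
      jAct g.γ x ∈ regPts (fun y : L.Disc => phi B B' (L.rep y)) →
        SlashEq (fun y : L.Disc => phi B B' (L.rep y)) N g A x :=
  slashEq_of_generators dense_regularPts regularPts_subset (fun _ => slashEq_T)
    (fun _ => slashEq_S hd) isOpen_regularPts hA

theorem jacobiSlash_phi (hd : d = L.dNeg) {g : Mp2Z} {A : Module.End ℂ (L.Disc → ℂ)}
    (hA : L.IsWeil g A) (l m : Fin N → ℤ) {x : ℍ × (Fin N → ℂ)}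
    (hx : x ∈ regPts fun y : L.Disc => phi B B' (L.rep y))
    (hgx : jAct g.γ (jTrans l m x) ∈ regPts fun y : L.Disc => phi B B' (L.rep y)) (y : L.Disc) :
    jacobiSlash L (fun τ => g.j τ ^ (-(N : ℤ))) g.γ (fun i => l i) (fun i => m i)
      (phi B B' (L.rep y)) x.1 x.2 = A (fun y' => phi B B' (L.rep y') (jIncl x)) y :=
  jacobiSlash_eq (Φ := fun y : L.Disc => phi B B' (L.rep y)) dense_regularPts regularPts_subset
    isOpen_regularPts l m
    (fun _ hx y => phi_heisenberg_translate (rep_mem_dual y) (mem_regularPts.1 hx y) l m)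
    (slashEq_phi hd hA) hx hgx y

/-- The components form a vector-valued Maaß–Jacobi form. -/
theorem isVectorValuedMaassJacobiForm_phi (hd : d = L.dNeg) :
    IsVectorValuedMaassJacobiForm L N fun y : L.Disc => phi B B' (L.rep y) where
  nonMoving y := phi_nonMoving B B' (L.rep y)
  almostMeromorphic y := phi_almostMeromorphic B B' (L.rep y)
  casimir y := by
    have := phi_casimir B B' (L.rep y)
    rwa [← Int.cast_natCast] at this
  growth y := phi_growth B B' (L.rep y)
  weil_exists := L.weil_exists
  slash g A hA l m τ z hx hgx y := by
    refine jacobiSlash_phi hd hA l m (x := (τ, z)) hx (fun y' => ?_) y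
    rw [← jacobiAct_eq]; exact hgx y'

end Side

/-! ### The unimodular case -/

section unimodular

lemma IsUnimodular.card_disc (h : L.IsUnimodular) : Fintype.card L.Disc = 1 := by
  have h1 := L.card_disc
  rw [← Int.cast_abs, h] at h1
  exact_mod_cast h1

lemma IsUnimodular.subsingleton (h : L.IsUnimodular) : Subsingleton L.Disc :=
  Fintype.card_le_one_iff_subsingleton.1 h.card_disc.le

lemma IsUnimodular.exists_rep (h : L.IsUnimodular) (y : L.Disc) :
    ∃ ν : Fin N → ℤ, L.rep y = fun k => (ν k : ℝ) := by
  obtain ⟨c, hc⟩ := exists_int_rep (0 : L.dual)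
  refine ⟨c, ?_⟩
  have := h.subsingleton
  rw [Subsingleton.elim y (QuotientAddGroup.mk 0), hc]
  simp

lemma IsUnimodular.weilT (h : L.IsUnimodular) : L.weilT = 1 := by
  refine LinearMap.ext fun f => funext fun y => ?_
  obtain ⟨ν, hν⟩ := h.exists_rep y
  rw [EvenLattice.weilT, Matrix.toLin'_apply, Matrix.mulVec_diagonal, hν, quad_intCast,
    Complex.ofReal_intCast, ee_intCast, one_mul, Module.End.one_apply]

/-- The scalar by which `S` acts in the unimodular case. -/
def weilScalar (L : EvenLattice N) : ℂ := Complex.exp (π * 𝕚 * ((L.dNeg : ℂ) - (L.dPos : ℂ)) / 4)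

lemma IsUnimodular.weilS (h : L.IsUnimodular) : L.weilS = L.weilScalar • 1 := by
  have := h.subsingleton
  refine LinearMap.ext fun f => funext fun y => ?_
  obtain ⟨ν, hν⟩ := h.exists_rep y
  rw [EvenLattice.weilS, Matrix.toLin'_apply, Matrix.mulVec, dotProduct,
    Fintype.sum_subsingleton _ y, Matrix.of_apply, h.card_disc, hν, bil_intCast,
    Complex.ofReal_intCast, ← Int.cast_neg, ee_intCast, LinearMap.smul_apply,
    Module.End.one_apply, Pi.smul_apply, smul_eq_mul, weilScalar]
  simp

variable {B B' : Side F}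

/-- In the unimodular case `S` acts trivially unless the theta series vanishes. -/
lemma IsUnimodular.weilScalar_eq_one (h : L.IsUnimodular) (hd : d = L.dNeg)
    {r : ℤ} (hr : (N : ℤ) = 2 * r)
    {y : L.Disc} {x : ℍ × (Fin N → ℂ)} (hx : x ∈ Side.regularPts B B')
    (hne : B.phi B' (L.rep y) (jIncl x) ≠ 0) : L.weilScalar = 1 := by
  set c := L.weilScalar
  have hc : c ≠ 0 := Complex.exp_ne_zero _
  set Φ : L.Disc → Jac[N] → ℂ := fun y => B.phi B' (L.rep y) with hΦ
  have hev : ∀ᶠ q in 𝓝 x, q ∈ regPts Φ ∧ Φ y (jIncl q) ≠ 0 :=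
    Eventually.and (isOpen_regPts.mem_nhds (Side.regularPts_subset hx))
      ((continuousAt_of_regPts (Side.regularPts_subset hx) y).eventually_ne hne)
  obtain ⟨q, hq, hq1, hq2⟩ := ((mem_closure_iff_frequently.1
    (dense_preimage_jAct (Side.dense_regularPts (B := B) (B' := B'))
      (ModularGroup.S * ModularGroup.S) x)).and_eventually hev).exists
  have hSS : L.IsWeil (Mp2Z.S * Mp2Z.S) (c • 1 * c • 1) := by
    rw [← h.weilS]; exact .mul .gen_S .gen_S
  have hST : L.IsWeil (Mp2Z.S * Mp2Z.T * (Mp2Z.S * Mp2Z.T * (Mp2Z.S * Mp2Z.T)))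
      (c • 1 * 1 * (c • 1 * 1 * (c • 1 * 1))) := by
    rw [← h.weilS]
    conv => arg 3; rw [← h.weilT]
    have h1 : L.IsWeil (Mp2Z.S * Mp2Z.T) (L.weilS * L.weilT) := .mul .gen_S .gen_T
    exact .mul h1 (.mul h1 h1)
  have hγ : (Mp2Z.S * Mp2Z.T * (Mp2Z.S * Mp2Z.T * (Mp2Z.S * Mp2Z.T))).γ = (Mp2Z.S * Mp2Z.S).γ := by
    change ModularGroup.S * ModularGroup.T * (ModularGroup.S * ModularGroup.T *
      (ModularGroup.S * ModularGroup.T)) = ModularGroup.S * ModularGroup.S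
    decide
  have e1 := Side.slashEq_phi (B := B) (B' := B') hd hSS q hq1 (Side.regularPts_subset hq) y
  have e2 := Side.slashEq_phi (B := B) (B' := B') hd hST q hq1
    (by rw [hγ]; exact Side.regularPts_subset hq) y
  have hj : ∀ g g' : Mp2Z, g.γ = g'.γ → autFac L N g q = autFac L N g' q := by
    intro g g' hg
    rw [autFac, autFac, hg, hr, ← mul_neg, zpow_mul, zpow_mul, zpow_two, zpow_two, ← pow_two,
      ← pow_two, g.sq, g'.sq, hg]
  rw [hj _ _ hγ, hγ, e1] at e2
  simp only [mul_one, smul_mul_assoc, one_mul, LinearMap.smul_apply, Module.End.one_apply,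
    Pi.smul_apply, smul_eq_mul] at e2
  have h3 : c * c * (Φ y (jIncl q)) * (c - 1) = 0 := by linear_combination -e2
  exact sub_eq_zero.1 ((mul_eq_zero.1 h3).resolve_left
    (mul_ne_zero (mul_ne_zero hc hc) hq2))

lemma IsUnimodular.isWeil_eq_one (h : L.IsUnimodular) (hc : L.weilScalar = 1) {g : Mp2Z}
    {A : Module.End ℂ (L.Disc → ℂ)} (hA : L.IsWeil g A) : A = 1 := by
  induction hA with
  | one => rfl
  | gen_T => exact h.weilT
  | gen_S => rw [h.weilS, hc, one_smul]
  | mul _ _ h1 h2 => rw [h1, h2, one_mul]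

lemma IsUnimodular.jacobiSlash (h : L.IsUnimodular) (hd : d = L.dNeg) {r : ℤ}
    (hr : (N : ℤ) = 2 * r) (y : L.Disc) (γ : SL(2, ℤ)) (l m : Fin N → ℤ) (τ : ℍ) (z : Fin N → ℂ)
    (hx : AnalyticAt ℝ (B.phi B' (L.rep y)) ((τ : ℂ), z))
    (hgx : AnalyticAt ℝ (B.phi B' (L.rep y)) (jacobiAct γ (fun i => l i) (fun i => m i) τ z)) :
    jacobiSlash L (fun τ => cocyc γ τ ^ (-r)) γ (fun i => l i) (fun i => m i)
      (B.phi B' (L.rep y)) τ z = B.phi B' (L.rep y) ((τ : ℂ), z) := by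
  have hsub := h.subsingleton
  have hall : ∀ {x : ℍ × (Fin N → ℂ)}, AnalyticAt ℝ (B.phi B' (L.rep y)) (jIncl x) →
      x ∈ regPts fun y : L.Disc => B.phi B' (L.rep y) := fun hx y' => by
    rwa [Subsingleton.elim y' y]
  rw [jacobiAct_eq γ l m (τ, z)] at hgx
  by_cases h0 : ∀ x ∈ Side.regularPts B B', B.phi B' (L.rep y) (jIncl x) = 0
  · have hz : ∀ {x : ℍ × (Fin N → ℂ)}, AnalyticAt ℝ (B.phi B' (L.rep y)) (jIncl x) →
        B.phi B' (L.rep y) (jIncl x) = 0 := fun {x} hx =>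
      eq_of_dense Side.dense_regularPts (f := fun x => B.phi B' (L.rep y) (jIncl x))
        (continuousAt_of_regPts (hall hx) y) continuousAt_const (Eventually.of_forall h0)
    rw [_root_.jacobiSlash, jacobiAct_eq γ l m (τ, z), hz hgx, mul_zero]
    exact (hz (x := (τ, z)) hx).symm
  · push Not at h0
    obtain ⟨x, hx', hne⟩ := h0
    have hc := h.weilScalar_eq_one hd hr hx' hne
    obtain ⟨g, A, hA, rfl⟩ := L.exists_isWeil_lift γ
    have e := Side.jacobiSlash_phi (B := B) (B' := B') hd hA l m (x := (τ, z)) (hall hx) (hall hgx) y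
    rw [h.isWeil_eq_one hc hA] at e
    rw [Module.End.one_apply] at e
    refine Eq.trans ?_ e
    have hj : (fun τ => cocyc g.γ τ ^ (-r)) = fun τ => g.j τ ^ (-(N : ℤ)) := by
      funext τ
      rw [hr, ← mul_neg, zpow_mul, zpow_two, ← pow_two, g.sq]
    rw [hj]

end unimodular

end EvenLattice

end

theorem mainTheorem6 {N d : ℕ} (L : EvenLattice N) (E E' : Fin d → Fin N → ℝ)
    (hE : L.IsCompatiblePair E E') :
    ∃ Φ : L.Disc → ℂ × (Fin N → ℂ) → ℂ,
      L.IsThetaTranslates E E' Φ ∧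
      IsVectorValuedMaassJacobiForm L (N : ℤ) Φ ∧
      (L.IsUnimodular → (∀ i, L.quad (E' i) = 0) →
        ∃ k : ℤ, 2 * k = (N : ℤ) ∧ IsHHarmonicMaassJacobiForm L E k (Φ 0)) := by
  obtain ⟨m, F, B, B', c, c', hc, hc', hEB, hEB'⟩ := hE.exists_sides
  have hd := hE.left.length_eq
  refine ⟨fun y => EvenLattice.Side.phi B B' (L.rep y),
    EvenLattice.isThetaTranslates_phi hc hc' hEB hEB',
    EvenLattice.Side.isVectorValuedMaassJacobiForm_phi hd, fun hU hiso => ?_⟩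
  obtain ⟨k, hk⟩ := L.even_rank_of_isUnimodular hU
  have hk' : (N : ℤ) = 2 * (k : ℤ) := by omega
  have hβ : ∀ i, B'.β i ^ 2 = 1 := by
    intro i
    have h1 := hiso i
    rw [hEB', EvenLattice.quad_smul, EvenLattice.quad, EvenLattice.Side.bil_dir_dir] at h1
    have h2 : c' i ^ 2 ≠ 0 := pow_ne_zero 2 (hc' i).ne'
    have h3 := (mul_eq_zero.1 h1).resolve_left h2
    linarith
  refine ⟨k, hk'.symm, ?_, ?_, ?_, ?_, ?_, ?_, ?_⟩
  · exact EvenLattice.Side.phi_nonMoving B B' _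
  · exact EvenLattice.Side.phi_almostMeromorphic B B' _
  · exact hU.jacobiSlash hd hk' 0
  · have := EvenLattice.Side.phi_casimir B B' (L.rep 0)
    have e : (N : ℝ) / 2 = ((k : ℤ) : ℝ) := by
      rw [hk]; push_cast; ring
    rwa [e] at this
  · intro i
    have := EvenLattice.Side.phi_heisenberg (B := B) (L.rep 0) hβ i (c i)
    rwa [← hEB] at this
  · intro w hw
    refine EvenLattice.Side.phi_holomorphic (L.rep 0) hβ fun i => ?_
    have := hw i
    rw [hEB, EvenLattice.bil_smul_right] at this
    exact (mul_eq_zero.1 this).resolve_left (hc i).ne'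
  · exact EvenLattice.Side.phi_growth B B' _
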